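/- **Setting.** Let $A_1,\bar A_1,A_2,\bar A_2$ be registers of $n,\bar n,m,m$ qubits, $d=2^n\le\bar d=2^{\bar n}$, $d_\chi=2^m$, $A=A_1A_2$, $\bar A=\bar A_1\bar A_2$, and let $\mathcal L=\mathcal L_a\otimes\mathcal L_{\bar a}$ with $\mathcal L_a\cong\mathcal H_{A_1}$, $\mathcal L_{\bar a}\cong\mathcal H_{\bar A_1}$. Let $|\chi\rangle=d_\chi^{-1/2}\sum_k|k\rangle_{A_2}|k\rangle_{\bar A_2}$. A stabilizer code with exact complementary recovery is a map $V^{(0)}:\mathcal L\to\mathcal H_A\otimes\mathcal H_{\bar A}$ with Clifford unitaries $R^{(0)}_A,R^{(0)}_{\bar A}$ such that $R_A^{(0)}R_{\bar A}^{(0)}V^{(0)}|\psi\rangle=|\psi\rangle_{A_1\bar A_1}|\chi\rangle_{A_2\bar A_2}$ for all $\psi$. For Hermitian $W$ on $\mathcal H_A\otimes\mathcal H_{\bar A}$ the skewed code is $V^{(\epsilon)}=e^{i\epsilon W}V^{(0)}$. *Recovery and proto-area.* For unitaries $R_A,R_{\bar A}$ put $\mathcal N_R(\sigma)=\mathrm{Tr}_{A_2\bar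 A_2}[R_AR_{\bar A}V^{(\epsilon)}\sigma V^{(\epsilon)\dagger}R_A^\dagger R_{\bar A}^\dagger]$. An optimal recovery $R^*$ is any maximiser over $R_A,R_{\bar A}$ of the coherent information $S(\mathcal N_R(\mathbb 1/d\bar d))-S((\mathcal N_R\otimes\mathrm{id}_r)(|\Phi\rangle\langle\Phi|))$, with $|\Phi\rangle$ maximally entangled between $\mathcal L$ and a reference $r$. The proto-area entropy is $S_{PA}=S(\mathrm{Tr}_{\bar A}V^{(\epsilon)}\sigma V^{(\epsilon)\dagger})-S(\mathrm{Tr}_{\bar A_1}\mathcal N_{R^*}(\sigma))$ and its correction is $S_{corr}=S(\mathrm{Tr}_{\bar A_2}|\chi\rangle\langle\chi|)-S_{PA}$, where $S$ is the von Neumann entropy. For a pure bulk state $|\psi\rangle=\sum_{i=1}^d\sqrt{\lambda_i}|i\rangle_a|i\rangle_{\bar a}$ with $\lambda_i>0$, $\sum_i\lambda_i=1$, $\langle S_{corr}\rangle$ is the average of $S_{corr}$ over the logical states $(U\otimes U')|\psi\rangle$ with $U,U'$ independent and Haar distributed on $U(d),U(\bar d)$. Put $$f_1(\lambda)=\frac1{2d}\sum_{i\ne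 j}(\lambda_i-\lambda_j)\ln\frac{\lambda_i}{\lambda_j},\qquad f_3(\lambda)=\frac1{d\bar d}\sum_{i,j}\frac{\lambda_i+\lambda_j}{2(\lambda_i-\lambda_j)}\ln\frac{\lambda_i}{\lambda_j}$$ (terms with $\lambda_i=\lambda_j$ in $f_3$ read as the limit $1$). *Magic.* For $\alpha>1$ and a $k$-qubit state, $\mathcal M_\alpha(\phi)=\frac1{1-\alpha}\ln\big(2^{-k}\sum_{P}|\langle\phi|P|\phi\rangle|^{2\alpha}\big)$, the sum running over the $4^k$ Pauli strings. Let $|V_R^{(\epsilon)}\rangle$ be the Choi state of $R_A^{(0)}R_{\bar A}^{(0)}V^{(\epsilon)}$ (with the reference $r$). The perturbative tripartite non-local magic is $\mathcal M^{NL}_\alpha(V^{(\epsilon)})=M\epsilon^2+o(\epsilon^2)$, where $M$ is the minimum of $\lim_{\epsilon\to0}\epsilon^{-2}\mathcal M_\alpha\big(\prod_{i<j}e^{i\epsilon T_{\tau(i)\tau(j)}}|V_R^{(\epsilon)}\rangle\big)$ over all Hermitian $T_{ij}$ acting on two of the four subsystems $A_1,A_2,\bar A_1,\bar A_2$ and all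 permutations $\tau$ of these subsystems. **Corollary.** Optimal recoveries exist for every skewed stabilizer code. Moreover there is an absolute constant $K$ such that, if $W$ is drawn from the Gaussian Unitary Ensemble (of any variance), the following holds with probability tending to $1$ as $d\to\infty$ (with $\bar d\ge d$), uniformly in $\bar d$, $d_\chi$, the code and the variance: for all $\alpha>1$, the leading coefficient $M=M_\alpha$ of $\mathcal M^{NL}_\alpha(V^{(\epsilon)})$ exists, and for all spectra $\lambda$ and every choice of optimal recoveries for the $V^{(\epsilon)}$ the limit $S_2=\lim_{\epsilon\to0}\epsilon^{-2}\langle S_{corr}\rangle$ exists and $$\Big|S_2-\frac{\alpha-1}{2\alpha}\Big(1-\frac1{d^2}\Big)^{-1}\Big(1-\frac1{\bar d^2}\Big)^{-1}M\,f_3(\lambda)\Big|\le K\Big(\frac1{d^2}+\frac1{\bar d^2}\Big)\,\frac{\alpha-1}{2\alpha}M\,\big(f_1(\lambda)+f_3(\lambda)\big).$$ That is, to leading order in $\epsilon$ and typically, $\langle S_{corr}\rangle=\frac{\alpha-1}{2\alpha}(1-\frac1{d^2})^{-1}(1-\frac1{\bar d^2})^{-1}\mathcal M^{NL}_\alpha(V^{(\epsilon)})f_3(\lambda)+O(\frac1{d^2})+O(\frac1{\bar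 d^2})$, the errors being relative to the magnitude of the non-local magic and of the spectral functions. -/

import Mathlib

open Filter Topology MeasureTheory ProbabilityTheory
open scoped Matrix Kronecker

noncomputable section

namespace SkewedCode

/-! ### Registers, entropies, partial traces

`a`, `b` index orthonormal bases of `A₁`, `Ā₁` (and of the isomorphic logical factors), and `c`
indexes bases of both `A₂` and `Ā₂`. -/

/-- Index set of the computational basis of `n` qubits. -/
abbrev Qubits (n : ℕ) : Type := Fin n → ZMod 2

/-- Basis of the logical space `L = L_a ⊗ L_ā`. -/
abbrev Logical (a b : Type) : Type := a × b

/-- Basis of the physical space `A ⊗ Ā`, `A = A₁ ⊗ A₂`, `Ā = Ā₁ ⊗ Ā₂`. -/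
abbrev Phys (a b c : Type) : Type := (a × c) × (b × c)

/-- Partial trace over the second tensor factor. -/
def traceSnd {m n : Type} [Fintype n] (ρ : Matrix (m × n) (m × n) ℂ) : Matrix m m ℂ :=
  fun i j => ∑ k, ρ (i, k) (j, k)

/-- The projector `|ψ⟩⟨ψ|`. -/
def density {n : Type} (ψ : n → ℂ) : Matrix n n ℂ := Matrix.vecMulVec ψ (star ψ)

open Classical in
/-- Von Neumann entropy `-Tr ρ ln ρ` (of a Hermitian matrix; `0` otherwise). -/
def entropy {n : Type} [Fintype n] [DecidableEq n] (ρ : Matrix n n ℂ) : ℝ :=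
  if h : ρ.IsHermitian then ∑ i, Real.negMulLog (h.eigenvalues i) else 0

/-! ### Haar measure on the unitary group and the Gaussian Unitary Ensemble -/

instance {n : Type} [Fintype n] [DecidableEq n] :
    MeasurableSpace (Matrix.unitaryGroup n ℂ) := borel _

instance {n : Type} [Fintype n] [DecidableEq n] :
    BorelSpace (Matrix.unitaryGroup n ℂ) := ⟨rfl⟩

instance {n : Type} [Fintype n] [DecidableEq n] :
    CompactSpace (Matrix.unitaryGroup n ℂ) := by
  have hbox : IsCompact (Set.univ.pi fun _ : n => Set.univ.pi fun _ : n =>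
      Metric.closedBall (0 : ℂ) 1 : Set (n → n → ℂ)) :=
    isCompact_univ_pi fun _ => isCompact_univ_pi fun _ => isCompact_closedBall _ _
  suffices h : IsCompact (Matrix.unitaryGroup n ℂ : Set (Matrix n n ℂ)) from
    isCompact_iff_compactSpace.mp h
  refine IsCompact.of_isClosed_subset (X := Matrix n n ℂ) hbox ?_ ?_
  · have h : (Matrix.unitaryGroup n ℂ : Set (Matrix n n ℂ)) =
        {U | star U * U = 1} ∩ {U | U * star U = 1} := by
      ext U
      exact Unitary.mem_iff
    rw [h]
    exact (isClosed_eq (by fun_prop) continuous_const).inter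
      (isClosed_eq (by fun_prop) continuous_const)
  · intro U hU
    exact fun i _ j _ => mem_closedBall_zero_iff.mpr (entry_norm_bound_of_unitary hU i j)

/-- Normalised Haar measure on `U(n)`. -/
def haarU (n : Type) [Fintype n] [DecidableEq n] : Measure (Matrix.unitaryGroup n ℂ) :=
  Measure.haarMeasure ⊤

/-- Law of independent standard real Gaussians, two for each pair of indices. -/
def gaussians (n : Type) [Fintype n] : Measure (Bool × n × n → ℝ) :=
  Measure.pi fun _ => gaussianReal 0 1

/-- The GUE matrix of scale `s`: Hermitian part of `s` times the Ginibre matrix with entries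
`ω(false,j,k) + i ω(true,j,k)`; diagonal entries have variance `s²`, the real and imaginary parts
of the entries above the diagonal have variance `s²/2`, all independent. -/
def gueMatrix {n : Type} (s : ℝ) (ω : Bool × n × n → ℝ) : Matrix n n ℂ := fun j k =>
  ((s / 2 : ℝ) : ℂ) * (((ω (false, j, k) + ω (false, k, j) : ℝ) : ℂ)
    + Complex.I * ((ω (true, j, k) - ω (true, k, j) : ℝ) : ℂ))

/-! ### Pauli operators, Clifford unitaries, stabilizer Rényi entropy

For `X = (ℤ/2)^k` the characters are `y ↦ (-1)^(z·y)`, so `pauli s χ` runs, up to phases, over the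
`4^k` Pauli strings on `k` qubits. -/

section Pauli

variable {X : Type} [Fintype X] [DecidableEq X] [AddCommGroup X]

/-- The Pauli (Weyl) operator `|y⟩ ↦ χ(y) |y + s⟩`. -/
def pauli (s : X) (χ : AddChar X ℂ) : Matrix X X ℂ :=
  fun x y => if x = y + s then χ y else 0

/-- Unitaries that map Pauli operators to Pauli operators up to a phase under conjugation. -/
def IsClifford (U : Matrix.unitaryGroup X ℂ) : Prop :=
  ∀ (s : X) (χ : AddChar X ℂ), ∃ (s' : X) (χ' : AddChar X ℂ) (z : ℂ),
    (U : Matrix X X ℂ) * pauli s χ * (U : Matrix X X ℂ)ᴴ = z • pauli s' χ'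

/-- Stabilizer `α`-Rényi entropy of a state vector (`|X| = 2^k`). -/
def sre (α : ℝ) (φ : X → ℂ) : ℝ :=
  1 / (1 - α) * Real.log ((Fintype.card X : ℝ)⁻¹ *
    ∑ s : X, ∑ χ : AddChar X ℂ, ‖star φ ⬝ᵥ (pauli s χ *ᵥ φ)‖ ^ (2 * α))

end Pauli

section Code

variable {a b c : Type} [Fintype a] [DecidableEq a] [Fintype b] [DecidableEq b]
  [Fintype c] [DecidableEq c]

/-! ### Codes, recovery, proto-area entropy -/

/-- The maximally entangled (flat-spectrum) state `|χ⟩` of `A₂ ⊗ Ā₂`. -/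
def chi : c × c → ℂ := fun p => if p.1 = p.2 then ((√(Fintype.card c : ℝ) : ℝ) : ℂ)⁻¹ else 0

/-- The isometry `|ψ⟩ ↦ |ψ⟩_{A₁Ā₁} |χ⟩_{A₂Ā₂}`. -/
def attachChi : Matrix (Phys a b c) (Logical a b) ℂ :=
  fun p l => if (p.1.1, p.2.1) = l then chi (p.1.2, p.2.2) else 0

/-- The encoding followed by the recovery unitaries `R_A ⊗ R_Ā`. -/
def recover (RA : Matrix.unitaryGroup (a × c) ℂ) (RB : Matrix.unitaryGroup (b × c) ℂ)
    (V : Matrix (Phys a b c) (Logical a b) ℂ) : Matrix (Phys a b c) (Logical a b) ℂ :=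
  ((RA : Matrix (a × c) (a × c) ℂ) ⊗ₖ (RB : Matrix (b × c) (b × c) ℂ)) * V

/-- The recovered state `Tr_{A₂Ā₂} (M ρ M†)` on `A₁Ā₁`, for `M` an encoding followed by a
recovery. -/
def recoveredState (M : Matrix (Phys a b c) (Logical a b) ℂ)
    (ρ : Matrix (Logical a b) (Logical a b) ℂ) : Matrix (a × b) (a × b) ℂ :=
  fun x y => ∑ s : c, ∑ t : c, (M * ρ * Mᴴ) ((x.1, s), (x.2, t)) ((y.1, s), (y.2, t))

/-- `(𝒩 ⊗ id_r)(|Φ⟩⟨Φ|)` on `A₁Ā₁r`, where `𝒩 = recoveredState M` and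
`|Φ⟩ = d_L^{-1/2} ∑_l |l⟩_L |l⟩_r`. -/
def recoveredWithRef (M : Matrix (Phys a b c) (Logical a b) ℂ) :
    Matrix ((a × b) × Logical a b) ((a × b) × Logical a b) ℂ :=
  fun x y => (Fintype.card (Logical a b) : ℂ)⁻¹ *
    recoveredState M (Matrix.single x.2 y.2 1) x.1 y.1

/-- Coherent information of the encode-recover channel. -/
def coherentInfo (V : Matrix (Phys a b c) (Logical a b) ℂ)
    (RA : Matrix.unitaryGroup (a × c) ℂ) (RB : Matrix.unitaryGroup (b × c) ℂ) : ℝ :=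
  entropy (traceSnd (recoveredWithRef (recover RA RB V)))
    - entropy (recoveredWithRef (recover RA RB V))

/-- `R_A ⊗ R_Ā` maximises the coherent information. -/
def IsOptimalRecovery (V : Matrix (Phys a b c) (Logical a b) ℂ)
    (RA : Matrix.unitaryGroup (a × c) ℂ) (RB : Matrix.unitaryGroup (b × c) ℂ) : Prop :=
  ∀ (RA' : Matrix.unitaryGroup (a × c) ℂ) (RB' : Matrix.unitaryGroup (b × c) ℂ),
    coherentInfo V RA' RB' ≤ coherentInfo V RA RB

/-- Proto-area entropy `S(ρ_A) - S(σ_{A₁}^{(R)})` of the logical state `σ`. -/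
def protoArea (V : Matrix (Phys a b c) (Logical a b) ℂ)
    (RA : Matrix.unitaryGroup (a × c) ℂ) (RB : Matrix.unitaryGroup (b × c) ℂ)
    (σ : Matrix (Logical a b) (Logical a b) ℂ) : ℝ :=
  entropy (traceSnd (V * σ * Vᴴ)) - entropy (traceSnd (recoveredState (recover RA RB V) σ))

/-- Proto-area correction `S_corr`, defined by `S_PA = S(χ) - S_corr`. -/
def protoAreaCorrection (V : Matrix (Phys a b c) (Logical a b) ℂ)
    (RA : Matrix.unitaryGroup (a × c) ℂ) (RB : Matrix.unitaryGroup (b × c) ℂ)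
    (σ : Matrix (Logical a b) (Logical a b) ℂ) : ℝ :=
  entropy (traceSnd (density (chi (c := c)))) - protoArea V RA RB σ

/-- The bulk state `∑ᵢ √λᵢ |i⟩_a |e i⟩_ā`. -/
def bulkState (e : a ↪ b) (lam : a → ℝ) : Logical a b → ℂ :=
  fun l => if l.2 = e l.1 then ((√(lam l.1) : ℝ) : ℂ) else 0

/-- `⟨S_corr⟩`: average of the correction over independent Haar unitaries on `a` and `ā`. -/
def avgCorrection (V : Matrix (Phys a b c) (Logical a b) ℂ)
    (RA : Matrix.unitaryGroup (a × c) ℂ) (RB : Matrix.unitaryGroup (b × c) ℂ)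
    (ψ : Logical a b → ℂ) : ℝ :=
  ∫ U : Matrix.unitaryGroup a ℂ, ∫ U' : Matrix.unitaryGroup b ℂ,
    protoAreaCorrection V RA RB
      (density (((U : Matrix a a ℂ) ⊗ₖ (U' : Matrix b b ℂ)) *ᵥ ψ)) ∂(haarU b) ∂(haarU a)

/-! ### Spectral functions of the bulk entanglement -/

/-- `f₁(λ) = (1/2d) ∑_{i≠j} (λᵢ - λⱼ) ln (λᵢ/λⱼ)` (the diagonal terms vanish). -/
def f₁ (lam : a → ℝ) : ℝ :=
  1 / (2 * (Fintype.card a : ℝ)) *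
    ∑ i, ∑ j, (lam i - lam j) * Real.log (lam i / lam j)

/-- `f₃(λ) = (1/(d d̄)) ∑_{ij} (λᵢ + λⱼ)/(2(λᵢ - λⱼ)) ln (λᵢ/λⱼ)`, a summand with `λᵢ = λⱼ` being
read as its limit `1`; here `dbar = d̄`. -/
def f₃ (dbar : ℝ) (lam : a → ℝ) : ℝ :=
  1 / ((Fintype.card a : ℝ) * dbar) * ∑ i, ∑ j,
    if lam i = lam j then 1
    else (lam i + lam j) / (2 * (lam i - lam j)) * Real.log (lam i / lam j)

/-! ### Choi state and perturbative tripartite non-local magic -/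

/-- Choi state `d_L^{-1/2} ∑_l |l⟩_r ⊗ V|l⟩`. -/
def choi (V : Matrix (Phys a b c) (Logical a b) ℂ) : Logical a b × Phys a b c → ℂ :=
  fun x => ((√(Fintype.card (Logical a b) : ℝ) : ℝ) : ℂ)⁻¹ * V x.2 x.1

/-- Two basis labels agree on the subsystem `A₁` (`0`), `A₂` (`1`), `Ā₁` (`2`), `Ā₂` (`3`). -/
def AgreeAt (k : Fin 4) (x y : Phys a b c) : Prop :=
  ![x.1.1 = y.1.1, x.1.2 = y.1.2, x.2.1 = y.2.1, x.2.2 = y.2.2] k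

/-- `T = T_{ij} ⊗ 1`: the matrix `T` acts only on the subsystems `i` and `j`. -/
def ActsOn (i j : Fin 4) (T : Matrix (Phys a b c) (Phys a b c) ℂ) : Prop :=
  (∀ x y, T x y ≠ 0 → ∀ k, k ≠ i → k ≠ j → AgreeAt k x y) ∧
  (∀ x y x' y', (∀ k, k ≠ i → k ≠ j → AgreeAt k x y) → (∀ k, k ≠ i → k ≠ j → AgreeAt k x' y') →
    AgreeAt i x x' → AgreeAt j x x' → AgreeAt i y y' → AgreeAt j y y' → T x y = T x' y')

/-- A choice of Hermitian generators, one for each ordered pair of subsystems. -/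
def IsTwoBody (T : Fin 4 → Fin 4 → Matrix (Phys a b c) (Phys a b c) ℂ) : Prop :=
  ∀ i j, i ≠ j → (T i j).IsHermitian ∧ ActsOn i j (T i j)

/-- `∏_{i<j} exp(iε T_{τ(i)τ(j)})`. -/
def twoBodyCircuit (τ : Equiv.Perm (Fin 4))
    (T : Fin 4 → Fin 4 → Matrix (Phys a b c) (Phys a b c) ℂ) (ε : ℝ) :
    Matrix (Phys a b c) (Phys a b c) ℂ :=
  (([(0, 1), (0, 2), (0, 3), (1, 2), (1, 3), (2, 3)] : List (Fin 4 × Fin 4)).map fun p =>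
    NormedSpace.exp ((Complex.I * (ε : ℂ)) • T (τ p.1) (τ p.2))).prod

variable [AddCommGroup a] [AddCommGroup b] [AddCommGroup c]

/-- The stabilizer Rényi entropy of the family of states `φ` is `m ε² + o(ε²)`. -/
def HasMagicCoeff (α : ℝ) (φ : ℝ → Logical a b × Phys a b c → ℂ) (m : ℝ) : Prop :=
  Tendsto (fun ε : ℝ => sre α (φ ε) / ε ^ 2) (𝓝[≠] 0) (𝓝 m)

/-- The perturbative tripartite non-local magic of the Choi states of the maps `M ε` is `m ε²` at
leading order: `m` is the minimum of the leading coefficients of the magic over all choices and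
orderings of two-body unitaries `exp(iε T_{ij})`. -/
def HasNonlocalMagicCoeff (α : ℝ) (M : ℝ → Matrix (Phys a b c) (Logical a b) ℂ) (m : ℝ) : Prop :=
  (∀ (τ : Equiv.Perm (Fin 4)) (T : Fin 4 → Fin 4 → Matrix (Phys a b c) (Phys a b c) ℂ),
    IsTwoBody T → ∃ m', HasMagicCoeff α (fun ε => choi (twoBodyCircuit τ T ε * M ε)) m') ∧
  IsLeast {m' : ℝ | ∃ (τ : Equiv.Perm (Fin 4))
      (T : Fin 4 → Fin 4 → Matrix (Phys a b c) (Phys a b c) ℂ), IsTwoBody T ∧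
      HasMagicCoeff α (fun ε => choi (twoBodyCircuit τ T ε * M ε)) m'} m

variable (a b c) in
/-- A stabilizer code with exact complementary recovery: an encoding map `V` and Clifford
unitaries on `A` and `Ā` with `R_A R_Ā V|ψ⟩ = |ψ⟩|χ⟩`. -/
structure StabilizerCode where
  /-- encoding map -/
  V : Matrix (Phys a b c) (Logical a b) ℂ
  /-- recovery on `A` -/
  RA : Matrix.unitaryGroup (a × c) ℂ
  /-- recovery on `Ā` -/
  RB : Matrix.unitaryGroup (b × c) ℂ
  clifford_RA : IsClifford RA
  clifford_RB : IsClifford RB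
  recover_eq : recover RA RB V = attachChi

/-- The skewed encoding map `exp(iεW) V`. -/
def StabilizerCode.skewed (C : StabilizerCode a b c) (W : Matrix (Phys a b c) (Phys a b c) ℂ)
    (ε : ℝ) : Matrix (Phys a b c) (Logical a b) ℂ :=
  NormedSpace.exp ((Complex.I * (ε : ℂ)) • W) * C.V

/-- Leading coefficient of the non-local magic of the skewed code, computed from its Choi state
after the recovery of the undeformed code. -/
def StabilizerCode.HasNonlocalMagicCoeff (C : StabilizerCode a b c) (α : ℝ)
    (W : Matrix (Phys a b c) (Phys a b c) ℂ) (m : ℝ) : Prop :=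
  SkewedCode.HasNonlocalMagicCoeff α (fun ε => recover C.RA C.RB (C.skewed W ε)) m

end Code

end SkewedCode

end

open SkewedCode

set_option linter.unusedSectionVars false

noncomputable section

namespace SkewedCode

open Finset (sum_congr mul_sum sum_comm sum_add_distrib mem_univ sum_mul sum_sub_distrib
    sum_eq_single sum_le_sum sum_ite_eq sum_const card_univ sum_eq_zero sum_nonneg single_le_sum
    sum_ite_eq' add_sum_erase univ sum_eq_zero_iff_of_nonneg sum_div sum_mul_sum sum_neg_distrib
    sum_const_zero sum_smul smul_sum abs_sum_le_sum_abs)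
open Matrix (of_apply conjTranspose_apply kroneckerMap_apply conjTranspose_mul
    conjTranspose_conjTranspose conjTranspose_smul conjTranspose_kronecker diag_apply
    conjTranspose_one mul_kronecker_mul conjTranspose_add trace_mul_comm one_kronecker_one
    conjTranspose_sub smul_kronecker kronecker_smul vecMulVec vecMulVec_apply mulVec_mulVec
    star_eq_conjTranspose diagonal_conjTranspose diagonal_apply trace_conjTranspose star_mulVec
    trace_smul trace_sub one_apply_eq diagonal of single smul_mul trace IsHermitian single_apply
    diagonal_mul mul_diagonal dotProduct_mulVec transpose_mul zero_kronecker trace_one mulVec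
    mem_unitaryGroup_iff mulVec_smul trace_diagonal entryLinearMap conjTranspose_neg add_kronecker
    kronecker_add transpose transpose_one transpose_smul transpose_transpose mul_vecMulVec
    vecMulVec_mul conjTranspose_zero isHermitian_zero)
open Complex (I star_def ofReal_mul norm_real conj_ofReal mul_conj' conj_mul' ofReal_zero
    ofReal_natCast ofReal_re ofReal_injective norm_I normSq_eq_norm_sq continuous_ofReal ofReal_sum
    re_sum ofReal_pow ofReal_one conj_I add_conj normSq_apply continuous_re ofReal_inv ofRealCLM
    im_ofReal_mul ofReal_div add_re ofReal_add norm_ofNat I_mul_I zero_re)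
open Real (negMulLog norm_eq_abs mul_self_sqrt sq_sqrt sqrt_nonneg log log_div log_inv
    log_le_sub_one_of_pos exp continuous_sqrt log_le_log log_mul sqrt_zero le_sqrt_of_sq_le
    norm_of_nonneg sqrt_sq rpow_two)
open Fintype (card sum_prod_type card_ne_zero card_pos one_lt_card sum_prod_type' card_prod
    sum_equiv)
open Module (End)

local notation "U(" n ")" => Matrix.unitaryGroup n ℂ
local notation "Mat" n:max => Matrix n n ℂ
local notation "Enc" a:max b:max c:max => Matrix (Phys a b c) (Logical a b) ℂ
local notation "TMat" a:max b:max c:max => Matrix ((a × b) × c) ((a × b) × c) ℂ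
local notation "PMat" a:max b:max c:max => Matrix (Phys a b c) (Phys a b c) ℂ
local notation "rt(" x ")" => ((√(x : ℝ) : ℝ) : ℂ)

variable {a b c : Type} [Fintype a] [DecidableEq a] [Fintype b] [DecidableEq b]
  [Fintype c] [DecidableEq c]

section

/-! ### Diagonalisations, and quadratic forms of divided-difference type -/

section Diagonalization

lemma card_pos_real (n : Type) [Fintype n] [Nonempty n] : (0 : ℝ) < card n := by
  exact_mod_cast card_pos

lemma card_cast_ne (n : Type) [Fintype n] [Nonempty n] : (card n : ℂ) ≠ 0 := by
  exact_mod_cast card_ne_zero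

variable {n : Type} [Fintype n] [DecidableEq n]

/-- `A = U diag(α) U†`. -/
def Diagonalizes (U : U(n)) (α : n → ℝ) (A : Mat n) : Prop :=
  A = U.1 * diagonal (fun i => (α i : ℂ)) * U.1ᴴ

lemma unitary_adj_mul (U : U(n)) : U.1ᴴ * U.1 = 1 := Matrix.mem_unitaryGroup_iff'.1 U.2

lemma unitary_mul_adj (U : U(n)) : U.1 * U.1ᴴ = 1 := mem_unitaryGroup_iff.1 U.2

lemma sum_norm_sq_col (U : U(n)) (j : n) : ∑ i, ‖U.1 i j‖ ^ 2 = 1 := by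
  have h := congrFun (congrFun (unitary_adj_mul U) j) j
  rw [Matrix.mul_apply, one_apply_eq] at h
  simp only [conjTranspose_apply, ← starRingEnd_apply, conj_mul'] at h
  exact_mod_cast h

lemma diagonalizes_eigen {A : Mat n} (hA : A.IsHermitian) : Diagonalizes hA.eigenvectorUnitary
    hA.eigenvalues A := by
  have h := hA.spectral_theorem
  rw [Unitary.conjStarAlgAut_apply] at h
  exact h

lemma Diagonalizes.isHermitian {U : U(n)} {α : n → ℝ} {A : Mat n} (h : Diagonalizes U α A) :
    A.IsHermitian := by
  rw [h, IsHermitian]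
  simp only [conjTranspose_mul, conjTranspose_conjTranspose, diagonal_conjTranspose, mul_assoc]
  congr 3
  ext i
  simp

lemma Diagonalizes.conj {U : U(n)} {α : n → ℝ} {A : Mat n} (h : Diagonalizes U α A) (W : U(n)) :
    Diagonalizes (W * U) α ((W : Mat n) * A * (W : Mat n)ᴴ) := by
  rw [Diagonalizes, h]
  simp [Matrix.mul_assoc]

lemma Diagonalizes.conjTranspose_mul {U : U(n)} {α : n → ℝ} {A : Mat n} (h : Diagonalizes U α A) :
    U.1ᴴ * A = diagonal (fun i => (α i : ℂ)) * U.1ᴴ := by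
  conv_lhs => rw [h]
  rw [← mul_assoc, ← mul_assoc, unitary_adj_mul, one_mul]

lemma Diagonalizes.mul_coe {U : U(n)} {α : n → ℝ} {A : Mat n} (h : Diagonalizes U α A) : A * (U :
    Mat n) = U.1 * diagonal (fun i => (α i : ℂ)) := by
  conv_lhs => rw [h]
  rw [mul_assoc, unitary_adj_mul, mul_one]

/-- Two diagonalisations of the same matrix only mix equal eigenvalues. -/
lemma Diagonalizes.eq_of_ne_zero {U U' : U(n)} {α α' : n → ℝ} {A : Mat n} (h : Diagonalizes U α A)
    (h' : Diagonalizes U' α' A) {i j : n} (hij : (U.1ᴴ * U'.1) i j ≠ 0) : α i = α' j := by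
  have e : diagonal (fun i => (α i : ℂ)) * (U.1ᴴ * U'.1) =
      (U.1ᴴ * U'.1) * diagonal (fun i => (α' i : ℂ)) := by
    rw [← mul_assoc, ← h.conjTranspose_mul, mul_assoc, h'.mul_coe, mul_assoc]
  have := congrFun (congrFun e i) j
  rw [diagonal_mul, mul_diagonal, mul_comm] at this
  exact_mod_cast mul_left_cancel₀ hij this

/-- `∑ |⟨aᵢ|Δ|bⱼ⟩|² g(αᵢ, βⱼ)` for eigenbases `aᵢ` and `bⱼ`. -/
def kernelForm (g : ℝ → ℝ → ℝ) (U : U(n)) (α : n → ℝ) (V : U(n)) (β : n → ℝ) (Δ : Mat n) : ℝ :=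
  ∑ i, ∑ j, ‖(U.1ᴴ * Δ * V.1) i j‖ ^ 2 * g (α i) (β j)

omit [DecidableEq n] in
lemma trace_conjTranspose_mul_schur (g : n → n → ℝ) (Z : Mat n) : (Zᴴ * of fun i j => (g i j : ℂ) *
    Z i j).trace = ((∑ i, ∑ j, ‖Z i j‖ ^ 2 * g i j : ℝ) : ℂ) := by
  simp only [trace, diag_apply, Matrix.mul_apply]
  rw [sum_comm]
  push_cast
  refine sum_congr rfl fun i _ => sum_congr rfl fun j _ => ?_
  rw [conjTranspose_apply, of_apply, ← conj_mul', starRingEnd_apply]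
  ring

lemma kernelForm_eq (g : ℝ → ℝ → ℝ) {U U' V V' : U(n)} {α α' β β' : n → ℝ} {A B : Mat n} (hU :
    Diagonalizes U α A) (hU' : Diagonalizes U' α' A) (hV : Diagonalizes V β B) (hV' : Diagonalizes
    V' β' B) (Δ : Mat n) : kernelForm g U α V β Δ = kernelForm g U' α' V' β' Δ := by
  set Z : Mat n := U.1ᴴ * Δ * V.1 with hZ
  set Zg : Mat n := of fun i j => (g (α i) (β j) : ℂ) * Z i j with hZg
  set P : Mat n := U.1ᴴ * U'.1 with hP
  set Q : Mat n := V.1ᴴ * V'.1 with hQ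
  have hPP : P * Pᴴ = 1 := by
    rw [hP, conjTranspose_mul, conjTranspose_conjTranspose, mul_assoc, ← mul_assoc (U' : Mat n),
      unitary_mul_adj, one_mul, unitary_adj_mul]
  have hQQ : Q * Qᴴ = 1 := by
    rw [hQ, conjTranspose_mul, conjTranspose_conjTranspose, mul_assoc, ← mul_assoc (V' : Mat n),
      unitary_mul_adj, one_mul, unitary_adj_mul]
  have hZ' : U'.1ᴴ * Δ * V'.1 = Pᴴ * Z * Q := by
    rw [hP, hZ, hQ, conjTranspose_mul, conjTranspose_conjTranspose]
    calc _ = U'.1ᴴ * (U.1 * U.1ᴴ) * Δ * (V.1 * V.1ᴴ) * V'.1 := by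
          rw [unitary_mul_adj, unitary_mul_adj, mul_one, mul_one]
      _ = _ := by simp only [mul_assoc]
  have hsch : (of fun i j => (g (α' i) (β' j) : ℂ) * (Pᴴ * Z * Q) i j) = Pᴴ * Zg * Q := by
    ext i j
    simp only [of_apply, Matrix.mul_apply, mul_sum, sum_mul]
    refine sum_congr rfl fun y _ => sum_congr rfl fun x _ => ?_
    by_cases h1 : P x i = 0
    · simp [conjTranspose_apply, h1]
    by_cases h2 : Q y j = 0
    · simp [h2]
    rw [hZg, of_apply, ← hU.eq_of_ne_zero hU' h1, ← hV.eq_of_ne_zero hV' h2]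
    ring
  have h1 := trace_conjTranspose_mul_schur (fun i j => g (α i) (β j)) Z
  have h2 := trace_conjTranspose_mul_schur (fun i j => g (α' i) (β' j)) (Pᴴ * Z * Q)
  rw [hsch] at h2
  have h3 : ((Pᴴ * Z * Q)ᴴ * (Pᴴ * Zg * Q)).trace = (Zᴴ * Zg).trace := by
    simp only [conjTranspose_mul, conjTranspose_conjTranspose]
    calc _ = (Qᴴ * (Zᴴ * (P * Pᴴ) * Zg * Q)).trace := by simp only [mul_assoc]
      _ = _ := by rw [hPP, mul_one, trace_mul_comm, mul_assoc, hQQ, mul_one]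
  rw [h3] at h2
  have := h1.symm.trans h2
  unfold kernelForm
  rw [hZ']
  exact_mod_cast this

lemma kernelForm_one (φ : ℝ → ℝ) (U : U(n)) (α : n → ℝ) : kernelForm (fun x _ => φ x) U α U α 1 = ∑
    i, φ (α i) := by
  unfold kernelForm
  rw [mul_one, unitary_adj_mul]
  refine sum_congr rfl fun i _ => ?_
  rw [sum_eq_single i] <;> simp +contextual [eq_comm]

lemma Diagonalizes.sum_eq {U U' : U(n)} {α α' : n → ℝ} {A : Mat n} (h : Diagonalizes U α A) (h' :
    Diagonalizes U' α' A) (φ : ℝ → ℝ) : ∑ i, φ (α i) = ∑ i, φ (α' i) := by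
  rw [← kernelForm_one φ U α, ← kernelForm_one φ U' α', kernelForm_eq _ h h' h h']

lemma Diagonalizes.entropy_eq {U : U(n)} {α : n → ℝ} {A : Mat n} (h : Diagonalizes U α A) : entropy
    A = ∑ i, negMulLog (α i) := by
  rw [entropy, dif_pos h.isHermitian]
  exact (diagonalizes_eigen h.isHermitian).sum_eq h _

lemma entropy_unitary_conj {A : Mat n} (hA : A.IsHermitian) (W : U(n)) : entropy ((W : Mat n) * A *
    (W : Mat n)ᴴ) = entropy A := by
  have h := diagonalizes_eigen hA
  rw [h.entropy_eq, (h.conj W).entropy_eq]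

lemma Diagonalizes.apply_self {U : U(n)} {α : n → ℝ} {A : Mat n} (h : Diagonalizes U α A) (i : n) :
    (α i : ℂ) = (U.1ᴴ * A * U.1) i i := by
  rw [h.conjTranspose_mul, mul_assoc, unitary_adj_mul, mul_one]
  simp

/-- Every eigenvalue in one diagonalisation occurs in any other. -/
lemma Diagonalizes.exists_eq {U U' : U(n)} {α α' : n → ℝ} {A : Mat n} (h : Diagonalizes U α A) (h' :
    Diagonalizes U' α' A) (i : n) : ∃ j, α i = α' j := by
  by_contra! hne
  have hz : ∀ j, (U.1ᴴ * U'.1) i j = 0 := fun j => by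
    by_contra hn
    exact hne j (h.eq_of_ne_zero h' hn)
  have : ((U.1ᴴ * U'.1) * (U'.1ᴴ * U.1)) i i = 0 := by
    rw [Matrix.mul_apply]
    exact sum_eq_zero fun j _ => by rw [hz, zero_mul]
  rw [mul_assoc, ← mul_assoc (U' : Mat n), unitary_mul_adj, one_mul, unitary_adj_mul] at this
  simp at this

instance {m k : Type*} [Finite m] [Finite k] : SecondCountableTopology (Matrix m k ℂ) :=
  inferInstanceAs (SecondCountableTopology (m → k → ℂ))

instance : SecondCountableTopology (U(n)) :=
  TopologicalSpace.Subtype.secondCountableTopology (U(n) : Set (Mat n))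

lemma tendsto_mat {ι m k : Type*} {l : Filter ι} {f : ι → Matrix m k ℂ} {M : Matrix m k ℂ} : Tendsto
    f l (𝓝 M) ↔ ∀ i j, Tendsto (fun x => f x i j) l (𝓝 (M i j)) := by
  exact (tendsto_pi_nhds (f := fun x i => f x i)).trans (forall_congr' fun i => tendsto_pi_nhds)

/-- Joint continuity of `kernelForm` in the diagonalised matrices. -/
lemma tendsto_kernelForm {ι : Type*} {l : Filter ι} [l.IsCountablyGenerated] {g : ℝ → ℝ → ℝ} {U V :
    ι → U(n)} {α β : ι → n → ℝ} {A B Δ : ι → Mat n} {U₀ V₀ : U(n)} {α₀ β₀ : n → ℝ} {A₀ B₀ Δ₀ : Mat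
    n} (hU : ∀ k, Diagonalizes (U k) (α k) (A k)) (hV : ∀ k, Diagonalizes (V k) (β k) (B k)) (hU₀ :
    Diagonalizes U₀ α₀ A₀) (hV₀ : Diagonalizes V₀ β₀ B₀) (hA : Tendsto A l (𝓝 A₀)) (hB : Tendsto B l
    (𝓝 B₀)) (hΔ : Tendsto Δ l (𝓝 Δ₀)) (hg : ∀ i j, ContinuousAt (fun p : ℝ × ℝ => g p.1 p.2) (α₀ i,
    β₀ j)) : Tendsto (fun k => kernelForm g (U k) (α k) (V k) (β k) (Δ k)) l (𝓝 (kernelForm g U₀ α₀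
    V₀ β₀ Δ₀)) := by
  refine tendsto_of_subseq_tendsto fun ns hns => ?_
  obtain ⟨⟨U₁, V₁⟩, -, φ, hφ, hφ'⟩ := (isCompact_univ (X := U(n) ×
    U(n))).tendsto_subseq (x := fun k => (U (ns k), V (ns k)))
    (fun _ => Set.mem_univ _)
  have hl : Tendsto (fun k => ns (φ k)) atTop l := hns.comp hφ.tendsto_atTop
  have hUl : Tendsto (fun k => (U (ns (φ k)) : Mat n)) atTop (𝓝 U₁) :=
    (continuous_subtype_val.tendsto _).comp (((continuous_fst.tendsto _).comp hφ'))
  have hVl : Tendsto (fun k => (V (ns (φ k)) : Mat n)) atTop (𝓝 V₁) :=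
    (continuous_subtype_val.tendsto _).comp (((continuous_snd.tendsto _).comp hφ'))
  have hconj : ∀ {Y : ℕ → Mat n} {Y₁ : Mat n}, Tendsto Y atTop (𝓝 Y₁) →
      Tendsto (fun k => (Y k)ᴴ) atTop (𝓝 Y₁ᴴ) := fun h =>
    (continuous_id.matrix_conjTranspose.tendsto _).comp h
  -- limits of the eigenvalues
  have key : ∀ {X : ι → U(n)} {X₁ : U(n)} {γ : ι → n → ℝ} {C : ι → Mat n} {C₀ : Mat n},
      (∀ k, Diagonalizes (X k) (γ k) (C k)) → Tendsto C l (𝓝 C₀) →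
      Tendsto (fun k => (X (ns (φ k)) : Mat n)) atTop (𝓝 X₁) →
      ∃ γ₁ : n → ℝ, Diagonalizes X₁ γ₁ C₀ ∧
        ∀ i, Tendsto (fun k => γ (ns (φ k)) i) atTop (𝓝 (γ₁ i)) := by
    intro X X₁ γ C C₀ hX hC hXl
    have hD : Tendsto (fun k => (X (ns (φ k)) : Mat n)ᴴ * C (ns (φ k)) *
        (X (ns (φ k)) : Mat n)) atTop
        (𝓝 ((X₁ : Mat n)ᴴ * C₀ * (X₁ : Mat n))) :=
      (((hconj hXl).mul (hC.comp hl)).mul hXl)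
    have heq : ∀ k, (X (ns (φ k)) : Mat n)ᴴ * C (ns (φ k)) *
        (X (ns (φ k)) : Mat n) = diagonal fun i => (γ (ns (φ k)) i : ℂ) := by
      intro k
      rw [(hX _).conjTranspose_mul, mul_assoc, unitary_adj_mul, mul_one]
    simp only [heq] at hD
    have hlim : ∀ i, Tendsto (fun k => γ (ns (φ k)) i) atTop
        (𝓝 (((X₁ : Mat n)ᴴ * C₀ * (X₁ : Mat n)) i i).re) := fun i => by
      have := (continuous_re.tendsto _).comp ((tendsto_mat.1 hD) i i)
      simpa [Function.comp_def] using this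
    refine ⟨_, ?_, hlim⟩
    have hD' : (X₁ : Mat n)ᴴ * C₀ * (X₁ : Mat n) = diagonal
        fun i => (((((X₁ : Mat n)ᴴ * C₀ * (X₁ : Mat n)) i i).re : ℝ) : ℂ) := by
      refine tendsto_nhds_unique hD (tendsto_mat.2 fun i j => ?_)
      by_cases hij : i = j
      · subst hij
        simpa [Function.comp_def] using (continuous_ofReal.tendsto _).comp (hlim i)
      · simp [Matrix.diagonal_apply_ne _ hij]
    rw [Diagonalizes, ← hD']
    calc C₀ = ((X₁ : Mat n) * (X₁ : Mat n)ᴴ) * C₀ * ((X₁ : Mat n) * (X₁ : Mat n)ᴴ) := by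
          rw [unitary_mul_adj, one_mul, mul_one]
      _ = _ := by simp only [mul_assoc]
  obtain ⟨α₁, hα₁, hαl⟩ := key hU hA hUl
  obtain ⟨β₁, hβ₁, hβl⟩ := key hV hB hVl
  refine ⟨φ, ?_⟩
  rw [kernelForm_eq g hU₀ hα₁ hV₀ hβ₁]
  unfold kernelForm
  refine tendsto_finsetSum _ fun i _ => tendsto_finsetSum _ fun j _ => Tendsto.mul ?_ ?_
  · have := tendsto_mat.1 (((hconj hUl).mul (hΔ.comp hl)).mul hVl) i j
    exact this.norm.pow 2
  · obtain ⟨i', hi'⟩ := hα₁.exists_eq hU₀ i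
    obtain ⟨j', hj'⟩ := hβ₁.exists_eq hV₀ j
    have := hg i' j'
    rw [← hi', ← hj'] at this
    exact this.tendsto.comp ((hαl i).prodMk_nhds (hβl j))

lemma tendsto_entropy {ι : Type*} {l : Filter ι} [l.IsCountablyGenerated] {A : ι → Mat n} {A₀ : Mat
    n} (hA : ∀ k, (A k).IsHermitian) (hA₀ : A₀.IsHermitian) (h : Tendsto A l (𝓝 A₀)) : Tendsto (fun
    k => entropy (A k)) l (𝓝 (entropy A₀)) := by
  have hd := fun k => diagonalizes_eigen (hA k)
  have hd₀ := diagonalizes_eigen hA₀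
  have := tendsto_kernelForm (g := fun x _ => negMulLog x) hd hd hd₀ hd₀ h h
    (tendsto_const_nhds (x := (1 : Mat n)))
    (fun i j => (Real.continuous_negMulLog.comp continuous_fst).continuousAt)
  simp only [kernelForm_one] at this
  simpa only [(hd _).entropy_eq, hd₀.entropy_eq] using this

lemma continuous_entropy {X : Type*} [TopologicalSpace X] [FirstCountableTopology X] {A : X → Mat n}
    (hA : ∀ x, (A x).IsHermitian) (h : Continuous A) : Continuous fun x => entropy (A x) :=
  continuous_iff_continuousAt.2 fun x => tendsto_entropy hA (hA x) (h.tendsto x)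

end Diagonalization

end

section

/-! ### The second-order kernel of the relative entropy -/

/-- `∫₀¹ (1-t) / (y + t(x-y)) dt`, the kernel of the quadratic form of the relative entropy. -/
def relKernel (x y : ℝ) : ℝ := ∫ t in (0 : ℝ)..1, (1 - t) / (y + t * (x - y))

/-- Reciprocal of the logarithmic mean. -/
def invLogMean (x y : ℝ) : ℝ := if x = y then 1 / x else (log x - log y) / (x - y)

lemma le_segment {c x y t : ℝ} (hx : c ≤ x) (hy : c ≤ y) (ht : t ∈ Set.Icc (0 : ℝ) 1) : c ≤ y + t *
    (x - y) := by
  nlinarith [ht.1, ht.2, mul_nonneg ht.1 (sub_nonneg.2 hx), mul_nonneg (sub_nonneg.2 ht.2)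
    (sub_nonneg.2 hy)]

lemma relKernel_eq_clamp {c x y : ℝ} (hx : c ≤ x) (hy : c ≤ y) : relKernel x y = ∫ t in (0 : ℝ)..1,
    (1 - t) / max c (y + t * (x - y)) := by
  refine intervalIntegral.integral_congr fun t ht => ?_
  rw [Set.uIcc_of_le zero_le_one] at ht
  simp only [max_eq_right (le_segment hx hy ht)]

lemma intervalIntegrable_relKernel {x y : ℝ} (hx : 0 < x) (hy : 0 < y) : IntervalIntegrable (fun t :
    ℝ => (1 - t) / (y + t * (x - y))) volume 0 1 := by
  refine ContinuousOn.intervalIntegrable ?_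
  rw [Set.uIcc_of_le zero_le_one]
  refine ContinuousOn.div (by fun_prop) (by fun_prop) fun t ht => ?_
  have := le_segment (min_le_left x y) (min_le_right x y) ht
  have := lt_min hx hy
  linarith

lemma relKernel_identity {x y : ℝ} (hx : 0 < x) (hy : 0 < y) : x * log x - y * log y - (log y + 1) *
    (x - y) = (x - y) ^ 2 * relKernel x y := by
  have hder : ∀ t ∈ Set.uIcc (0 : ℝ) 1, HasDerivAt
      (fun t : ℝ => (1 - t) * (x - y) * log (y + t * (x - y)) +
        (y + t * (x - y)) * log (y + t * (x - y)) - (y + t * (x - y)))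
      ((x - y) ^ 2 * ((1 - t) / (y + t * (x - y)))) t := by
    intro t ht
    rw [Set.uIcc_of_le zero_le_one] at ht
    have hpos : 0 < y + t * (x - y) :=
      lt_of_lt_of_le (lt_min hx hy) (le_segment (min_le_left x y) (min_le_right x y) ht)
    have hu : HasDerivAt (fun t : ℝ => y + t * (x - y)) (x - y) t := by
      simpa using ((hasDerivAt_id t).mul_const (x - y)).const_add y
    have hl := hu.log hpos.ne'
    have h1 : HasDerivAt (fun t : ℝ => (1 - t) * (x - y)) (-(x - y)) t := by
      simpa using ((hasDerivAt_id t).const_sub 1).mul_const (x - y)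
    refine (((h1.mul hl).add (hu.mul hl)).sub hu).congr_deriv ?_
    have hw := mul_div_cancel₀ (x - y) hpos.ne'
    linear_combination hw
  have := intervalIntegral.integral_eq_sub_of_hasDerivAt hder
    ((intervalIntegrable_relKernel hx hy).const_mul _)
  rw [intervalIntegral.integral_const_mul] at this
  rw [relKernel, this]
  ring_nf

lemma continuousAt_relKernel {x y : ℝ} (hx : 0 < x) (hy : 0 < y) : ContinuousAt (fun p : ℝ × ℝ =>
    relKernel p.1 p.2) (x, y) := by
  set c := min x y / 2 with hc
  have hm : 0 < min x y := lt_min hx hy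
  have hc0 : 0 < c := by positivity
  have hcont : Continuous fun p : ℝ × ℝ =>
      ∫ t in (0 : ℝ)..1, (1 - t) / max c (p.2 + t * (p.1 - p.2)) := by
    refine intervalIntegral.continuous_parametric_intervalIntegral_of_continuous' ?_ _ _
    refine Continuous.div (by fun_prop) (by fun_prop) fun p => ?_
    have := le_max_left c (p.1.2 + p.2 * (p.1.1 - p.1.2))
    linarith
  refine hcont.continuousAt.congr ?_
  have hx' : c < x := by have := min_le_left x y; linarith
  have hy' : c < y := by have := min_le_right x y; linarith
  filter_upwards [(continuous_fst.tendsto (x, y)).eventually_const_lt hx',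
    (continuous_snd.tendsto (x, y)).eventually_const_lt hy'] with p h1 h2
  exact (relKernel_eq_clamp h1.le h2.le).symm

lemma relKernel_add_swap {x y : ℝ} (hx : 0 < x) (hy : 0 < y) : relKernel x y + relKernel y x =
    invLogMean x y := by
  unfold invLogMean
  split_ifs with h
  · subst h
    have : ∀ t : ℝ, (1 - t) / (x + t * (x - x)) = (1 - t) * x⁻¹ := fun t => by
      rw [sub_self, mul_zero, add_zero, div_eq_mul_inv]
    simp only [relKernel, this, intervalIntegral.integral_mul_const]
    rw [intervalIntegral.integral_sub (by simp) (by simp)]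
    simp
    ring
  · have hxy : x - y ≠ 0 := sub_ne_zero.2 h
    have h1 := relKernel_identity hx hy
    have h2 := relKernel_identity hy hx
    rw [eq_div_iff hxy]
    apply mul_left_cancel₀ hxy
    linear_combination -h1 - h2

/-! ### Relative entropy with respect to a product with the maximally mixed state -/

section RelEntropy

variable {a c : Type} [Fintype a] [DecidableEq a] [Fintype c] [DecidableEq c]

/-- The unitary `u ⊗ v`. -/
def kronU (u : U(a)) (v : U(c)) : U(a × c) := ⟨u.1 ⊗ₖ v.1, Matrix.kronecker_mem_unitary u.2 v.2⟩

/-- `ρ ↦ Tr₂ ρ ⊗ 1/d₂`. -/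
def mixSnd (A : Mat (a × c)) : Mat (a × c) := traceSnd A ⊗ₖ ((card c : ℂ)⁻¹ • (1 : Mat c))

omit [Fintype a] [DecidableEq a] [DecidableEq c] in
lemma isHermitian_traceSnd {A : Mat (a × c)} (hA : A.IsHermitian) : (traceSnd A).IsHermitian := by
  ext i j
  simp only [conjTranspose_apply, traceSnd, star_sum]
  exact sum_congr rfl fun k _ => hA.apply _ _

lemma Diagonalizes.mixSnd {V : U(a)} {β : a → ℝ} {A : Mat (a × c)} (h : Diagonalizes V β (traceSnd
    A)) : Diagonalizes (kronU V (1 : U(c))) (fun p => β p.1 / card c) (mixSnd A) := by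
  have hd : diagonal (fun p : a × c => ((β p.1 / card c : ℝ) : ℂ)) =
      diagonal (fun i => (β i : ℂ)) ⊗ₖ ((card c : ℂ)⁻¹ • (1 : Mat c)) := by
    rw [Matrix.smul_one_eq_diagonal, Matrix.diagonal_kronecker_diagonal]
    congr 1
    ext p
    push_cast
    rw [div_eq_mul_inv]
  rw [Diagonalizes, SkewedCode.mixSnd, hd]
  simp only [kronU, Submonoid.coe_one]
  rw [conjTranspose_kronecker, ← mul_kronecker_mul, ← mul_kronecker_mul, ← h]
  simp

omit [DecidableEq a] in
lemma traceSnd_kron_one_conj (V : Mat a) (A : Mat (a × c)) : traceSnd ((V ⊗ₖ (1 : Mat c))ᴴ * A * (V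
    ⊗ₖ (1 : Mat c))) = Vᴴ * traceSnd A * V := by
  ext i j
  simp only [traceSnd, Matrix.mul_apply, conjTranspose_kronecker, kroneckerMap_apply, sum_prod_type,
    conjTranspose_one, Matrix.one_apply, mul_ite, ite_mul, mul_zero, zero_mul, mul_one, sum_ite_eq,
    sum_ite_eq', mem_univ, if_true, sum_mul, mul_sum]
  rw [sum_comm]
  refine sum_congr rfl fun x _ => ?_
  rw [sum_comm]

lemma relEntropy_identity [Nonempty c] {A : Mat (a × c)} {U : U(a × c)} {α : a × c → ℝ} {V : U(a)}
    {β : a → ℝ} (hU : Diagonalizes U α A) (hV : Diagonalizes V β (traceSnd A)) (htr : A.trace = 1)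
    (hα : ∀ i, 0 < α i) (hβ : ∀ i, 0 < β i) : log (card c) - entropy A + entropy (traceSnd A) =
    kernelForm relKernel U α (kronU V 1) (fun p => β p.1 / card c) (A - mixSnd A) := by
  have hc := card_pos_real c
  have hV' := hV.mixSnd
  set V' := kronU V (1 : U(c)) with hV'def
  set β' : a × c → ℝ := fun p => β p.1 / card c with hβ'
  have hβ'pos : ∀ p, 0 < β' p := fun p => div_pos (hβ _) hc
  set u : Mat (a × c) := U.1ᴴ * V'.1 with hu
  have hentry : ∀ i j, (U.1ᴴ * (A - mixSnd A) *
      (V' : Mat (a × c))) i j = ((α i - β' j : ℝ) : ℂ) * u i j := by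
    intro i j
    rw [mul_sub, sub_mul, hU.conjTranspose_mul, mul_assoc, mul_assoc, hV'.mul_coe, ← mul_assoc, ←
      mul_assoc, mul_assoc, ← hu, Matrix.sub_apply, diagonal_mul, mul_diagonal]
    push_cast
    ring
  have hform : kernelForm relKernel U α V' β' (A - mixSnd A) = ∑ i, ∑ j, ‖u i j‖ ^ 2 *
      (α i * log (α i) - β' j * log (β' j) - (log (β' j) + 1) * (α i - β' j)) := by
    unfold kernelForm
    refine sum_congr rfl fun i _ => sum_congr rfl fun j _ => ?_
    rw [hentry, relKernel_identity (hα i) (hβ'pos j), norm_mul, norm_real, mul_pow, norm_eq_abs,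
      sq_abs]
    ring
  have hcol : ∀ j, ∑ i, ‖u i j‖ ^ 2 = 1 := sum_norm_sq_col (U⁻¹ * V')
  have hrow : ∀ i, ∑ j, ‖u i j‖ ^ 2 = 1 := fun i => by
    refine Eq.trans (sum_congr rfl fun j _ => ?_) (sum_norm_sq_col (U⁻¹ * V')⁻¹ i)
    exact congrArg (· ^ 2) (norm_star _).symm
  have hdiag : ∀ j, ((∑ i, ‖u i j‖ ^ 2 * α i : ℝ) : ℂ) = (V'.1ᴴ * A * V'.1) j j := by
    intro j
    have : V'.1ᴴ * A * V'.1 = uᴴ * (diagonal (fun i => (α i : ℂ)) * u) := by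
      conv_lhs => rw [hU]
      rw [hu, conjTranspose_mul, conjTranspose_conjTranspose]
      simp only [mul_assoc]
    rw [this, Matrix.mul_apply]
    push_cast
    refine sum_congr rfl fun i _ => ?_
    rw [diagonal_mul, conjTranspose_apply, ← conj_mul', starRingEnd_apply]
    ring
  have hblock : ∀ j : a, ∑ t : c, ∑ i, ‖u i (j, t)‖ ^ 2 * α i = β j := by
    intro j
    have h1 : ((∑ t : c, ∑ i, ‖u i (j, t)‖ ^ 2 * α i : ℝ) : ℂ) = (β j : ℂ) := by
      rw [hV.apply_self, ← traceSnd_kron_one_conj, traceSnd, ofReal_sum]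
      exact sum_congr rfl fun t _ => hdiag (j, t)
    exact_mod_cast h1
  have hβsum : ∑ j, β j = 1 := by
    have h1 : (∑ j, (β j : ℂ)) = A.trace := by
      have : (traceSnd A).trace = ∑ j, (β j : ℂ) := by
        rw [hV, trace_mul_comm, ← mul_assoc, unitary_adj_mul, one_mul, trace_diagonal]
      rw [← this, trace, trace, sum_prod_type]
      rfl
    rw [htr] at h1
    exact_mod_cast h1
  rw [hform, hU.entropy_eq, hV.entropy_eq]
  have e1 : ∑ i, ∑ j, ‖u i j‖ ^ 2 * (α i * log (α i) - β' j * log (β' j) -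
        (log (β' j) + 1) * (α i - β' j)) =
      (∑ i, (∑ j, ‖u i j‖ ^ 2) * (α i * log (α i))) -
      (∑ j, (∑ i, ‖u i j‖ ^ 2) * (β' j * log (β' j) - (log (β' j) + 1) * β' j)) -
      ∑ j, (log (β' j) + 1) * ∑ i, ‖u i j‖ ^ 2 * α i := by
    simp only [sum_mul, mul_sum]
    rw [sum_comm (s := univ) (t := univ) (f := fun j i => ‖u i j‖ ^ 2 * (β' j * log (β' j) - (log
        (β' j) + 1) * β' j)), sum_comm (s := univ) (t := univ) (f := fun j i => (log (β' j) + 1) *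
        (‖u i j‖ ^ 2 * α i)), ← sum_sub_distrib, ← sum_sub_distrib]
    refine sum_congr rfl fun i _ => ?_
    rw [← sum_sub_distrib, ← sum_sub_distrib]
    exact sum_congr rfl fun j _ => by ring
  have e2 : ∑ j, (log (β' j) + 1) * ∑ i, ‖u i j‖ ^ 2 * α i =
      ∑ j, (log (β j / card c) + 1) * β j := by
    rw [sum_prod_type]
    refine sum_congr rfl fun j _ => ?_
    change ∑ t, (log (β j / card c) + 1) * _ = _
    rw [← mul_sum, hblock]
  have e3 : ∑ j : a × c, (β' j * log (β' j) - (log (β' j) + 1) * β' j) = -1 := by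
    trans ∑ j, -β j
    swap
    · rw [sum_neg_distrib, hβsum]
    rw [sum_prod_type]
    refine sum_congr rfl fun j _ => ?_
    simp only [hβ', sum_const, card_univ, nsmul_eq_mul]
    field_simp
    ring
  rw [e1, e2]
  simp only [hrow, hcol, one_mul]
  rw [e3]
  have e4 : ∑ j, (log (β j / card c) + 1) * β j = (∑ j, β j * log (β j)) - log (card c) + 1 := by
    have : ∀ j, (log (β j / card c) + 1) * β j =
        β j * log (β j) - log (card c) * β j + β j := fun j => by
      rw [log_div (hβ j).ne' hc.ne']
      ring
    simp only [this, sum_add_distrib, sum_sub_distrib, ← mul_sum, hβsum, mul_one]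
  rw [e4]
  simp only [negMulLog, neg_mul, sum_neg_distrib]
  ring

lemma entropy_traceSnd_chi [Nonempty c] : entropy (traceSnd (density (chi (c := c)))) = log (card c)
    := by
  have hc := card_pos_real c
  have h : Diagonalizes (1 : U(c)) (fun _ => (card c : ℝ)⁻¹)
      (traceSnd (density (chi (c := c)))) := by
    rw [Diagonalizes]
    simp only [OneMemClass.coe_one, one_mul, conjTranspose_one, mul_one]
    ext i j
    rw [traceSnd, diagonal_apply]
    simp only [density, vecMulVec_apply, chi, Pi.star_apply]
    have hs : rt(card c)⁻¹ * star (rt(card c)⁻¹) = ((card c : ℝ)⁻¹ : ℝ) := by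
      rw [← ofReal_inv, star_def, conj_ofReal, ← ofReal_mul, ← mul_inv, mul_self_sqrt hc.le]
    split_ifs with hij
    · subst hij
      rw [sum_eq_single i (fun k _ hk => by simp [hk.symm]) (by simp), if_pos rfl, hs]
    · refine sum_eq_zero fun k _ => ?_
      by_cases h1 : i = k
      · subst h1
        simp [Ne.symm hij]
      · simp [h1]
  rw [h.entropy_eq]
  simp only [negMulLog, sum_const, card_univ, nsmul_eq_mul, log_inv]
  field_simp

end RelEntropy

end

section

/-! ### Hilbert–Schmidt norm -/

section HilbertSchmidt

variable {m n : Type} [Fintype m] [Fintype n]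

/-- Squared Hilbert–Schmidt norm. -/
def nsq (X : Matrix m n ℂ) : ℝ := ∑ i, ∑ j, ‖X i j‖ ^ 2

/-- Hilbert–Schmidt inner product. -/
def hs (X Y : Matrix m n ℂ) : ℂ := ∑ i, ∑ j, star (X i j) * Y i j

lemma nsq_nonneg (X : Matrix m n ℂ) : 0 ≤ nsq X := by unfold nsq; positivity

lemma hs_self (X : Matrix m n ℂ) : hs X X = nsq X := by
  unfold hs nsq
  push_cast
  simp only [← starRingEnd_apply, conj_mul']

lemma hs_add_left (X Y Z : Matrix m n ℂ) : hs (X + Y) Z = hs X Z + hs Y Z := by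
  simp only [hs, Matrix.add_apply, star_add, add_mul, sum_add_distrib]

lemma hs_add_right (X Y Z : Matrix m n ℂ) : hs X (Y + Z) = hs X Y + hs X Z := by
  simp only [hs, Matrix.add_apply, mul_add, sum_add_distrib]

lemma hs_sub_left (X Y Z : Matrix m n ℂ) : hs (X - Y) Z = hs X Z - hs Y Z := by
  simp only [hs, Matrix.sub_apply, star_sub, sub_mul, sum_sub_distrib]

lemma hs_sub_right (X Y Z : Matrix m n ℂ) : hs X (Y - Z) = hs X Y - hs X Z := by
  simp only [hs, Matrix.sub_apply, mul_sub, sum_sub_distrib]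

lemma hs_smul_left (z : ℂ) (X Y : Matrix m n ℂ) : hs (z • X) Y = star z * hs X Y := by
  simp only [hs, Matrix.smul_apply, smul_eq_mul, star_mul', mul_sum, mul_assoc]

lemma hs_smul_right (z : ℂ) (X Y : Matrix m n ℂ) : hs X (z • Y) = z * hs X Y := by
  simp only [hs, Matrix.smul_apply, smul_eq_mul, mul_sum]
  exact sum_congr rfl fun i _ => sum_congr rfl fun j _ => by ring

lemma star_hs (X Y : Matrix m n ℂ) : star (hs X Y) = hs Y X := by
  simp only [hs, star_sum, star_mul', star_star, mul_comm]

@[simp] theorem hs_zero_right (X : Matrix m n ℂ) : hs X 0 = 0 := by simp [hs]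

lemma nsq_smul (z : ℂ) (X : Matrix m n ℂ) : nsq (z • X) = ‖z‖ ^ 2 * nsq X := by
  simp only [nsq, Matrix.smul_apply, smul_eq_mul, norm_mul, mul_pow, mul_sum]

@[simp] theorem nsq_zero : nsq (0 : Matrix m n ℂ) = 0 := by simp [nsq]

lemma nsq_eq_zero {X : Matrix m n ℂ} : nsq X = 0 ↔ X = 0 := by
  constructor
  · intro h
    ext i j
    have h1 := (sum_eq_zero_iff_of_nonneg fun i _ =>
      sum_nonneg fun j _ => sq_nonneg ‖X i j‖).1 h i (mem_univ _)
    have h2 := (sum_eq_zero_iff_of_nonneg fun j _ => sq_nonneg ‖X i j‖).1 h1 j (mem_univ _)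
    simpa using h2
  · rintro rfl
    simp

lemma nsq_add_of_re_hs_eq_zero {X Y : Matrix m n ℂ} (h : (hs X Y).re = 0) : nsq (X + Y) = nsq X +
    nsq Y := by
  have h1 : ((nsq (X + Y) : ℝ) : ℂ) = nsq X + nsq Y + (hs X Y + star (hs X Y)) := by
    rw [← hs_self, hs_add_left, hs_add_right, hs_add_right, hs_self, hs_self, star_hs]
    ring
  have h2 := congrArg Complex.re h1
  simpa [h] using h2

lemma nsq_add_le {t : ℝ} (ht : 0 < t) (X Y : Matrix m n ℂ) : nsq (X + Y) ≤ (1 + t) * nsq X + (1 + 1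
    / t) * nsq Y := by
  simp only [nsq, mul_sum, ← sum_add_distrib]
  refine sum_le_sum fun i _ => sum_le_sum fun j _ => ?_
  have h1 : ‖X i j + Y i j‖ ^ 2 ≤ (‖X i j‖ + ‖Y i j‖) ^ 2 := by
    gcongr
    exact norm_add_le _ _
  have h2 : 0 ≤ (t * ‖X i j‖ - ‖Y i j‖) ^ 2 / t := by positivity
  have h3 : (t * ‖X i j‖ - ‖Y i j‖) ^ 2 / t =
      t * ‖X i j‖ ^ 2 - 2 * ‖X i j‖ * ‖Y i j‖ + 1 / t * ‖Y i j‖ ^ 2 := by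
    field_simp
    ring
  rw [Matrix.add_apply]
  nlinarith

lemma continuous_nsq : Continuous (nsq : Matrix m n ℂ → ℝ) := by
  unfold nsq
  refine continuous_finsetSum _ fun i _ => continuous_finsetSum _ fun j _ => ?_
  exact (continuous_id.matrix_elem i j).norm.pow 2

lemma nsq_conjTranspose (X : Matrix m n ℂ) : nsq Xᴴ = nsq X := by
  unfold nsq
  rw [sum_comm]
  simp [conjTranspose_apply]

lemma hs_eq_trace (X Y : Matrix m n ℂ) : hs X Y = (Xᴴ * Y).trace := by
  simp only [hs, trace, diag_apply, Matrix.mul_apply, conjTranspose_apply]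
  rw [sum_comm]

lemma nsq_unitary_mul [DecidableEq m] (U : Mat m) (hU : Uᴴ * U = 1) (X : Matrix m n ℂ) : nsq (U * X)
    = nsq X := by
  have : ((nsq (U * X) : ℝ) : ℂ) = nsq X := by
    rw [← hs_self, ← hs_self, hs_eq_trace, hs_eq_trace, conjTranspose_mul, Matrix.mul_assoc, ←
      Matrix.mul_assoc Uᴴ, hU, Matrix.one_mul]
  exact_mod_cast this

end HilbertSchmidt

section HermAnti

variable {n : Type} [Fintype n]

/-- Hermitian part. -/
def hermPart (X : Mat n) : Mat n := (2⁻¹ : ℂ) • (X + Xᴴ)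

/-- Anti-Hermitian part. -/
def antiPart (X : Mat n) : Mat n := (2⁻¹ : ℂ) • (X - Xᴴ)

lemma hermPart_add_antiPart (X : Mat n) : hermPart X + antiPart X = X := by
  unfold hermPart antiPart
  rw [← smul_add, add_add_sub_cancel, ← two_smul ℂ X, smul_smul]
  norm_num

lemma hermPart_conjTranspose (X : Mat n) : (hermPart X)ᴴ = hermPart X := by
  unfold hermPart
  rw [conjTranspose_smul, conjTranspose_add, conjTranspose_conjTranspose, add_comm]
  simp

lemma antiPart_conjTranspose (X : Mat n) : (antiPart X)ᴴ = -antiPart X := by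
  unfold antiPart
  rw [conjTranspose_smul, conjTranspose_sub, conjTranspose_conjTranspose, ← smul_neg, neg_sub]
  simp

lemma antiPart_eq_zero {X : Mat n} (h : Xᴴ = X) : antiPart X = 0 := by
  rw [antiPart, h, sub_self, smul_zero]

lemma antiPart_add (X Y : Mat n) : antiPart (X + Y) = antiPart X + antiPart Y := by
  unfold antiPart
  rw [conjTranspose_add, ← smul_add]
  congr 1
  abel

lemma re_hs_herm_anti {X Y : Mat n} (hX : Xᴴ = X) (hY : Yᴴ = -Y) : (hs X Y).re = 0 := by
  have h : star (hs X Y) = -hs X Y := by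
    rw [hs_eq_trace, ← trace_conjTranspose, conjTranspose_mul, conjTranspose_conjTranspose, hY, hX,
      Matrix.neg_mul, Matrix.trace_neg, trace_mul_comm]
  have := congrArg Complex.re h
  simp at this
  linarith

lemma nsq_herm_add_anti (X : Mat n) : nsq X = nsq (hermPart X) + nsq (antiPart X) := by
  conv_lhs => rw [← hermPart_add_antiPart X]
  exact nsq_add_of_re_hs_eq_zero
    (re_hs_herm_anti (hermPart_conjTranspose X) (antiPart_conjTranspose X))

end HermAnti

/-! ### Conditional expectations of a tensor product -/

section CondExp

variable {T f r : Type} [Fintype f] [DecidableEq f]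

/-- `(Tr_f ⊗ 1/d_f)`, for an index set `T ≃ f × r`. -/
def pexp (e : T ≃ f × r) : End ℂ (Mat T) where
  toFun Y := of fun p q => if (e p).1 = (e q).1 then
    (card f : ℂ)⁻¹ * ∑ z, Y (e.symm (z, (e p).2)) (e.symm (z, (e q).2)) else 0
  map_add' X Y := by
    ext p q
    simp only [of_apply, Matrix.add_apply, sum_add_distrib, mul_add]
    split_ifs <;> simp
  map_smul' z X := by
    ext p q
    simp only [of_apply, Matrix.smul_apply, smul_eq_mul, ← mul_sum, RingHom.id_apply]
    split_ifs
    · ring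
    · simp

lemma pexp_apply (e : T ≃ f × r) (Y : Mat T) (p q : T) : pexp e Y p q = if (e p).1 = (e q).1 then
      (card f : ℂ)⁻¹ * ∑ z, Y (e.symm (z, (e p).2)) (e.symm (z, (e q).2)) else 0 := rfl

lemma pexp_mul_self [Nonempty f] (e : T ≃ f × r) : pexp e * pexp e = pexp e := by
  have hf : (card f : ℂ) ≠ 0 := by exact_mod_cast card_ne_zero
  refine LinearMap.ext fun Y => ?_
  ext p q
  rw [End.mul_apply]
  simp only [pexp_apply, Equiv.apply_symm_apply, if_true, sum_const, card_univ, nsmul_eq_mul]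
  split_ifs <;> simp [hf]

lemma pexp_conjTranspose (e : T ≃ f × r) (Y : Mat T) : pexp e Yᴴ = (pexp e Y)ᴴ := by
  ext p q
  rw [conjTranspose_apply]
  simp only [pexp_apply, conjTranspose_apply, eq_comm (a := (e q).1)]
  split_ifs
  · simp
  · simp

lemma hs_pexp [Fintype T] [Fintype r] (e : T ≃ f × r) (X Y : Mat T) : hs (pexp e X) Y = hs X (pexp e
    Y) := by
  have key : ∀ X Y : Mat T, hs (pexp e X) Y = ∑ i : r, ∑ j : r, (card f : ℂ)⁻¹ *
      ((∑ z, star (X (e.symm (z, i)) (e.symm (z, j)))) *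
        ∑ z, Y (e.symm (z, i)) (e.symm (z, j))) := by
    intro X Y
    unfold hs
    rw [← e.symm.sum_comp, sum_prod_type, sum_comm]
    refine sum_congr rfl fun i _ => ?_
    simp_rw [← e.symm.sum_comp (fun q => star (pexp e X _ q) * Y _ q), sum_prod_type]
    rw [sum_congr rfl fun z _ => sum_comm, sum_comm]
    refine sum_congr rfl fun j _ => ?_
    rw [mul_sum, mul_sum]
    refine sum_congr rfl fun z _ => ?_
    rw [sum_eq_single z]
    · simp only [pexp_apply, Equiv.apply_symm_apply, if_true, star_mul', star_inv₀, star_natCast,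
        star_sum]
      ring
    · intro z' _ hz'
      simp [pexp_apply, hz'.symm]
    · simp
  rw [key, ← star_hs, key, star_sum]
  refine sum_congr rfl fun i _ => ?_
  rw [star_sum]
  refine sum_congr rfl fun j _ => ?_
  simp only [star_mul', star_inv₀, star_natCast, star_sum, star_star]
  ring

lemma continuous_end [Fintype T] (q : End ℂ (Mat T)) : Continuous q :=
  LinearMap.continuous_of_finiteDimensional (E := Mat T) (F' := Mat T) q

end CondExp

section Residual

/-- Index set of `A₁ ⊗ Ā₁ ⊗ (A₂ ≅ Ā₂)`. -/
abbrev Tri (a b c : Type) : Type := (a × b) × c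

variable (a b c) in
/-- Conditional expectation onto operators trivial on `A₁`. -/
def expA : End ℂ (TMat a b c) := pexp (f := a) (r := b × c) (Equiv.prodAssoc a b c)

variable (a b c) in
/-- Conditional expectation onto operators trivial on `Ā₁`. -/
def expB : End ℂ (TMat a b c) := pexp (f := b) (r := a × c)
    (((Equiv.prodComm a b).prodCongr (Equiv.refl c)).trans (Equiv.prodAssoc b a c))

variable (a b c) in
/-- Conditional expectation onto operators trivial on the last factor. -/
def expC : End ℂ (TMat a b c) := pexp (f := c) (r := a × b) (Equiv.prodComm (a × b) c)

lemma expA_apply (Y : TMat a b c) (x l : a) (y k : b) (s t : c) :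
    expA a b c Y ((x, y), s) ((l, k), t) = if x = l then
      (card a : ℂ)⁻¹ * ∑ z, Y ((z, y), s) ((z, k), t) else 0 := rfl

lemma expB_apply (Y : TMat a b c) (x l : a) (y k : b) (s t : c) :
    expB a b c Y ((x, y), s) ((l, k), t) = if y = k then
      (card b : ℂ)⁻¹ * ∑ z, Y ((x, z), s) ((l, z), t) else 0 := rfl

lemma expC_apply (Y : TMat a b c) (p q : a × b) (s t : c) :
    expC a b c Y (p, s) (q, t) = if s = t then (card c : ℂ)⁻¹ * ∑ z, Y (p, z) (q, z) else 0 := rfl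

lemma commute_expA_expB : Commute (expA a b c) (expB a b c) := by
  refine LinearMap.ext fun Y => ?_
  ext ⟨⟨x, y⟩, s⟩ ⟨⟨l, k⟩, t⟩
  simp only [End.mul_apply, expA_apply, expB_apply]
  split_ifs <;> simp [← mul_sum, mul_left_comm (card a : ℂ)⁻¹]
  rw [sum_comm]
  simp

lemma commute_expA_expC : Commute (expA a b c) (expC a b c) := by
  refine LinearMap.ext fun Y => ?_
  ext ⟨⟨x, y⟩, s⟩ ⟨⟨l, k⟩, t⟩
  simp only [End.mul_apply, expA_apply, expC_apply]
  split_ifs <;> simp [← mul_sum, mul_left_comm (card a : ℂ)⁻¹]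
  rw [sum_comm]
  simp

lemma commute_expB_expC : Commute (expB a b c) (expC a b c) := by
  refine LinearMap.ext fun Y => ?_
  ext ⟨⟨x, y⟩, s⟩ ⟨⟨l, k⟩, t⟩
  simp only [End.mul_apply, expB_apply, expC_apply]
  split_ifs <;> simp [← mul_sum, mul_left_comm (card b : ℂ)⁻¹]
  rw [sum_comm]
  simp

variable (a b c) in
/-- Component that is nontrivial on all three factors. -/
def compO : End ℂ (TMat a b c) := (1 - expA a b c) * (1 - expB a b c) * (1 - expC a b c)

variable (a b c) in
/-- Component that is nontrivial exactly on `A₁` and the last factor. -/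
def compA : End ℂ (TMat a b c) := (1 - expA a b c) * expB a b c * (1 - expC a b c)

variable (a b c) in
/-- Component that is nontrivial exactly on `Ā₁` and the last factor. -/
def compB : End ℂ (TMat a b c) := expA a b c * (1 - expB a b c) * (1 - expC a b c)

variable (a b c) in
/-- Component that is nontrivial exactly on the last factor. -/
def compC : End ℂ (TMat a b c) := expA a b c * expB a b c * (1 - expC a b c)

end Residual

end

section

section ResidualAlgebra

/-- Multiplication table of the components of a triple of commuting projections. -/
def ComponentRelations {R : Type*} [Ring R] (p q r : R) : Prop :=
    (p * ((1 - p) * (1 - q) * (1 - r)) = 0 ∧ q * ((1 - p) * (1 - q) * (1 - r)) = 0) ∧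
    ((1 - p) * (1 - q) * (1 - r) * ((1 - p) * (1 - q) * (1 - r)) = (1 - p) * (1 - q) * (1 - r) ∧
     (1 - p) * q * (1 - r) * ((1 - p) * q * (1 - r)) = (1 - p) * q * (1 - r) ∧
     p * (1 - q) * (1 - r) * (p * (1 - q) * (1 - r)) = p * (1 - q) * (1 - r) ∧
     p * q * (1 - r) * (p * q * (1 - r)) = p * q * (1 - r)) ∧
    ((1 - p) * (1 - q) * (1 - r) * ((1 - p) * q * (1 - r)) = 0 ∧
     (1 - p) * (1 - q) * (1 - r) * (p * (1 - q) * (1 - r)) = 0 ∧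
     (1 - p) * (1 - q) * (1 - r) * (p * q * (1 - r)) = 0 ∧
     (1 - p) * q * (1 - r) * (p * (1 - q) * (1 - r)) = 0 ∧
     (1 - p) * q * (1 - r) * (p * q * (1 - r)) = 0 ∧
     p * (1 - q) * (1 - r) * (p * q * (1 - r)) = 0) ∧
    ((1 - r) * (1 - q) * (1 - p) = (1 - p) * (1 - q) * (1 - r) ∧
     (1 - r) * q * (1 - p) = (1 - p) * q * (1 - r) ∧
     (1 - r) * (1 - q) * p = p * (1 - q) * (1 - r) ∧
     (1 - r) * q * p = p * q * (1 - r)) ∧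
    ((1 - p) * (1 - q) * (1 - r) * p = 0 ∧ (1 - p) * (1 - q) * (1 - r) * q = 0 ∧
     (1 - p) * q * (1 - r) * p = 0 ∧ p * (1 - q) * (1 - r) * q = 0 ∧
     (1 - p) * (1 - q) * (1 - r) * r = 0 ∧ (1 - p) * q * (1 - r) * r = 0 ∧
     p * (1 - q) * (1 - r) * r = 0 ∧ p * q * (1 - r) * r = 0) ∧
    (p * ((1 - p) * q * (1 - r)) = 0 ∧ q * ((1 - p) * q * (1 - r)) = (1 - p) * q * (1 - r) ∧
     p * (p * (1 - q) * (1 - r)) = p * (1 - q) * (1 - r) ∧ q * (p * (1 - q) * (1 - r)) = 0 ∧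
     p * (p * q * (1 - r)) = p * q * (1 - r) ∧ q * (p * q * (1 - r)) = p * q * (1 - r))

lemma componentRelations {R : Type*} [Ring R] {p q r : R} (pp : p * p = p) (qq : q * q = q) (rr : r
    * r = r) (pq : Commute p q) (pr : Commute p r) (qr : Commute q r) : ComponentRelations p q r :=
    by
  have qp : q * p = p * q := pq.eq.symm
  have rp : r * p = p * r := pr.eq.symm
  have rq : r * q = q * r := qr.eq.symm
  have qp' : ∀ x, q * (p * x) = p * (q * x) := fun x => by rw [← mul_assoc, qp, mul_assoc]
  have rp' : ∀ x, r * (p * x) = p * (r * x) := fun x => by rw [← mul_assoc, rp, mul_assoc]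
  have rq' : ∀ x, r * (q * x) = q * (r * x) := fun x => by rw [← mul_assoc, rq, mul_assoc]
  have pp' : ∀ x, p * (p * x) = p * x := fun x => by rw [← mul_assoc, pp]
  have qq' : ∀ x, q * (q * x) = q * x := fun x => by rw [← mul_assoc, qq]
  simp only [ComponentRelations, mul_sub, sub_mul, mul_one, one_mul, mul_assoc, qp, rp, rq, qp',
    rp', rq', pp, qq, rr, pp', qq']
  refine ⟨⟨?_, ?_⟩, ⟨?_, ?_, ?_, ?_⟩, ⟨?_, ?_, ?_, ?_, ?_, ?_⟩, ⟨?_, ?_, ?_, ?_⟩,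
    ⟨?_, ?_, ?_, ?_, ?_, ?_, ?_, ?_⟩, ?_, ?_, ?_, ?_, ?_, ?_⟩ <;> first | trivial | abel

/-- `q` is self-adjoint for the Hilbert–Schmidt inner product. -/
def IsSelfAdj {T : Type} [Fintype T] (q : End ℂ (Mat T)) : Prop := ∀ X Y, hs (q X) Y = hs X (q Y)

lemma IsSelfAdj.one_sub {T : Type} [Fintype T] {q : End ℂ (Mat T)} (h : IsSelfAdj q) : IsSelfAdj (1
    - q) := fun X Y => by
  simp only [LinearMap.sub_apply, End.one_apply, hs_sub_left, hs_sub_right, h X Y]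

lemma IsSelfAdj.hs_mul {T : Type} [Fintype T] {q r : End ℂ (Mat T)} (hq : IsSelfAdj q) (hr :
    IsSelfAdj r) (X Y : Mat T) : hs ((q * r) X) Y = hs X ((r * q) Y) := by
  rw [End.mul_apply, hq, hr, End.mul_apply]

/-- `q` commutes with the adjoint. -/
def PreservesStar {T : Type} (q : End ℂ (Mat T)) : Prop := ∀ X, q Xᴴ = (q X)ᴴ

lemma PreservesStar.one_sub {T : Type} {q : End ℂ (Mat T)} (h : PreservesStar q) : PreservesStar (1
    - q) := fun X => by
  simp only [LinearMap.sub_apply, End.one_apply, h X, conjTranspose_sub]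

lemma PreservesStar.mul {T : Type} {q r : End ℂ (Mat T)} (hq : PreservesStar q) (hr : PreservesStar
    r) : PreservesStar (q * r) := fun X => by
  rw [End.mul_apply, End.mul_apply, hr X, hq]

lemma PreservesStar.antiPart {T : Type} [Fintype T] {q : End ℂ (Mat T)} (h : PreservesStar q) (X :
    Mat T) : q (antiPart X) = antiPart (q X) := by
  simp only [SkewedCode.antiPart, map_smul, map_sub, h X]

lemma PreservesStar.hermPart {T : Type} [Fintype T] {q : End ℂ (Mat T)} (h : PreservesStar q) (X :
    Mat T) : q (hermPart X) = hermPart (q X) := by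
  simp only [SkewedCode.hermPart, map_smul, map_add, h X]

lemma nsq_apply_le {T : Type} [Fintype T] {q : End ℂ (Mat T)} (hq : IsSelfAdj q) (hqq : q * q = q)
    (X : Mat T) : nsq (q X) ≤ nsq X := by
  have h : hs (q X) (X - q X) = 0 := by
    rw [hs_sub_right, ← hq, ← End.mul_apply, hqq, sub_self]
  have h1 := nsq_add_of_re_hs_eq_zero (X := q X) (Y := X - q X) (by rw [h]; rfl)
  rw [add_sub_cancel] at h1
  linarith [nsq_nonneg (X - q X)]

lemma isSelfAdj_expA : IsSelfAdj (expA a b c) := hs_pexp _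
lemma isSelfAdj_expB : IsSelfAdj (expB a b c) := hs_pexp _
lemma isSelfAdj_expC : IsSelfAdj (expC a b c) := hs_pexp _
lemma preservesStar_expA : PreservesStar (expA a b c) := pexp_conjTranspose _
lemma preservesStar_expB : PreservesStar (expB a b c) := pexp_conjTranspose _
lemma preservesStar_expC : PreservesStar (expC a b c) := pexp_conjTranspose _

lemma preservesStar_compA : PreservesStar (compA a b c) :=
  (preservesStar_expA.one_sub.mul preservesStar_expB).mul preservesStar_expC.one_sub
lemma preservesStar_compB : PreservesStar (compB a b c) :=
  (preservesStar_expA.mul preservesStar_expB.one_sub).mul preservesStar_expC.one_sub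
lemma preservesStar_compC : PreservesStar (compC a b c) :=
  (preservesStar_expA.mul preservesStar_expB).mul preservesStar_expC.one_sub

lemma comp_sum : compO a b c + compA a b c + compB a b c + compC a b c = 1 - expC a b c := by
  unfold compO compA compB compC
  rw [← add_mul, ← add_mul, ← add_mul, ← mul_add, add_assoc, ← mul_add]
  simp

variable [Nonempty a] [Nonempty b] [Nonempty c]

lemma comp_rels : ComponentRelations (expA a b c) (expB a b c) (expC a b c) :=
  componentRelations (pexp_mul_self _) (pexp_mul_self _) (pexp_mul_self _) commute_expA_expB
    commute_expA_expC commute_expB_expC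

lemma isSelfAdj_compO : IsSelfAdj (compO a b c) := fun X Y => by
  have := (comp_rels (a := a) (b := b) (c := c)).2.2.2.1.1
  conv_rhs => rw [compO]; rw [← this]
  rw [compO, End.mul_apply, End.mul_apply, isSelfAdj_expA.one_sub, isSelfAdj_expB.one_sub,
    isSelfAdj_expC.one_sub]
  rfl

lemma isSelfAdj_compA : IsSelfAdj (compA a b c) := fun X Y => by
  have := (comp_rels (a := a) (b := b) (c := c)).2.2.2.1.2.1
  conv_rhs => rw [compA]; rw [← this]
  rw [compA, End.mul_apply, End.mul_apply, isSelfAdj_expA.one_sub, isSelfAdj_expB,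
    isSelfAdj_expC.one_sub]
  rfl

lemma isSelfAdj_compB : IsSelfAdj (compB a b c) := fun X Y => by
  have := (comp_rels (a := a) (b := b) (c := c)).2.2.2.1.2.2.1
  conv_rhs => rw [compB]; rw [← this]
  rw [compB, End.mul_apply, End.mul_apply, isSelfAdj_expA, isSelfAdj_expB.one_sub,
    isSelfAdj_expC.one_sub]
  rfl

lemma isSelfAdj_compC : IsSelfAdj (compC a b c) := fun X Y => by
  have := (comp_rels (a := a) (b := b) (c := c)).2.2.2.1.2.2.2
  conv_rhs => rw [compC]; rw [← this]
  rw [compC, End.mul_apply, End.mul_apply, isSelfAdj_expA, isSelfAdj_expB, isSelfAdj_expC.one_sub]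
  rfl

lemma compO_mul_self : compO a b c * compO a b c = compO a b c := comp_rels.2.1.1
lemma compA_mul_self : compA a b c * compA a b c = compA a b c := comp_rels.2.1.2.1
lemma compB_mul_self : compB a b c * compB a b c = compB a b c := comp_rels.2.1.2.2.1
lemma compC_mul_self : compC a b c * compC a b c = compC a b c := comp_rels.2.1.2.2.2
lemma compO_mul_compA : compO a b c * compA a b c = 0 := comp_rels.2.2.1.1
lemma compO_mul_compB : compO a b c * compB a b c = 0 := comp_rels.2.2.1.2.1
lemma compA_mul_compB : compA a b c * compB a b c = 0 := comp_rels.2.2.1.2.2.2.1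
lemma compO_mul_expA : compO a b c * expA a b c = 0 := comp_rels.2.2.2.2.1.1
lemma compO_mul_expB : compO a b c * expB a b c = 0 := comp_rels.2.2.2.2.1.2.1
lemma compA_mul_expA : compA a b c * expA a b c = 0 := comp_rels.2.2.2.2.1.2.2.1
lemma compB_mul_expB : compB a b c * expB a b c = 0 := comp_rels.2.2.2.2.1.2.2.2.1
lemma compO_mul_expC : compO a b c * expC a b c = 0 := comp_rels.2.2.2.2.1.2.2.2.2.1
lemma compA_mul_expC : compA a b c * expC a b c = 0 := comp_rels.2.2.2.2.1.2.2.2.2.2.1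
lemma compB_mul_expC : compB a b c * expC a b c = 0 := comp_rels.2.2.2.2.1.2.2.2.2.2.2.1
lemma compC_mul_expC : compC a b c * expC a b c = 0 := comp_rels.2.2.2.2.1.2.2.2.2.2.2.2
lemma expA_mul_compO : expA a b c * compO a b c = 0 := comp_rels.1.1
lemma expB_mul_compO : expB a b c * compO a b c = 0 := comp_rels.1.2
lemma expA_mul_compA : expA a b c * compA a b c = 0 := comp_rels.2.2.2.2.2.1
lemma expB_mul_compA : expB a b c * compA a b c = compA a b c := comp_rels.2.2.2.2.2.2.1
lemma expA_mul_compB : expA a b c * compB a b c = compB a b c := comp_rels.2.2.2.2.2.2.2.1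
lemma expB_mul_compB : expB a b c * compB a b c = 0 := comp_rels.2.2.2.2.2.2.2.2.1
lemma expA_mul_compC : expA a b c * compC a b c = compC a b c := comp_rels.2.2.2.2.2.2.2.2.2.1
lemma expB_mul_compC : expB a b c * compC a b c = compC a b c := comp_rels.2.2.2.2.2.2.2.2.2.2

lemma hs_eq_zero_of_mul {T : Type} [Fintype T] {q r : End ℂ (Mat T)} (hq : IsSelfAdj q) (h : q * r =
    0) (X Y : Mat T) : hs (q X) (r Y) = 0 := by
  rw [hq, ← End.mul_apply, h, LinearMap.zero_apply, hs_zero_right]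

variable (a b c) in
/-- Component that breaks the product structure between `A₁Ā₁` and the last factor. -/
def compP : End ℂ (TMat a b c) := compO a b c + compA a b c + compB a b c

/-- What is left of `Y` after removing all operators of product form and all Hermitian operators
supported on `A₁` (or `Ā₁`) and the last factor. -/
def resid (Y : TMat a b c) : TMat a b c :=
  compO a b c Y + compA a b c (antiPart Y) + compB a b c (antiPart Y)

lemma nsq_three (X Y Z : TMat a b c) : nsq (compO a b c X + compA a b c Y + compB a b c Z) = nsq
    (compO a b c X) + nsq (compA a b c Y) + nsq (compB a b c Z) := by
  rw [nsq_add_of_re_hs_eq_zero, nsq_add_of_re_hs_eq_zero]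
  · rw [hs_eq_zero_of_mul isSelfAdj_compO compO_mul_compA]; rfl
  · rw [hs_add_left, hs_eq_zero_of_mul isSelfAdj_compO compO_mul_compB, hs_eq_zero_of_mul
      isSelfAdj_compA compA_mul_compB]
    simp

lemma nsq_compA_herm_anti (Y : TMat a b c) : nsq (compA a b c Y) = nsq (compA a b c (hermPart Y)) +
    nsq (compA a b c (antiPart Y)) := by
  rw [nsq_herm_add_anti, preservesStar_compA.hermPart, preservesStar_compA.antiPart]

lemma nsq_compB_herm_anti (Y : TMat a b c) : nsq (compB a b c Y) = nsq (compB a b c (hermPart Y)) +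
    nsq (compB a b c (antiPart Y)) := by
  rw [nsq_herm_add_anti, preservesStar_compB.hermPart, preservesStar_compB.antiPart]

lemma nsq_resid_le_compP (Y : TMat a b c) : nsq (resid Y) ≤ nsq (compP a b c Y) := by
  simp only [resid, compP, LinearMap.add_apply]
  rw [nsq_three, nsq_three, nsq_compA_herm_anti Y, nsq_compB_herm_anti Y]
  linarith [nsq_nonneg (compA a b c (hermPart Y)), nsq_nonneg (compB a b c (hermPart Y))]

lemma compP_eq_resid {Y : TMat a b c} (h : nsq (compP a b c Y) ≤ nsq (resid Y)) : compA a b c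
    (hermPart Y) = 0 ∧ compB a b c (hermPart Y) = 0 := by
  simp only [resid, compP, LinearMap.add_apply] at h
  rw [nsq_three, nsq_three, nsq_compA_herm_anti Y, nsq_compB_herm_anti Y] at h
  have h1 := nsq_nonneg (compA a b c (hermPart Y))
  have h2 := nsq_nonneg (compB a b c (hermPart Y))
  exact ⟨nsq_eq_zero.1 (by linarith), nsq_eq_zero.1 (by linarith)⟩

lemma isSelfAdj_compP : IsSelfAdj (compP a b c) := fun X Y => by
  simp only [compP, LinearMap.add_apply, hs_add_left, hs_add_right, isSelfAdj_compO X Y,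
    isSelfAdj_compA X Y, isSelfAdj_compB X Y]

lemma mul_eq_zero_swap {T : Type} [Fintype T] {q r : End ℂ (Mat T)} (hq : IsSelfAdj q) (hr :
    IsSelfAdj r) (h : q * r = 0) : r * q = 0 := by
  refine LinearMap.ext fun X => nsq_eq_zero.1 ?_
  have : ((nsq ((r * q) X) : ℝ) : ℂ) = 0 := by
    rw [← hs_self, End.mul_apply, hr, hq, ← End.mul_apply q r, h]
    simp
  exact_mod_cast this

lemma compP_mul_self : compP a b c * compP a b c = compP a b c := by
  have h1 := mul_eq_zero_swap isSelfAdj_compO isSelfAdj_compA (compO_mul_compA (a := a) (b := b) (c := c))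
  have h2 := mul_eq_zero_swap isSelfAdj_compO isSelfAdj_compB (compO_mul_compB (a := a) (b := b) (c := c))
  have h3 := mul_eq_zero_swap isSelfAdj_compA isSelfAdj_compB (compA_mul_compB (a := a) (b := b) (c := c))
  simp only [compP, mul_add, add_mul, h1, h2, h3, compO_mul_self, compA_mul_self, compB_mul_self,
    compO_mul_compA, compO_mul_compB, compA_mul_compB]
  abel

lemma resid_add (X Y : TMat a b c) : resid (X + Y) = resid X + resid Y := by
  simp only [resid, antiPart_add, map_add]
  abel

lemma apply_zero_of_mul {T : Type} {q r : End ℂ (Mat T)} (h : q * r = 0) {Y : Mat T} (hY : r Y = Y)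
    : q Y = 0 := by
  rw [← hY, ← End.mul_apply, h, LinearMap.zero_apply]

lemma antiPart_fixed {T : Type} [Fintype T] {q : End ℂ (Mat T)} (hq : PreservesStar q) {Y : Mat T}
    (hY : q Y = Y) : q (antiPart Y) = antiPart Y := by
  rw [hq.antiPart, hY]

lemma resid_eq_zero_of_expA {Y : TMat a b c} (h : expA a b c Y = Y) (hY : Yᴴ = Y) : resid Y = 0 :=
    by
  rw [resid, apply_zero_of_mul compO_mul_expA h, antiPart_eq_zero hY]
  simp

lemma resid_eq_zero_of_expB {Y : TMat a b c} (h : expB a b c Y = Y) (hY : Yᴴ = Y) : resid Y = 0 :=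
    by
  rw [resid, apply_zero_of_mul compO_mul_expB h, antiPart_eq_zero hY]
  simp

lemma resid_eq_zero_of_expC {Y : TMat a b c} (h : expC a b c Y = Y) : resid Y = 0 := by
  have h' := antiPart_fixed preservesStar_expC h
  rw [resid, apply_zero_of_mul compO_mul_expC h, apply_zero_of_mul compA_mul_expC h',
    apply_zero_of_mul compB_mul_expC h']
  simp

lemma resid_eq_zero_of_expA_expB {Y : TMat a b c} (hA : expA a b c Y = Y) (hB : expB a b c Y = Y) :
    resid Y = 0 := by
  rw [resid, apply_zero_of_mul compO_mul_expA hA, apply_zero_of_mul compA_mul_expA (antiPart_fixed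
    preservesStar_expA hA), apply_zero_of_mul compB_mul_expB (antiPart_fixed preservesStar_expB hB)]
  simp

lemma resid_decomposition (Y : TMat a b c) : Y = resid Y + (expC a b c Y + compC a b c Y + compA a b
    c (hermPart Y) + compB a b c (hermPart Y)) := by
  have h := LinearMap.congr_fun (comp_sum (a := a) (b := b) (c := c)) Y
  simp only [LinearMap.add_apply, LinearMap.sub_apply, End.one_apply] at h
  have hA : compA a b c Y = compA a b c (hermPart Y) + compA a b c (antiPart Y) := by
    rw [← map_add, hermPart_add_antiPart]
  have hB : compB a b c Y = compB a b c (hermPart Y) + compB a b c (antiPart Y) := by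
    rw [← map_add, hermPart_add_antiPart]
  rw [hA, hB] at h
  rw [resid, ← sub_eq_zero]
  rw [← sub_eq_zero] at h
  rw [← neg_eq_zero, ← h]
  abel

end ResidualAlgebra

end

section

section Hat

/-- Reshape an encoding map to an operator on `A₁ ⊗ Ā₁ ⊗ C`, the two registers `A₂`, `Ā₂` becoming
row and column index of the last factor. -/
def hat (M : Enc a b c) : TMat a b c := of fun p q => M ((p.1.1, p.2), (p.1.2, q.2)) q.1

/-- `red W = √d_C · hat (W * attachChi)`. -/
def red (W : PMat a b c) : TMat a b c :=
  of fun p q => ∑ u, W ((p.1.1, p.2), (p.1.2, q.2)) ((q.1.1, u), (q.1.2, u))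

/-- The image of an operator on `A` under `red`. -/
def liftA (X : Mat (a × c)) : TMat a b c :=
  of fun p q => if p.1.2 = q.1.2 then X (p.1.1, p.2) (q.1.1, q.2) else 0

/-- The image of an operator on `Ā` under `red`. -/
def liftB (X : Mat (b × c)) : TMat a b c :=
  of fun p q => if p.1.1 = q.1.1 then X (p.1.2, q.2) (q.1.2, p.2) else 0

/-- `N ⊗ |ζ⟩`. -/
def prodOp (N : Mat (a × b)) (ζ : Mat c) : Enc a b c :=
  of fun p l => N (p.1.1, p.2.1) l * ζ p.1.2 p.2.2

lemma hat_add (M N : Enc a b c) : hat (M + N) = hat M + hat N := rfl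
lemma hat_sub (M N : Enc a b c) : hat (M - N) = hat M - hat N := rfl
lemma hat_smul (z : ℂ) (M : Enc a b c) : hat (z • M) = z • hat M := rfl

lemma hat_prodOp (N : Mat (a × b)) (ζ : Mat c) : hat (prodOp N ζ) = N ⊗ₖ ζ := rfl

lemma red_add (V W : PMat a b c) : red (V + W) = red V + red W := by
  ext p q
  simp [red, sum_add_distrib]

lemma red_smul (z : ℂ) (W : PMat a b c) : red (z • W) = z • red W := by
  ext p q
  simp [red, mul_sum]

lemma hs_hat (M N : Enc a b c) : hs (hat M) (hat N) = hs M N := by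
  unfold hs
  rw [← sum_prod_type', ← sum_prod_type']
  exact sum_equiv (⟨fun x => (((x.1.1.1, x.1.2), (x.1.1.2, x.2.2)), x.2.1),
      fun x => (((x.1.1.1, x.1.2.1), x.1.1.2), (x.2, x.1.2.2)), fun _ => rfl, fun _ => rfl⟩ :
      Tri a b c × Tri a b c ≃ Phys a b c × Logical a b) _ _ fun _ => rfl

lemma nsq_hat (M : Enc a b c) : nsq (hat M) = nsq M :=
  ofReal_injective (by rw [← hs_self, hs_hat, hs_self])

lemma continuous_hat : Continuous (hat : Enc a b c → _) :=
  continuous_matrix fun _ _ => continuous_id.matrix_elem _ _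

variable (a b c) in
/-- `attachChi` with explicit index types. -/
abbrev chiIso : Enc a b c := attachChi

lemma hat_mul_attachChi (W : PMat a b c) : hat (W * chiIso a b c) = rt(card c)⁻¹ • red W := by
  ext ⟨⟨x, y⟩, s⟩ ⟨⟨l, k⟩, t⟩
  change (W * chiIso a b c) ((x, s), (y, t)) (l, k) =
    rt(card c)⁻¹ * ∑ u, W ((x, s), (y, t)) ((l, u), (k, u))
  rw [Matrix.mul_apply]
  simp only [sum_prod_type, attachChi, chi, Prod.mk.injEq, ite_and, mul_ite, mul_zero, mul_sum]
  rw [sum_eq_single l (fun x' _ hx' => by simp [hx']) (by simp)]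
  refine sum_congr rfl fun u _ => ?_
  rw [sum_eq_single k (fun y' _ hy' => by simp [hy']) (by simp)]
  simp [mul_comm]

lemma hat_attachChi : hat (chiIso a b c) = rt(card c)⁻¹ • 1 := by
  ext ⟨⟨x, y⟩, s⟩ ⟨⟨l, k⟩, t⟩
  simp only [hat, attachChi, chi, of_apply, Matrix.smul_apply, Matrix.one_apply, smul_eq_mul,
    Prod.mk.injEq]
  split_ifs <;> simp_all

lemma red_kronecker_one (X : Mat (a × c)) : red (X ⊗ₖ (1 : Mat (b × c))) = liftA X := by
  ext ⟨⟨x, y⟩, s⟩ ⟨⟨l, k⟩, t⟩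
  simp only [red, liftA, of_apply, kroneckerMap_apply, Matrix.one_apply, Prod.mk.injEq]
  by_cases h : y = k <;> simp [h]

lemma red_one_kronecker (X : Mat (b × c)) : red ((1 : Mat (a × c)) ⊗ₖ X) = liftB X := by
  ext ⟨⟨x, y⟩, s⟩ ⟨⟨l, k⟩, t⟩
  simp only [red, liftB, of_apply, kroneckerMap_apply, Matrix.one_apply, Prod.mk.injEq]
  by_cases h : x = l <;> simp [h]

lemma liftA_conjTranspose (X : Mat (a × c)) : (liftA (b := b) X)ᴴ = liftA Xᴴ := by
  ext p q
  simp only [liftA, of_apply, conjTranspose_apply, eq_comm (a := p.1.2)]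
  split_ifs <;> simp

lemma liftB_conjTranspose (X : Mat (b × c)) : (liftB (a := a) X)ᴴ = liftB Xᴴ := by
  ext p q
  simp only [liftB, of_apply, conjTranspose_apply, eq_comm (a := p.1.1)]
  split_ifs <;> simp

lemma expB_liftA [Nonempty b] (X : Mat (a × c)) : expB a b c (liftA X) = liftA X := by
  ext ⟨⟨x, y⟩, s⟩ ⟨⟨l, k⟩, t⟩
  rw [expB_apply]
  simp [liftA]

lemma expA_liftB [Nonempty a] (X : Mat (b × c)) : expA a b c (liftB X) = liftB X := by
  ext ⟨⟨x, y⟩, s⟩ ⟨⟨l, k⟩, t⟩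
  rw [expA_apply]
  simp [liftB]

lemma expC_kronecker_one [Nonempty c] (N : Mat (a × b)) : expC a b c (N ⊗ₖ (1 : Mat c)) = N ⊗ₖ (1 :
    Mat c) := by
  ext ⟨p, s⟩ ⟨q, t⟩
  rw [expC_apply]
  simp [Matrix.one_apply]

lemma expA_one_kronecker [Nonempty a] (Z : Mat c) : expA a b c ((1 : Mat (a × b)) ⊗ₖ Z) = 1 ⊗ₖ Z :=
    by
  ext ⟨⟨x, y⟩, s⟩ ⟨⟨l, k⟩, t⟩
  rw [expA_apply]
  by_cases h1 : x = l <;> by_cases h2 : y = k <;> simp [h1, h2]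

lemma expB_one_kronecker [Nonempty b] (Z : Mat c) : expB a b c ((1 : Mat (a × b)) ⊗ₖ Z) = 1 ⊗ₖ Z :=
    by
  ext ⟨⟨x, y⟩, s⟩ ⟨⟨l, k⟩, t⟩
  rw [expB_apply]
  by_cases h1 : x = l <;> by_cases h2 : y = k <;> simp [h1, h2]

lemma exists_liftA [Nonempty b] {Y : TMat a b c} (h : expB a b c Y = Y) (hY : Yᴴ = Y) : ∃ X,
    X.IsHermitian ∧ liftA X = Y := by
  obtain ⟨y₀⟩ := ‹Nonempty b›
  refine ⟨of fun p q => Y ((p.1, y₀), p.2) ((q.1, y₀), q.2), ?_, ?_⟩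
  · ext p q
    rw [conjTranspose_apply, of_apply, of_apply, ← conjTranspose_apply, hY]
  · have hsame : ∀ x s l t y, Y ((x, y), s) ((l, y), t) = Y ((x, y₀), s) ((l, y₀), t) := by
      intro x s l t y
      rw [← h]
      simp [expB_apply]
    ext ⟨⟨x, y⟩, s⟩ ⟨⟨l, k⟩, t⟩
    simp only [liftA, of_apply]
    split_ifs with hyk
    · subst hyk
      exact (hsame _ _ _ _ _).symm
    · rw [← h, expB_apply, if_neg hyk]

lemma exists_liftB [Nonempty a] {Y : TMat a b c} (h : expA a b c Y = Y) (hY : Yᴴ = Y) : ∃ X,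
    X.IsHermitian ∧ liftB X = Y := by
  obtain ⟨x₀⟩ := ‹Nonempty a›
  refine ⟨of fun p q => Y ((x₀, p.1), q.2) ((x₀, q.1), p.2), ?_, ?_⟩
  · ext p q
    rw [conjTranspose_apply, of_apply, of_apply, ← conjTranspose_apply, hY]
  · have hsame : ∀ x s l t y, Y ((x, y), s) ((x, l), t) = Y ((x₀, y), s) ((x₀, l), t) := by
      intro x s l t y
      rw [← h]
      simp [expA_apply]
    ext ⟨⟨x, y⟩, s⟩ ⟨⟨l, k⟩, t⟩
    simp only [liftB, of_apply]
    split_ifs with hyk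
    · subst hyk
      exact (hsame _ _ _ _ _).symm
    · rw [← h, expA_apply, if_neg hyk]

lemma exists_kronecker_one [Nonempty c] {Y : TMat a b c} (h : expC a b c Y = Y) : ∃ N : Mat (a × b),
    N ⊗ₖ (1 : Mat c) = Y ∧ ∀ p q s, N p q = Y (p, s) (q, s) := by
  obtain ⟨s₀⟩ := ‹Nonempty c›
  have hsame : ∀ p q s, Y (p, s) (q, s) = Y (p, s₀) (q, s₀) := by
    intro p q s
    rw [← h]
    simp [expC_apply]
  refine ⟨of fun p q => Y (p, s₀) (q, s₀), ?_, fun p q s => (hsame _ _ _).symm⟩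
  ext ⟨p, s⟩ ⟨q, t⟩
  simp only [kroneckerMap_apply, of_apply, Matrix.one_apply]
  split_ifs with hst
  · subst hst
    rw [mul_one, hsame p q s]
  · rw [mul_zero, ← h, expC_apply, if_neg hst]

lemma exists_one_kronecker [Nonempty a] [Nonempty b] {Y : TMat a b c} (hA : expA a b c Y = Y) (hB :
    expB a b c Y = Y) : ∃ Z : Mat c, (1 : Mat (a × b)) ⊗ₖ Z = Y := by
  obtain ⟨x₀⟩ := ‹Nonempty a›
  obtain ⟨y₀⟩ := ‹Nonempty b›
  have hsa : ∀ x y k s t, Y ((x, y), s) ((x, k), t) = Y ((x₀, y), s) ((x₀, k), t) := by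
    intro x y k s t
    rw [← hA]
    simp [expA_apply]
  have hsb : ∀ x y l s t, Y ((x, y), s) ((l, y), t) = Y ((x, y₀), s) ((l, y₀), t) := by
    intro x y k s t
    rw [← hB]
    simp [expB_apply]
  refine ⟨of fun s t => Y ((x₀, y₀), s) ((x₀, y₀), t), ?_⟩
  ext ⟨⟨x, y⟩, s⟩ ⟨⟨l, k⟩, t⟩
  simp only [kroneckerMap_apply, of_apply, Matrix.one_apply, Prod.mk.injEq]
  by_cases hx : x = l
  · subst hx
    by_cases hy : y = k
    · subst hy
      simp [hsa x, hsb x₀ y]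
    · rw [if_neg (by simp [hy]), zero_mul, ← hB, expB_apply, if_neg hy]
  · rw [if_neg (by simp [hx]), zero_mul, ← hA, expA_apply, if_neg hx]

lemma conjTranspose_expC_red {W : PMat a b c} (hW : W.IsHermitian) : (expC a b c (red W))ᴴ = expC a
    b c (red W) := by
  ext ⟨p, s⟩ ⟨q, t⟩
  rw [conjTranspose_apply, expC_apply, expC_apply]
  by_cases h : s = t
  · subst h
    simp only [if_true, red, of_apply, star_mul', star_inv₀, star_natCast, star_sum, hW.apply]
    rw [sum_comm]
  · rw [if_neg h, if_neg (Ne.symm h), star_zero]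

/-! ### Product approximations -/

lemma nsq_kronecker {m n k l : Type} [Fintype m] [Fintype n] [Fintype k] [Fintype l] (X : Matrix m n
    ℂ) (Y : Matrix k l ℂ) : nsq (X ⊗ₖ Y) = nsq X * nsq Y := by
  simp only [nsq, sum_prod_type, kroneckerMap_apply, norm_mul, mul_pow, ← mul_sum, ← sum_mul]

/-- Traceless part. -/
def traceless {n : Type} [Fintype n] [DecidableEq n] (X : Mat n) : Mat n :=
  X - ((card n : ℂ)⁻¹ * X.trace) • 1

lemma one_sub_expC_kronecker (N : Mat (a × b)) (ζ : Mat c) : (1 - expC a b c) (N ⊗ₖ ζ) = N ⊗ₖ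
    traceless ζ := by
  ext ⟨p, s⟩ ⟨q, t⟩
  simp only [LinearMap.sub_apply, End.one_apply, Matrix.sub_apply, expC_apply, traceless,
    kroneckerMap_apply, Matrix.smul_apply, Matrix.one_apply, smul_eq_mul, trace, diag_apply, ←
    mul_sum]
  split_ifs <;> ring

lemma one_sub_expA_expB_kronecker (N : Mat (a × b)) (ζ : Mat c) : (1 - expA a b c * expB a b c) (N
    ⊗ₖ ζ) = traceless N ⊗ₖ ζ := by
  ext ⟨⟨x, y⟩, s⟩ ⟨⟨l, k⟩, t⟩
  simp only [LinearMap.sub_apply, End.one_apply, End.mul_apply, Matrix.sub_apply, expA_apply,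
    expB_apply, traceless, kroneckerMap_apply, Matrix.smul_apply, Matrix.one_apply, smul_eq_mul,
    trace, diag_apply, ← sum_mul, sum_prod_type, Prod.mk.injEq, card_prod, Nat.cast_mul, mul_inv]
  by_cases h1 : x = l <;> by_cases h2 : y = k <;> simp [h1, h2]
  simp only [← mul_sum, ← sum_mul]
  ring

lemma compP_eq : compP a b c = (1 - expC a b c) * (1 - expA a b c * expB a b c) := by
  have h : ∀ {R : Type} [Ring R] {p q r : R}, Commute p q → Commute p r → Commute q r →
      (1 - p) * (1 - q) * (1 - r) + (1 - p) * q * (1 - r) + p * (1 - q) * (1 - r) =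
      (1 - r) * (1 - p * q) := by
    intro R _ p q r pq pr qr
    have e : r * (p * q) = p * (q * r) := by
      rw [← mul_assoc, ← pr.eq, mul_assoc, qr.eq]
    simp only [mul_sub, sub_mul, mul_one, one_mul, mul_assoc, e]
    abel
  exact h commute_expA_expB commute_expA_expC commute_expB_expC

lemma nsq_compP_kronecker (N : Mat (a × b)) (ζ : Mat c) : nsq (compP a b c (N ⊗ₖ ζ)) * nsq (N ⊗ₖ ζ)
    = nsq ((1 - expC a b c) (N ⊗ₖ ζ)) * nsq ((1 - expA a b c * expB a b c) (N ⊗ₖ ζ)) := by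
  rw [compP_eq, End.mul_apply, one_sub_expA_expB_kronecker, one_sub_expC_kronecker,
    one_sub_expC_kronecker]
  simp only [nsq_kronecker]
  ring

end Hat

end

section

section ProductGap

variable [Nonempty a] [Nonempty b] [Nonempty c]

lemma nsq_add_le_two {m n : Type} [Fintype m] [Fintype n] (X Y : Matrix m n ℂ) : nsq (X + Y) ≤ 2 *
    nsq X + 2 * nsq Y := by
  have := nsq_add_le one_pos X Y
  norm_num at this
  exact this

lemma nsq_neg {m n : Type} [Fintype m] [Fintype n] (X : Matrix m n ℂ) : nsq (-X) = nsq X := by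
  simp [nsq]

lemma nsq_sub_le_two {m n : Type} [Fintype m] [Fintype n] (X Y : Matrix m n ℂ) : nsq (X - Y) ≤ 2 *
    nsq X + 2 * nsq Y := by
  have := nsq_add_le_two X (-Y)
  rwa [← sub_eq_add_neg, nsq_neg] at this

lemma one_sub_expC_one : (1 - expC a b c) (1 : TMat a b c) = 0 := by
  rw [← one_kronecker_one (m := a × b) (n := c), LinearMap.sub_apply, expC_kronecker_one]
  simp

lemma one_sub_expA_expB_one : (1 - expA a b c * expB a b c) (1 : TMat a b c) = 0 := by
  rw [← one_kronecker_one (m := a × b) (n := c), LinearMap.sub_apply, End.mul_apply,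
    expB_one_kronecker, expA_one_kronecker]
  simp

lemma isSelfAdj_expA_expB : IsSelfAdj (expA a b c * expB a b c) := fun X Y => by
  rw [isSelfAdj_expA.hs_mul isSelfAdj_expB, commute_expA_expB.eq]

lemma nsq_one_sub_expC_le (X : TMat a b c) : nsq ((1 - expC a b c) X) ≤ nsq X :=
  nsq_apply_le isSelfAdj_expC.one_sub (by
    have := pexp_mul_self (Equiv.prodComm (a × b) c)
    change expC a b c * expC a b c = expC a b c at this
    simp [mul_sub, sub_mul, this]) X

lemma nsq_one_sub_expA_expB_le (X : TMat a b c) : nsq ((1 - expA a b c * expB a b c) X) ≤ nsq X :=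
  nsq_apply_le isSelfAdj_expA_expB.one_sub (by
    have hA : expA a b c * expA a b c = expA a b c := pexp_mul_self _
    have hB : expB a b c * expB a b c = expB a b c := pexp_mul_self _
    have : expA a b c * expB a b c * (expA a b c * expB a b c) = expA a b c * expB a b c := by
      rw [mul_assoc, ← mul_assoc (expB a b c), ← commute_expA_expB.eq, mul_assoc, hB, ← mul_assoc,
        hA]
    simp [mul_sub, sub_mul, this]) X

lemma nsq_compP_le (X : TMat a b c) : nsq (compP a b c X) ≤ nsq X :=
  nsq_apply_le isSelfAdj_compP compP_mul_self X

lemma nsq_one {n : Type} [Fintype n] [DecidableEq n] : nsq (1 : Mat n) = card n := by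
  simp [nsq, Matrix.one_apply, apply_ite]

lemma nsq_chiIso : nsq (chiIso a b c) = card (Logical a b) := by
  have hc := card_pos_real c
  rw [← nsq_hat, hat_attachChi, nsq_smul, nsq_one, norm_inv, norm_real, norm_eq_abs, abs_of_nonneg
    (sqrt_nonneg _), inv_pow, sq_sqrt hc.le]
  simp only [card_prod, Nat.cast_mul]
  field_simp

/-- A family close to product operators at second order has its first-order term in the tangent
space of the product operators up to the defect. -/
lemma nsq_compP_le_of_product_approx {ι : Type*} {l : Filter ι} [l.NeBot] {r e : ι → ℝ} {e₀ : ℝ} (hr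
    : Tendsto r l (𝓝 0)) (hr0 : ∀ᶠ k in l, r k ≠ 0) {M : ι → Enc a b c} {G : Enc a b c} (hG :
    Tendsto (fun k => (r k : ℂ)⁻¹ • (M k - chiIso a b c)) l (𝓝 G)) {N : ι → Mat (a × b)} {ζ : ι →
    Mat c} (he : Tendsto e l (𝓝 e₀)) (h : ∀ᶠ k in l, nsq (M k - prodOp (N k) (ζ k)) ≤ e k * r k ^ 2)
    : nsq (compP a b c (hat G)) ≤ e₀ := by
  set Gk : ι → TMat a b c := fun k => hat ((r k : ℂ)⁻¹ • (M k - chiIso a b c)) with hGk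
  have hGl : Tendsto Gk l (𝓝 (hat G)) := (continuous_hat.tendsto _).comp hG
  have hnG : Tendsto (fun k => nsq (Gk k)) l (𝓝 (nsq (hat G))) :=
    (continuous_nsq.tendsto _).comp hGl
  have hcP : Tendsto (fun k => nsq (compP a b c (Gk k))) l (𝓝 (nsq (compP a b c (hat G)))) :=
    ((continuous_nsq.comp (continuous_end (compP a b c))).tendsto _).comp hGl
  set δ : ℝ := nsq (chiIso a b c) / 4 with hδ
  have hδ0 : 0 < δ := by
    rw [hδ, nsq_chiIso]
    have : (0 : ℝ) < card (Logical a b) := by exact_mod_cast card_pos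
    positivity
  set K : ℝ := 2 * (nsq (hat G) + 1) + 2 * (|e₀| + 1) with hK
  have hK0 : 0 < K := by have := nsq_nonneg (hat G); positivity
  have hr2 : Tendsto (fun k => r k ^ 2) l (𝓝 0) := by simpa using hr.pow 2
  have hsmall : ∀ᶠ k in l, K * r k ^ 2 < δ := by
    have := hr2.const_mul K
    rw [mul_zero] at this
    exact this.eventually_lt_const hδ0
  have main : ∀ t : ℝ, 0 < t → nsq (compP a b c (hat G)) ≤ (1 + t) * e₀ := by
    intro t ht
    have hlim : Tendsto (fun k => (1 + t) * e k + (1 + 1 / t) * (K ^ 2 / δ) * r k ^ 2) l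
        (𝓝 ((1 + t) * e₀)) := by
      have := (he.const_mul (1 + t)).add (hr2.const_mul ((1 + 1 / t) * (K ^ 2 / δ)))
      simpa using this
    refine le_of_tendsto_of_tendsto hcP hlim ?_
    filter_upwards [hr0, h, hsmall, hnG.eventually_lt_const (lt_add_one _),
      he.eventually_lt_const (lt_of_le_of_lt (le_abs_self e₀) (lt_add_one _))]
      with k hk0 hk hks hkG hke
    have hrpos : 0 < r k ^ 2 := by positivity
    set P : TMat a b c := hat (prodOp (N k) (ζ k)) with hP
    set E : TMat a b c := hat (M k) - P with hE
    have hEn : nsq E ≤ e k * r k ^ 2 := by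
      rw [hE, hP, ← hat_sub, nsq_hat]
      exact hk
    have hM : hat (M k) = hat (chiIso a b c) + (r k : ℂ) • Gk k := by
      have hne : (r k : ℂ) ≠ 0 := by exact_mod_cast hk0
      simp only [hGk]
      rw [← hat_smul, ← hat_add, smul_smul, mul_inv_cancel₀ hne, one_smul]
      congr 1
      abel
    have hPeq : P = hat (chiIso a b c) + (r k : ℂ) • Gk k - E := by rw [hE, ← hM]; abel
    have hrn : ∀ X : TMat a b c, nsq ((r k : ℂ) • X) = r k ^ 2 * nsq X := by
      intro X
      rw [nsq_smul, norm_real, norm_eq_abs, sq_abs]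
    have hfac : ∀ q : End ℂ (TMat a b c),
        (∀ X, nsq (q X) ≤ nsq X) → q 1 = 0 → nsq (q P) ≤ K * r k ^ 2 := by
      intro q hq hq1
      have : q P = (r k : ℂ) • q (Gk k) - q E := by
        rw [hPeq, map_sub, map_add, hat_attachChi, map_smul, hq1, map_smul]
        simp
      rw [this]
      have h1 := nsq_sub_le_two ((r k : ℂ) • q (Gk k)) (q E)
      rw [hrn] at h1
      have h2 := hq (Gk k)
      have h3 := hq E
      nlinarith
    have hPn : δ ≤ nsq P := by
      have h1 := nsq_add_le_two P (E - (r k : ℂ) • Gk k)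
      have h2 := nsq_sub_le_two E ((r k : ℂ) • Gk k)
      rw [hrn] at h2
      have h3 : P + (E - (r k : ℂ) • Gk k) = hat (chiIso a b c) := by rw [hPeq]; abel
      rw [h3, nsq_hat] at h1
      nlinarith
    have hPc : nsq (compP a b c P) ≤ K ^ 2 / δ * r k ^ 2 * r k ^ 2 := by
      have h1 := nsq_compP_kronecker (N k) (ζ k)
      rw [← hat_prodOp, ← hP] at h1
      have h2 := hfac _ nsq_one_sub_expC_le one_sub_expC_one
      have h3 := hfac _ nsq_one_sub_expA_expB_le one_sub_expA_expB_one
      have h4 : nsq (compP a b c P) * δ ≤ (K * r k ^ 2) * (K * r k ^ 2) :=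
        calc _ ≤ nsq (compP a b c P) * nsq P := mul_le_mul_of_nonneg_left hPn (nsq_nonneg _)
          _ = _ := h1
          _ ≤ _ := mul_le_mul h2 h3 (nsq_nonneg _) (by positivity)
      rw [div_mul_eq_mul_div, div_mul_eq_mul_div, le_div_iff₀ hδ0]
      linarith
    have h5 : (r k : ℂ) • compP a b c (Gk k) = compP a b c E + compP a b c P := by
      have hP1 : compP a b c (1 : TMat a b c) = 0 := by
        rw [compP_eq, End.mul_apply, one_sub_expA_expB_one, map_zero]
      rw [← map_add, hE, sub_add_cancel, hM, map_add, hat_attachChi, map_smul, map_smul, hP1]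
      simp
    have h6 := nsq_add_le ht (compP a b c E) (compP a b c P)
    rw [← h5, hrn] at h6
    have h7 := nsq_compP_le E
    have h8 : r k ^ 2 * nsq (compP a b c (Gk k)) ≤
        r k ^ 2 * ((1 + t) * e k + (1 + 1 / t) * (K ^ 2 / δ) * r k ^ 2) := by
      have h9 : (1 + t) * nsq (compP a b c E) ≤ (1 + t) * (e k * r k ^ 2) := by
        gcongr
        exact h7.trans hEn
      have h10 : (1 + 1 / t) * nsq (compP a b c P) ≤
          (1 + 1 / t) * (K ^ 2 / δ * r k ^ 2 * r k ^ 2) := by gcongr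
      linarith
    exact le_of_mul_le_mul_left h8 hrpos
  have hl : Tendsto (fun t : ℝ => (1 + t) * e₀) (𝓝[>] 0) (𝓝 ((1 + 0) * e₀)) :=
    ((continuous_const.add continuous_id).mul continuous_const).continuousAt.tendsto.mono_left
      nhdsWithin_le_nhds
  rw [add_zero, one_mul] at hl
  exact ge_of_tendsto hl (eventually_mem_nhdsWithin.mono main)

end ProductGap

/-! ### Low-rank approximation and entropy of spectra -/

section Spectra

lemma Diagonalizes.sum_norm_sq {R S : Type} [Fintype R] [DecidableEq R] [Fintype S] {Φ : Matrix R S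
    ℂ} {U : U(R)} {p : R → ℝ} (h : Diagonalizes U p (Φ * Φᴴ)) (i : R) : ∑ s, ‖(U.1ᴴ * Φ) i s‖ ^ 2 =
    p i := by
  have h1 := h.apply_self i
  have h2 : U.1ᴴ * (Φ * Φᴴ) * U.1 = (U.1ᴴ * Φ) * (U.1ᴴ * Φ)ᴴ := by
    rw [Matrix.conjTranspose_mul, conjTranspose_conjTranspose]
    simp only [Matrix.mul_assoc]
  rw [h2, Matrix.mul_apply] at h1
  simp only [conjTranspose_apply, ← starRingEnd_apply, mul_conj'] at h1
  exact_mod_cast h1.symm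

lemma exists_rankOne_approx {R S : Type} [Fintype R] [DecidableEq R] [Fintype S] (Φ : Matrix R S ℂ)
    {U : U(R)} {p : R → ℝ} (h : Diagonalizes U p (Φ * Φᴴ)) (i : R) : ∃ (n : R → ℂ) (z : S → ℂ), nsq
    (Φ - vecMulVec n z) = nsq Φ - p i := by
  set B : Matrix R S ℂ := U.1ᴴ * Φ with hB
  have hUU : (U.1ᴴ)ᴴ * U.1ᴴ = 1 := by
    rw [conjTranspose_conjTranspose, unitary_mul_adj]
  refine ⟨fun j => (U : Mat R) j i, fun s => B i s, ?_⟩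
  rw [← nsq_unitary_mul _ hUU (Φ - _), ← nsq_unitary_mul _ hUU Φ, Matrix.mul_sub, ← hB]
  have hK : U.1ᴴ * vecMulVec (fun j => (U : Mat R) j i)
      (fun s => B i s) = of fun j s => if j = i then B i s else 0 := by
    ext j s
    rw [Matrix.mul_apply]
    simp only [vecMulVec_apply, of_apply, ← mul_assoc, ← sum_mul]
    have := congrFun (congrFun (unitary_adj_mul U) j) i
    rw [Matrix.mul_apply] at this
    rw [this, Matrix.one_apply]
    split_ifs <;> simp
  rw [hK, ← h.sum_norm_sq, nsq, nsq, ← add_sum_erase _ _ (mem_univ i), ← add_sum_erase (univ) (fun j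
    => ∑ s, ‖B j s‖ ^ 2) (mem_univ i)]
  have e1 : ∑ s, ‖(B - of fun j s => if j = i then B i s else 0) i s‖ ^ 2 = 0 := by simp
  rw [e1, zero_add, add_sub_cancel_left]
  refine sum_congr rfl fun j hj => ?_
  simp [Finset.ne_of_mem_erase hj]

lemma nsq_sub_rankOne_ge {R S : Type} [Fintype R] [DecidableEq R] [Fintype S] (Φ : Matrix R S ℂ) {U
    : U(R)} {p : R → ℝ} (h : Diagonalizes U p (Φ * Φᴴ)) {i : R} (hi : ∀ j, p j ≤ p i) (n : R → ℂ) (z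
    : S → ℂ) : nsq Φ - p i ≤ nsq (Φ - vecMulVec n z) := by
  set ν : ℝ := ∑ j, ‖n j‖ ^ 2 with hν
  set w : S → ℂ := fun s => ∑ j, star (n j) * Φ j s with hw
  have hexp : nsq (Φ - vecMulVec n z) =
      nsq Φ + ∑ s, (ν * ‖z s‖ ^ 2 - 2 * (star (z s) * w s).re) := by
    simp only [nsq]
    rw [sum_comm, sum_comm (f := fun i j => ‖Φ i j‖ ^ 2), ← sum_add_distrib]
    refine sum_congr rfl fun s _ => ?_
    simp only [hν, hw, sum_mul, mul_sum, re_sum]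
    rw [← sum_sub_distrib, ← sum_add_distrib]
    refine sum_congr rfl fun j _ => ?_
    rw [Matrix.sub_apply, vecMulVec_apply, ← normSq_eq_norm_sq, Complex.normSq_sub, ←
      normSq_eq_norm_sq, ← normSq_eq_norm_sq, ← normSq_eq_norm_sq, Complex.normSq_mul]
    have : Φ j s * (starRingEnd ℂ) (n j * z s) = star (z s) * (star (n j) * Φ j s) := by
      rw [map_mul, starRingEnd_apply, starRingEnd_apply]
      ring
    rw [this]
    ring
  have hwn : ∑ s, ‖w s‖ ^ 2 ≤ p i * ν := by
    set n' : R → ℂ := U.1ᴴ *ᵥ n with hn'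
    have h1 : ((∑ s, ‖w s‖ ^ 2 : ℝ) : ℂ) = star n ⬝ᵥ ((Φ * Φᴴ) *ᵥ n) := by
      have h2 : w = star n ᵥ* Φ := by
        ext s
        simp [hw, Matrix.vecMul, dotProduct]
      have h3 : star w = Φᴴ *ᵥ n := by
        rw [h2, Matrix.star_vecMul, star_star]
      rw [← mulVec_mulVec, dotProduct_mulVec, ← h2, ← h3, dotProduct]
      push_cast
      simp only [Pi.star_apply, ← starRingEnd_apply, mul_conj']
    have h4 : star n ⬝ᵥ ((Φ * Φᴴ) *ᵥ n) = ((∑ j, p j * ‖n' j‖ ^ 2 : ℝ) : ℂ) := by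
      rw [h, ← mulVec_mulVec, ← mulVec_mulVec, ← hn', dotProduct_mulVec]
      have : star n ᵥ* U.1 = star n' := by
        rw [hn', star_mulVec, conjTranspose_conjTranspose]
      rw [this, dotProduct]
      push_cast
      refine sum_congr rfl fun j _ => ?_
      rw [Matrix.mulVec_diagonal, Pi.star_apply, ← conj_mul', starRingEnd_apply]
      ring
    have h5 : ∑ j, ‖n' j‖ ^ 2 = ν := by
      have h6 : ((∑ j, ‖n' j‖ ^ 2 : ℝ) : ℂ) = ((∑ j, ‖n j‖ ^ 2 : ℝ) : ℂ) := by
        have h7 : ∀ v : R → ℂ, ((∑ j, ‖v j‖ ^ 2 : ℝ) : ℂ) = star v ⬝ᵥ v := fun v => by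
          rw [dotProduct]
          push_cast
          simp only [Pi.star_apply, ← starRingEnd_apply, conj_mul']
        rw [h7, h7, hn', star_mulVec, conjTranspose_conjTranspose, ← dotProduct_mulVec,
          mulVec_mulVec, unitary_mul_adj, Matrix.one_mulVec]
      exact_mod_cast h6
    have h8 : ∑ s, ‖w s‖ ^ 2 = ∑ j, p j * ‖n' j‖ ^ 2 := by exact_mod_cast h1.trans h4
    rw [h8, ← h5, mul_sum]
    exact sum_le_sum fun j _ => mul_le_mul_of_nonneg_right (hi j) (sq_nonneg _)
  rw [hexp]
  have hre : ∀ s, (star (z s) * w s).re ≤ ‖z s‖ * ‖w s‖ := fun s =>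
    (Complex.re_le_norm _).trans (by simp)
  by_cases hν0 : ν = 0
  · have hw0 : ∀ s, w s = 0 := by
      have hs : ∑ s, ‖w s‖ ^ 2 = 0 :=
        le_antisymm (by simpa [hν0] using hwn) (sum_nonneg fun _ _ => sq_nonneg _)
      intro s
      have := (sum_eq_zero_iff_of_nonneg fun s _ => sq_nonneg ‖w s‖).1 hs s (mem_univ _)
      simpa using this
    simp [hν0, hw0, ← h.sum_norm_sq i, sum_nonneg]
  · have hνpos : 0 < ν := lt_of_le_of_ne (sum_nonneg fun _ _ => sq_nonneg _) (Ne.symm hν0)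
    have h1 : ∀ s, -(‖w s‖ ^ 2 / ν) ≤ ν * ‖z s‖ ^ 2 - 2 * (star (z s) * w s).re := by
      intro s
      have h2 : 0 ≤ (ν * ‖z s‖ - ‖w s‖) ^ 2 / ν := by positivity
      have h3 : (ν * ‖z s‖ - ‖w s‖) ^ 2 / ν =
          ν * ‖z s‖ ^ 2 - 2 * (‖z s‖ * ‖w s‖) + ‖w s‖ ^ 2 / ν := by
        field_simp
        ring
      linarith [hre s]
    have h4 := sum_le_sum fun s (_ : s ∈ univ) => h1 s
    rw [sum_neg_distrib, ← sum_div] at h4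
    have h5 : (∑ s, ‖w s‖ ^ 2) / ν ≤ p i := by rwa [div_le_iff₀ hνpos]
    linarith

variable {n : Type} [Fintype n] {p : n → ℝ}

lemma negMulLog_le_mul_log_inv {x t : ℝ} (hx : 0 ≤ x) (ht : 0 < t) : negMulLog x ≤ x * log t⁻¹ + t -
    x := by
  rcases hx.eq_or_lt with rfl | hx
  · simpa using ht.le
  · have h := mul_le_mul_of_nonneg_left (log_le_sub_one_of_pos (div_pos ht hx)) hx.le
    rw [log_div ht.ne' hx.ne', show x * (t / x - 1) = t - x by field_simp] at h
    rw [negMulLog, log_inv]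
    linarith

lemma mul_neg_log_le_negMulLog {x t : ℝ} (hx : 0 ≤ x) (h : x ≤ t) : x * -log t ≤ negMulLog x := by
  rcases hx.eq_or_lt with rfl | hx
  · simp
  · rw [negMulLog]
    nlinarith [log_le_log hx h]

lemma sum_negMulLog_le_of_top (hp : ∀ i, 0 ≤ p i) (hs : ∑ i, p i = 1) (i : n) {q t : ℝ} (hq : 1 - p
    i ≤ q) (ht : 0 < t) (ht1 : t ≤ 1) : ∑ j, negMulLog (p j) ≤ q * log (1 / t) + card n * t + q :=
    by
  classical
  have h1 (x : ℝ) (hx : 0 ≤ x) := negMulLog_le_mul_log_inv hx ht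
  have h2 : negMulLog (p i) ≤ 1 - p i := by
    simpa using negMulLog_le_mul_log_inv (hp i) one_pos
  rw [one_div]
  have hL : 0 ≤ log t⁻¹ := Real.log_nonneg ((one_le_inv₀ ht).2 ht1)
  rw [← add_sum_erase _ _ (mem_univ i)]
  have h3 : ∑ j ∈ univ.erase i, negMulLog (p j) ≤ ∑ j ∈ univ.erase i, (p j * log t⁻¹ + t) :=
    sum_le_sum fun j _ => (h1 _ (hp j)).trans (by linarith [hp j])
  rw [sum_add_distrib, ← sum_mul] at h3
  have h4 : ∑ j ∈ univ.erase i, p j = 1 - p i := by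
    rw [← hs, ← add_sum_erase univ p (mem_univ i)]
    ring
  have h5 : ∑ j ∈ univ.erase i, t ≤ card n * t := by
    rw [sum_const, nsmul_eq_mul]
    gcongr
    exact Finset.card_le_univ _
  rw [h4] at h3
  nlinarith

lemma one_sub_le_sum_negMulLog (hp : ∀ i, 0 ≤ p i) (hs : ∑ i, p i = 1) {i : n} (hi : ∀ j, p j ≤ p i)
    : 1 - p i ≤ ∑ j, negMulLog (p j) := by
  have hpos : 0 < p i := by
    by_contra hn
    have : ∑ j, p j ≤ 0 := Finset.sum_nonpos fun j _ => (hi j).trans (not_lt.1 hn)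
    linarith
  have h2 := sum_le_sum fun j (_ : j ∈ univ) => mul_neg_log_le_negMulLog (hp j) (hi j)
  rw [← sum_mul, hs, one_mul] at h2
  linarith [log_le_sub_one_of_pos hpos]

lemma negMulLog_one_sub_le_sum (hp : ∀ i, 0 ≤ p i) (hs : ∑ i, p i = 1) (i : n) : negMulLog (1 - p i)
    ≤ ∑ j, negMulLog (p j) := by
  classical
  have h4 : ∑ j ∈ univ.erase i, p j = 1 - p i := by
    rw [← hs, ← add_sum_erase univ p (mem_univ i)]
    ring
  have hle : ∀ j, p j ≤ 1 := fun j => by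
    rw [← hs]
    exact single_le_sum (fun k _ => hp k) (mem_univ j)
  rw [← add_sum_erase _ _ (mem_univ i)]
  have h0 : 0 ≤ negMulLog (p i) := Real.negMulLog_nonneg (hp i) (hle i)
  have h1 (j) (hj : j ∈ univ.erase i) : p j * -log (1 - p i) ≤ negMulLog (p j) :=
    mul_neg_log_le_negMulLog (hp j) (h4 ▸ single_le_sum (fun k _ => hp k) hj)
  have h2 := sum_le_sum h1
  rw [← sum_mul, h4] at h2
  rw [negMulLog]
  linarith

lemma sum_negMulLog_le_log_card [Nonempty n] (hp : ∀ i, 0 ≤ p i) (hs : ∑ i, p i = 1) : ∑ j,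
    negMulLog (p j) ≤ log (card n) := by
  have hn : (0 : ℝ) < card n := by exact_mod_cast card_pos
  have h2 := sum_le_sum fun j (_ : j ∈ univ) => negMulLog_le_mul_log_inv (hp j) (inv_pos.2 hn)
  rw [sum_sub_distrib, sum_add_distrib, ← sum_mul, hs] at h2
  simp [hn.ne'] at h2
  exact h2

lemma log_card_sub_le_sum_negMulLog [Nonempty n] (hp : ∀ i, 0 ≤ p i) (hs : ∑ i, p i = 1) : log (card
    n) - card n * ∑ j, (p j - (card n : ℝ)⁻¹) ^ 2 ≤ ∑ j, negMulLog (p j) := by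
  have hn : (0 : ℝ) < card n := by exact_mod_cast card_pos
  set N : ℝ := (card n : ℝ) with hN
  have h1 : ∀ j, p j * (log N + 1) - p j ^ 2 * N ≤ negMulLog (p j) := by
    intro j
    rcases (hp j).eq_or_lt with h | h
    · rw [← h]; simp
    · have := log_le_sub_one_of_pos (mul_pos h hn)
      rw [log_mul h.ne' hn.ne'] at this
      rw [negMulLog]
      nlinarith
  have h2 := sum_le_sum fun j (_ : j ∈ univ) => h1 j
  rw [sum_sub_distrib, ← sum_mul, ← sum_mul, hs] at h2
  have h3 : N * ∑ j, (p j - N⁻¹) ^ 2 = (∑ j, p j ^ 2) * N - 1 := by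
    have : ∀ j, (p j - N⁻¹) ^ 2 = p j ^ 2 - 2 * N⁻¹ * p j + N⁻¹ ^ 2 := fun j => by ring
    simp only [this, sum_add_distrib, sum_sub_distrib, ← mul_sum, hs, sum_const, card_univ,
      nsmul_eq_mul, ← hN]
    field_simp
    ring
  rw [h3]
  linarith

end Spectra

end

section

/-! ### Entrywise derivatives at the origin -/

section Derivative

variable {m n k l : Type}

/-- The matrix family `F` has derivative `F'` at `0`, entry by entry. -/
def MDeriv (F : ℝ → Matrix m n ℂ) (F' : Matrix m n ℂ) : Prop :=
  ∀ i j, HasDerivAt (fun ε : ℝ => F ε i j) (F' i j) 0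

lemma mderiv_const (A : Matrix m n ℂ) : MDeriv (fun _ => A) 0 := fun i j => by
  simpa using hasDerivAt_const (0 : ℝ) (A i j)

lemma MDeriv.sub {F G : ℝ → Matrix m n ℂ} {F' G' : Matrix m n ℂ} (hF : MDeriv F F') (hG : MDeriv G
    G') : MDeriv (fun ε => F ε - G ε) (F' - G') := fun i j => by
  exact (hF i j).fun_sub (hG i j)

lemma MDeriv.smul {F : ℝ → Matrix m n ℂ} {F' : Matrix m n ℂ} (hF : MDeriv F F') (z : ℂ) : MDeriv
    (fun ε => z • F ε) (z • F') := fun i j => by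
  simpa using (hF i j).const_mul z

lemma MDeriv.mul [Fintype n] {F : ℝ → Matrix m n ℂ} {F' : Matrix m n ℂ} {G : ℝ → Matrix n k ℂ} {G' :
    Matrix n k ℂ} (hF : MDeriv F F') (hG : MDeriv G G') : MDeriv (fun ε => F ε * G ε) (F' * G 0 + F
    0 * G') := fun i j => by
  simp only [Matrix.mul_apply, Matrix.add_apply, ← sum_add_distrib]
  exact HasDerivAt.fun_sum fun u _ => (hF i u).mul (hG u j)

lemma MDeriv.kronecker {F : ℝ → Matrix m n ℂ} {F' : Matrix m n ℂ} {G : ℝ → Matrix k l ℂ} {G' :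
    Matrix k l ℂ} (hF : MDeriv F F') (hG : MDeriv G G') : MDeriv (fun ε => F ε ⊗ₖ G ε) (F' ⊗ₖ G 0 +
    F 0 ⊗ₖ G') := fun i j => by
  exact (hF i.1 j.1).fun_mul (hG i.2 j.2)

lemma MDeriv.conjTranspose {F : ℝ → Matrix m n ℂ} {F' : Matrix m n ℂ} (hF : MDeriv F F') : MDeriv
    (fun ε => (F ε)ᴴ) F'ᴴ := fun i j => by
  simpa using (hF j i).star

lemma MDeriv.tendsto {F : ℝ → Matrix m n ℂ} {F' : Matrix m n ℂ} (hF : MDeriv F F') : Tendsto (fun ε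
    : ℝ => (ε : ℂ)⁻¹ • (F ε - F 0)) (𝓝[≠] 0) (𝓝 F') := by
  refine tendsto_mat.2 fun i j => ?_
  have h := hasDerivAt_iff_tendsto_slope_zero.1 (hF i j)
  simpa using h

lemma MDeriv.continuousAt {F : ℝ → Matrix m n ℂ} {F' : Matrix m n ℂ} (hF : MDeriv F F') : Tendsto F
    (𝓝 0) (𝓝 (F 0)) :=
  tendsto_mat.2 fun i j => (hF i j).continuousAt

variable [Fintype n] [DecidableEq n]

lemma mderiv_exp (W : Mat n) : MDeriv (fun ε : ℝ => NormedSpace.exp ((I * (ε : ℂ)) • W)) (I • W) :=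
    by
  intro i j
  let _ : NormedRing (Mat n) := Matrix.linftyOpNormedRing
  let _ : NormedAlgebra ℝ (Mat n) := Matrix.linftyOpNormedAlgebra
  have h := hasDerivAt_exp_smul_const (𝕂 := ℝ) (𝔸 := Mat n) (I • W) 0
  have h2 := ((entryLinearMap ℝ ℂ i j).toContinuousLinearMap.hasFDerivAt).comp_hasDerivAt (0 : ℝ) h
  simp only [zero_smul, NormedSpace.exp_zero, one_mul] at h2
  have hf : (fun ε : ℝ => NormedSpace.exp ((I * (ε : ℂ)) • W) i j) =
      (LinearMap.toContinuousLinearMap (entryLinearMap ℝ ℂ i j)) ∘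
        fun u : ℝ => NormedSpace.exp (u • I • W) := by
    funext ε
    have h3 : (I * (ε : ℂ)) • W = ε • I • W := by
      ext p q
      simp
      ring
    rw [h3]
    rfl
  rw [hf]
  exact h2

lemma exp_I_zero_smul (W : Mat n) : NormedSpace.exp ((I * ((0 : ℝ) : ℂ)) • W) = 1 := by simp

lemma exp_I_smul_mem_unitary {W : Mat n} (hW : W.IsHermitian) (ε : ℝ) : NormedSpace.exp ((I * (ε :
    ℂ)) • W) ∈ U(n) := by
  rw [Matrix.mem_unitaryGroup_iff', star_eq_conjTranspose, ← Matrix.exp_conjTranspose]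
  have h : ((I * (ε : ℂ)) • W)ᴴ = -((I * (ε : ℂ)) • W) := by
    rw [conjTranspose_smul, hW.eq, ← neg_smul]
    simp
  rw [h, ← Matrix.exp_add_of_commute _ _ (Commute.refl ((I * (ε : ℂ)) • W)).neg_left,
    neg_add_cancel, NormedSpace.exp_zero]

/-- The unitary `exp(iεW)`. -/
def expU {W : Mat n} (hW : W.IsHermitian) (ε : ℝ) : U(n) := ⟨_, exp_I_smul_mem_unitary hW ε⟩

lemma exp_unitary_conj (U : U(n)) (W : Mat n) (z : ℂ) : NormedSpace.exp (z • (U.1 * W * U.1ᴴ)) = U.1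
    * NormedSpace.exp (z • W) * U.1ᴴ := by
  let u : (Mat n)ˣ := ⟨U, U.1ᴴ, unitary_mul_adj U, unitary_adj_mul U⟩
  have h := Matrix.exp_units_conj u (z • W)
  simpa [u, Matrix.mul_smul, smul_mul] using h

end Derivative

/-! ### Coherent information and the distance to product operators -/

section Coherent

open scoped ComplexOrder

/-- The Choi vector of `M` as an operator from the discarded registers to `A₁Ā₁r`. -/
def choiMat (M : Enc a b c) : Matrix ((a × b) × Logical a b) (c × c) ℂ :=
  of fun p s => M ((p.1.1, s.1), (p.1.2, s.2)) p.2

lemma recoveredWithRef_eq (M : Enc a b c) : recoveredWithRef M = (card (Logical a b) : ℂ)⁻¹ •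
    (choiMat M * (choiMat M)ᴴ) := by
  ext p q
  simp only [recoveredWithRef, Matrix.smul_apply, smul_eq_mul]
  congr 1
  rw [Matrix.mul_apply, sum_prod_type]
  refine sum_congr rfl fun s _ => sum_congr rfl fun t _ => ?_
  rw [Matrix.mul_apply, sum_eq_single q.2]
  · rw [Matrix.mul_apply, sum_eq_single p.2]
    · simp [choiMat]
    · intro l _ hl
      simp [hl.symm]
    · simp
  · intro l _ hl
    rw [Matrix.mul_apply, sum_eq_zero, zero_mul]
    intro k _
    simp [hl.symm]
  · simp

lemma nsq_choiMat (M : Enc a b c) : nsq (choiMat M) = nsq M := by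
  rw [← nsq_hat]
  simp only [nsq, choiMat, hat, of_apply, sum_prod_type]
  refine sum_congr rfl fun x _ => sum_congr rfl fun y _ => ?_
  exact (sum_congr rfl fun l _ => sum_comm).trans sum_comm

lemma trace_mul_conjTranspose {m n : Type} [Fintype m] [Fintype n] (X : Matrix m n ℂ) : (X *
    Xᴴ).trace = nsq X := by
  rw [trace_mul_comm, ← hs_eq_trace, hs_self]

lemma trace_recoveredWithRef (M : Enc a b c) : (recoveredWithRef M).trace = ((nsq M / card (Logical
    a b) : ℝ) : ℂ) := by
  rw [recoveredWithRef_eq, trace_smul, trace_mul_conjTranspose, nsq_choiMat]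
  push_cast
  rw [smul_eq_mul, div_eq_inv_mul]

lemma posSemidef_recoveredWithRef (M : Enc a b c) : (recoveredWithRef M).PosSemidef := by
  rw [recoveredWithRef_eq]
  refine (Matrix.posSemidef_self_mul_conjTranspose _).smul ?_
  have : ((card (Logical a b) : ℂ)⁻¹) = (((card (Logical a b) : ℝ)⁻¹ : ℝ) : ℂ) := by
    push_cast; rfl
  rw [this]
  exact_mod_cast (by positivity : (0 : ℝ) ≤ (card (Logical a b) : ℝ)⁻¹)

lemma posSemidef_traceSnd {m n : Type} [Fintype m] [Fintype n] {A : Mat (m × n)} (h : A.PosSemidef)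
    : (traceSnd A).PosSemidef := by
  have : traceSnd A = ∑ k : n, A.submatrix (fun i => (i, k)) (fun i => (i, k)) := by
    ext i j
    simp [traceSnd, Matrix.sum_apply]
  rw [this]
  exact Matrix.posSemidef_sum _ fun k _ => h.submatrix _

lemma trace_traceSnd {m n : Type} [Fintype m] [Fintype n] (A : Mat (m × n)) : (traceSnd A).trace =
    A.trace := by
  simp [trace, traceSnd, sum_prod_type]

lemma Diagonalizes.trace_eq {n : Type} [Fintype n] [DecidableEq n] {U : U(n)} {α : n → ℝ} {A : Mat
    n} (h : Diagonalizes U α A) : A.trace = ((∑ i, α i : ℝ) : ℂ) := by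
  rw [h, trace_mul_comm, ← mul_assoc, unitary_adj_mul, one_mul, trace_diagonal]
  push_cast
  rfl

lemma Diagonalizes.smul {n : Type} [Fintype n] [DecidableEq n] {U : U(n)} {α : n → ℝ} {A : Mat n} (h
    : Diagonalizes U α A) (r : ℝ) : Diagonalizes U (fun i => r * α i) ((r : ℂ) • A) := by
  have h' := h
  unfold Diagonalizes at h' ⊢
  rw [h', ← smul_mul, ← Matrix.mul_smul]
  congr 2
  ext i j
  simp [diagonal_apply]

lemma Diagonalizes.nsq_sub {n : Type} [Fintype n] [DecidableEq n] {U : U(n)} {α : n → ℝ} {A : Mat n}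
    (h : Diagonalizes U α A) (r : ℝ) : ∑ i, (α i - r) ^ 2 = nsq (A - (r : ℂ) • 1) := by
  have h1 : A - (r : ℂ) • 1 = U.1 * (diagonal (fun i => ((α i - r : ℝ) : ℂ)) * U.1ᴴ) := by
    have h' := h
    unfold Diagonalizes at h'
    have : diagonal (fun i => ((α i - r : ℝ) : ℂ)) =
        diagonal (fun i => (α i : ℂ)) - (r : ℂ) • 1 := by
      ext i j
      by_cases hij : i = j <;> simp [hij]
    rw [this, sub_mul, mul_sub, ← mul_assoc, ← h', smul_mul, one_mul, Matrix.mul_smul,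
      unitary_mul_adj]
  rw [h1, nsq_unitary_mul _ (unitary_adj_mul U), ← nsq_conjTranspose, Matrix.conjTranspose_mul,
    Matrix.conjTranspose_conjTranspose, nsq_unitary_mul _ (unitary_adj_mul U),
    diagonal_conjTranspose]
  simp only [nsq]
  refine sum_congr rfl fun i _ => ?_
  rw [sum_eq_single i]
  · simp [-Complex.ofReal_sub, norm_real]
  · intro j _ hj
    simp [hj.symm]
  · simp

variable [Nonempty a] [Nonempty b]

lemma recoveredWithRef_spectrum {M : Enc a b c} (hM : nsq M = card (Logical a b)) : ∃ (U : U((a × b)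
    × Logical a b)) (p : (a × b) × Logical a b → ℝ), Diagonalizes U p (recoveredWithRef M) ∧ (∀ i, 0
    ≤ p i) ∧ ∑ i, p i = 1 ∧ Diagonalizes U (fun i => card (Logical a b) * p i) (choiMat M * (choiMat
    M)ᴴ) := by
  have hps := posSemidef_recoveredWithRef M
  have hD := diagonalizes_eigen hps.isHermitian
  have h0 : (card (Logical a b) : ℝ) ≠ 0 := by positivity
  refine ⟨_, _, hD, hps.eigenvalues_nonneg, ?_, ?_⟩
  · have := hD.trace_eq
    rw [trace_recoveredWithRef, hM, div_self h0] at this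
    exact_mod_cast this.symm
  · have := hD.smul (card (Logical a b))
    have hE : ((card (Logical a b) : ℝ) : ℂ) • recoveredWithRef M = choiMat M * (choiMat M)ᴴ := by
      have h1 : (card (Logical a b) : ℂ) ≠ 0 := by exact_mod_cast h0
      rw [recoveredWithRef_eq, smul_smul, ofReal_natCast, mul_inv_cancel₀ h1, one_smul]
    rw [hE] at this
    exact this

lemma choiMat_sub_prodOp (M : Enc a b c) (N : Mat (a × b)) (ζ : Mat c) : nsq (M - prodOp N ζ) = nsq
    (choiMat M - vecMulVec (fun p => N p.1 p.2) (fun s => ζ s.1 s.2)) := by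
  rw [← nsq_choiMat]
  rfl

/-- A recovery with small output entropy is close to a product operator. -/
lemma exists_prodOp_approx {M : Enc a b c} (hM : nsq M = card (Logical a b)) : ∃ (η : ℝ) (N : Mat (a
    × b)) (ζ : Mat c), 0 ≤ η ∧ nsq (M - prodOp N ζ) = card (Logical a b) * η ∧ η ≤ entropy
    (recoveredWithRef M) ∧ negMulLog η ≤ entropy (recoveredWithRef M) := by
  obtain ⟨U, p, hU, hp, hs, hΦ⟩ := recoveredWithRef_spectrum hM
  obtain ⟨i, hi⟩ := Finite.exists_max p
  obtain ⟨n, z, hnz⟩ := exists_rankOne_approx _ hΦ i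
  refine ⟨1 - p i, of fun x l => n (x, l), of fun s t => z (s, t), ?_, ?_, ?_, ?_⟩
  · have := single_le_sum (fun j _ => hp j) (mem_univ i)
    linarith
  · rw [choiMat_sub_prodOp]
    refine hnz.trans ?_
    rw [nsq_choiMat, hM]
    ring
  · rw [hU.entropy_eq]
    exact one_sub_le_sum_negMulLog hp hs hi
  · rw [hU.entropy_eq]
    exact negMulLog_one_sub_le_sum hp hs i

/-- A recovery close to a product operator has small output entropy. -/
lemma entropy_recoveredWithRef_le {M : Enc a b c} (hM : nsq M = card (Logical a b)) {N : Mat (a ×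
    b)} {ζ : Mat c} {q t : ℝ} (hq : nsq (M - prodOp N ζ) ≤ card (Logical a b) * q) (ht : 0 < t) (ht1
    : t ≤ 1) : entropy (recoveredWithRef M) ≤ q * log (1 / t) + card ((a × b) × Logical a b) * t + q
    := by
  obtain ⟨U, p, hU, hp, hs, hΦ⟩ := recoveredWithRef_spectrum hM
  obtain ⟨i, hi⟩ := Finite.exists_max p
  have h0 : (0 : ℝ) < card (Logical a b) := by positivity
  rw [hU.entropy_eq]
  refine sum_negMulLog_le_of_top hp hs i ?_ ht ht1
  have h := nsq_sub_rankOne_ge _ hΦ (fun j => mul_le_mul_of_nonneg_left (hi j) h0.le)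
    (fun p => N p.1 p.2) (fun s => ζ s.1 s.2)
  rw [← choiMat_sub_prodOp, nsq_choiMat, hM] at h
  have h2 : (card (Logical a b) : ℝ) * (1 - p i) ≤ card (Logical a b) * q := by
    linarith
  exact le_of_mul_le_mul_left h2 h0

lemma traceSnd_recoveredWithRef_spectrum {M : Enc a b c} (hM : nsq M = card (Logical a b)) : ∃ (U :
    U(a × b)) (p : a × b → ℝ), Diagonalizes U p (traceSnd (recoveredWithRef M)) ∧ (∀ i, 0 ≤ p i) ∧ ∑
    i, p i = 1 := by
  have hps := posSemidef_traceSnd (posSemidef_recoveredWithRef M)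
  have hD := diagonalizes_eigen hps.isHermitian
  have h0 : (card (Logical a b) : ℝ) ≠ 0 := by positivity
  refine ⟨_, _, hD, hps.eigenvalues_nonneg, ?_⟩
  have := hD.trace_eq
  rw [trace_traceSnd, trace_recoveredWithRef, hM, div_self h0] at this
  exact_mod_cast this.symm

lemma entropy_traceSnd_recoveredWithRef_le {M : Enc a b c} (hM : nsq M = card (Logical a b)) :
    entropy (traceSnd (recoveredWithRef M)) ≤ log (card (a × b)) := by
  obtain ⟨U, p, hU, hp, hs⟩ := traceSnd_recoveredWithRef_spectrum hM
  rw [hU.entropy_eq]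
  exact sum_negMulLog_le_log_card hp hs

lemma le_entropy_traceSnd_recoveredWithRef {M : Enc a b c} (hM : nsq M = card (Logical a b)) : log
    (card (a × b)) - card (a × b) * nsq (traceSnd (recoveredWithRef M) - (((card (a × b) : ℝ)⁻¹ : ℝ)
    : ℂ) • 1) ≤ entropy (traceSnd (recoveredWithRef M)) := by
  obtain ⟨U, p, hU, hp, hs⟩ := traceSnd_recoveredWithRef_spectrum hM
  rw [hU.entropy_eq, ← hU.nsq_sub]
  exact log_card_sub_le_sum_negMulLog hp hs

end Coherent

end

section

/-! ### Scalar asymptotics of the entropy bound -/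

section Scalar

lemma monotoneOn_negMulLog : MonotoneOn negMulLog (Set.Icc 0 (exp (-1))) := by
  refine monotoneOn_of_deriv_nonneg (convex_Icc _ _) Real.continuous_negMulLog.continuousOn
    (fun x hx => ?_) fun x hx => ?_
  · rw [interior_Icc] at hx
    exact (Real.differentiableAt_negMulLog_iff.2 hx.1.ne').differentiableWithinAt
  · rw [interior_Icc] at hx
    rw [Real.deriv_negMulLog hx.1.ne']
    have := Real.log_lt_log hx.1 hx.2
    rw [Real.log_exp] at this
    linarith

lemma tendsto_log_sq_inv : Tendsto (fun ε : ℝ => log (1 / ε ^ 2)) (𝓝[≠] 0) atTop := by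
  have h : Tendsto (fun ε : ℝ => log ε) (𝓝[≠] 0) atBot := Real.tendsto_log_nhdsNE_zero
  have h2 := tendsto_neg_atBot_atTop.comp (h.const_mul_atBot (zero_lt_two))
  refine h2.congr fun ε => ?_
  simp [Real.log_pow]

lemma le_of_negMulLog_le {w κ C : ℝ} (hw : 0 ≤ w) (hκ : 0 < κ) : ∀ᶠ ε in 𝓝[≠] (0 : ℝ), ∀ η : ℝ, η ≤
    (w + κ / 2) * ε ^ 2 * log (1 / ε ^ 2) + C * ε ^ 2 → negMulLog η ≤ (w + κ / 2) * ε ^ 2 * log (1 /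
    ε ^ 2) + C * ε ^ 2 → η ≤ (w + κ) * ε ^ 2 := by
  have hsq : Tendsto (fun ε : ℝ => ε ^ 2) (𝓝[≠] 0) (𝓝 0) := by
    have : Tendsto (fun ε : ℝ => ε ^ 2) (𝓝 0) (𝓝 (0 ^ 2)) := (continuous_pow 2).tendsto 0
    rw [zero_pow two_ne_zero] at this
    exact this.mono_left nhdsWithin_le_nhds
  have hB : Tendsto (fun ε : ℝ => (w + κ / 2) * ε ^ 2 * log (1 / ε ^ 2) + C * ε ^ 2)
      (𝓝[≠] 0) (𝓝 0) := by
    have h1 := (Real.continuous_negMulLog.tendsto 0).comp hsq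
    have h2 := (h1.const_mul (w + κ / 2)).add (hsq.const_mul C)
    simp only [Real.negMulLog_zero, mul_zero, add_zero] at h2
    refine h2.congr fun ε => ?_
    simp only [Function.comp, negMulLog, one_div, log_inv]
    ring
  have hlog := tendsto_log_sq_inv.eventually_gt_atTop ((C + (w + κ) * log (w + κ)) / (κ / 2))
  filter_upwards [hB.eventually_le_const (Real.exp_pos (-1)), hlog, self_mem_nhdsWithin]
    with ε hε hl hne η h1 h2
  by_contra hcon
  rw [not_le] at hcon
  have hε2 : 0 < ε ^ 2 := by have : ε ≠ 0 := hne; positivity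
  have hwκ : 0 < w + κ := by linarith
  have hx : 0 < (w + κ) * ε ^ 2 := by positivity
  have h3 := monotoneOn_negMulLog ⟨hx.le, hcon.le.trans (h1.trans hε)⟩
    ⟨hx.le.trans hcon.le, h1.trans hε⟩ hcon.le
  have h4 := h3.trans h2
  rw [negMulLog, log_mul hwκ.ne' hε2.ne'] at h4
  rw [div_lt_iff₀ (by positivity)] at hl
  rw [one_div, log_inv] at hl h4
  have h5 : ε ^ 2 * (-(w + κ) * (log (w + κ) + log (ε ^ 2))) ≤
      ε ^ 2 * ((w + κ / 2) * -log (ε ^ 2) + C) := by linarith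
  have h6 := le_of_mul_le_mul_left h5 hε2
  nlinarith

end Scalar

/-! ### Optimal recoveries are close to product operators -/

section Competitor

/-- The skewing `exp(iεW)` applied to the recovered code. -/
def evo (W : PMat a b c) (ε : ℝ) : Enc a b c := NormedSpace.exp ((I * (ε : ℂ)) • W) * chiIso a b c

lemma nsq_recover (RA : U(a × c)) (RB : U(b × c)) (V : Enc a b c) : nsq (recover RA RB V) = nsq V :=
  nsq_unitary_mul _ (unitary_adj_mul (kronU RA RB)) V

lemma evo_zero (W : PMat a b c) : evo W 0 = chiIso a b c := by
  rw [evo, exp_I_zero_smul, Matrix.one_mul]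

lemma mderiv_evo (W : PMat a b c) : MDeriv (evo W) (I • (W * chiIso a b c)) := by
  have h := (mderiv_exp W).mul (mderiv_const (chiIso a b c))
  rw [Matrix.mul_zero, add_zero, smul_mul] at h
  exact h

variable [Nonempty a] [Nonempty b] [Nonempty c]

lemma nsq_evo {W : PMat a b c} (hW : W.IsHermitian) (ε : ℝ) : nsq (evo W ε) = card (Logical a b) :=
    by
  exact (nsq_unitary_mul _ (unitary_adj_mul (expU hW ε)) _).trans nsq_chiIso

lemma MDeriv.hat {M : ℝ → Enc a b c} {M' : Enc a b c} (h : MDeriv M M') :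
    MDeriv (fun ε => hat (M ε)) (SkewedCode.hat M') := fun _ _ => h _ _

/-- The local generators that cancel the part of the deformation removable by recoveries. -/
lemma exists_local_generators {W : PMat a b c} (hW : W.IsHermitian) : ∃ (XA : Mat (a × c)) (XB : Mat
    (b × c)) (N : Mat (a × b)) (Z : Mat c), XA.IsHermitian ∧ XB.IsHermitian ∧ N.IsHermitian ∧
    Z.trace = 0 ∧ liftA XA + liftB XB + red W = resid (red W) + (N ⊗ₖ (1 : Mat c) + (1 : Mat (a ×
    b)) ⊗ₖ Z) := by
  have hA := preservesStar_compA (a := a) (b := b) (c := c) (hermPart (red W))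
  have hB := preservesStar_compB (a := a) (b := b) (c := c) (hermPart (red W))
  rw [hermPart_conjTranspose] at hA hB
  obtain ⟨XA, hXA, hXA'⟩ := exists_liftA (a := a) (b := b) (c := c)
    (Y := -compA a b c (hermPart (red W)))
    (by rw [map_neg, ← End.mul_apply, expB_mul_compA])
    (by rw [conjTranspose_neg, ← hA])
  obtain ⟨XB, hXB, hXB'⟩ := exists_liftB (a := a) (b := b) (c := c)
    (Y := -compB a b c (hermPart (red W)))
    (by rw [map_neg, ← End.mul_apply, expA_mul_compB])
    (by rw [conjTranspose_neg, ← hB])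
  obtain ⟨N, hN, hN'⟩ := exists_kronecker_one (a := a) (b := b) (c := c) (Y := expC a b c (red W))
    (by rw [← End.mul_apply, show expC a b c * expC a b c = expC a b c from pexp_mul_self _])
  obtain ⟨Z, hZ⟩ := exists_one_kronecker (a := a) (b := b) (c := c) (Y := compC a b c (red W))
    (by rw [← End.mul_apply, expA_mul_compC])
    (by rw [← End.mul_apply, expB_mul_compC])
  have hZtr : Z.trace = 0 := by
    obtain ⟨p⟩ := (inferInstance : Nonempty (a × b))
    obtain ⟨s⟩ := (inferInstance : Nonempty c)
    have h := LinearMap.congr_fun (mul_eq_zero_swap isSelfAdj_compC isSelfAdj_expC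
      (compC_mul_expC (a := a) (b := b) (c := c))) (red W)
    rw [End.mul_apply, ← hZ] at h
    have h' := congrFun (congrFun h (p, s)) (p, s)
    rw [expC_apply, if_pos rfl] at h'
    simpa [trace] using h'
  refine ⟨XA, XB, N, Z, hXA, hXB, ?_, hZtr, ?_⟩
  · obtain ⟨s⟩ := (inferInstance : Nonempty c)
    ext p q
    rw [conjTranspose_apply, hN' q p s, hN' p q s, ← conjTranspose_apply, conjTranspose_expC_red hW]
  rw [hXA', hXB', hN, hZ]
  have := resid_decomposition (red W)
  nth_rewrite 3 [this]
  abel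

lemma mderiv_competitor (XA : Mat (a × c)) (XB : Mat (b × c)) (W : PMat a b c) : MDeriv (fun ε : ℝ
    => (NormedSpace.exp ((I * (ε : ℂ)) • XA) ⊗ₖ NormedSpace.exp ((I * (ε : ℂ)) • XB)) * evo W ε) (I
    • ((XA ⊗ₖ (1 : Mat (b × c)) + (1 : Mat (a × c)) ⊗ₖ XB + W) * chiIso a b c)) := by
  have h := ((mderiv_exp XA).kronecker (mderiv_exp XB)).mul (mderiv_evo W)
  simp only [exp_I_zero_smul, evo_zero, one_kronecker_one, Matrix.one_mul] at h
  convert h using 1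
  rw [smul_kronecker, kronecker_smul, ← smul_add, smul_mul, ← smul_add, ← Matrix.add_mul]

lemma hat_prodOp_perturbed (N : Mat (a × b)) (Z : Mat c) (z w : ℂ) : hat (prodOp (1 + z • N) (w • (1
    + z • Z))) = w • (1 + z • (N ⊗ₖ (1 : Mat c) + (1 : Mat (a × b)) ⊗ₖ Z) + z ^ 2 • (N ⊗ₖ Z)) :=
    by
  rw [hat_prodOp, kronecker_smul, add_kronecker, kronecker_add, kronecker_add, one_kronecker_one,
    smul_kronecker, smul_kronecker, kronecker_smul, kronecker_smul, smul_smul, smul_add z, pow_two]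
  congr 1
  abel

lemma tendsto_nsq_div {m n : Type} [Fintype m] [Fintype n] {F : ℝ → Matrix m n ℂ} {F' : Matrix m n
    ℂ} (h : MDeriv F F') : Tendsto (fun ε : ℝ => nsq (F ε - F 0) / ε ^ 2) (𝓝[≠] 0) (𝓝 (nsq F')) :=
    by
  have h1 := (continuous_nsq.tendsto _).comp h.tendsto
  refine h1.congr fun ε => ?_
  simp only [Function.comp]
  rw [nsq_smul, norm_inv, norm_real, norm_eq_abs, inv_pow, sq_abs, div_eq_inv_mul]

lemma MDeriv.choiMat {M : ℝ → Enc a b c} {M' : Enc a b c} (h : MDeriv M M') :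
    MDeriv (fun ε => choiMat (M ε)) (SkewedCode.choiMat M') := fun _ _ => h _ _

lemma MDeriv.traceSnd {m n : Type} [Fintype n] {F : ℝ → Mat (m × n)}
    {F' : Mat (m × n)} (h : MDeriv F F') :
    MDeriv (fun ε => traceSnd (F ε)) (SkewedCode.traceSnd F') := fun _ _ =>
  HasDerivAt.fun_sum fun _ _ => h _ _

lemma traceSnd_recoveredWithRef_chiIso : traceSnd (recoveredWithRef (chiIso a b c)) = (((card (a ×
    b) : ℝ)⁻¹ : ℝ) : ℂ) • 1 := by
  have hc : rt(card c) * rt(card c) = card c := by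
    rw [← ofReal_mul, mul_self_sqrt (Nat.cast_nonneg _), ofReal_natCast]
  have hc0 := card_cast_ne c
  have hchi : ∑ s : c × c, chi s * star (chi s) = (1 : ℂ) := by
    rw [sum_prod_type]
    simp only [chi, apply_ite star, star_zero, mul_ite, ite_mul, zero_mul, mul_zero]
    simp only [sum_ite_eq, mem_univ, if_true]
    simp only [star_inv₀, star_def, conj_ofReal, ← mul_inv, hc]
    simp [hc0]
  ext x y
  rw [recoveredWithRef_eq]
  simp only [traceSnd, Matrix.smul_apply, Matrix.mul_apply, choiMat, of_apply, chiIso, attachChi,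
    conjTranspose_apply, smul_eq_mul]
  rw [← mul_sum]
  have h1 : ∀ l : Logical a b, ∑ s : c × c, (if (x.1, x.2) = l then chi (s.1, s.2) else 0) *
      star (if (y.1, y.2) = l then chi (s.1, s.2) else (0 : ℂ)) =
      if x = l then (if y = l then 1 else 0) else 0 := by
    intro l
    by_cases hx : x = l <;> by_cases hy : y = l <;> simp [hx, hy]
    simpa using hchi
  rw [sum_congr rfl fun l _ => h1 l]
  rw [sum_ite_eq]
  simp [Matrix.one_apply, eq_comm]

lemma coherentInfo_competitor {W : PMat a b c} (hW : W.IsHermitian) {κ : ℝ} (hκ : 0 < κ) : ∃ C : ℝ,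
    ∀ᶠ ε in 𝓝[≠] (0 : ℝ), ∃ (RA : U(a × c)) (RB : U(b × c)), log (card (a × b)) - ((nsq (resid (red
    W)) / card c / card (Logical a b) + κ) * ε ^ 2 * log (1 / ε ^ 2) + C * ε ^ 2) ≤ coherentInfo
    (evo W ε) RA RB := by
  obtain ⟨XA, XB, N, Z, hXA, hXB, -, -, hdec⟩ := exists_local_generators hW
  set D : ℝ := (card (Logical a b) : ℝ) with hD
  have hD0 : 0 < D := by rw [hD]; positivity
  set w : ℝ := nsq (resid (red W)) / card c / D with hw
  set M : ℝ → Enc a b c := fun ε =>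
    (NormedSpace.exp ((I * (ε : ℂ)) • XA) ⊗ₖ NormedSpace.exp ((I * (ε : ℂ)) • XB)) * evo W ε with hM
  have hM' := mderiv_competitor XA XB W
  rw [← hM] at hM'
  have hM0 : M 0 = chiIso a b c := by
    simp only [hM, exp_I_zero_smul, evo_zero, one_kronecker_one, Matrix.one_mul]
  set dc : ℂ := rt(card c)⁻¹ with hdc
  set F : TMat a b c := N ⊗ₖ (1 : Mat c) + (1 : Mat (a × b)) ⊗ₖ Z with hF
  set P : ℝ → Enc a b c := fun ε =>
    prodOp (1 + (I * (ε : ℂ)) • N) (dc • (1 + (I * (ε : ℂ)) • Z)) with hP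
  have hPd : MDeriv (fun ε => hat (P ε)) (dc • I • F) := by
    intro i j
    have h1 : HasDerivAt (fun ε : ℝ => I * (ε : ℂ)) I 0 := by
      simpa using (ofRealCLM.hasDerivAt (x := (0 : ℝ))).const_mul I
    have h2 := (((h1.mul_const (F i j)).const_add ((1 : TMat a b c) i j)).fun_add
      ((h1.fun_pow 2).mul_const ((N ⊗ₖ Z) i j))).const_mul dc
    simp only [ofReal_zero, mul_zero] at h2
    have hfun : (fun ε : ℝ => hat (P ε) i j) = fun ε : ℝ => dc *
        ((1 : TMat a b c) i j + I * (ε : ℂ) * F i j + (I * (ε : ℂ)) ^ 2 * (N ⊗ₖ Z) i j) := by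
      funext ε
      simp only [hP]
      rw [hat_prodOp_perturbed]
      simp only [Matrix.add_apply, Matrix.smul_apply, hF, smul_eq_mul]
    rw [hfun]
    exact h2.congr_deriv (by simp)
  have hP0 : hat (P 0) = hat (M 0) := by
    have h1 : P 0 = prodOp (1 + (I * ((0 : ℝ) : ℂ)) • N) (dc • (1 + (I * ((0 : ℝ) : ℂ)) • Z)) := rfl
    rw [hM0, hat_attachChi, ← hdc, h1, hat_prodOp_perturbed]
    simp
  have hdiff := tendsto_nsq_div (hM'.hat.sub hPd)
  have hval : nsq (hat (I • ((XA ⊗ₖ (1 : Mat (b × c)) +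
        (1 : Mat (a × c)) ⊗ₖ XB + W) * chiIso a b c)) - dc • I • F) =
      D * w := by
    rw [hat_smul, hat_mul_attachChi, red_add, red_add, red_kronecker_one, red_one_kronecker, hdec,
      smul_comm dc, ← smul_sub, ← smul_sub, add_sub_cancel_right, nsq_smul, nsq_smul, norm_I,
      norm_inv, norm_real, norm_eq_abs, inv_pow, sq_abs, sq_sqrt (Nat.cast_nonneg _), hw]
    field_simp
  rw [hval] at hdiff
  have hMn : ∀ ε, nsq (M ε) = card (Logical a b) := fun ε => by
    have := nsq_recover (expU hXA ε) (expU hXB ε) (evo W ε)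
    rw [nsq_evo hW] at this
    exact this
  have hS := (((hM'.choiMat).mul (hM'.choiMat).conjTranspose).smul
    ((card (Logical a b) : ℂ)⁻¹)).traceSnd
  have hS2 := tendsto_nsq_div hS
  simp only [← recoveredWithRef_eq] at hS2
  rw [hM0, traceSnd_recoveredWithRef_chiIso] at hS2
  obtain ⟨C₁, hC₁⟩ : ∃ C₁ : ℝ, ∀ᶠ ε in 𝓝[≠] (0 : ℝ), nsq (traceSnd (recoveredWithRef (M ε)) -
      (((card (a × b) : ℝ)⁻¹ : ℝ) : ℂ) • 1) / ε ^ 2 < C₁ :=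
    ⟨_, hS2.eventually_lt_const (lt_add_one _)⟩
  refine ⟨card ((a × b) × Logical a b) + (w + κ) + card (a × b) * C₁, ?_⟩
  have hsmall : ∀ᶠ ε in 𝓝[≠] (0 : ℝ), ε ^ 2 ≤ 1 := by
    have : Tendsto (fun ε : ℝ => ε ^ 2) (𝓝[≠] 0) (𝓝 (0 ^ 2)) :=
      ((continuous_pow 2).tendsto 0).mono_left nhdsWithin_le_nhds
    exact this.eventually_le_const (by norm_num)
  filter_upwards [hdiff.eventually_lt_const (by nlinarith : D * w < D * (w + κ)), hC₁, hsmall,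
    self_mem_nhdsWithin] with ε h1 h2 h3 hne
  have hε2 : 0 < ε ^ 2 := by have : ε ≠ 0 := hne; positivity
  refine ⟨expU hXA ε, expU hXB ε, ?_⟩
  rw [hP0, sub_self, sub_zero, ← hat_sub, nsq_hat, div_lt_iff₀ hε2] at h1
  rw [div_lt_iff₀ hε2] at h2
  have h4 := entropy_recoveredWithRef_le (hMn ε) (N := 1 + (I * (ε : ℂ)) • N)
    (ζ := dc • (1 + (I * (ε : ℂ)) • Z)) (q := (w + κ) * ε ^ 2)
    (by rw [← mul_assoc]; exact h1.le) hε2 h3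
  have h5 := le_entropy_traceSnd_recoveredWithRef (hMn ε)
  have h6 : (card (a × b) : ℝ) * nsq (traceSnd (recoveredWithRef (M ε)) -
      (((card (a × b) : ℝ)⁻¹ : ℝ) : ℂ) • 1) ≤ card (a × b) * (C₁ * ε ^ 2) := by
    gcongr
  change _ ≤ entropy (traceSnd (recoveredWithRef (M ε))) - entropy (recoveredWithRef (M ε))
  linarith

/-- Optimal recoveries bring the skewed code close to a product operator. -/
lemma optimal_prodOp_approx {W : PMat a b c} (hW : W.IsHermitian) {κ : ℝ} (hκ : 0 < κ) : ∀ᶠ ε in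
    𝓝[≠] (0 : ℝ), ∀ (RA : U(a × c)) (RB : U(b × c)), IsOptimalRecovery (evo W ε) RA RB → ∃ (N : Mat
    (a × b)) (ζ : Mat c), nsq (recover RA RB (evo W ε) - prodOp N ζ) ≤ (nsq (resid (red W)) / card c
    + κ) * ε ^ 2 := by
  set D : ℝ := (card (Logical a b) : ℝ) with hD
  have hD0 : 0 < D := by rw [hD]; positivity
  set w : ℝ := nsq (resid (red W)) / card c / D with hw
  have hw0 : 0 ≤ w := by
    have := nsq_nonneg (resid (red W))
    positivity
  obtain ⟨C, hC⟩ := coherentInfo_competitor hW (κ := κ / D / 2) (by positivity)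
  filter_upwards [hC, le_of_negMulLog_le (C := C) hw0 (κ := κ / D) (by positivity)]
    with ε ⟨RA', RB', h1⟩ h2 RA RB hopt
  have hM : nsq (recover RA RB (evo W ε)) = card (Logical a b) := by
    rw [nsq_recover, nsq_evo hW]
  obtain ⟨η, N, ζ, -, hN, h3, h4⟩ := exists_prodOp_approx hM
  have h5 := entropy_traceSnd_recoveredWithRef_le hM
  have h6 := h1.trans (hopt RA' RB')
  have h7 : coherentInfo (evo W ε) RA RB =
    entropy (traceSnd (recoveredWithRef (recover RA RB (evo W ε)))) -
      entropy (recoveredWithRef (recover RA RB (evo W ε))) := rfl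
  have h8 := h2 η (by linarith) (by linarith)
  refine ⟨N, ζ, ?_⟩
  rw [hN]
  calc D * η ≤ D * ((w + κ / D) * ε ^ 2) := by gcongr
    _ = _ := by rw [hw]; field_simp

end Competitor

end

section

/-! ### Rigidity of exact recoveries -/

section Rigidity

open scoped ComplexOrder

/-- Blocks of an operator on a tensor product. -/
def blk (Q : Mat (b × c)) (y k : b) : Mat c := of fun s t => Q (y, s) (k, t)

lemma sum_blk_mul_conjTranspose (Q : U(b × c)) (y : b) : ∑ k, blk Q.1 y k * (blk Q.1 y k)ᴴ = 1 := by
  ext s t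
  have h := congrFun (congrFun (unitary_mul_adj Q) (y, s)) (y, t)
  rw [Matrix.mul_apply, sum_prod_type] at h
  simpa [Matrix.sum_apply, Matrix.mul_apply, blk, Matrix.one_apply] using h

lemma sum_conjTranspose_mul_blk (Q : U(b × c)) (k : b) : ∑ y, (blk Q.1 y k)ᴴ * blk Q.1 y k = 1 := by
  ext s t
  have h := congrFun (congrFun (unitary_adj_mul Q) (k, s)) (k, t)
  rw [Matrix.mul_apply, sum_prod_type] at h
  simpa [Matrix.sum_apply, Matrix.mul_apply, blk, Matrix.one_apply] using h

lemma exists_kronU_of_blk [Nonempty b] [Nonempty c] (Q : U(b × c)) (h : ∀ y k y' k', ∃ z : ℂ, blk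
    Q.1 y k * (blk Q.1 y' k')ᴴ = z • 1) : ∃ u v, Q = kronU u v := by
  obtain ⟨y₀⟩ := ‹Nonempty b›
  obtain ⟨s₀⟩ := ‹Nonempty c›
  obtain ⟨k₀, hk₀⟩ : ∃ k, blk Q.1 y₀ k ≠ 0 := by
    by_contra! hcon
    have := sum_blk_mul_conjTranspose Q y₀
    simp only [hcon, zero_mul, sum_const_zero] at this
    exact zero_ne_one this
  set Q₀ := blk Q.1 y₀ k₀ with hQ₀
  choose z hz using fun y k => h y k y₀ k₀
  have hz0 := hz y₀ k₀
  rw [← hQ₀] at hz0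
  set g : ℝ := ∑ t, ‖Q₀ s₀ t‖ ^ 2 with hg
  have hzg : z y₀ k₀ = g := by
    have := congrFun (congrFun hz0 s₀) s₀
    simp only [Matrix.mul_apply, conjTranspose_apply, Matrix.smul_apply, one_apply_eq, smul_eq_mul,
      mul_one] at this
    rw [← this, hg]
    push_cast
    exact sum_congr rfl fun t _ => mul_conj' _
  have hg0 : 0 < g := by
    refine lt_of_le_of_ne (by positivity) fun h0 => hk₀ ?_
    rw [hzg, ← h0, ofReal_zero, zero_smul] at hz0
    exact Matrix.self_mul_conjTranspose_eq_zero.1 hz0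
  have hgc : (g : ℂ) ≠ 0 := by exact_mod_cast hg0.ne'
  have hsq : ((√g : ℝ) : ℂ) * ((√g : ℝ) : ℂ) = g := by
    rw [← ofReal_mul, mul_self_sqrt hg0.le]
  have hs0 : ((√g : ℝ) : ℂ) ≠ 0 := fun h0 => hgc (by rw [← hsq, h0, zero_mul])
  rw [hzg] at hz0
  set v : Mat c := ((√g : ℝ) : ℂ)⁻¹ • Q₀ with hv
  have hQv : Q₀ = ((√g : ℝ) : ℂ) • v := by rw [hv, smul_smul, mul_inv_cancel₀ hs0, one_smul]
  have hvv : v * vᴴ = 1 := by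
    rw [hv, conjTranspose_smul, smul_mul, Matrix.mul_smul, hz0, smul_smul, smul_smul, star_inv₀,
      star_def, conj_ofReal, ← mul_inv, hsq, inv_mul_cancel₀ hgc, one_smul]
  have hvv' : vᴴ * v = 1 := mul_eq_one_comm.1 hvv
  set u : Mat b := of fun y k => z y k * ((√g : ℝ) : ℂ)⁻¹ with hu
  have hblk : ∀ y k, blk Q.1 y k = u y k • v := by
    intro y k
    have h1 := hz y k
    rw [← hQ₀, hQv, conjTranspose_smul, Matrix.mul_smul] at h1
    have h2 := congrArg (fun X => (((√g : ℝ) : ℂ)⁻¹ • X) * v) h1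
    simp only [smul_smul, star_def, conj_ofReal, inv_mul_cancel₀ hs0, one_smul, Matrix.mul_assoc,
      hvv', Matrix.mul_one, smul_mul, Matrix.one_mul] at h2
    rw [h2, hu, of_apply, mul_comm]
  have hQuv : Q.1 = u ⊗ₖ v := by
    ext p q
    exact congrFun (congrFun (hblk p.1 q.1) p.2) q.2
  have huu : u * uᴴ = 1 := by
    have h1 := unitary_mul_adj Q
    rw [hQuv, conjTranspose_kronecker, ← mul_kronecker_mul, hvv] at h1
    ext y k
    have h2 := congrFun (congrFun h1 (y, s₀)) (k, s₀)
    simpa [kroneckerMap_apply, Matrix.one_apply] using h2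
  exact ⟨⟨u, mem_unitaryGroup_iff.2 huu⟩, ⟨v, mem_unitaryGroup_iff.2 hvv⟩, Subtype.ext hQuv⟩

lemma exists_kronU_of_mul_transpose [Nonempty a] [Nonempty b] [Nonempty c] (R : U(a × c)) (Q : U(b ×
    c)) (n : a → a → b → b → ℂ) (ζ : Mat c) (h : ∀ x l y k, blk R.1 x l * (blk Q.1 y k)ᵀ = n x l y k
    • ζ) : ∃ u v, Q = kronU u v := by
  obtain ⟨l⟩ := ‹Nonempty a›
  obtain ⟨y₀⟩ := ‹Nonempty b›
  refine exists_kronU_of_blk Q ?_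
  set B := fun y k => blk Q.1 y k with hB
  have key : ∀ y k y' k', (B y' k')ᵀᴴ * (B y k)ᵀ =
      (∑ x, star (n x l y' k') * n x l y k) • (ζᴴ * ζ) := by
    intro y k y' k'
    calc (B y' k')ᵀᴴ * (B y k)ᵀ = (B y' k')ᵀᴴ * (1 * (B y k)ᵀ) := by rw [one_mul]
      _ = ∑ x, (blk R.1 x l * (B y' k')ᵀ)ᴴ * (blk R.1 x l * (B y k)ᵀ) := by
        rw [← sum_conjTranspose_mul_blk R l, sum_mul, mul_sum]
        refine sum_congr rfl fun x _ => ?_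
        rw [conjTranspose_mul]
        simp only [Matrix.mul_assoc]
      _ = _ := by
        rw [sum_smul]
        refine sum_congr rfl fun x _ => ?_
        rw [h, h, conjTranspose_smul, smul_mul, Matrix.mul_smul, smul_smul]
  have hG : ∃ w : ℂ, ζᴴ * ζ = w • 1 := by
    have h1 : (∑ k, ∑ x, star (n x l y₀ k) * n x l y₀ k) • (ζᴴ * ζ) = 1 := by
      rw [sum_smul, ← sum_congr rfl fun k _ => key y₀ k y₀ k]
      have h2 := congrArg transpose (sum_blk_mul_conjTranspose Q y₀)
      rw [Matrix.transpose_sum, transpose_one] at h2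
      rw [← h2]
      refine sum_congr rfl fun k _ => ?_
      rw [transpose_mul]
      rfl
    have h0 : (∑ k, ∑ x, star (n x l y₀ k) * n x l y₀ k) ≠ 0 := by
      intro h0
      rw [h0, zero_smul] at h1
      exact zero_ne_one h1
    exact ⟨_, by rw [← h1, smul_smul, inv_mul_cancel₀ h0, one_smul]⟩
  obtain ⟨w, hw⟩ := hG
  intro y k y' k'
  have h1 := congrArg transpose (key y k y' k')
  rw [hw, smul_smul, transpose_mul, transpose_smul, transpose_one, transpose_transpose] at h1
  exact ⟨_, h1⟩

lemma exists_kronecker_of_tendsto {R S : Type} [Fintype R] [Fintype S] {T : ℕ → Mat (R × S)} {T₀ :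
    Mat (R × S)} (hT : Tendsto T atTop (𝓝 T₀)) {N : ℕ → Mat R} {ζ : ℕ → Mat S} (h : Tendsto (fun k
    => nsq (T k - N k ⊗ₖ ζ k)) atTop (𝓝 0)) : ∃ (N₀ : Mat R) (ζ₀ : Mat S), T₀ = N₀ ⊗ₖ ζ₀ := by
  have hP : ∀ i j, Tendsto (fun k => (N k ⊗ₖ ζ k) i j) atTop (𝓝 (T₀ i j)) := by
    intro i j
    have h1 : Tendsto (fun k => (T k - N k ⊗ₖ ζ k) i j) atTop (𝓝 0) := by
      rw [tendsto_zero_iff_norm_tendsto_zero]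
      have h2 := (continuous_sqrt.tendsto 0).comp h
      rw [sqrt_zero] at h2
      refine squeeze_zero (fun _ => norm_nonneg _) (fun k => ?_) h2
      refine le_sqrt_of_sq_le ?_
      exact (single_le_sum (f := fun j => ‖(T k - N k ⊗ₖ ζ k) i j‖ ^ 2)
        (fun _ _ => by positivity) (mem_univ j)).trans
        (single_le_sum (f := fun i => ∑ j, ‖(T k - N k ⊗ₖ ζ k) i j‖ ^ 2)
          (fun _ _ => by positivity) (mem_univ i))
    have h3 := (tendsto_mat.1 hT i j).sub h1
    simpa using h3
  have hminor : ∀ p q p' q' s t s' t', T₀ (p, s) (q, t) * T₀ (p', s') (q', t') =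
      T₀ (p, s') (q, t') * T₀ (p', s) (q', t) := by
    intro p q p' q' s t s' t'
    refine tendsto_nhds_unique ((hP (p, s) (q, t)).mul (hP (p', s') (q', t'))) ?_
    refine ((hP (p, s') (q, t')).mul (hP (p', s) (q', t))).congr fun k => ?_
    simp only [kroneckerMap_apply]
    ring
  by_cases h0 : T₀ = 0
  · exact ⟨0, 0, by rw [h0, zero_kronecker]⟩
  · obtain ⟨p₀, s₀, q₀, t₀, hne⟩ : ∃ p s q t, T₀ (p, s) (q, t) ≠ 0 := by
      by_contra! hcon
      exact h0 (by ext ⟨p, s⟩ ⟨q, t⟩; exact hcon p s q t)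
    refine ⟨of fun p q => T₀ (p, s₀) (q, t₀),
      of fun s t => T₀ (p₀, s) (q₀, t) * (T₀ (p₀, s₀) (q₀, t₀))⁻¹, ?_⟩
    ext ⟨p, s⟩ ⟨q, t⟩
    simp only [kroneckerMap_apply, of_apply]
    rw [← mul_assoc, ← hminor p q p₀ q₀ s t s₀ t₀, mul_inv_cancel_right₀ hne]

lemma hat_recover_chiIso (RA : U(a × c)) (RB : U(b × c)) (x l : a) (y k : b) (s t : c) : hat
    (recover RA RB (chiIso a b c)) ((x, y), s) ((l, k), t) = rt(card c)⁻¹ * (blk RA.1 x l * (blk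
    RB.1 y k)ᵀ) s t := by
  rw [recover, hat_mul_attachChi]
  rfl

/-- If the recovered reference code is a product operator, the recoveries are local. -/
lemma exists_kronU_of_prodOp [Nonempty a] [Nonempty b] [Nonempty c] {RA : U(a × c)} {RB : U(b × c)}
    {N : Mat (a × b)} {ζ : Mat c} (h : hat (recover RA RB (chiIso a b c)) = N ⊗ₖ ζ) : (∃ u v, RA =
    kronU u v) ∧ ∃ u v, RB = kronU u v := by
  have hc : rt(card c) ≠ 0 := by
    have : (0 : ℝ) < √(card c : ℝ) := Real.sqrt_pos.2 (by positivity)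
    exact_mod_cast this.ne'
  have h1 : ∀ x l y k, blk RA.1 x l * (blk RB.1 y k)ᵀ = (rt(card c) * N (x, y) (l, k)) • ζ := by
    intro x l y k
    ext s t
    have h2 := hat_recover_chiIso RA RB x l y k s t
    rw [h, kroneckerMap_apply] at h2
    rw [Matrix.smul_apply, smul_eq_mul, mul_assoc, h2, mul_inv_cancel_left₀ hc]
  refine ⟨?_, exists_kronU_of_mul_transpose RA RB _ ζ h1⟩
  refine exists_kronU_of_mul_transpose RB RA
    (fun y k x l => rt(card c) * N (x, y) (l, k)) ζᵀ fun y k x l => ?_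
  rw [← transpose_smul, ← h1, transpose_mul, transpose_transpose]

end Rigidity

/-! ### Gauge fixing of recoveries -/

section Limits

lemma tendsto_mul {ι m n k : Type*} [Fintype n] {l : Filter ι} {F : ι → Matrix m n ℂ} {G : ι →
    Matrix n k ℂ} {A : Matrix m n ℂ} {B : Matrix n k ℂ} (hF : Tendsto F l (𝓝 A)) (hG : Tendsto G l
    (𝓝 B)) : Tendsto (fun x => F x * G x) l (𝓝 (A * B)) :=
  tendsto_mat.2 fun i j => by
    simp only [Matrix.mul_apply]
    exact tendsto_finsetSum _ fun u _ =>
      (tendsto_mat.1 hF i u).mul (tendsto_mat.1 hG u j)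

lemma tendsto_matrix_smul {ι m n : Type*} {l : Filter ι} {F : ι → Matrix m n ℂ} {z : ι → ℂ} {A :
    Matrix m n ℂ} {w : ℂ} (hz : Tendsto z l (𝓝 w)) (hF : Tendsto F l (𝓝 A)) : Tendsto (fun x => z x
    • F x) l (𝓝 (w • A)) :=
  tendsto_mat.2 fun i j => hz.mul (tendsto_mat.1 hF i j)

lemma tendsto_kronecker {ι m n k o : Type*} {l : Filter ι} {F : ι → Matrix m n ℂ} {G : ι → Matrix k
    o ℂ} {A : Matrix m n ℂ} {B : Matrix k o ℂ} (hF : Tendsto F l (𝓝 A)) (hG : Tendsto G l (𝓝 B)) :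
    Tendsto (fun x => F x ⊗ₖ G x) l (𝓝 (A ⊗ₖ B)) :=
  tendsto_mat.2 fun i j =>
    (tendsto_mat.1 hF i.1 j.1).mul (tendsto_mat.1 hG i.2 j.2)

lemma tendsto_conjTranspose {ι m n : Type*} {l : Filter ι} {F : ι → Matrix m n ℂ} {A : Matrix m n ℂ}
    (hF : Tendsto F l (𝓝 A)) : Tendsto (fun x => (F x)ᴴ) l (𝓝 Aᴴ) :=
  tendsto_mat.2 fun i j => (tendsto_mat.1 hF j i).star

lemma tendsto_trace {ι n : Type*} [Fintype n] {l : Filter ι} {F : ι → Mat n} {A : Mat n} (hF :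
    Tendsto F l (𝓝 A)) : Tendsto (fun x => (F x).trace) l (𝓝 A.trace) :=
  tendsto_finsetSum _ fun i _ => tendsto_mat.1 hF i i

end Limits

section Gauge

variable {a c : Type} [Fintype a] [DecidableEq a] [Fintype c] [DecidableEq c]

lemma nsq_unitary_sub_one {n : Type} [Fintype n] [DecidableEq n] (U : U(n)) : nsq (U.1 - 1) = 2 *
    card n - 2 * U.1.trace.re := by
  have h : ((nsq (U.1 - 1) : ℝ) : ℂ) = 2 * card n - U.1.trace - star U.1.trace := by
    rw [← hs_self, hs_eq_trace, conjTranspose_sub, conjTranspose_one, sub_mul, mul_sub,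
      unitary_adj_mul, Matrix.mul_one, Matrix.one_mul, trace_sub, trace_sub, trace_sub, trace_one,
      trace_conjTranspose]
    ring
  have h2 := congrArg Complex.re h
  simp at h2
  linarith

/-- Partial trace over the first tensor factor. -/
def traceFst (X : Mat (a × c)) : Mat c := of fun s t => ∑ z, X (z, s) (z, t)

lemma continuous_kronU : Continuous fun g : U(a) × U(c) => ((kronU g.1 g.2 : U(a × c)) : Mat (a ×
    c)) := by
  refine continuous_matrix fun i j => ?_
  exact ((continuous_subtype_val.comp continuous_fst).matrix_elem i.1 j.1).mul
    ((continuous_subtype_val.comp continuous_snd).matrix_elem i.2 j.2)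

lemma trace_im_eq_zero_of_isMin {n : Type} [Fintype n] [DecidableEq n] {R : U(n)} {G : ℝ → U(n)} {h
    : Mat n} (hG : MDeriv (fun θ => (G θ : Mat n)) (I • h)) (hG0 : G 0 = 1) (hmin : ∀ θ, nsq (R.1 -
    1) ≤ nsq ((G θ * R : U(n)) - 1 : Mat n)) : (h * R.1).trace.im = 0 := by
  have h1 : HasDerivAt (fun θ => ((G θ).1 * R.1).trace.re) (I • h * R.1).trace.re 0 := by
    have h2 := hG.mul (mderiv_const R.1)
    rw [Matrix.mul_zero, add_zero] at h2
    have h3 : HasDerivAt (fun θ => ((G θ).1 * R.1).trace)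
        (I • h * R.1).trace 0 := HasDerivAt.fun_sum fun i _ => h2 i i
    exact Complex.reCLM.hasFDerivAt.comp_hasDerivAt 0 h3
  have h4 : IsLocalMax (fun θ => ((G θ).1 * R.1).trace.re) 0 := by
    refine Filter.Eventually.of_forall fun θ => ?_
    have h5 := hmin θ
    rw [nsq_unitary_sub_one, nsq_unitary_sub_one] at h5
    have h6 : ((G θ * R : U(n)) : Mat n) = (G θ).1 * R.1 := rfl
    rw [h6] at h5
    simp only [hG0, OneMemClass.coe_one, Matrix.one_mul]
    linarith
  have h7 := h4.hasDerivAt_eq_zero h1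
  rw [smul_mul, trace_smul] at h7
  simpa using h7

/-- Squared distance of a unitary to the identity. -/
def distOne {n : Type} [Fintype n] [DecidableEq n] (U : U(n)) : ℝ := nsq (U.1 - 1)

/-- Orthogonality of a unitary to all local generators. -/
def IsGauged (R : U(a × c)) : Prop := (∀ O : Mat a, O.IsHermitian →
    ((O ⊗ₖ (1 : Mat c)) * R.1).trace.im = 0) ∧
  ∀ O : Mat c, O.IsHermitian → (((1 : Mat a) ⊗ₖ O) * R.1).trace.im = 0

lemma kronU_mul_kronU (u₁ u₂ : U(a)) (v₁ v₂ : U(c)) : kronU u₁ v₁ * kronU u₂ v₂ = kronU (u₁ * u₂)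
    (v₁ * v₂) :=
  Subtype.ext (mul_kronecker_mul _ _ _ _).symm

lemma kronU_one : kronU (1 : U(a)) (1 : U(c)) = 1 := Subtype.ext one_kronecker_one

lemma continuous_distOne_kronU (R : U(a × c)) : Continuous fun g : U(a) × U(c) => distOne (kronU g.1
    g.2 * R) := by
  have h : Continuous fun g : U(a) × U(c) =>
      (kronU g.1 g.2).1 * R.1 - 1 :=
    (continuous_kronU.matrix_mul continuous_const).sub continuous_const
  exact continuous_nsq.comp h

lemma isGauged_of_isMin {R : U(a × c)} (hmin : ∀ u v, distOne R ≤ distOne (kronU u v * R)) :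
    IsGauged R := by
  refine ⟨fun O hO => ?_, fun O hO => ?_⟩
  · refine trace_im_eq_zero_of_isMin (G := fun θ => kronU (expU hO θ) 1) ?_ ?_ fun θ => hmin _ _
    · have h := (mderiv_exp O).kronecker (mderiv_const (1 : Mat c))
      rw [Matrix.kronecker_zero, add_zero, smul_kronecker] at h
      exact h
    · rw [← kronU_one]
      exact congrArg (fun u => kronU u 1) (Subtype.ext (exp_I_zero_smul O))
  · refine trace_im_eq_zero_of_isMin (G := fun θ => kronU 1 (expU hO θ)) ?_ ?_ fun θ => hmin _ _
    · have h := (mderiv_const (1 : Mat a)).kronecker (mderiv_exp O)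
      rw [zero_kronecker, zero_add, kronecker_smul] at h
      exact h
    · rw [← kronU_one]
      exact congrArg (fun v => kronU 1 v) (Subtype.ext (exp_I_zero_smul O))

lemma exists_gauge (R : U(a × c)) : ∃ (u : U(a)) (v : U(c)), (∀ u' v', distOne (kronU u v * R) ≤
    distOne (kronU u' v' * R)) ∧ IsGauged (kronU u v * R) := by
  obtain ⟨⟨u, v⟩, -, huv⟩ := isCompact_univ.exists_isMinOn Set.univ_nonempty
    (continuous_distOne_kronU R).continuousOn
  have hmin : ∀ u' v', distOne (kronU u v * R) ≤ distOne (kronU u' v' * R) :=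
    fun u' v' => isMinOn_univ_iff.1 huv (u', v')
  refine ⟨u, v, hmin, isGauged_of_isMin fun u' v' => ?_⟩
  rw [← mul_assoc, kronU_mul_kronU]
  exact hmin _ _

/-- The generator of a convergent family of gauge-fixed unitaries is Hermitian and has vanishing
partial traces. -/
lemma generator_of_gauge {ι : Type} {l : Filter ι} [l.NeBot] {r : ι → ℝ} (hr : Tendsto r l (𝓝 0))
    (hr0 : ∀ k, r k ≠ 0) {R : ι → U(a × c)} {Y : Mat (a × c)} (hY : Tendsto (fun k => (r k : ℂ)⁻¹ •
    ((R k).1 - 1)) l (𝓝 Y)) (hR : ∀ k, IsGauged (R k)) : ∃ X : Mat (a × c), X.IsHermitian ∧ Y = I •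
    X ∧ traceSnd X = 0 ∧ traceFst X = 0 := by
  have hrc : Tendsto (fun k => (r k : ℂ)) l (𝓝 0) := by
    have := (continuous_ofReal.tendsto 0).comp hr
    rwa [ofReal_zero] at this
  have hanti : Y + Yᴴ = 0 := by
    have hYH : Tendsto (fun k => ((r k : ℂ)⁻¹ • ((R k).1 - 1))ᴴ) l (𝓝 Yᴴ) :=
      tendsto_conjTranspose hY
    have hm : Tendsto (fun k => (r k : ℂ) • (((r k : ℂ)⁻¹ • ((R k).1 - 1))ᴴ *
        ((r k : ℂ)⁻¹ • ((R k).1 - 1)))) l (𝓝 ((0 : ℂ) • (Yᴴ * Y))) :=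
      tendsto_matrix_smul hrc (tendsto_mul hYH hY)
    rw [zero_smul] at hm
    have hsum := (hY.add hYH).add hm
    rw [add_zero] at hsum
    refine tendsto_nhds_unique hsum ?_
    refine tendsto_const_nhds.congr fun k => ?_
    have hk : (r k : ℂ) ≠ 0 := by exact_mod_cast hr0 k
    have hu := unitary_adj_mul (R k)
    rw [conjTranspose_smul, smul_mul, Matrix.mul_smul, smul_smul, smul_smul, star_inv₀, star_def,
      conj_ofReal, mul_inv_cancel₀ hk, one_mul, ← smul_add, ← smul_add, conjTranspose_sub,
      conjTranspose_one, sub_mul, mul_sub, hu, Matrix.one_mul, Matrix.mul_one]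
    rw [eq_comm, smul_eq_zero]
    right
    abel
  set X : Mat (a × c) := -I • Y with hX
  have hYX : Y = I • X := by rw [hX, smul_smul]; simp
  have hXH : X.IsHermitian := by
    have : Yᴴ = -Y := by rw [eq_neg_iff_add_eq_zero, add_comm]; exact hanti
    rw [IsHermitian, hX, conjTranspose_smul, this]
    simp
  have him : ∀ h : Mat (a × c), h.IsHermitian →
      (∀ k, (h * (R k).1).trace.im = 0) → (h * X).trace.re = 0 := by
    intro h hh hk
    have h1 : Tendsto (fun k => (h * ((r k : ℂ)⁻¹ • ((R k).1 - 1))).trace.im) l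
        (𝓝 (h * Y).trace.im) :=
      (Complex.continuous_im.tendsto _).comp (tendsto_trace (tendsto_mul tendsto_const_nhds hY))
    have h2 : (h * Y).trace.im = 0 := by
      refine tendsto_nhds_unique h1 (tendsto_const_nhds.congr fun k => ?_)
      rw [Matrix.mul_smul, trace_smul, mul_sub, Matrix.mul_one, trace_sub, smul_eq_mul, ←
        ofReal_inv, im_ofReal_mul, Complex.sub_im, hk k, zero_sub]
      have h3 : star h.trace = h.trace := by rw [← trace_conjTranspose, hh.eq]
      rw [Complex.conj_eq_iff_im.1 h3, neg_zero, mul_zero]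
    rw [hYX, Matrix.mul_smul, trace_smul] at h2
    simpa using h2
  have hS : (traceSnd X).IsHermitian := isHermitian_traceSnd hXH
  have hF : (traceFst X).IsHermitian := by
    ext s t
    simp only [traceFst, conjTranspose_apply, of_apply, star_sum]
    exact sum_congr rfl fun z _ => hXH.apply _ _
  refine ⟨X, hXH, hYX, ?_, ?_⟩
  · have h1 := him (traceSnd X ⊗ₖ (1 : Mat c))
      (by rw [IsHermitian, conjTranspose_kronecker, hS.eq, conjTranspose_one])
      fun k => (hR k).1 _ hS
    have h2 : ((traceSnd X ⊗ₖ (1 : Mat c)) * X).trace = nsq (traceSnd X) := by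
      rw [← hs_self, hs_eq_trace, hS.eq]
      simp only [trace, diag_apply, Matrix.mul_apply, kroneckerMap_apply, sum_prod_type,
        Matrix.one_apply, mul_ite, mul_one, mul_zero, ite_mul, zero_mul, sum_ite_eq, mem_univ,
        if_true]
      refine sum_congr rfl fun i _ => ?_
      rw [sum_comm]
      refine sum_congr rfl fun j _ => ?_
      rw [← mul_sum]
      rfl
    rw [h2, ofReal_re] at h1
    exact nsq_eq_zero.1 h1
  · have h1 := him ((1 : Mat a) ⊗ₖ traceFst X)
      (by rw [IsHermitian, conjTranspose_kronecker, hF.eq, conjTranspose_one])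
      fun k => (hR k).2 _ hF
    have h2 : (((1 : Mat a) ⊗ₖ traceFst X) * X).trace = nsq (traceFst X) := by
      rw [← hs_self, hs_eq_trace, hF.eq]
      simp only [trace, diag_apply, Matrix.mul_apply, kroneckerMap_apply,
        Fintype.sum_prod_type_right, Matrix.one_apply, one_mul, ite_mul, zero_mul, sum_ite_eq,
        mem_univ, if_true]
      refine sum_congr rfl fun i _ => ?_
      rw [sum_comm]
      refine sum_congr rfl fun j _ => ?_
      rw [← mul_sum]
      rfl
    rw [h2, ofReal_re] at h1
    exact nsq_eq_zero.1 h1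

end Gauge

end

section

/-! ### First-order limits of optimal recoveries -/

section FirstOrder

lemma recover_mul (gA RA : U(a × c)) (gB RB : U(b × c)) (V : Enc a b c) : recover (gA * RA) (gB *
    RB) V = recover gA gB (recover RA RB V) := by
  rw [recover, recover, recover, ← Matrix.mul_assoc, ← mul_kronecker_mul]
  rfl

lemma recover_sub (RA : U(a × c)) (RB : U(b × c)) (V V' : Enc a b c) : recover RA RB (V - V') =
    recover RA RB V - recover RA RB V' := by
  rw [recover, recover, recover, Matrix.mul_sub]

lemma recover_kronU_prodOp (u : U(a)) (v v' : U(c)) (u' : U(b)) (N : Mat (a × b)) (ζ : Mat c) :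
    recover (kronU u v) (kronU u' v') (prodOp N ζ) = prodOp ((u.1 ⊗ₖ u'.1) * N) (v.1 * ζ * v'.1ᵀ) :=
    by
  ext ⟨⟨x, s⟩, ⟨y, t⟩⟩ l
  simp only [recover, kronU, prodOp, Matrix.mul_apply, of_apply, kroneckerMap_apply, sum_prod_type,
    Matrix.transpose_apply]
  rw [sum_mul]
  refine sum_congr rfl fun x' _ => ?_
  rw [sum_mul, sum_comm]
  refine sum_congr rfl fun y' _ => ?_
  rw [mul_sum, sum_comm]
  refine sum_congr rfl fun t' _ => ?_
  rw [sum_mul, mul_sum]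
  refine sum_congr rfl fun s' _ => ?_
  ring

lemma abs_apply_le_sqrt_nsq {m n : Type} [Fintype m] [Fintype n] (X : Matrix m n ℂ) (i : m) (j : n)
    : ‖X i j‖ ≤ √(nsq X) :=
  le_sqrt_of_sq_le ((single_le_sum (f := fun j => ‖X i j‖ ^ 2)
    (fun _ _ => by positivity) (mem_univ j)).trans
    (single_le_sum (f := fun i => ∑ j, ‖X i j‖ ^ 2) (fun _ _ => by positivity) (mem_univ i)))

lemma isCompact_entry_box (m n : Type) [Fintype m] [Fintype n] : IsCompact {X : Matrix m n ℂ | ∀ i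
    j, ‖X i j‖ ≤ 1} := by
  have h : IsCompact (Set.univ.pi fun _ : m => Set.univ.pi fun _ : n =>
      Metric.closedBall (0 : ℂ) 1 : Set (m → n → ℂ)) :=
    isCompact_univ_pi fun _ => isCompact_univ_pi fun _ => isCompact_closedBall _ _
  refine IsCompact.of_isClosed_subset (X := Matrix m n ℂ) h ?_
    fun X hX i _ j _ => mem_closedBall_zero_iff.mpr (hX i j)
  simp only [Set.ofPred_forall]
  exact isClosed_iInter fun i => isClosed_iInter fun j =>
    isClosed_le (continuous_id.matrix_elem i j).norm continuous_const

lemma tendsto_recover_sub_div {ι : Type} {l : Filter ι} {r ε : ι → ℝ} (hε : Tendsto ε l (𝓝[≠] 0))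
    (hr : Tendsto r l (𝓝 0)) (hr0 : ∀ k, r k ≠ 0) {R : ι → U(a × c)} {Q : ι → U(b × c)} {X : Mat (a
    × c)} {Y : Mat (b × c)} {θ : ℝ} (hX : Tendsto (fun k => (r k : ℂ)⁻¹ • ((R k : Mat (a × c)) - 1))
    l (𝓝 X)) (hY : Tendsto (fun k => (r k : ℂ)⁻¹ • ((Q k).1 - 1)) l (𝓝 Y)) (hθ : Tendsto (fun k => ε
    k / r k) l (𝓝 θ)) (W : PMat a b c) : Tendsto (fun k => (r k : ℂ)⁻¹ • (recover (R k) (Q k) (evo W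
    (ε k)) - chiIso a b c)) l (𝓝 ((X ⊗ₖ (1 : Mat (b × c)) + (1 : Mat (a × c)) ⊗ₖ Y + ((θ : ℂ) * I) •
    W) * chiIso a b c)) := by
  have hrc : Tendsto (fun k => (r k : ℂ)) l (𝓝 0) := by
    have := (continuous_ofReal.tendsto 0).comp hr
    rwa [ofReal_zero] at this
  have hQ1 : Tendsto (fun k => (Q k : Mat (b × c))) l (𝓝 1) := by
    have h1 := (tendsto_matrix_smul hrc hY).add (tendsto_const_nhds (x := (1 : Mat (b × c))))
    rw [zero_smul, zero_add] at h1
    refine h1.congr fun k => ?_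
    rw [smul_smul, mul_inv_cancel₀ (by exact_mod_cast hr0 k), one_smul, sub_add_cancel]
  have hevo : Tendsto (fun k => evo W (ε k)) l (𝓝 (chiIso a b c)) := by
    have := (mderiv_evo W).continuousAt
    rw [evo_zero] at this
    exact this.comp (hε.mono_right nhdsWithin_le_nhds)
  have hd : Tendsto (fun k => ((ε k / r k : ℝ) : ℂ) • ((ε k : ℂ)⁻¹ • (evo W (ε k) - chiIso a b c))) l
      (𝓝 ((θ : ℂ) • (I • (W * chiIso a b c)))) := by
    refine tendsto_matrix_smul ((continuous_ofReal.tendsto θ).comp hθ) ?_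
    have := (mderiv_evo W).tendsto
    rw [evo_zero] at this
    exact this.comp hε
  have h1 := (tendsto_mul (tendsto_kronecker hX hQ1) hevo).add ((tendsto_mul
    (tendsto_kronecker (tendsto_const_nhds (x := (1 : Mat (a × c)))) hY) hevo).add hd)
  rw [smul_smul, ← smul_mul, ← Matrix.add_mul, ← Matrix.add_mul, ← add_assoc] at h1
  refine h1.congr' ?_
  filter_upwards [hε.eventually (eventually_mem_nhdsWithin)] with k hk
  have hk0 : (ε k : ℂ) ≠ 0 := by
    have : ε k ≠ 0 := hk
    exact_mod_cast this
  rw [smul_smul, ofReal_div, div_mul_eq_mul_div, mul_inv_cancel₀ hk0, one_div, smul_kronecker,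
    kronecker_smul, smul_mul, smul_mul, ← smul_add, ← smul_add]
  congr 1
  have h2 : ((R k : Mat (a × c)) - 1) ⊗ₖ (Q k : Mat (b × c)) + (1 : Mat (a × c)) ⊗ₖ ((Q k).1 - 1) =
      (R k : Mat (a × c)) ⊗ₖ (Q k).1 - 1 := by
    ext i j
    simp only [Matrix.add_apply, Matrix.sub_apply, kroneckerMap_apply, ← one_kronecker_one (α := ℂ)
      (m := a × c) (n := b × c)]
    ring
  rw [← add_assoc, ← Matrix.add_mul, h2, Matrix.sub_mul, Matrix.one_mul, sub_add_sub_cancel]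
  rfl

variable [Nonempty a] [Nonempty b] [Nonempty c]

/-- Part of the deformation that controls the proto-area correction. -/
def areaPart (W : PMat a b c) : TMat a b c := resid (red W) + antiPart (compC a b c (red W))

lemma antiPart_real_smul {n : Type} [Fintype n] (θ : ℝ) (X : Mat n) : antiPart ((θ : ℂ) • X) = (θ :
    ℂ) • antiPart X := by
  rw [antiPart, antiPart, conjTranspose_smul, star_def, conj_ofReal, ← smul_sub, smul_comm]

lemma resid_real_smul (θ : ℝ) (X : TMat a b c) : resid ((θ : ℂ) • X) = (θ : ℂ) • resid X := by
  rw [resid, resid, antiPart_real_smul, map_smul, map_smul, map_smul, smul_add, smul_add]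

lemma liftA_smul (z : ℂ) (X : Mat (a × c)) : liftA (b := b) (z • X) = z • liftA X := by
  ext p q
  simp [liftA]

lemma liftB_smul (z : ℂ) (X : Mat (b × c)) : liftB (a := a) (z • X) = z • liftB X := by
  ext p q
  simp [liftB]

lemma isHermitian_of_one_kronecker {Z : Mat c} (h : ((1 : Mat (a × b)) ⊗ₖ Z)ᴴ = 1 ⊗ₖ Z) :
    Z.IsHermitian := by
  obtain ⟨x⟩ := ‹Nonempty a›
  obtain ⟨y⟩ := ‹Nonempty b›
  ext s t
  simpa [kroneckerMap_apply] using congrFun (congrFun h ((x, y), s)) ((x, y), t)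

lemma exists_areaPart_decomposition (W : PMat a b c) {XA : Mat (a × c)} {XB : Mat (b × c)} (hA :
    XA.IsHermitian) (hB : XB.IsHermitian) (h₁ : compA a b c (hermPart (liftA XA + liftB XB + red W))
    = 0) (h₂ : compB a b c (hermPart (liftA XA + liftB XB + red W)) = 0) : ∃ (N : Mat (a × b)) (Z :
    Mat c), Z.IsHermitian ∧ liftA XA + liftB XB + red W = areaPart W + N ⊗ₖ (1 : Mat c) + (1 : Mat
    (a × b)) ⊗ₖ Z := by
  set F := liftA XA + liftB XB + red W with hF
  have hLA : (liftA (b := b) XA)ᴴ = liftA XA := by rw [liftA_conjTranspose, hA.eq]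
  have hLB : (liftB (a := a) XB)ᴴ = liftB XB := by rw [liftB_conjTranspose, hB.eq]
  have hres : resid F = resid (red W) := by
    rw [hF, resid_add, resid_add, resid_eq_zero_of_expB (expB_liftA XA) hLA, resid_eq_zero_of_expA
      (expA_liftB XB) hLB, zero_add, zero_add]
  have hanti : antiPart (compC a b c F) = antiPart (compC a b c (red W)) := by
    rw [← preservesStar_compC.antiPart, ← preservesStar_compC.antiPart, hF, antiPart_add,
      antiPart_add, antiPart_eq_zero hLA, antiPart_eq_zero hLB, zero_add, zero_add]
  have hfixA : expA a b c (hermPart (compC a b c F)) = hermPart (compC a b c F) := by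
    rw [preservesStar_expA.hermPart, ← End.mul_apply, expA_mul_compC]
  have hfixB : expB a b c (hermPart (compC a b c F)) = hermPart (compC a b c F) := by
    rw [preservesStar_expB.hermPart, ← End.mul_apply, expB_mul_compC]
  obtain ⟨Z, hZ⟩ := exists_one_kronecker hfixA hfixB
  obtain ⟨N, hN, -⟩ := exists_kronecker_one (a := a) (b := b) (c := c) (Y := expC a b c F)
    (by rw [← End.mul_apply, show expC a b c * expC a b c = expC a b c from pexp_mul_self _])
  refine ⟨N, Z, isHermitian_of_one_kronecker (a := a) (b := b)
    (by rw [hZ, hermPart_conjTranspose]), ?_⟩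
  have h := resid_decomposition F
  rw [h₁, h₂, add_zero, add_zero, hres, ← hermPart_add_antiPart (compC a b c F), hanti] at h
  rw [hN, hZ, areaPart]
  refine h.trans ?_
  abel

lemma eq_zero_of_compA_liftA {X : Mat (a × c)} (h₁ : traceSnd X = 0) (h₂ : traceFst X = 0) (h :
    compA a b c (liftA X) = 0) : X = 0 := by
  have hA : expA a b c (liftA X) = 0 := by
    ext ⟨⟨x, y⟩, s⟩ ⟨⟨l, k⟩, t⟩
    rw [expA_apply]
    have h3 := congrFun (congrFun h₂ s) t
    simp only [traceFst, of_apply, Matrix.zero_apply] at h3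
    by_cases hy : y = k <;> simp [liftA, hy, h3]
  have hC : expC a b c (liftA X) = 0 := by
    ext ⟨⟨x, y⟩, s⟩ ⟨⟨l, k⟩, t⟩
    rw [expC_apply]
    have h3 := congrFun (congrFun h₁ x) l
    simp only [traceSnd, Matrix.zero_apply] at h3
    by_cases hy : y = k <;> simp [liftA, hy, h3]
  have hX : liftA (b := b) X = 0 := by
    have h3 : compA a b c (liftA X) = liftA X := by
      simp only [compA, End.mul_apply, LinearMap.sub_apply, End.one_apply, hC, sub_zero, expB_liftA,
        hA]
    rw [← h3, h]
  obtain ⟨y⟩ := ‹Nonempty b›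
  ext ⟨x, s⟩ ⟨l, t⟩
  simpa [liftA] using congrFun (congrFun hX ((x, y), s)) ((l, y), t)

lemma eq_zero_of_compB_liftB {X : Mat (b × c)} (h₁ : traceSnd X = 0) (h₂ : traceFst X = 0) (h :
    compB a b c (liftB X) = 0) : X = 0 := by
  have hB : expB a b c (liftB X) = 0 := by
    ext ⟨⟨x, y⟩, s⟩ ⟨⟨l, k⟩, t⟩
    rw [expB_apply]
    have h3 := congrFun (congrFun h₂ t) s
    simp only [traceFst, of_apply, Matrix.zero_apply] at h3
    by_cases hx : x = l <;> simp [liftB, hx, h3]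
  have hC : expC a b c (liftB X) = 0 := by
    ext ⟨⟨x, y⟩, s⟩ ⟨⟨l, k⟩, t⟩
    rw [expC_apply]
    have h3 := congrFun (congrFun h₁ y) k
    simp only [traceSnd, Matrix.zero_apply] at h3
    by_cases hx : x = l <;> simp [liftB, hx, h3]
  have hX : liftB (a := a) X = 0 := by
    have h3 : compB a b c (liftB X) = liftB X := by
      simp only [compB, End.mul_apply, LinearMap.sub_apply, End.one_apply, hC, sub_zero, hB,
        expA_liftB]
    rw [← h3, h]
  obtain ⟨x⟩ := ‹Nonempty a›
  ext ⟨y, s⟩ ⟨k, t⟩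
  simpa [liftB] using congrFun (congrFun hX ((x, y), t)) ((x, k), s)

/-- First-order behaviour of gauge-fixed recoveries that are close to product operators. -/
lemma tendsto_gauged_recover {W : PMat a b c} {ε : ℕ → ℝ} (hε : Tendsto ε atTop (𝓝[≠] 0)) (hε0 : ∀
    k, ε k ≠ 0) {R : ℕ → U(a × c)} {Q : ℕ → U(b × c)} (hR : Tendsto (fun k => distOne (R k)) atTop
    (𝓝 0)) (hQ : Tendsto (fun k => distOne (Q k)) atTop (𝓝 0)) (hRg : ∀ k, IsGauged (R k)) (hQg : ∀
    k, IsGauged (Q k)) (happ : ∀ κ : ℝ, 0 < κ → ∀ᶠ k in atTop, ∃ (N : Mat (a × b)) (ζ : Mat c), nsq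
    (recover (R k) (Q k) (evo W (ε k)) - prodOp N ζ) ≤ (nsq (resid (red W)) / card c + κ) * ε k ^ 2)
    : ∃ (φ : ℕ → ℕ) (G : Enc a b c) (N : Mat (a × b)) (Z : Mat c), StrictMono φ ∧ Z.IsHermitian ∧
    Tendsto (fun k => (ε (φ k) : ℂ)⁻¹ • (recover (R (φ k)) (Q (φ k)) (evo W (ε (φ k))) - chiIso a b
    c)) atTop (𝓝 G) ∧ hat G = (rt(card c)⁻¹ * I) • (areaPart W + N ⊗ₖ (1 : Mat c) + (1 : Mat (a ×
    b)) ⊗ₖ Z) := by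
  set r : ℕ → ℝ := fun k => √(distOne (R k)) + √(distOne (Q k)) + |ε k| with hr
  have hrpos : ∀ k, 0 < r k := fun k => by
    have := abs_pos.2 (hε0 k)
    positivity
  have hr0 : Tendsto r atTop (𝓝 0) := by
    have h1 := ((continuous_sqrt.tendsto 0).comp hR).add ((continuous_sqrt.tendsto 0).comp hQ)
    have h2 := h1.add (continuous_abs.tendsto (0 : ℝ) |>.comp (hε.mono_right nhdsWithin_le_nhds))
    simp only [sqrt_zero, abs_zero, add_zero] at h2
    exact h2
  set A : ℕ → Mat (a × c) := fun k => (r k : ℂ)⁻¹ • ((R k : Mat (a × c)) - 1) with hA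
  set B : ℕ → Mat (b × c) := fun k => (r k : ℂ)⁻¹ • ((Q k).1 - 1) with hB
  have hnA : ∀ k, nsq (A k) = (√(distOne (R k)) / r k) ^ 2 := fun k => by
    rw [hA, nsq_smul, norm_inv, norm_real, norm_of_nonneg (hrpos k).le, div_pow, sq_sqrt (show 0 ≤
      distOne (R k) from nsq_nonneg _), inv_pow, div_eq_inv_mul]
    rfl
  have hnB : ∀ k, nsq (B k) = (√(distOne (Q k)) / r k) ^ 2 := fun k => by
    rw [hB, nsq_smul, norm_inv, norm_real, norm_of_nonneg (hrpos k).le, div_pow, sq_sqrt (show 0 ≤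
      distOne (Q k) from nsq_nonneg _), inv_pow, div_eq_inv_mul]
    rfl
  have hsA : ∀ k, √(nsq (A k)) = √(distOne (R k)) / r k := fun k => by
    rw [hnA, sqrt_sq (div_nonneg (sqrt_nonneg _) (hrpos k).le)]
  have hsB : ∀ k, √(nsq (B k)) = √(distOne (Q k)) / r k := fun k => by
    rw [hnB, sqrt_sq (div_nonneg (sqrt_nonneg _) (hrpos k).le)]
  have hsum : ∀ k, √(nsq (A k)) + √(nsq (B k)) + |ε k / r k| = 1 := fun k => by
    rw [hsA, hsB, abs_div, abs_of_pos (hrpos k), ← add_div, ← add_div]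
    exact div_self (hrpos k).ne'
  obtain ⟨⟨⟨A₀, B₀⟩, θ⟩, -, φ, hφ, hlim⟩ := (((isCompact_entry_box (a × c) (a × c)).prod
    (isCompact_entry_box (b × c) (b × c))).prod (isCompact_Icc (a := (-1 : ℝ)) (b := 1))).tendsto_subseq
    (x := fun k => ((A k, B k), ε k / r k)) fun k => by
      have h1 := hsum k
      have h2 := sqrt_nonneg (nsq (A k))
      have h3 := sqrt_nonneg (nsq (B k))
      have h4 := abs_nonneg (ε k / r k)
      refine ⟨⟨fun i j => (abs_apply_le_sqrt_nsq _ i j).trans (by linarith),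
        fun i j => (abs_apply_le_sqrt_nsq _ i j).trans (by linarith)⟩, ?_⟩
      exact abs_le.1 (by linarith)
  have hAl : Tendsto (fun k => A (φ k)) atTop (𝓝 A₀) :=
    (continuous_fst.comp continuous_fst).continuousAt.tendsto.comp hlim
  have hBl : Tendsto (fun k => B (φ k)) atTop (𝓝 B₀) :=
    (continuous_snd.comp continuous_fst).continuousAt.tendsto.comp hlim
  have hθl : Tendsto (fun k => ε (φ k) / r (φ k)) atTop (𝓝 θ) :=
    continuous_snd.continuousAt.tendsto.comp hlim
  have hφt := hφ.tendsto_atTop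
  have hsum₀ : √(nsq A₀) + √(nsq B₀) + |θ| = 1 := by
    refine tendsto_nhds_unique ((((continuous_sqrt.comp continuous_nsq).tendsto A₀).comp hAl).add
      (((continuous_sqrt.comp continuous_nsq).tendsto B₀).comp hBl) |>.add
      ((continuous_abs.tendsto θ).comp hθl)) (tendsto_const_nhds.congr fun k => (hsum (φ k)).symm)
  obtain ⟨XA, hXA, hXA', hXA1, hXA2⟩ := generator_of_gauge (hr0.comp hφt)
    (fun k => (hrpos (φ k)).ne') hAl fun k => hRg (φ k)
  obtain ⟨XB, hXB, hXB', hXB1, hXB2⟩ := generator_of_gauge (hr0.comp hφt)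
    (fun k => (hrpos (φ k)).ne') hBl fun k => hQg (φ k)
  have hMl := tendsto_recover_sub_div (hε.comp hφt) (hr0.comp hφt) (fun k => (hrpos (φ k)).ne')
    hAl hBl hθl W
  set F : TMat a b c := liftA XA + liftB XB + (θ : ℂ) • red W with hF
  have hGF : hat ((A₀ ⊗ₖ (1 : Mat (b × c)) + (1 : Mat (a × c)) ⊗ₖ B₀ +
      ((θ : ℂ) * I) • W) * chiIso a b c) =
      (rt(card c)⁻¹ * I) • F := by
    rw [hat_mul_attachChi, red_add, red_add, red_kronecker_one, red_one_kronecker, red_smul, hXA',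
      hXB', liftA_smul, liftB_smul, mul_comm (θ : ℂ), ← smul_smul, ← smul_add, ← smul_add,
      smul_smul]
  have hLA : (liftA (b := b) XA)ᴴ = liftA XA := by rw [liftA_conjTranspose, hXA.eq]
  have hLB : (liftB (a := a) XB)ᴴ = liftB XB := by rw [liftB_conjTranspose, hXB.eq]
  have hres : resid F = (θ : ℂ) • resid (red W) := by
    rw [hF, resid_add, resid_add, resid_eq_zero_of_expB (expB_liftA XA) hLA, resid_eq_zero_of_expA
      (expA_liftB XB) hLB, zero_add, zero_add, resid_real_smul]
  have hc0 : (0 : ℝ) < card c := by positivity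
  have hle : nsq (compP a b c F) ≤ nsq (resid F) := by
    have key : ∀ κ : ℝ, 0 < κ → nsq (compP a b c F) / card c ≤
        (nsq (resid (red W)) / card c + κ) * θ ^ 2 := by
      intro κ hκ
      have h1 := hφt.eventually (happ κ hκ)
      have h2 : ∃ (N : ℕ → Mat (a × b)) (ζ : ℕ → Mat c), ∀ᶠ k in atTop,
          nsq (recover (R (φ k)) (Q (φ k)) (evo W (ε (φ k))) - prodOp (N k) (ζ k)) ≤
            (nsq (resid (red W)) / card c + κ) * ε (φ k) ^ 2 := by
        classical
        obtain ⟨k₀, hk₀⟩ := eventually_atTop.1 h1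
        choose! N ζ hNζ using hk₀
        exact ⟨N, ζ, eventually_atTop.2 ⟨k₀, hNζ⟩⟩
      obtain ⟨N, ζ, h3⟩ := h2
      have h4 := nsq_compP_le_of_product_approx (e := fun k =>
        (nsq (resid (red W)) / card c + κ) * (ε (φ k) / r (φ k)) ^ 2) (hr0.comp hφt)
        (Eventually.of_forall fun k => (hrpos (φ k)).ne') hMl ((hθl.pow 2).const_mul _)
        (N := N) (ζ := ζ) (h3.mono fun k hk => hk.trans (le_of_eq (by
          have := (hrpos (φ k)).ne'
          simp only [Function.comp]
          field_simp)))
      rw [hGF, map_smul, nsq_smul, norm_mul, norm_I, mul_one, norm_inv, norm_real, norm_eq_abs,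
        inv_pow, sq_abs, sq_sqrt hc0.le, inv_mul_eq_div] at h4
      exact h4
    rw [hres, nsq_smul, norm_real, norm_eq_abs, sq_abs]
    have hl : Tendsto (fun κ : ℝ => (nsq (resid (red W)) / card c + κ) * θ ^ 2) (𝓝[>] 0)
        (𝓝 ((nsq (resid (red W)) / card c + 0) * θ ^ 2)) :=
      ((continuous_const.add continuous_id).mul continuous_const).continuousAt.tendsto.mono_left
        nhdsWithin_le_nhds
    have h5 := ge_of_tendsto hl (eventually_mem_nhdsWithin.mono key)
    rw [add_zero, div_mul_eq_mul_div] at h5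
    have h6 := (div_le_div_iff_of_pos_right hc0).1 h5
    linarith
  obtain ⟨h₁, h₂⟩ := compP_eq_resid hle
  have hθ0 : θ ≠ 0 := by
    intro h0
    rw [h0, ofReal_zero, zero_smul, add_zero] at hF
    have hherm : hermPart F = liftA XA + liftB XB := by
      rw [hF, hermPart, conjTranspose_add, hLA, hLB, ← two_smul ℂ, smul_smul]
      norm_num
    rw [hherm, map_add] at h₁ h₂
    have h3 : compA a b c (liftB XB) = 0 := apply_zero_of_mul compA_mul_expA (expA_liftB XB)
    have h4 : compB a b c (liftA XA) = 0 := apply_zero_of_mul compB_mul_expB (expB_liftA XA)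
    rw [h3, add_zero] at h₁
    rw [h4, zero_add] at h₂
    have h5 := eq_zero_of_compA_liftA hXA1 hXA2 h₁
    have h6 := eq_zero_of_compB_liftB hXB1 hXB2 h₂
    rw [hXA', hXB', h5, h6, h0, smul_zero, smul_zero] at hsum₀
    simp [nsq] at hsum₀
  have hθc : (θ : ℂ) ≠ 0 := by exact_mod_cast hθ0
  have hF' : ((θ⁻¹ : ℝ) : ℂ) • F = liftA (((θ⁻¹ : ℝ) : ℂ) • XA) + liftB (((θ⁻¹ : ℝ) : ℂ) • XB) + red W := by
    rw [hF, liftA_smul, liftB_smul, smul_add, smul_add, smul_smul, ← ofReal_mul, inv_mul_cancel₀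
      hθ0, ofReal_one, one_smul]
  have hherm : hermPart (((θ⁻¹ : ℝ) : ℂ) • F) = ((θ⁻¹ : ℝ) : ℂ) • hermPart F := by
    rw [hermPart, hermPart, conjTranspose_smul, star_def, conj_ofReal, ← smul_add, smul_comm]
  have hH : ∀ {n : Type} (X : Mat n), X.IsHermitian → (((θ⁻¹ : ℝ) : ℂ) • X).IsHermitian := by
    intro n X hX
    rw [IsHermitian, conjTranspose_smul, hX.eq, star_def, conj_ofReal]
  obtain ⟨N, Z, hZ, hdec⟩ := exists_areaPart_decomposition W (hH _ hXA) (hH _ hXB)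
    (by rw [← hF', hherm, map_smul, h₁, smul_zero]) (by rw [← hF', hherm, map_smul, h₂, smul_zero])
  refine ⟨φ, ((θ⁻¹ : ℝ) : ℂ) • ((A₀ ⊗ₖ (1 : Mat (b × c)) +
      (1 : Mat (a × c)) ⊗ₖ B₀ + ((θ : ℂ) * I) • W) * chiIso a b c),
    N, Z, hφ, hZ, ?_, ?_⟩
  · refine (tendsto_matrix_smul ((continuous_ofReal.tendsto _).comp (hθl.inv₀ hθ0)) hMl).congr
      fun k => ?_
    have h3 : (r (φ k) : ℂ) ≠ 0 := by exact_mod_cast (hrpos (φ k)).ne'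
    simp only [Function.comp, smul_smul]
    congr 1
    rw [inv_div, ofReal_div, div_mul_eq_mul_div, mul_inv_cancel₀ h3, one_div]
  · rw [hat_smul, hGF, smul_comm, hF', hdec]

end FirstOrder

end

section

/-! ### Existence of optimal recoveries, and their first-order behaviour -/

section Optimal

lemma continuous_recover (V : Enc a b c) : Continuous fun p : U(a × c) × U(b × c) => recover p.1 p.2
    V := by
  have h := continuous_kronU (a := a × c) (c := b × c)
  exact h.matrix_mul continuous_const

lemma continuous_choiMat : Continuous (choiMat : Enc a b c → _) :=
  continuous_matrix fun _ _ => continuous_id.matrix_elem _ _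

lemma continuous_recoveredWithRef : Continuous fun M : Enc a b c => recoveredWithRef M := by
  simp only [recoveredWithRef_eq]
  have h := continuous_choiMat (a := a) (b := b) (c := c)
  exact (h.matrix_mul h.matrix_conjTranspose).const_smul (card (Logical a b) : ℂ)⁻¹

open scoped ComplexOrder in
lemma isHermitian_recoveredWithRef (M : Enc a b c) :
    (recoveredWithRef M).IsHermitian := (posSemidef_recoveredWithRef M).isHermitian

lemma continuous_traceSnd {m n : Type} [Fintype n] : Continuous (traceSnd : Mat (m × n) → Mat m) :=
  continuous_matrix fun _ _ => continuous_finsetSum _ fun _ _ => continuous_id.matrix_elem _ _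

lemma continuous_coherentInfo (V : Enc a b c) : Continuous fun p : U(a × c) × U(b × c) =>
    coherentInfo V p.1 p.2 := by
  have hρ : Continuous fun p : U(a × c) × U(b × c) =>
      recoveredWithRef (recover p.1 p.2 V) :=
    continuous_recoveredWithRef.comp (continuous_recover V)
  have hσ : Continuous fun p : U(a × c) × U(b × c) =>
      traceSnd (recoveredWithRef (recover p.1 p.2 V)) := continuous_traceSnd.comp hρ
  exact (continuous_entropy (fun p => isHermitian_traceSnd (isHermitian_recoveredWithRef _))
    hσ).sub (continuous_entropy (fun p => isHermitian_recoveredWithRef _) hρ)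

lemma exists_optimalRecovery (V : Enc a b c) : ∃ (RA : U(a × c)) (RB : U(b × c)), IsOptimalRecovery
    V RA RB := by
  obtain ⟨⟨RA, RB⟩, -, h⟩ := isCompact_univ.exists_isMaxOn Set.univ_nonempty
    (continuous_coherentInfo V).continuousOn
  exact ⟨RA, RB, fun RA' RB' => isMaxOn_univ_iff.1 h (RA', RB')⟩

lemma tendsto_recover {ι : Type*} {l : Filter ι} {RA : ι → U(a × c)} {RB : ι → U(b × c)} {V : ι →
    Enc a b c} {RA₀ : U(a × c)} {RB₀ : U(b × c)} {V₀ : Enc a b c} (hA : Tendsto RA l (𝓝 RA₀)) (hB :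
    Tendsto RB l (𝓝 RB₀)) (hV : Tendsto V l (𝓝 V₀)) : Tendsto (fun k => recover (RA k) (RB k) (V k))
    l (𝓝 (recover RA₀ RB₀ V₀)) := by
  have hA' : Tendsto (fun k => (RA k : Mat (a × c))) l (𝓝 (RA₀ : Mat (a × c))) :=
    (continuous_subtype_val.tendsto RA₀).comp hA
  have hB' : Tendsto (fun k => (RB k : Mat (b × c))) l (𝓝 (RB₀ : Mat (b × c))) :=
    (continuous_subtype_val.tendsto RB₀).comp hB
  exact tendsto_mul (tendsto_kronecker hA' hB') hV

variable [Nonempty a] [Nonempty b] [Nonempty c]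

lemma exists_prodOp_approx_gauged {M : Enc a b c} {RA : U(a × c)} {RB : U(b × c)} {q : ℝ} (h : ∃ (N
    : Mat (a × b)) (ζ : Mat c), nsq (recover RA RB M - prodOp N ζ) ≤ q) (u : U(a)) (v v' : U(c)) (u'
    : U(b)) : ∃ (N : Mat (a × b)) (ζ : Mat c), nsq (recover (kronU u v * RA) (kronU u' v' * RB) M -
    prodOp N ζ) ≤ q := by
  obtain ⟨N, ζ, h⟩ := h
  exact ⟨_, _, by rwa [recover_mul, ← recover_kronU_prodOp, ← recover_sub, nsq_recover]⟩

lemma tendsto_distOne_of_tendsto {R : ℕ → U(a × c)} {u : U(a)} {v : U(c)} (hR : Tendsto R atTop (𝓝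
    (kronU u v))) {R' : ℕ → U(a × c)} (hmin : ∀ k u' v', distOne (R' k) ≤ distOne (kronU u' v' * R
    k)) : Tendsto (fun k => distOne (R' k)) atTop (𝓝 0) := by
  have h1 : Tendsto (fun k => distOne (kronU u⁻¹ v⁻¹ * R k)) atTop
      (𝓝 (distOne (kronU u⁻¹ v⁻¹ * kronU u v))) := by
    have h2 : Continuous fun R : U(a × c) => distOne (kronU u⁻¹ v⁻¹ * R) := by
      have h3 : Continuous fun R : U(a × c) =>
          (kronU u⁻¹ v⁻¹).1 * R.1 - 1 :=
        (continuous_const.matrix_mul continuous_subtype_val).sub continuous_const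
      exact continuous_nsq.comp h3
    exact (h2.tendsto _).comp hR
  rw [kronU_mul_kronU, inv_mul_cancel, inv_mul_cancel, kronU_one] at h1
  have h0 : distOne (1 : U(a × c)) = 0 := by
    rw [distOne, OneMemClass.coe_one, sub_self]
    exact nsq_eq_zero.2 rfl
  rw [h0] at h1
  exact squeeze_zero (fun k => nsq_nonneg _) (fun k => hmin k _ _) h1

/-- Along a subsequence and up to local unitaries, optimal recoveries differ from the recovery of
the undeformed code by a first-order term, whose relevant part is determined by the deformation. -/
lemma exists_subseq_optimal {W : PMat a b c} (hW : W.IsHermitian) {ε : ℕ → ℝ} (hε : Tendsto ε atTop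
    (𝓝[≠] 0)) (hε0 : ∀ k, ε k ≠ 0) {RA : ℕ → U(a × c)} {RB : ℕ → U(b × c)} (hopt : ∀ k,
    IsOptimalRecovery (evo W (ε k)) (RA k) (RB k)) : ∃ (φ : ℕ → ℕ) (u : ℕ → U(a)) (v v' : ℕ → U(c))
    (u' : ℕ → U(b)) (G : Enc a b c) (N : Mat (a × b)) (Z : Mat c), StrictMono φ ∧ Z.IsHermitian ∧
    Tendsto (fun k => (ε (φ k) : ℂ)⁻¹ • (recover (kronU (u k) (v k)) (kronU (u' k) (v' k)) (recover
    (RA (φ k)) (RB (φ k)) (evo W (ε (φ k)))) - chiIso a b c)) atTop (𝓝 G) ∧ hat G = (rt(card c)⁻¹ *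
    I) • (areaPart W + N ⊗ₖ (1 : Mat c) + (1 : Mat (a × b)) ⊗ₖ Z) := by
  choose uA vA hminA hgA using fun k => exists_gauge (RA k)
  choose uB vB hminB hgB using fun k => exists_gauge (RB k)
  obtain ⟨⟨RA₀, RB₀⟩, -, ψ, hψ, hlim⟩ := (isCompact_univ (X := U(a × c) ×
    U(b × c))).tendsto_subseq (x := fun k => (RA k, RB k)) fun k => Set.mem_univ _
  have hψt := hψ.tendsto_atTop
  have hlA₀ : Tendsto (fun k => RA (ψ k)) atTop (𝓝 RA₀) := (continuous_fst.tendsto _).comp hlim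
  have hlB₀ : Tendsto (fun k => RB (ψ k)) atTop (𝓝 RB₀) := (continuous_snd.tendsto _).comp hlim
  have happ : ∀ κ : ℝ, 0 < κ → ∀ᶠ k in atTop, ∃ (N : Mat (a × b)) (ζ : Mat c),
      nsq (recover (RA (ψ k)) (RB (ψ k)) (evo W (ε (ψ k))) - prodOp N ζ) ≤
        (nsq (resid (red W)) / card c + κ) * ε (ψ k) ^ 2 := fun κ hκ =>
    ((hε.comp hψt).eventually (optimal_prodOp_approx hW hκ)).mono fun k hk => hk _ _ (hopt (ψ k))
  have hevo : Tendsto (fun k => evo W (ε (ψ k))) atTop (𝓝 (chiIso a b c)) := by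
    have := (mderiv_evo W).continuousAt
    rw [evo_zero] at this
    exact this.comp ((hε.comp hψt).mono_right nhdsWithin_le_nhds)
  have hrec : Tendsto (fun k => hat (recover (RA (ψ k)) (RB (ψ k)) (evo W (ε (ψ k))))) atTop
      (𝓝 (hat (recover RA₀ RB₀ (chiIso a b c)))) :=
    (continuous_hat.tendsto _).comp (tendsto_recover hlA₀ hlB₀ hevo)
  have hprod : ∃ (N₀ : Mat (a × b)) (ζ₀ : Mat c),
      hat (recover RA₀ RB₀ (chiIso a b c)) = N₀ ⊗ₖ ζ₀ := by
    obtain ⟨N, ζ, h2⟩ : ∃ (N : ℕ → Mat (a × b)) (ζ : ℕ → Mat c), ∀ᶠ k in atTop,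
        nsq (recover (RA (ψ k)) (RB (ψ k)) (evo W (ε (ψ k))) - prodOp (N k) (ζ k)) ≤
          (nsq (resid (red W)) / card c + 1) * ε (ψ k) ^ 2 := by
      obtain ⟨k₀, hk₀⟩ := eventually_atTop.1 (happ 1 one_pos)
      choose! N ζ hNζ using hk₀
      exact ⟨N, ζ, eventually_atTop.2 ⟨k₀, hNζ⟩⟩
    refine exists_kronecker_of_tendsto hrec (N := N) (ζ := ζ) ?_
    have h3 : Tendsto (fun k => (nsq (resid (red W)) / card c + 1) * ε (ψ k) ^ 2) atTop (𝓝 0) := by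
      have h4 := (((hε.mono_right nhdsWithin_le_nhds).comp hψt).pow 2).const_mul
        (nsq (resid (red W)) / card c + 1)
      simpa [Function.comp_def] using h4
    refine squeeze_zero' (Eventually.of_forall fun k => nsq_nonneg _) (h2.mono fun k hk => ?_) h3
    rw [← hat_prodOp, ← hat_sub, nsq_hat]
    exact hk
  obtain ⟨N₀, ζ₀, hN₀⟩ := hprod
  obtain ⟨⟨u₀, v₀, h₀⟩, ⟨u₀', v₀', h₀'⟩⟩ := exists_kronU_of_prodOp hN₀
  rw [h₀] at hlA₀
  rw [h₀'] at hlB₀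
  obtain ⟨φ, G, N, Z, hφ, hZ, hG, hhat⟩ := tendsto_gauged_recover (W := W) (hε.comp hψt)
    (fun k => hε0 (ψ k))
    (R := fun k => kronU (uA (ψ k)) (vA (ψ k)) * RA (ψ k))
    (Q := fun k => kronU (uB (ψ k)) (vB (ψ k)) * RB (ψ k))
    (tendsto_distOne_of_tendsto hlA₀ fun k => hminA (ψ k))
    (tendsto_distOne_of_tendsto hlB₀ fun k => hminB (ψ k))
    (fun k => hgA (ψ k)) (fun k => hgB (ψ k))
    fun κ hκ => (happ κ hκ).mono fun k hk => exists_prodOp_approx_gauged hk _ _ _ _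
  refine ⟨ψ ∘ φ, fun k => uA (ψ (φ k)), fun k => vA (ψ (φ k)), fun k => vB (ψ (φ k)),
    fun k => uB (ψ (φ k)), G, N, Z, hψ.comp hφ, hZ, ?_, hhat⟩
  simp only [recover_mul] at hG
  exact hG

end Optimal

/-! ### Reduction of a stabilizer code to its recovered form -/

section Reduction

/-- The proto-area correction of the state `M σ M†`. -/
def areaCorr (M : Enc a b c) (σ : Mat (Logical a b)) : ℝ :=
  log (card c) - entropy (traceSnd (M * σ * Mᴴ)) + entropy (traceSnd (traceSnd (M * σ * Mᴴ)))

lemma trace_kronecker_one_mul {m n : Type} [Fintype m] [Fintype n] [DecidableEq n] (T : Mat m) (A :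
    Mat (m × n)) : ((T ⊗ₖ (1 : Mat n)) * A).trace = (T * traceSnd A).trace := by
  simp only [trace, diag_apply, Matrix.mul_apply, kroneckerMap_apply, sum_prod_type,
    Matrix.one_apply, mul_ite, mul_one, mul_zero, ite_mul, zero_mul, sum_ite_eq, mem_univ, if_true,
    traceSnd]
  refine sum_congr rfl fun i _ => ?_
  rw [sum_comm]
  exact sum_congr rfl fun j _ => (mul_sum _ _ _).symm

lemma traceSnd_kronU_conj {m n : Type} [Fintype m] [Fintype n] [DecidableEq m] [DecidableEq n] (u :
    U(m)) (v : U(n)) (A : Mat (m × n)) : traceSnd ((kronU u v).1 * A * (kronU u v).1ᴴ) = u.1 *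
    traceSnd A * u.1ᴴ := by
  refine Matrix.ext_iff_trace_mul_left.2 fun T => ?_
  rw [← trace_kronecker_one_mul, ← mul_assoc, ← mul_assoc, trace_mul_comm, ← mul_assoc, ← mul_assoc]
  have h : (kronU u v).1ᴴ * T ⊗ₖ (1 : Mat n) * (kronU u v).1 = (u.1ᴴ * T * u.1) ⊗ₖ (1 : Mat n) := by
    simp only [kronU]
    rw [conjTranspose_kronecker, ← mul_kronecker_mul, ← mul_kronecker_mul, Matrix.mul_one,
      unitary_adj_mul]
  rw [h, trace_kronecker_one_mul, ← mul_assoc, ← mul_assoc, trace_mul_comm _ u.1ᴴ]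
  simp only [mul_assoc]

lemma recover_conj (RA : U(a × c)) (RB : U(b × c)) (V : Enc a b c) (σ : Mat (Logical a b)) : recover
    RA RB V * σ * (recover RA RB V)ᴴ = (kronU RA RB).1 * (V * σ * Vᴴ) * (kronU RA RB).1ᴴ :=
    by
  simp only [recover, kronU, conjTranspose_mul, Matrix.mul_assoc]

lemma traceSnd_recoveredState (M : Enc a b c) (σ : Mat (Logical a b)) : traceSnd (recoveredState M
    σ) = traceSnd (traceSnd (M * σ * Mᴴ)) := by
  ext i j
  simp only [traceSnd, recoveredState, sum_prod_type]
  exact sum_comm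

lemma isHermitian_conj {m n : Type} [Fintype m] [Fintype n] {σ : Mat n} (hσ : σ.IsHermitian) (M :
    Matrix m n ℂ) : (M * σ * Mᴴ).IsHermitian :=
  Matrix.isHermitian_mul_mul_conjTranspose M hσ

lemma protoAreaCorrection_eq [Nonempty c] (V : Enc a b c) (RA : U(a × c)) (RB : U(b × c)) {σ : Mat
    (Logical a b)} (hσ : σ.IsHermitian) : protoAreaCorrection V RA RB σ = areaCorr (recover RA RB V)
    σ := by
  rw [protoAreaCorrection, protoArea, entropy_traceSnd_chi, areaCorr, traceSnd_recoveredState,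
    recover_conj, traceSnd_kronU_conj, entropy_unitary_conj (isHermitian_traceSnd (isHermitian_conj
    hσ V))]
  ring

lemma areaCorr_recover_kronU (u : U(a)) (v v' : U(c)) (u' : U(b)) (M : Enc a b c) {σ : Mat (Logical
    a b)} (hσ : σ.IsHermitian) : areaCorr (recover (kronU u v) (kronU u' v') M) σ = areaCorr M σ :=
    by
  have h := isHermitian_traceSnd (isHermitian_conj hσ M)
  rw [areaCorr, recover_conj, traceSnd_kronU_conj, traceSnd_kronU_conj, entropy_unitary_conj h,
    entropy_unitary_conj (isHermitian_traceSnd h), areaCorr]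

/-- The deformation seen after the recovery of the undeformed code. -/
def StabilizerCode.conjugated [AddCommGroup a] [AddCommGroup b] [AddCommGroup c] (C : StabilizerCode
    a b c) (W : PMat a b c) : PMat a b c :=
  (kronU C.RA C.RB).1 * W * (kronU C.RA C.RB).1ᴴ

variable [AddCommGroup a] [AddCommGroup b] [AddCommGroup c]

lemma StabilizerCode.recover_skewed (C : StabilizerCode a b c) (W : PMat a b c) (ε : ℝ) : recover
    C.RA C.RB (C.skewed W ε) = evo (C.conjugated W) ε := by
  have h : (kronU C.RA C.RB).1 * C.V = chiIso a b c := C.recover_eq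
  rw [evo, StabilizerCode.conjugated, exp_unitary_conj, ← h, Matrix.mul_assoc, ← Matrix.mul_assoc
    _ᴴ, unitary_adj_mul, Matrix.one_mul, Matrix.mul_assoc]
  rfl

lemma StabilizerCode.recover_skewed_eq (C : StabilizerCode a b c) (W : PMat a b c) (ε : ℝ) (RA : U(a
    × c)) (RB : U(b × c)) : recover RA RB (C.skewed W ε) = recover (RA * C.RA⁻¹) (RB * C.RB⁻¹) (evo
    (C.conjugated W) ε) := by
  rw [← C.recover_skewed, ← recover_mul, inv_mul_cancel_right, inv_mul_cancel_right]

lemma StabilizerCode.isOptimalRecovery (C : StabilizerCode a b c) {W : PMat a b c} {ε : ℝ} {RA : U(a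
    × c)} {RB : U(b × c)} (h : IsOptimalRecovery (C.skewed W ε) RA RB) : IsOptimalRecovery (evo
    (C.conjugated W) ε) (RA * C.RA⁻¹) (RB * C.RB⁻¹) := by
  intro RA' RB'
  have h1 := h (RA' * C.RA) (RB' * C.RB)
  unfold coherentInfo at h1 ⊢
  rw [C.recover_skewed_eq, C.recover_skewed_eq, mul_inv_cancel_right, mul_inv_cancel_right] at h1
  exact h1

end Reduction

end

section

/-! ### Second-order behaviour of the proto-area correction -/

section AreaLimit

lemma eventually_pos_of_tendsto_diagonal {ι : Type*} {l : Filter ι} {n : Type} [Fintype n]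
    [DecidableEq n] {A : ι → Mat n} {d : n → ℝ} (hd : ∀ i, 0 < d i) (hA : Tendsto A l (𝓝 (diagonal
    fun i => (d i : ℂ)))) : ∀ᶠ k in l, ∀ (U : U(n)) (α : n → ℝ), Diagonalizes U α (A k) → ∀ i, 0 < α
    i := by
  cases isEmpty_or_nonempty n
  · exact Eventually.of_forall fun k U α _ i => isEmptyElim i
  obtain ⟨i₀, hi₀⟩ := Finite.exists_min d
  have h1 : Tendsto (fun k => ∑ p, ∑ q, ‖(A k - diagonal fun i => (d i : ℂ)) p q‖) l (𝓝 0) := by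
    simpa using tendsto_finsetSum univ fun p _ => tendsto_finsetSum univ fun q _ =>
      ((tendsto_mat.1 hA p q).sub_const (diagonal (fun i => (d i : ℂ)) p q)).norm
  filter_upwards [h1.eventually_lt_const (hd i₀)] with k hk U α hU i
  set E := A k - diagonal fun i => (d i : ℂ) with hE
  have h2 : (α i : ℂ) = (U.1ᴴ * E * U.1) i i +
      (U.1ᴴ * (diagonal fun i => (d i : ℂ)) * U.1) i i := by
    rw [hU.apply_self i, hE, mul_sub, sub_mul, Matrix.sub_apply]
    ring
  have h3 : ‖(U.1ᴴ * E * U.1) i i‖ ≤ ∑ p, ∑ q, ‖E p q‖ := by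
    rw [Matrix.mul_apply, sum_comm]
    refine (norm_sum_le _ _).trans (sum_le_sum fun q _ => ?_)
    rw [Matrix.mul_apply, sum_mul]
    refine (norm_sum_le _ _).trans (sum_le_sum fun p _ => ?_)
    have h4 := entry_norm_bound_of_unitary U.2 p i
    have h5 := entry_norm_bound_of_unitary U.2 q i
    rw [norm_mul, norm_mul, conjTranspose_apply, norm_star]
    calc _ ≤ 1 * ‖E p q‖ * 1 := by gcongr
      _ = _ := by ring
  have h4 : (U.1ᴴ * (diagonal fun i => (d i : ℂ)) * U.1) i i =
      ((∑ p, d p * ‖U.1 p i‖ ^ 2 : ℝ) : ℂ) := by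
    rw [Matrix.mul_apply]
    push_cast
    refine sum_congr rfl fun p _ => ?_
    rw [mul_diagonal, conjTranspose_apply, ← mul_conj' (U.1 p i), star_def]
    ring
  have h5 : d i₀ ≤ ∑ p, d p * ‖U.1 p i‖ ^ 2 := by
    calc d i₀ = ∑ p, d i₀ * ‖U.1 p i‖ ^ 2 := by rw [← mul_sum, sum_norm_sq_col, mul_one]
      _ ≤ _ := sum_le_sum fun p _ => by gcongr; exact hi₀ p
  rw [h4] at h2
  have h6 := congrArg Complex.re h2
  rw [add_re, ofReal_re, ofReal_re] at h6
  have h7 := (Complex.abs_re_le_norm _).trans h3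
  have h8 := (abs_le.1 h7).1
  linarith

/-- The operator on `A` obtained by contracting `Y` with the bulk state. -/
def bMat (e : a ↪ b) (lam : a → ℝ) (Y : TMat a b c) : Mat (a × c) := of fun p q => rt(lam q.1) *
    ∑ l, rt(lam l) * Y ((p.1, e q.1), p.2) ((l, e l), q.2)

/-- The second-order coefficient of the proto-area correction. -/
def areaQuad (e : a ↪ b) (lam : a → ℝ) (Y : TMat a b c) : ℝ :=
  (2 * (card c : ℝ))⁻¹ * ∑ p : a × c, ∑ q : a × c,
    ‖(bMat e lam Y - (bMat e lam Y)ᴴ) p q‖ ^ 2 * invLogMean (lam p.1) (lam q.1)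

lemma bMat_add (e : a ↪ b) (lam : a → ℝ) (X Y : TMat a b c) : bMat e lam (X + Y) = bMat e lam X +
    bMat e lam Y := by
  ext p q
  simp [bMat, mul_add, sum_add_distrib]

lemma bMat_smul (e : a ↪ b) (lam : a → ℝ) (z : ℂ) (Y : TMat a b c) : bMat e lam (z • Y) = z • bMat e
    lam Y := by
  ext p q
  simp only [bMat, Matrix.smul_apply, of_apply, smul_eq_mul, mul_sum]
  exact sum_congr rfl fun l _ => by ring

lemma bMat_kronecker_one (e : a ↪ b) (lam : a → ℝ) (N : Mat (a × b)) : ∃ n : Mat a, bMat e lam (N ⊗ₖ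
    (1 : Mat c)) = n ⊗ₖ (1 : Mat c) := by
  refine ⟨of fun i j => rt(lam j) * ∑ l, rt(lam l) * N (i, e j) (l, e l), ?_⟩
  ext p q
  simp only [bMat, of_apply, kroneckerMap_apply, mul_assoc, sum_mul]

lemma bMat_one_kronecker (e : a ↪ b) (lam : a → ℝ) {Z : Mat c} (hZ : Z.IsHermitian) : (bMat e lam
    ((1 : Mat (a × b)) ⊗ₖ Z)).IsHermitian := by
  have h : bMat e lam ((1 : Mat (a × b)) ⊗ₖ Z) = diagonal (fun i =>
      rt(lam i) * rt(lam i)) ⊗ₖ Z := by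
    ext p q
    simp only [bMat, of_apply, kroneckerMap_apply, Matrix.one_apply, Prod.mk.injEq]
    rw [sum_eq_single q.1]
    · by_cases hpq : p.1 = q.1 <;> simp [hpq, mul_assoc]
    · intro l _ hl
      have : e q.1 ≠ e l := fun h => hl (e.injective h).symm
      simp [this]
    · simp
  rw [h, IsHermitian, conjTranspose_kronecker, hZ.eq, diagonal_conjTranspose]
  congr 2
  ext i
  simp

lemma traceSnd_bMat (e : a ↪ b) (lam : a → ℝ) {Y : TMat a b c} (hY : traceSnd Y = 0) : traceSnd
    (bMat e lam Y) = 0 := by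
  ext i j
  simp only [traceSnd, bMat, of_apply, Matrix.zero_apply]
  rw [← mul_sum, sum_comm]
  have h : ∀ l, ∑ s, rt(lam l) * Y ((i, e j), s) ((l, e l), s) = 0 := fun l => by
    rw [← mul_sum]
    have := congrFun (congrFun hY (i, e j)) (l, e l)
    simp only [traceSnd, Matrix.zero_apply] at this
    rw [this, mul_zero]
  simp [h]

lemma conj_density {m n : Type} [Fintype m] [Fintype n] (M : Matrix m n ℂ) (ψ : n → ℂ) : M * density
    ψ * Mᴴ = density (M *ᵥ ψ) := by
  rw [density, density, mul_vecMulVec, vecMulVec_mul, star_mulVec]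

lemma isHermitian_density {n : Type} [Fintype n] (ψ : n → ℂ) : (density ψ).IsHermitian := by
  ext i j
  simp [density, vecMulVec, mul_comm]

lemma chiIso_mulVec_bulkState (e : a ↪ b) (lam : a → ℝ) (j : a) (s t : c) (k : b) : (chiIso a b c *ᵥ
    bulkState e lam) ((j, s), (k, t)) = if k = e j ∧ s = t then rt(card c)⁻¹ * rt(lam j) else 0 :=
    by
  simp only [mulVec, dotProduct, chiIso, attachChi, ite_mul, zero_mul, sum_ite_eq, mem_univ,
    if_true, chi, bulkState]
  by_cases h1 : k = e j <;> by_cases h2 : s = t <;> simp [h1, h2]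

lemma traceSnd_mul_density_chiIso (e : a ↪ b) (lam : a → ℝ) (G : Enc a b c) : traceSnd (G * density
    (bulkState e lam) * (chiIso a b c)ᴴ) = rt(card c)⁻¹ • bMat e lam (hat G) := by
  rw [density, mul_vecMulVec, vecMulVec_mul, ← star_mulVec]
  ext ⟨i, s⟩ ⟨j, t⟩
  simp only [traceSnd, vecMulVec_apply, Pi.star_apply, chiIso_mulVec_bulkState, sum_prod_type, bMat,
    Matrix.smul_apply, of_apply, hat, smul_eq_mul]
  rw [sum_eq_single (e j)]
  · rw [sum_eq_single t]
    · have hG : (G *ᵥ bulkState e lam) ((i, s), e j, t) =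
          ∑ l, rt(lam l) * G ((i, s), e j, t) (l, e l) := by
        simp only [mulVec, dotProduct, bulkState, sum_prod_type]
        refine sum_congr rfl fun l _ => ?_
        rw [sum_eq_single (e l)]
        · simp [mul_comm]
        · intro k _ hk
          simp [hk]
        · simp
      rw [hG]
      simp
      ring
    · intro u _ hu
      simp [hu.symm]
    · simp
  · intro k _ hk
    simp [hk]
  · simp

lemma traceSnd_chiIso_bulkState [Nonempty c] (e : a ↪ b) {lam : a → ℝ} (hlam : ∀ i, 0 < lam i) :
    traceSnd (chiIso a b c * density (bulkState e lam) * (chiIso a b c)ᴴ) = diagonal fun p : a × c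
    => ((lam p.1 / card c : ℝ) : ℂ) := by
  have hc : rt(card c) * rt(card c) = card c := by
    rw [← ofReal_mul, mul_self_sqrt (Nat.cast_nonneg _), ofReal_natCast]
  rw [traceSnd_mul_density_chiIso, hat_attachChi, bMat_smul, smul_smul, ← mul_inv, hc]
  ext p q
  simp only [bMat, Matrix.smul_apply, of_apply, Matrix.one_apply, smul_eq_mul, diagonal_apply]
  rw [sum_eq_single q.1]
  · by_cases hpq : p = q
    · have : rt(lam q.1) * rt(lam q.1) = (lam q.1 : ℂ) := by
        rw [← ofReal_mul, mul_self_sqrt (hlam _).le]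
      simp [hpq, this, div_eq_inv_mul]
    · have : ¬ (p.1 = q.1 ∧ p.2 = q.2) := fun h => hpq (Prod.ext h.1 h.2)
      simp [hpq, this]
  · intro l _ hl
    have : e q.1 ≠ e l := fun h => hl (e.injective h).symm
    simp [this]
  · simp

lemma tendsto_traceSnd {ι : Type*} {m n : Type} [Fintype n] {l : Filter ι} {F : ι → Mat (m × n)} {A
    : Mat (m × n)} (h : Tendsto F l (𝓝 A)) : Tendsto (fun k => traceSnd (F k)) l (𝓝 (traceSnd A)) :=
  (continuous_traceSnd.tendsto A).comp h

lemma tendsto_mixSnd {ι : Type*} {l : Filter ι} {F : ι → Mat (a × c)} {A : Mat (a × c)} (h : Tendsto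
    F l (𝓝 A)) : Tendsto (fun k => mixSnd (F k)) l (𝓝 (mixSnd A)) :=
  tendsto_kronecker (tendsto_traceSnd h) tendsto_const_nhds

lemma sub_kronecker {m n p q : Type*} (A B : Matrix m n ℂ) (C : Matrix p q ℂ) : (A - B) ⊗ₖ C = A ⊗ₖ
    C - B ⊗ₖ C := by
  ext
  simp [kroneckerMap_apply, sub_mul]

lemma mixSnd_sub (A B : Mat (a × c)) : mixSnd (A - B) = mixSnd A - mixSnd B := by
  rw [mixSnd, mixSnd, mixSnd, ← sub_kronecker]
  congr 1
  ext
  simp [traceSnd]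

lemma mixSnd_add (A B : Mat (a × c)) : mixSnd (A + B) = mixSnd A + mixSnd B := by
  rw [mixSnd, mixSnd, mixSnd, ← add_kronecker]
  congr 1
  ext
  simp [traceSnd, sum_add_distrib]

lemma mixSnd_smul (z : ℂ) (A : Mat (a × c)) : mixSnd (z • A) = z • mixSnd A := by
  rw [mixSnd, mixSnd, ← smul_kronecker]
  congr 1
  ext
  simp [traceSnd, mul_sum]

lemma mixSnd_kronecker_one [Nonempty c] (n : Mat a) : mixSnd (n ⊗ₖ (1 : Mat c)) = n ⊗ₖ (1 : Mat c)
    := by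
  have h : traceSnd (n ⊗ₖ (1 : Mat c)) = (card c : ℂ) • n := by
    ext i j
    simp [traceSnd]
  have hc0 := card_cast_ne c
  rw [mixSnd, h, smul_kronecker, kronecker_smul, smul_smul, mul_inv_cancel₀ hc0, one_smul]

lemma kernelForm_smul {n : Type} [Fintype n] [DecidableEq n] (g : ℝ → ℝ → ℝ) (U V : U(n)) (α β : n →
    ℝ) (z : ℂ) (Δ : Mat n) : kernelForm g U α V β (z • Δ) = ‖z‖ ^ 2 * kernelForm g U α V β Δ := by
  simp only [kernelForm, Matrix.mul_smul, smul_mul, Matrix.smul_apply, norm_smul, mul_pow, mul_sum,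
    mul_assoc]

lemma invLogMean_div {r : ℝ} (hr : 0 < r) {x y : ℝ} (hx : 0 < x) (hy : 0 < y) : invLogMean (x / r)
    (y / r) = r * invLogMean x y := by
  have hr0 := hr.ne'
  unfold invLogMean
  by_cases h : x = y
  · simp [h, div_eq_mul_inv]
  · have h1 : x / r ≠ y / r := fun h2 => h ((div_left_inj' hr0).1 h2)
    have h2 : x - y ≠ 0 := sub_ne_zero.2 h
    rw [if_neg h, if_neg h1, log_div hx.ne' hr0, log_div hy.ne' hr0]
    field_simp
    ring

lemma kernelForm_hermitian {n : Type} [Fintype n] [DecidableEq n] {d : n → ℝ} (hd : ∀ i, 0 < d i) {Δ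
    : Mat n} (hΔ : Δᴴ = Δ) : ∑ p, ∑ q, ‖Δ p q‖ ^ 2 * relKernel (d p) (d q) = 2⁻¹ * ∑ p, ∑ q, ‖Δ p q‖
    ^ 2 * invLogMean (d p) (d q) := by
  have h1 : ∀ p q, ‖Δ q p‖ = ‖Δ p q‖ := fun p q => by
    conv_rhs => rw [← hΔ, conjTranspose_apply, norm_star]
  have h2 : ∑ p, ∑ q, ‖Δ p q‖ ^ 2 * relKernel (d p) (d q) =
      ∑ p, ∑ q, ‖Δ p q‖ ^ 2 * relKernel (d q) (d p) := by
    rw [sum_comm]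
    exact sum_congr rfl fun p _ => sum_congr rfl fun q _ => by rw [h1]
  have h3 : ∑ p, ∑ q, ‖Δ p q‖ ^ 2 * invLogMean (d p) (d q) =
      ∑ p, ∑ q, ‖Δ p q‖ ^ 2 * relKernel (d p) (d q) +
        ∑ p, ∑ q, ‖Δ p q‖ ^ 2 * relKernel (d q) (d p) := by
    simp only [← sum_add_distrib, ← mul_add, relKernel_add_swap (hd _) (hd _)]
  rw [h3, ← h2]
  ring

/-- Second-order limit of the proto-area correction of the bulk state. -/
lemma tendsto_areaCorr [Nonempty c] {ι : Type*} {l : Filter ι} [l.IsCountablyGenerated] {ε : ι → ℝ}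
    (hε : Tendsto ε l (𝓝 0)) (hε0 : ∀ k, ε k ≠ 0) {M : ι → Enc a b c} (hM : ∀ k, (M k)ᴴ * M k = 1)
    {G : Enc a b c} (hG : Tendsto (fun k => (ε k : ℂ)⁻¹ • (M k - chiIso a b c)) l (𝓝 G)) {Y : TMat a
    b c} (hY : traceSnd Y = 0) {N : Mat (a × b)} {Z : Mat c} (hZ : Z.IsHermitian) (hhat : hat G =
    (rt(card c)⁻¹ * I) • (Y + N ⊗ₖ (1 : Mat c) + (1 : Mat (a × b)) ⊗ₖ Z)) (e : a ↪ b) {lam : a → ℝ}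
    (hlam : ∀ i, 0 < lam i) (hsum : ∑ i, lam i = 1) : Tendsto (fun k => areaCorr (M k) (density
    (bulkState e lam)) / ε k ^ 2) l (𝓝 (areaQuad e lam Y)) := by
  have hc0 : (0 : ℝ) < card c := by positivity
  set σ := density (bulkState e lam) with hσ
  set J := chiIso a b c with hJ
  have hεc : Tendsto (fun k => (ε k : ℂ)) l (𝓝 0) := by
    have := (continuous_ofReal.tendsto 0).comp hε
    rwa [ofReal_zero] at this
  have hMJ : Tendsto M l (𝓝 J) := by
    have h1 := (tendsto_matrix_smul hεc hG).add (tendsto_const_nhds (x := J))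
    rw [zero_smul, zero_add] at h1
    refine h1.congr fun k => ?_
    rw [smul_smul, mul_inv_cancel₀ (by exact_mod_cast hε0 k), one_smul, sub_add_cancel]
  set A : ι → Mat (a × c) := fun k => traceSnd (M k * σ * (M k)ᴴ) with hA
  set d : a × c → ℝ := fun p => lam p.1 / card c with hd
  have hd0 : ∀ p, 0 < d p := fun p => div_pos (hlam _) hc0
  set A₀ : Mat (a × c) := diagonal fun p => (d p : ℂ) with hA₀
  have hJA : traceSnd (J * σ * Jᴴ) = A₀ := traceSnd_chiIso_bulkState e hlam
  have hAH : ∀ k, (A k).IsHermitian := fun k =>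
    isHermitian_traceSnd (isHermitian_conj (isHermitian_density _) _)
  have hAt : Tendsto A l (𝓝 A₀) := by
    rw [← hJA]
    exact tendsto_traceSnd (tendsto_mul (tendsto_mul hMJ tendsto_const_nhds)
      (tendsto_conjTranspose hMJ))
  have hA₀s : traceSnd A₀ = diagonal fun i => (lam i : ℂ) := by
    ext i j
    simp only [hA₀, hd, traceSnd, diagonal_apply, Prod.mk.injEq, and_true]
    by_cases hij : i = j
    · have : (card c : ℂ) ≠ 0 := by exact_mod_cast hc0.ne'
      simp [hij]
      field_simp
    · simp [hij]
  have hD₀ : Diagonalizes 1 d A₀ := by simp [Diagonalizes, hA₀]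
  have hDs₀ : Diagonalizes 1 lam (traceSnd A₀) := by simp [Diagonalizes, hA₀s]
  have hA₀m : mixSnd A₀ = A₀ := by
    rw [hDs₀.mixSnd, kronU_one]
    simp [hA₀, hd]
  have htr : ∀ k, (A k).trace = 1 := by
    intro k
    have h1 : σ.trace = 1 := by
      simp only [hσ, density, trace, diag_apply, vecMulVec_apply, bulkState, Pi.star_apply,
        sum_prod_type]
      rw [← ofReal_one, ← hsum, ofReal_sum]
      refine sum_congr rfl fun i _ => ?_
      rw [sum_eq_single (e i)]
      · rw [if_pos rfl, star_def, conj_ofReal, ← ofReal_mul, mul_self_sqrt (hlam i).le]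
      · intro k _ hk
        simp [hk]
      · simp
    rw [hA, trace_traceSnd, trace_mul_comm, ← Matrix.mul_assoc, hM, Matrix.one_mul, h1]
  set T := traceSnd (G * σ * Jᴴ) + (traceSnd (G * σ * Jᴴ))ᴴ with hT
  have hAd : Tendsto (fun k => (ε k : ℂ)⁻¹ • (A k - A₀)) l (𝓝 T) := by
    have h1 := tendsto_traceSnd ((tendsto_mul (tendsto_mul hG
      (tendsto_const_nhds (x := σ))) (tendsto_conjTranspose hMJ)).add (tendsto_mul
      (tendsto_const_nhds (x := J * σ)) (tendsto_conjTranspose hG)))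
    have h2 : traceSnd (G * σ * Jᴴ + J * σ * Gᴴ) = T := by
      have h3 : J * σ * Gᴴ = (G * σ * Jᴴ)ᴴ := by
        rw [conjTranspose_mul, conjTranspose_mul, conjTranspose_conjTranspose, (isHermitian_density
          _).eq, Matrix.mul_assoc]
      rw [h3, hT]
      ext i j
      simp only [traceSnd, Matrix.add_apply, conjTranspose_apply, sum_add_distrib, star_sum]
    rw [h2] at h1
    refine h1.congr fun k => ?_
    rw [← hJA, hA]
    ext i j
    simp only [smul_mul, conjTranspose_smul, star_inv₀, star_def, conj_ofReal, Matrix.mul_smul, ←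
      smul_add, conjTranspose_sub, Matrix.sub_mul, Matrix.mul_sub]
    simp only [traceSnd, Matrix.smul_apply, Matrix.sub_apply, Matrix.add_apply, smul_eq_mul, ←
      mul_sum, ← sum_sub_distrib]
    congr 1
    exact sum_congr rfl fun u _ => by ring
  set Δ : ι → Mat (a × c) := fun k => (ε k : ℂ)⁻¹ • (A k - mixSnd (A k)) with hΔ
  have hΔt : Tendsto Δ l (𝓝 (T - mixSnd T)) := by
    refine (hAd.sub (tendsto_mixSnd hAd)).congr fun k => ?_
    rw [mixSnd_smul, mixSnd_sub, hA₀m, ← smul_sub]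
    congr 1
    abel
  have hTm : T - mixSnd T = (I * (card c : ℂ)⁻¹) • (bMat e lam Y - (bMat e lam Y)ᴴ) := by
    obtain ⟨n, hn⟩ := bMat_kronecker_one (c := c) e lam N
    have hcc : rt(card c)⁻¹ * rt(card c)⁻¹ = (card c : ℂ)⁻¹ := by
      rw [← mul_inv, ← ofReal_mul, mul_self_sqrt hc0.le, ofReal_natCast]
    have h1 : T = (I * (card c : ℂ)⁻¹) • ((bMat e lam Y - (bMat e lam Y)ᴴ) +
        (n - nᴴ) ⊗ₖ (1 : Mat c)) := by
      rw [hT, traceSnd_mul_density_chiIso, hhat, bMat_smul, bMat_add, bMat_add, hn, smul_smul, ←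
        mul_assoc, hcc, mul_comm _ I, conjTranspose_smul, conjTranspose_add, conjTranspose_add,
        (bMat_one_kronecker e lam hZ).eq, conjTranspose_kronecker, conjTranspose_one, sub_kronecker]
      have h2 : star (I * (card c : ℂ)⁻¹) = -(I * (card c : ℂ)⁻¹) := by
        simp
      rw [h2, neg_smul, ← smul_neg, ← smul_add]
      congr 1
      abel
    have h2 : mixSnd (bMat e lam Y - (bMat e lam Y)ᴴ) = 0 := by
      have h3 := traceSnd_bMat e lam hY
      have h4 : traceSnd ((bMat e lam Y)ᴴ) = (traceSnd (bMat e lam Y))ᴴ := by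
        ext i j
        simp [traceSnd]
      rw [mixSnd_sub, mixSnd, mixSnd, h4, h3, conjTranspose_zero, zero_kronecker, sub_zero]
    rw [h1, mixSnd_smul, mixSnd_add, h2, zero_add, mixSnd_kronecker_one, ← smul_sub,
      add_sub_cancel_right]
  have hlim := tendsto_kernelForm (g := relKernel) (fun k => diagonalizes_eigen (hAH k))
    (fun k => (diagonalizes_eigen (isHermitian_traceSnd (hAH k))).mixSnd)
    hD₀ hDs₀.mixSnd hAt (tendsto_mixSnd hAt) hΔt
    fun p q => continuousAt_relKernel (hd0 p) (hd0 q)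
  have hval : kernelForm relKernel 1 d (kronU 1 1) (fun p : a × c => lam p.1 / card c)
      (T - mixSnd T) = areaQuad e lam Y := by
    rw [hTm, kernelForm_smul, kronU_one, kernelForm, norm_mul, norm_I, one_mul, norm_inv,
      Complex.norm_natCast]
    simp only [OneMemClass.coe_one, conjTranspose_one, Matrix.one_mul, Matrix.mul_one]
    have h1 : (I • (bMat e lam Y - (bMat e lam Y)ᴴ))ᴴ = I • (bMat e lam Y - (bMat e lam Y)ᴴ) := by
      rw [conjTranspose_smul, conjTranspose_sub, conjTranspose_conjTranspose, star_def, conj_I,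
        neg_smul, ← smul_neg, neg_sub]
    have h2 := kernelForm_hermitian hd0 h1
    simp only [Matrix.smul_apply, norm_smul, norm_I, one_mul] at h2
    rw [areaQuad]
    refine (congrArg _ h2).trans ?_
    have h3 : ∀ p q : a × c, invLogMean (d p) (d q) =
        card c * invLogMean (lam p.1) (lam q.1) := fun p q =>
      invLogMean_div hc0 (hlam _) (hlam _)
    simp only [h3, mul_left_comm _ (card c : ℝ), ← mul_sum]
    field_simp
  rw [hval] at hlim
  refine hlim.congr' ?_
  filter_upwards [eventually_pos_of_tendsto_diagonal hd0 hAt,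
    eventually_pos_of_tendsto_diagonal hlam (hA₀s ▸ tendsto_traceSnd hAt)] with k h1 h2
  have hU := diagonalizes_eigen (hAH k)
  have hV := diagonalizes_eigen (isHermitian_traceSnd (hAH k))
  have h3 := relEntropy_identity hU hV (htr k) (h1 _ _ hU) (h2 _ _ hV)
  rw [hΔ, kernelForm_smul, ← h3, norm_inv, norm_real, norm_eq_abs, inv_pow, sq_abs, inv_mul_eq_div,
    areaCorr]

end AreaLimit

end

section

/-! ### Averaging over the logical frame -/

section Averaging

instance {n : Type} [Fintype n] [DecidableEq n] : IsProbabilityMeasure (haarU n) :=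
  ⟨by simpa [haarU] using (Measure.haarMeasure_self (G := U(n)) (K₀ := ⊤))⟩

/-- Dominated convergence on a compact space for locally uniformly convergent families. -/
lemma tendsto_integral_of_joint {X ι : Type*} [TopologicalSpace X] [CompactSpace X] [MeasurableSpace
    X] {μ : Measure X} [IsFiniteMeasure μ] {l : Filter ι} [l.IsCountablyGenerated] {f : ι → X → ℝ}
    {F : X → ℝ} (hf : ∀ᶠ k in l, AEStronglyMeasurable (f k) μ) (h : ∀ x, Tendsto (fun p : ι × X => f
    p.1 p.2) (l ×ˢ 𝓝 x) (𝓝 (F x))) : Tendsto (fun k => ∫ x, f k x ∂μ) l (𝓝 (∫ x, F x ∂μ)) := by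
  have h1 : ∃ B : ℝ, ∀ᶠ k in l, ∀ x ∈ (Set.univ : Set X), ‖f k x‖ ≤ B := by
    refine isCompact_univ.induction_on (p := fun s => ∃ B : ℝ, ∀ᶠ k in l, ∀ x ∈ s, ‖f k x‖ ≤ B)
      ⟨0, by simp⟩ ?_ ?_ ?_
    · rintro s t hst ⟨B, hB⟩
      exact ⟨B, hB.mono fun k hk x hx => hk x (hst hx)⟩
    · rintro s t ⟨B, hB⟩ ⟨B', hB'⟩
      refine ⟨max B B', ?_⟩
      filter_upwards [hB, hB'] with k hk hk' x hx
      exact hx.elim (fun h => (hk x h).trans (le_max_left _ _))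
        fun h => (hk' x h).trans (le_max_right _ _)
    · intro x _
      have h2 := (h x).norm.eventually (ge_mem_nhds (lt_add_one ‖F x‖))
      obtain ⟨P, hP, Q, hQ, hPQ⟩ := eventually_prod_iff.1 h2
      exact ⟨{y | Q y}, mem_nhdsWithin_of_mem_nhds hQ, ‖F x‖ + 1,
        hP.mono fun k hk y hy => hPQ hk hy⟩
  obtain ⟨B, hB⟩ := h1
  refine tendsto_integral_filter_of_dominated_convergence (fun _ => B) hf
    (hB.mono fun k hk => Eventually.of_forall fun x => hk x (Set.mem_univ x))
    (integrable_const _) (Eventually.of_forall fun x => ?_)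
  exact (h x).comp (tendsto_id.prodMk (tendsto_const_nhds.mono_right (by simp)))

/-- Conjugation by a product unitary on the first two factors. -/
def rotate (U : U(a)) (U' : U(b)) (Y : TMat a b c) : TMat a b c :=
  ((kronU U⁻¹ U'⁻¹).1 ⊗ₖ (1 : Mat c)) * Y * ((kronU U U').1 ⊗ₖ (1 : Mat c))

/-- The encoding seen from the rotated logical frame. -/
def reframe (U : U(a)) (U' : U(b)) (M : Enc a b c) : Enc a b c :=
  recover (kronU U⁻¹ 1) (kronU U'⁻¹ 1) (M * (kronU U U').1)

lemma hat_reframe (U : U(a)) (U' : U(b)) (M : Enc a b c) : hat (reframe U U' M) = rotate U U' (hat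
    M) := by
  ext ⟨⟨x, y⟩, s⟩ ⟨⟨l, k⟩, t⟩
  have hcomm : ∀ f : a → b → a → b → ℂ, ∑ i, ∑ j, ∑ p, ∑ q, f i j p q =
      ∑ p, ∑ q, ∑ i, ∑ j, f i j p q := fun f => by
    rw [sum_congr rfl fun _ _ => sum_comm, sum_comm]
    refine sum_congr rfl fun p _ => ?_
    rw [sum_congr rfl fun _ _ => sum_comm, sum_comm]
  simp only [reframe, rotate, hat, recover, kronU, of_apply, Matrix.mul_apply, kroneckerMap_apply,
    sum_prod_type, Matrix.one_apply, mul_ite, mul_one, mul_zero, ite_mul, zero_mul, sum_ite_eq,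
    sum_ite_eq', mem_univ, if_true, OneMemClass.coe_one, mul_sum, sum_mul]
  rw [hcomm]
  refine sum_congr rfl fun p _ => ?_
  rw [sum_eq_single s]
  · refine sum_congr rfl fun q _ => ?_
    rw [sum_eq_single t]
    · simp [mul_assoc]
    · intro t' _ ht
      simp [ht.symm]
    · simp
  · intro s' _ hs
    simp [hs.symm]
  · simp

lemma traceSnd_add {m n : Type} [Fintype n] (X Y : Mat (m × n)) : traceSnd (X + Y) = traceSnd X +
    traceSnd Y := by
  ext i j
  simp [traceSnd, sum_add_distrib]

lemma rotate_add (U : U(a)) (U' : U(b)) (X Y : TMat a b c) : rotate U U' (X + Y) = rotate U U' X +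
    rotate U U' Y := by
  rw [rotate, Matrix.mul_add, Matrix.add_mul, rotate, rotate]

lemma rotate_smul (U : U(a)) (U' : U(b)) (z : ℂ) (X : TMat a b c) : rotate U U' (z • X) = z • rotate
    U U' X := by
  rw [rotate, Matrix.mul_smul, smul_mul, rotate]

lemma rotate_kronecker (U : U(a)) (U' : U(b)) (N : Mat (a × b)) (Z : Mat c) : rotate U U' (N ⊗ₖ Z) =
    ((kronU U⁻¹ U'⁻¹).1 * N * (kronU U U').1) ⊗ₖ Z := by
  rw [rotate, ← mul_kronecker_mul, ← mul_kronecker_mul, Matrix.one_mul, Matrix.mul_one]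

lemma kronU_inv_mul (U : U(a)) (U' : U(b)) : (kronU U⁻¹ U'⁻¹).1 * (kronU U U').1 = 1 := by
  rw [← Submonoid.coe_mul, kronU_mul_kronU, inv_mul_cancel, inv_mul_cancel, kronU_one]
  rfl

lemma reframe_chiIso (U : U(a)) (U' : U(b)) : reframe U U' (chiIso a b c) = chiIso a b c := by
  have h : rotate U U' (1 : TMat a b c) = 1 := by
    rw [← one_kronecker_one, rotate_kronecker, Matrix.mul_one, kronU_inv_mul]
  ext ⟨⟨x, s⟩, y, t⟩ l
  have h2 := hat_reframe U U' (chiIso a b c)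
  rw [hat_attachChi, rotate_smul, h, ← hat_attachChi] at h2
  exact congrFun (congrFun h2 ((x, y), s)) (l, t)

lemma reframe_sub (U : U(a)) (U' : U(b)) (M N : Enc a b c) : reframe U U' (M - N) = reframe U U' M -
    reframe U U' N := by
  rw [reframe, Matrix.sub_mul, recover_sub, reframe, reframe]

lemma reframe_smul (U : U(a)) (U' : U(b)) (z : ℂ) (M : Enc a b c) : reframe U U' (z • M) = z •
    reframe U U' M := by
  rw [reframe, smul_mul, recover, Matrix.mul_smul]
  rfl

lemma recover_conjTranspose_mul (RA : U(a × c)) (RB : U(b × c)) (V : Enc a b c) : (recover RA RB V)ᴴ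
    * recover RA RB V = Vᴴ * V := by
  change (((kronU RA RB).1) * V)ᴴ * ((kronU RA RB).1 * V) = _
  rw [conjTranspose_mul, Matrix.mul_assoc, ← Matrix.mul_assoc _ _ V, unitary_adj_mul,
    Matrix.one_mul]

lemma reframe_conjTranspose_mul (U : U(a)) (U' : U(b)) {M : Enc a b c} (hM : Mᴴ * M = 1) : (reframe
    U U' M)ᴴ * reframe U U' M = 1 := by
  rw [reframe, recover_conjTranspose_mul, conjTranspose_mul, Matrix.mul_assoc, ← Matrix.mul_assoc _
    M, hM, Matrix.one_mul, unitary_adj_mul]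

lemma areaCorr_reframe (U : U(a)) (U' : U(b)) (M : Enc a b c) (ψ : Logical a b → ℂ) : areaCorr M
    (density ((U.1 ⊗ₖ U'.1) *ᵥ ψ)) = areaCorr (reframe U U' M) (density ψ) := by
  rw [reframe, areaCorr_recover_kronU _ _ _ _ _ (isHermitian_density _), areaCorr, areaCorr,
    conj_density, conj_density, mulVec_mulVec]
  rfl

lemma conjTranspose_mul_eq_traceSnd (M N : Enc a b c) : Mᴴ * N = traceSnd ((hat M)ᴴ * hat N) := by
  ext p q
  simp only [traceSnd, hat, Matrix.mul_apply, conjTranspose_apply, of_apply, sum_prod_type]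
  conv_rhs => rw [sum_comm]
  refine sum_congr rfl fun x _ => ?_
  rw [sum_comm, sum_congr rfl fun y _ => sum_comm, sum_comm]

lemma evo_conjTranspose_mul [Nonempty a] [Nonempty b] [Nonempty c] {W : PMat a b c} (hW :
    W.IsHermitian) (ε : ℝ) : (evo W ε)ᴴ * evo W ε = 1 := by
  have h : (chiIso a b c)ᴴ * chiIso a b c = 1 := by
    have hc := card_cast_ne c
    have hcc : rt(card c)⁻¹ * rt(card c)⁻¹ = (card c : ℂ)⁻¹ := by
      rw [← mul_inv, ← ofReal_mul, mul_self_sqrt (Nat.cast_nonneg _), ofReal_natCast]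
    rw [conjTranspose_mul_eq_traceSnd, hat_attachChi, conjTranspose_smul, conjTranspose_one,
      smul_mul, Matrix.one_mul, smul_smul, star_inv₀, star_def, conj_ofReal, hcc]
    ext p q
    simp only [traceSnd, Matrix.smul_apply, Matrix.one_apply, Prod.mk.injEq, and_true, smul_eq_mul,
      sum_const, card_univ, nsmul_eq_mul]
    rw [mul_inv_cancel_left₀ hc]
  change ((expU hW ε).1 * chiIso a b c)ᴴ * ((expU hW ε).1 * chiIso a b c) = 1
  rw [conjTranspose_mul, Matrix.mul_assoc, ← Matrix.mul_assoc _ _ (chiIso a b c), unitary_adj_mul,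
    Matrix.one_mul, h]

lemma traceSnd_rotate (U : U(a)) (U' : U(b)) {Y : TMat a b c} (hY : traceSnd Y = 0) : traceSnd
    (rotate U U' Y) = 0 := by
  have h : rotate U U' Y = (kronU (kronU U⁻¹ U'⁻¹) (1 : U(c)) : TMat a b c) * Y *
      (kronU (kronU U⁻¹ U'⁻¹) (1 : U(c)) : TMat a b c)ᴴ := by
    rw [rotate]
    simp [kronU, conjTranspose_kronecker, star_eq_conjTranspose]
  rw [h, traceSnd_kronU_conj, hY, Matrix.mul_zero, Matrix.zero_mul]

lemma traceSnd_areaPart [Nonempty a] [Nonempty b] [Nonempty c] (W : PMat a b c) : traceSnd (areaPart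
    W) = 0 := by
  have h0 : ∀ X : TMat a b c, traceSnd ((1 - expC a b c) X) = 0 := by
    intro X
    have hc := card_cast_ne c
    ext p q
    simp only [traceSnd, LinearMap.sub_apply, End.one_apply, Matrix.sub_apply, expC_apply, if_true,
      sum_sub_distrib, sum_const, card_univ, nsmul_eq_mul, Matrix.zero_apply]
    rw [mul_inv_cancel_left₀ hc, sub_self]
  have hadd : ∀ X Y : TMat a b c, traceSnd X = 0 → traceSnd Y = 0 →
      traceSnd (X + Y) = 0 := fun X Y hX hY => by
    rw [traceSnd_add, hX, hY, add_zero]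
  obtain ⟨hO, hA, hB, hC⟩ := (comp_rels (a := a) (b := b) (c := c)).2.2.2.1
  have h1 : traceSnd (antiPart (compC a b c (red W))) = 0 := by
    have h2 : traceSnd (compC a b c (red W)) = 0 := by
      rw [compC, ← hC, mul_assoc, End.mul_apply]
      exact h0 _
    ext p q
    have h3 := congrFun (congrFun h2 p) q
    have h4 := congrArg star (congrFun (congrFun h2 q) p)
    simp only [traceSnd, Matrix.zero_apply, star_sum, star_zero] at h3 h4
    simp only [traceSnd, antiPart, Matrix.smul_apply, Matrix.sub_apply, conjTranspose_apply, ←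
      smul_sum, sum_sub_distrib, h3, h4, sub_zero, smul_zero, Matrix.zero_apply]
  refine hadd _ _ (hadd _ _ (hadd _ _ ?_ ?_) ?_) h1
  · rw [compO, ← hO, mul_assoc, End.mul_apply]
    exact h0 _
  · rw [compA, ← hA, mul_assoc, End.mul_apply]
    exact h0 _
  · rw [compB, ← hB, mul_assoc, End.mul_apply]
    exact h0 _

variable [Nonempty a] [Nonempty b] [Nonempty c]

lemma tendsto_kronU {ι : Type*} {m n : Type} [Fintype m] [DecidableEq m] [Fintype n] [DecidableEq n]
    {l : Filter ι} {u : ι → U(m)} {v : ι → U(n)} {u₀ : U(m)} {v₀ : U(n)} (hu : Tendsto u l (𝓝 u₀))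
    (hv : Tendsto v l (𝓝 v₀)) : Tendsto (fun k => kronU (u k) (v k)) l (𝓝 (kronU u₀ v₀)) := by
  refine tendsto_subtype_rng.2 ?_
  have hu' : Tendsto (fun k => (u k : Mat m)) l (𝓝 (u₀ : Mat m)) :=
    (continuous_subtype_val.tendsto u₀).comp hu
  have hv' : Tendsto (fun k => (v k : Mat n)) l (𝓝 (v₀ : Mat n)) :=
    (continuous_subtype_val.tendsto v₀).comp hv
  exact tendsto_kronecker hu' hv'

lemma tendsto_reframe {ι : Type*} {l : Filter ι} {U : ι → U(a)} {U' : ι → U(b)} {M : ι → Enc a b c}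
    {U₀ : U(a)} {U₀' : U(b)} {M₀ : Enc a b c} (hU : Tendsto U l (𝓝 U₀)) (hU' : Tendsto U' l (𝓝 U₀'))
    (hM : Tendsto M l (𝓝 M₀)) : Tendsto (fun k => reframe (U k) (U' k) (M k)) l (𝓝 (reframe U₀ U₀'
    M₀)) :=
  tendsto_recover (tendsto_kronU hU.inv tendsto_const_nhds) (tendsto_kronU hU'.inv tendsto_const_nhds)
    (tendsto_mul hM ((continuous_subtype_val.tendsto _).comp (tendsto_kronU hU hU')))

lemma continuous_areaCorr_reframe (M : Enc a b c) (ψ : Logical a b → ℂ) : Continuous fun p : U(a) ×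
    U(b) => areaCorr (reframe p.1 p.2 M) (density ψ) := by
  have h : Continuous fun p : U(a) × U(b) =>
      reframe p.1 p.2 M := continuous_iff_continuousAt.2 fun p =>
    tendsto_reframe (continuous_fst.tendsto p) (continuous_snd.tendsto p) tendsto_const_nhds
  have h2 : Continuous fun p : U(a) × U(b) =>
      traceSnd (reframe p.1 p.2 M * density ψ * (reframe p.1 p.2 M)ᴴ) :=
    continuous_traceSnd.comp ((h.matrix_mul continuous_const).matrix_mul h.matrix_conjTranspose)
  have h3 := fun p : U(a) × U(b) =>
    isHermitian_traceSnd (isHermitian_conj (isHermitian_density ψ) (reframe p.1 p.2 M))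
  exact (continuous_const.sub (continuous_entropy h3 h2)).add
    (continuous_entropy (fun p => isHermitian_traceSnd (h3 p)) (continuous_traceSnd.comp h2))

/-- The Haar average of the second-order coefficient of the proto-area correction. -/
def avgQuad (e : a ↪ b) (lam : a → ℝ) (Y : TMat a b c) : ℝ :=
  ∫ U : U(a), ∫ U' : U(b), areaQuad e lam (rotate U U' Y) ∂(haarU b) ∂(haarU a)

lemma tendsto_integral_areaCorr {ε : ℕ → ℝ} (hε : Tendsto ε atTop (𝓝 0)) (hε0 : ∀ k, ε k ≠ 0) {M : ℕ
    → Enc a b c} (hM : ∀ k, (M k)ᴴ * M k = 1) {G : Enc a b c} (hG : Tendsto (fun k => (ε k : ℂ)⁻¹ •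
    (M k - chiIso a b c)) atTop (𝓝 G)) {Y : TMat a b c} (hY : traceSnd Y = 0) {N : Mat (a × b)} {Z :
    Mat c} (hZ : Z.IsHermitian) (hhat : hat G = (rt(card c)⁻¹ * I) • (Y + N ⊗ₖ (1 : Mat c) + (1 :
    Mat (a × b)) ⊗ₖ Z)) (e : a ↪ b) {lam : a → ℝ} (hlam : ∀ i, 0 < lam i) (hsum : ∑ i, lam i = 1) :
    Tendsto (fun k => ∫ U : U(a), ∫ U' : U(b), areaCorr (reframe U U' (M k)) (density (bulkState e
    lam)) / ε k ^ 2 ∂(haarU b) ∂(haarU a)) atTop (𝓝 (avgQuad e lam Y)) := by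
  have hcont := fun k => (continuous_areaCorr_reframe (M k) (bulkState e lam)).div_const (ε k ^ 2)
  have hinner : ∀ U₀ : U(a), Tendsto (fun p : ℕ × U(a) => ∫ U' : U(b),
        areaCorr (reframe p.2 U' (M p.1)) (density (bulkState e lam)) / ε p.1 ^ 2 ∂(haarU b))
        (atTop ×ˢ 𝓝 U₀) (𝓝 (∫ U' : U(b), areaQuad e lam (rotate U₀ U' Y) ∂(haarU b))) := by
    intro U₀
    refine tendsto_integral_of_joint (Eventually.of_forall fun p =>
      ((hcont p.1).comp (Continuous.prodMk_right p.2)).aestronglyMeasurable) fun U₀' => ?_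
    have t1 : Tendsto (fun p : (ℕ × U(a)) × U(b) => p.1.1)
        ((atTop ×ˢ 𝓝 U₀) ×ˢ 𝓝 U₀') atTop := tendsto_fst.comp tendsto_fst
    have t2 : Tendsto (fun p : (ℕ × U(a)) × U(b) => p.1.2)
        ((atTop ×ˢ 𝓝 U₀) ×ˢ 𝓝 U₀') (𝓝 U₀) := tendsto_snd.comp tendsto_fst
    have t3 : Tendsto (fun p : (ℕ × U(a)) × U(b) => p.2)
        ((atTop ×ˢ 𝓝 U₀) ×ˢ 𝓝 U₀') (𝓝 U₀') := tendsto_snd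
    refine tendsto_areaCorr (hε.comp t1) (fun p => hε0 _)
      (fun p => reframe_conjTranspose_mul _ _ (hM _)) (G := reframe U₀ U₀' G) ?_
      (traceSnd_rotate U₀ U₀' hY) (N := (kronU U₀⁻¹ U₀'⁻¹).1 * N *
        (kronU U₀ U₀').1) hZ ?_ e hlam hsum
    · refine (tendsto_reframe t2 t3 (hG.comp t1)).congr fun p => ?_
      simp only [Function.comp_apply]
      rw [reframe_smul, reframe_sub, reframe_chiIso]
    · rw [hat_reframe, hhat, rotate_smul, rotate_add, rotate_add, rotate_kronecker,
        rotate_kronecker, Matrix.mul_one, kronU_inv_mul]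
  refine tendsto_integral_of_joint (Eventually.of_forall fun k => ?_) hinner
  refine Continuous.aestronglyMeasurable (continuous_iff_continuousAt.2 fun U₀ => ?_)
  refine tendsto_integral_of_joint (Eventually.of_forall fun U =>
    ((hcont k).comp (Continuous.prodMk_right U)).aestronglyMeasurable) fun U₀' => ?_
  rw [← nhds_prod_eq]
  exact (hcont k).tendsto _

lemma StabilizerCode.tendsto_avgCorrection [AddCommGroup a] [AddCommGroup b] [AddCommGroup c] (C :
    StabilizerCode a b c) {W : PMat a b c} (hW : W.IsHermitian) {RA : ℝ → U(a × c)} {RB : ℝ → U(b ×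
    c)} (hopt : ∀ ε, IsOptimalRecovery (C.skewed W ε) (RA ε) (RB ε)) (e : a ↪ b) {lam : a → ℝ} (hlam
    : ∀ i, 0 < lam i) (hsum : ∑ i, lam i = 1) : Tendsto (fun ε => avgCorrection (C.skewed W ε) (RA
    ε) (RB ε) (bulkState e lam) / ε ^ 2) (𝓝[≠] 0) (𝓝 (avgQuad e lam (areaPart (C.conjugated W)))) :=
    by
  have hW' : (C.conjugated W).IsHermitian := isHermitian_conj hW _
  refine tendsto_of_subseq_tendsto fun ε₀ hε₀ => ?_
  obtain ⟨n, hn⟩ := eventually_atTop.1 (hε₀.eventually self_mem_nhdsWithin)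
  set ε : ℕ → ℝ := fun k => ε₀ (k + n) with hεd
  have hε : Tendsto ε atTop (𝓝[≠] 0) := hε₀.comp (tendsto_add_atTop_nat n)
  have hε0 : ∀ k, ε k ≠ 0 := fun k => hn _ (Nat.le_add_left _ _)
  obtain ⟨φ, u, v, v', u', G, N, Z, hφ, hZ, hG, hhat⟩ := exists_subseq_optimal hW' hε hε0
    fun k => C.isOptimalRecovery (hopt (ε k))
  refine ⟨fun k => φ k + n, ?_⟩
  have h := tendsto_integral_areaCorr
    ((tendsto_nhdsWithin_iff.1 hε).1.comp hφ.tendsto_atTop) (fun k => hε0 _)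
    (fun k => by
      rw [recover_conjTranspose_mul, recover_conjTranspose_mul, evo_conjTranspose_mul hW']) hG
    (traceSnd_areaPart _) hZ hhat e hlam hsum
  refine h.congr fun k => ?_
  change _ = avgCorrection (C.skewed W (ε (φ k))) (RA (ε (φ k))) (RB (ε (φ k))) (bulkState e lam) /
    ε (φ k) ^ 2
  rw [avgCorrection, ← integral_div]
  refine integral_congr_ae (Eventually.of_forall fun U => ?_)
  simp only
  rw [← integral_div]
  refine integral_congr_ae (Eventually.of_forall fun U' => ?_)
  simp only [Function.comp_apply]
  rw [protoAreaCorrection_eq _ _ _ (isHermitian_density _), C.recover_skewed_eq, ← areaCorr_reframe,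
    areaCorr_recover_kronU _ _ _ _ _ (isHermitian_density _)]

end Averaging

end

section

/-! ### Moments of Haar-distributed unitaries -/

section Haar

variable {n : Type} [Fintype n] [DecidableEq n]

/-- Conjugation `X ↦ U† X U`. -/
def adj (U : U(n)) (X : Mat n) : Mat n := U.1ᴴ * X * U.1

lemma adj_add (U : U(n)) (X Y : Mat n) : adj U (X + Y) = adj U X + adj U Y := by
  rw [adj, Matrix.mul_add, Matrix.add_mul, adj, adj]

lemma adj_smul (U : U(n)) (z : ℂ) (X : Mat n) : adj U (z • X) = z • adj U X := by
  rw [adj, Matrix.mul_smul, smul_mul, adj]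

lemma adj_mul (V U : U(n)) (X : Mat n) : adj (V * U) X = adj U (adj V X) := by
  simp only [adj, Submonoid.coe_mul, conjTranspose_mul, mul_assoc]

lemma adj_one (U : U(n)) : adj U 1 = 1 := by
  rw [adj, mul_one, unitary_adj_mul]

lemma adj_single (U : U(n)) (x m i l : n) : adj U (single x m 1) i l = star ((U : Mat n) x i) * (U :
    Mat n) m l := by
  simp [adj, Matrix.mul_apply, single_apply, ite_and]

lemma continuous_adj (X : Mat n) (i l : n) : Continuous fun U : U(n) => adj U X i l :=
  ((continuous_subtype_val.matrix_conjTranspose.matrix_mul continuous_const).matrix_mul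
    continuous_subtype_val).matrix_elem i l

instance : (haarU n).IsMulLeftInvariant :=
  inferInstanceAs (Measure.haarMeasure (⊤ : TopologicalSpace.PositiveCompacts _)).IsMulLeftInvariant

lemma integrable_haarU {f : U(n) → ℂ} (hf : Continuous f) : Integrable f (haarU n) :=
  hf.integrable_of_hasCompactSupport (HasCompactSupport.of_compactSpace f)

/-- Sesquilinear forms on matrices that are invariant under unitary conjugation. -/
lemma exists_of_sesq_invariant [Nontrivial n] (F : Mat n →ₗ[ℂ] Mat n →ₗ⋆[ℂ] ℂ) (hF : ∀ (V : U(n)) X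
    Y, F (adj V X) (adj V Y) = F X Y) : ∃ p q : ℂ, ∀ X Y, F X Y = p * (X.trace * star Y.trace) + q *
    hs Y X := by
  set f : n → n → n → n → ℂ := fun x m y k => F (single x m 1) (single y k 1) with hf
  have hphase : ∀ x m y k, ¬ (x = m ∧ y = k) → ¬ (x = y ∧ m = k) → f x m y k = 0 := by
    have key : ∀ j x m y k, (if x = j then -I else 1) * (if m = j then I else 1) *
        ((if y = j then I else 1) * (if k = j then -I else 1)) ≠ 1 →
        f x m y k = 0 := by
      intro j x m y k h
      let V : U(n) := ⟨diagonal fun i => if i = j then I else 1, by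
        rw [mem_unitaryGroup_iff, star_eq_conjTranspose, diagonal_conjTranspose,
          Matrix.diagonal_mul_diagonal, ← Matrix.diagonal_one]
        congr 1
        ext i
        by_cases hi : i = j <;> simp [hi]⟩
      have hV : ∀ x m, adj V (single x m 1) = ((if x = j then -I else 1) *
          (if m = j then I else 1)) • single x m (1 : ℂ) := by
        intro x m
        ext i l
        rw [adj_single]
        simp only [V, diagonal_apply, Matrix.smul_apply, single_apply, smul_eq_mul]
        by_cases h1 : x = i <;> by_cases h2 : m = l <;> by_cases h3 : x = j <;>
          by_cases h4 : m = j <;> simp_all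
      have h1 := hF V (single x m 1) (single y k 1)
      rw [hV, hV, LinearMap.map_smulₛₗ (F _), F.map_smul, LinearMap.smul_apply, smul_eq_mul,
        smul_eq_mul, ← mul_assoc, mul_comm (starRingEnd ℂ _)] at h1
      by_contra h0
      refine h (mul_right_cancel₀ h0 (Eq.trans ?_ (h1.trans (one_mul _).symm)))
      congr 2
      by_cases h3 : y = j <;> by_cases h4 : k = j <;> simp [h3, h4]
    have hI : ¬ I = 1 := fun h => by simpa using congrArg Complex.re h
    have hI' : ¬ -I = 1 := fun h => by simpa using congrArg Complex.re h
    have hI2 : ¬ (-1 : ℂ) = 1 := by norm_num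
    intro x m y k h1 h2
    by_cases hxm : x = m
    · have hyk : ¬ y = k := fun h => h1 ⟨hxm, h⟩
      refine key y x m y k ?_
      by_cases h3 : m = y <;> simp [hxm, h3, Ne.symm hyk, hI]
    · by_cases hxy : x = y
      · have hmk : ¬ m = k := fun h => h2 ⟨hxy, h⟩
        refine key m x m y k ?_
        simp [hxm, hxy ▸ hxm, Ne.symm hmk, hI]
      · refine key x x m y k ?_
        by_cases h3 : k = x <;> simp [Ne.symm hxm, Ne.symm hxy, h3, hI', hI2]
  have hperm : ∀ (σ : Equiv.Perm n) x m y k, f (σ x) (σ m) (σ y) (σ k) = f x m y k := by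
    intro σ x m y k
    let V : U(n) := ⟨of fun i j => if σ i = j then 1 else 0, by
      rw [mem_unitaryGroup_iff]
      ext i j
      simp [Matrix.mul_apply, Matrix.one_apply, Matrix.star_apply, eq_comm]⟩
    have hV : ∀ x m, adj V (single x m 1) = single (σ x) (σ m) (1 : ℂ) := by
      intro x m
      ext i l
      rw [adj_single]
      by_cases h1 : σ x = i <;> by_cases h2 : σ m = l <;> simp [V, h1, h2]
    simp only [hf, ← hV, hF]
  have hperm2 : ∀ x x' y y' : n, x ≠ x' → y ≠ y' → ∃ σ : Equiv.Perm n, σ x = y ∧ σ x' = y' := by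
    intro x x' y y' h h'
    refine ⟨Equiv.swap (Equiv.swap x y x') y' * Equiv.swap x y, ?_, by simp⟩
    rw [Equiv.Perm.mul_apply, Equiv.swap_apply_left, Equiv.swap_apply_of_ne_of_ne _ h']
    intro h2
    exact h ((Equiv.swap x y).injective ((Equiv.swap_apply_left x y).trans h2))
  obtain ⟨x₀, x₁, hx⟩ := exists_pair_ne n
  refine ⟨f x₀ x₀ x₁ x₁, f x₀ x₁ x₀ x₁, ?_⟩
  have hdiag : ∀ x, f x x x x = f x₀ x₀ x₁ x₁ + f x₀ x₁ x₀ x₁ := by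
    intro x
    obtain ⟨m, hm⟩ := exists_ne x
    have hm' := hm.symm
    set D : Mat n := single x x 1 - single m m 1 with hD
    set E : Mat n := single m x 1 - single x m 1 with hE
    set T : Mat n := single x x 1 + single m m 1 - single x m 1 - single m x 1 with hT
    obtain ⟨hTT, hTD, hDT, hET⟩ : T * T = (2 : ℂ) • T ∧ T * D = D - E ∧ D * T = D + E ∧
        E * T = E + D := by
      refine ⟨?_, ?_, ?_, ?_⟩ <;>
        simp [hD, hE, hT, add_mul, mul_add, sub_mul, mul_sub, hm, hm', two_smul] <;> abel
    have hTH : Tᴴ = T := by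
      simp only [hT, conjTranspose_add, conjTranspose_sub, Matrix.conjTranspose_single, star_one]
      abel
    clear_value T D E
    have hk : star ((I - 1) / 2) = -((I + 1) / 2) := by
      simp
      ring
    let V : U(n) := ⟨1 + ((I - 1) / 2) • T, by
      rw [mem_unitaryGroup_iff, star_eq_conjTranspose]
      simp only [conjTranspose_add, conjTranspose_smul, hTH, conjTranspose_one, add_mul, mul_add,
        smul_mul, Matrix.mul_smul, hTT, mul_one, one_mul, hk]
      match_scalars
      · ring
      · linear_combination (-1 / 2 : ℂ) * I_mul_I⟩
    have hVD : adj V D = I • E := by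
      change (1 + ((I - 1) / 2) • T)ᴴ * D * (1 + ((I - 1) / 2) • T) = _
      simp only [conjTranspose_add, conjTranspose_smul, hTH, conjTranspose_one, add_mul, mul_add,
        smul_mul, Matrix.mul_smul, hDT, hTD, hET, sub_mul, mul_one, one_mul, hk]
      match_scalars <;> ring
    have hswap := hperm (Equiv.swap x m) x x m m
    have hswap2 := hperm (Equiv.swap x m) x x x x
    have hswap3 := hperm (Equiv.swap x m) x m x m
    simp only [Equiv.swap_apply_left, Equiv.swap_apply_right] at hswap hswap2 hswap3
    have h1 := hF V D D
    rw [hVD, LinearMap.map_smulₛₗ (F _), F.map_smul, LinearMap.smul_apply, smul_smul, smul_eq_mul,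
      conj_I, neg_mul, I_mul_I, neg_neg, one_mul] at h1
    simp only [hD, hE, map_sub, LinearMap.sub_apply] at h1
    change f m x m x - f x m m x - (f m x x m - f x m x m) =
      f x x x x - f m m x x - (f x x m m - f m m m m) at h1
    rw [hphase m x x m (by simp [hm]) (by simp [hm]), hphase x m m x (by simp [hm'])
      (by simp [hm']), hswap, hswap2, hswap3] at h1
    obtain ⟨σ, h4, h5⟩ := hperm2 _ _ _ _ hx hm'
    rw [← hperm σ x₀ x₀ x₁ x₁, ← hperm σ x₀ x₁ x₀ x₁, h4, h5]
    linear_combination (-1 / 2 : ℂ) * h1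
  have hfv : ∀ x m y k, f x m y k = (if x = m ∧ y = k then f x₀ x₀ x₁ x₁ else 0) +
      if x = y ∧ m = k then f x₀ x₁ x₀ x₁ else 0 := by
    intro x m y k
    by_cases h1 : x = m ∧ y = k
    · obtain ⟨rfl, rfl⟩ := h1
      by_cases h2 : x = y
      · subst h2
        simp [hdiag]
      · obtain ⟨σ, h3, h4⟩ := hperm2 _ _ _ _ hx h2
        rw [← hperm σ x₀ x₀ x₁ x₁, h3, h4]
        simp [h2]
    · by_cases h2 : x = y ∧ m = k
      · obtain ⟨rfl, rfl⟩ := h2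
        have hxm : x ≠ m := fun h => h1 ⟨h, h⟩
        obtain ⟨σ, h3, h4⟩ := hperm2 _ _ _ _ hx hxm
        rw [← hperm σ x₀ x₁ x₀ x₁, h3, h4]
        simp [hxm]
      · rw [hphase _ _ _ _ h1 h2, if_neg h1, if_neg h2, add_zero]
  intro X Y
  have hsingle : ∀ (X : Mat n), X = ∑ x, ∑ m, X x m • single x m (1 : ℂ) := fun X => by
    conv_lhs => rw [Matrix.matrix_eq_sum_single X]
    simp [Matrix.smul_single]
  have hexp : F X Y = ∑ y, ∑ k, star (Y y k) * ∑ x, ∑ m, X x m * f x m y k := by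
    conv_lhs => rw [hsingle X, hsingle Y]
    simp only [map_sum, map_smul, LinearMap.sum_apply, LinearMap.smul_apply, LinearMap.map_smulₛₗ,
      smul_eq_mul]
    rfl
  have hin : ∀ y k, ∑ x, ∑ m, X x m * f x m y k =
      (if y = k then X.trace * f x₀ x₀ x₁ x₁ else 0) + X y k * f x₀ x₁ x₀ x₁ := by
    intro y k
    simp only [fun x m => hfv x m y k, mul_add, sum_add_distrib]
    congr 1
    · by_cases hyk : y = k <;> simp [hyk, trace, sum_mul]
    · simp [ite_and]
  simp only [hexp, hin, mul_add, sum_add_distrib, mul_ite, mul_zero, sum_ite_eq, mem_univ, if_true]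
  congr 1
  · rw [← sum_mul, trace, trace, star_sum]
    simp only [diag_apply]
    ring
  · simp only [hs, mul_sum]
    exact sum_congr rfl fun y _ => sum_congr rfl fun k _ => by ring

/-- Second moment of the adjoint representation on traceless matrices. -/
def haarCoeff (i l i' l' : n) : ℂ :=
  ((card n : ℂ) * (if i = i' ∧ l = l' then 1 else 0) - if i = l ∧ i' = l' then 1 else 0) /
    ((card n : ℂ) * ((card n : ℂ) ^ 2 - 1))

lemma integral_adj_mul_star [Nontrivial n] {X : Mat n} (hX : X.trace = 0) (Y : Mat n) (i l i' l' :
    n) : ∫ U : U(n), adj U X i l * star (adj U Y i' l') ∂(haarU n) = haarCoeff i l i' l' * hs Y X :=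
    by
  have hint : ∀ X Y : Mat n, Integrable (fun U : U(n) =>
      adj U X i l * star (adj U Y i' l')) (haarU n) := fun X Y =>
    integrable_haarU ((continuous_adj X i l).mul (continuous_adj Y i' l').star)
  let F : Mat n →ₗ[ℂ] Mat n →ₗ⋆[ℂ] ℂ := LinearMap.mk₂'ₛₗ (RingHom.id ℂ) (starRingEnd ℂ)
    (fun X Y => ∫ U : U(n), adj U X i l * star (adj U Y i' l') ∂(haarU n))
    (fun X X' Y => by
      rw [← integral_add (hint X Y) (hint X' Y)]
      simp only [adj_add, Matrix.add_apply, add_mul])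
    (fun z X Y => by
      rw [RingHom.id_apply, smul_eq_mul, ← integral_const_mul]
      simp only [adj_smul, Matrix.smul_apply, smul_eq_mul, mul_assoc])
    (fun X Y Y' => by
      rw [← integral_add (hint X Y) (hint X Y')]
      simp only [adj_add, Matrix.add_apply, star_add, mul_add])
    (fun z X Y => by
      rw [smul_eq_mul, ← integral_const_mul]
      simp only [adj_smul, Matrix.smul_apply, smul_eq_mul, star_mul', starRingEnd_apply,
        mul_left_comm])
  have hFd : ∀ X Y, F X Y =
      ∫ U : U(n), adj U X i l * star (adj U Y i' l') ∂(haarU n) := fun _ _ => rfl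
  obtain ⟨p, q, hpq⟩ := exists_of_sesq_invariant F (fun V X Y => by
    rw [hFd, hFd]
    have := integral_mul_left_eq_self (μ := haarU n)
      (fun U : U(n) => adj U X i l * star (adj U Y i' l')) V
    simpa only [adj_mul] using this)
  set d : ℂ := (card n : ℂ) with hd
  have h1 : (if i = l ∧ i' = l' then (1 : ℂ) else 0) = p * d ^ 2 + q * d := by
    have h := hpq 1 1
    rw [hFd] at h
    simp only [adj_one, integral_const, probReal_univ, one_smul] at h
    have h2 : hs (1 : Mat n) 1 = d := by
      simp [hs, Matrix.one_apply, hd]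
    rw [h2, trace_one, Matrix.one_apply, Matrix.one_apply] at h
    rw [← hd] at h
    by_cases h3 : i = l <;> by_cases h4 : i' = l' <;>
      simp only [h3, h4, if_true, if_false, and_true, and_false] at h ⊢ <;>
      simpa [hd, pow_two, hs] using h
  have h2 : (if i = i' ∧ l = l' then (1 : ℂ) else 0) = p * d + q * d ^ 2 := by
    have h : ∑ x, ∑ m, F (single x m 1) (single x m 1) = p * d + q * d ^ 2 := by
      have ht : ∀ x m : n, (single x m (1 : ℂ)).trace = if x = m then 1 else 0 := by
        intro x m
        by_cases hxm : x = m
        · subst hxm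
          simp
        · simp [hxm]
      have hss : ∀ x m : n, hs (single x m (1 : ℂ)) (single x m 1) = 1 := by
        intro x m
        simp [hs, single_apply, ite_and]
      simp only [hpq, ht, hss, sum_add_distrib]
      simp [hd, pow_two]
      ring
    rw [← h]
    simp only [hFd]
    have h3 : ∑ x, ∑ m, ∫ U : U(n), adj U (single x m 1) i l *
        star (adj U (single x m 1) i' l') ∂(haarU n) = ∫ U : U(n),
        (1 : Mat n) i i' * (1 : Mat n) l' l ∂(haarU n) := by
      rw [sum_congr rfl fun x _ => (integral_finsetSum _ fun m _ => hint _ _).symm, ←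
        integral_finsetSum _ fun x _ => integrable_finsetSum _ fun m _ => hint _ _]
      refine integral_congr_ae (Eventually.of_forall fun U => ?_)
      simp only
      rw [← unitary_adj_mul U, Matrix.mul_apply, Matrix.mul_apply, sum_mul_sum]
      refine sum_congr rfl fun x _ => sum_congr rfl fun m _ => ?_
      rw [adj_single, adj_single, conjTranspose_apply, conjTranspose_apply, star_mul', star_star]
      ring
    rw [h3, integral_const, probReal_univ, one_smul, Matrix.one_apply, Matrix.one_apply]
    by_cases h3 : i = i' <;> by_cases h4 : l = l' <;> simp [h3, h4, eq_comm]
  rw [← hFd, hpq, hX, zero_mul, mul_zero, zero_add, haarCoeff, ← hd, h1, h2]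
  have hd1 : (1 : ℝ) < card n := by exact_mod_cast one_lt_card
  have hd2 : d ^ 2 - 1 ≠ 0 := by
    have h3 : ((card n : ℝ) ^ 2 - 1) ≠ 0 := by nlinarith
    rw [hd]
    exact_mod_cast h3
  have hd0 : d ≠ 0 := by
    rw [hd]
    exact_mod_cast card_ne_zero
  field_simp
  ring

end Haar

end

section

/-! ### Haar average of the second-order coefficient -/

section AverageForm

/-- Block of an operator at fixed labels of the second and third factors. -/
def sliceA (Y : TMat a b c) (y y' : b) (s t : c) : Mat a :=
  of fun x x' => Y ((x, y), s) ((x', y'), t)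

lemma rotate_apply (U : U(a)) (U' : U(b)) (Y : TMat a b c) (i l : a) (j k : b) (s t : c) : rotate U
    U' Y ((i, j), s) ((l, k), t) = adj U' (of fun y y' => adj U (sliceA Y y y' s t) i l) j k := by
  have hcomm : ∀ f : a → b → a → b → ℂ, ∑ p, ∑ q, ∑ i, ∑ j, f i j p q =
      ∑ q, ∑ j, ∑ p, ∑ i, f i j p q := fun f => by
    rw [sum_comm]
    refine sum_congr rfl fun q _ => ?_
    rw [sum_congr rfl fun _ _ => sum_comm, sum_comm]
  have hU : ∀ i x, ((U⁻¹ : U(a)) : Mat a) i x = star ((U : Mat a) x i) := fun _ _ => rfl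
  have hU' : ∀ i x, ((U'⁻¹ : U(b)) : Mat b) i x = star ((U' : Mat b) x i) := fun _ _ => rfl
  simp only [rotate, adj, sliceA, kronU, Matrix.mul_apply, kroneckerMap_apply, sum_prod_type,
    Matrix.one_apply, mul_ite, mul_one, mul_zero, ite_mul, zero_mul, sum_ite_eq, sum_ite_eq',
    mem_univ, if_true, of_apply, conjTranspose_apply, hU, hU', sum_mul, mul_sum]
  rw [hcomm]
  refine sum_congr rfl fun q _ => sum_congr rfl fun j' _ =>
    sum_congr rfl fun p _ => sum_congr rfl fun i' _ => by ring

lemma rotate_conjTranspose (U : U(a)) (U' : U(b)) (Y : TMat a b c) : rotate U U' Yᴴ = (rotate U U'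
    Y)ᴴ := by
  have h : (kronU U⁻¹ U'⁻¹).1ᴴ = (kronU U U').1 := by
    simp [kronU, conjTranspose_kronecker, star_eq_conjTranspose]
  rw [rotate, rotate, conjTranspose_mul, conjTranspose_mul, conjTranspose_kronecker,
    conjTranspose_kronecker, conjTranspose_one, h, ← h, conjTranspose_conjTranspose,
    Matrix.mul_assoc]

lemma continuous_rotate (Y : TMat a b c) (p q : Tri a b c) : Continuous fun g : U(a) × U(b) =>
    rotate g.1 g.2 Y p q := by
  refine continuous_iff_continuousAt.2 fun g => ?_
  have h1 : Tendsto (fun g : U(a) × U(b) => kronU g.1 g.2)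
      (𝓝 g) (𝓝 (kronU g.1 g.2)) := tendsto_kronU (continuous_fst.tendsto g) (continuous_snd.tendsto g)
  have h2 : Tendsto (fun g : U(a) × U(b) =>
      kronU g.1⁻¹ g.2⁻¹) (𝓝 g) (𝓝 (kronU g.1⁻¹ g.2⁻¹)) :=
    tendsto_kronU (continuous_fst.tendsto g).inv (continuous_snd.tendsto g).inv
  exact tendsto_mat.1 (tendsto_mul (tendsto_mul
    (tendsto_kronecker ((continuous_subtype_val.tendsto _).comp h2) tendsto_const_nhds)
    tendsto_const_nhds) (tendsto_kronecker ((continuous_subtype_val.tendsto _).comp h1)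
    tendsto_const_nhds)) p q

/-- Haar measure on the product of the two unitary groups. -/
abbrev haarProd (a b : Type) [Fintype a] [DecidableEq a] [Fintype b] [DecidableEq b] :
    Measure (U(a) × U(b)) := (haarU a).prod (haarU b)

lemma integrable_haarProd {f : U(a) × U(b) → ℂ} (hf : Continuous f) : Integrable f (haarProd a b) :=
  hf.integrable_of_hasCompactSupport (HasCompactSupport.of_compactSpace f)

lemma _root_.MeasureTheory.Integrable.sub_fun {X : Type*} [MeasurableSpace X] {μ : Measure X}
    {f g : X → ℂ} (hf : Integrable f μ) (hg : Integrable g μ) :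
    Integrable (fun x => f x - g x) μ := hf.sub hg

/-- Hilbert–Schmidt pairing of blocks at fixed labels of the last factor. -/
def blockHs (Y' Y : TMat a b c) (s t : c) : ℂ :=
  ∑ y, ∑ y', hs (sliceA Y' y y' s t) (sliceA Y y y' s t)

/-- Both partial traces over the first two factors vanish. -/
def Balanced (Y : TMat a b c) : Prop :=
  (∀ y y' s t, (sliceA Y y y' s t).trace = 0) ∧ ∀ s t, ∑ y, sliceA Y y y s t = 0

lemma integral_rotate_mul_star [Nontrivial a] [Nontrivial b] {Y : TMat a b c} (hY : Balanced Y) (Y'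
    : TMat a b c) (i l i' l' : a) (j k j' k' : b) (s t : c) : ∫ g, rotate g.1 g.2 Y ((i, j), s) ((l,
    k), t) * star (rotate g.1 g.2 Y' ((i', j'), s) ((l', k'), t)) ∂(haarProd a b) = haarCoeff i l i'
    l' * haarCoeff j k j' k' * blockHs Y' Y s t := by
  have hcont : Continuous fun g : U(a) × U(b) =>
      rotate g.1 g.2 Y ((i, j), s) ((l, k), t) *
        star (rotate g.1 g.2 Y' ((i', j'), s) ((l', k'), t)) :=
    (continuous_rotate Y _ _).mul (continuous_rotate Y' _ _).star
  rw [integral_prod _ (integrable_haarProd hcont)]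
  have h1 : ∀ U : U(a), ∫ U' : U(b),
      rotate U U' Y ((i, j), s) ((l, k), t) * star (rotate U U' Y' ((i', j'), s) ((l', k'), t))
        ∂(haarU b) = haarCoeff j k j' k' * ∑ y, ∑ y', adj U (sliceA Y y y' s t) i l *
          star (adj U (sliceA Y' y y' s t) i' l') := by
    intro U
    simp only [rotate_apply]
    rw [integral_adj_mul_star, hs]
    · simp only [of_apply, mul_comm (star _)]
    · have h2 := congrArg (fun X => adj U X i l) (hY.2 s t)
      simp only [adj, Matrix.mul_sum, Matrix.sum_mul, Matrix.sum_apply, Matrix.mul_zero,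
        Matrix.zero_mul, Matrix.zero_apply] at h2
      simpa only [trace, diag_apply, of_apply, adj] using h2
  simp only [h1]
  have hint : ∀ y y', Integrable (fun U : U(a) => adj U (sliceA Y y y' s t) i l *
      star (adj U (sliceA Y' y y' s t) i' l')) (haarU a) := fun y y' =>
    integrable_haarU ((continuous_adj _ i l).mul (continuous_adj _ i' l').star)
  rw [integral_const_mul, integral_finsetSum _ fun y _ => integrable_finsetSum _ fun y' _ => hint y
    y', blockHs, mul_comm (haarCoeff i l i' l'), mul_assoc]
  congr 1
  rw [mul_sum]
  refine sum_congr rfl fun y _ => ?_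
  rw [integral_finsetSum _ fun y' _ => hint y y', mul_sum]
  exact sum_congr rfl fun y' _ => integral_adj_mul_star (hY.1 y y' s t) _ _ _ _ _

/-- Anti-Hermitian part (doubled) of the contracted operator. -/
def areaEntry (e : a ↪ b) (lam : a → ℝ) (Y : TMat a b c) (p q : a × c) : ℂ :=
  (bMat e lam Y - (bMat e lam Y)ᴴ) p q

lemma areaEntry_add (e : a ↪ b) (lam : a → ℝ) (X Y : TMat a b c) (p q : a × c) : areaEntry e lam (X
    + Y) p q = areaEntry e lam X p q + areaEntry e lam Y p q := by
  simp only [areaEntry, bMat_add, conjTranspose_add, Matrix.sub_apply, Matrix.add_apply]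
  ring

lemma areaEntry_rotate (e : a ↪ b) (lam : a → ℝ) (Y : TMat a b c) (U : U(a)) (U' : U(b)) (i j : a)
    (s t : c) : areaEntry e lam (rotate U U' Y) (i, s) (j, t) = ∑ l, rt(lam l) * (rt(lam j) * rotate
    U U' Y ((i, e j), s) ((l, e l), t) - rt(lam i) * rotate U U' Yᴴ ((l, e l), s) ((j, e i), t)) :=
    by
  simp only [areaEntry, bMat, Matrix.sub_apply, conjTranspose_apply, of_apply, star_mul', star_sum,
    star_def, conj_ofReal, rotate_conjTranspose, mul_sum, ← sum_sub_distrib]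
  exact sum_congr rfl fun l _ => by ring

lemma continuous_areaEntry_rotate (e : a ↪ b) (lam : a → ℝ) (Y : TMat a b c) (p q : a × c) :
    Continuous fun g : U(a) × U(b) => areaEntry e lam (rotate g.1 g.2 Y) p q := by
  obtain ⟨i, s⟩ := p
  obtain ⟨j, t⟩ := q
  simp only [areaEntry_rotate]
  exact continuous_finsetSum _ fun l _ => continuous_const.mul
    ((continuous_const.mul (continuous_rotate _ _ _)).sub
      (continuous_const.mul (continuous_rotate _ _ _)))

lemma ofReal_avgQuad (e : a ↪ b) (lam : a → ℝ) (Y : TMat a b c) : (avgQuad e lam Y : ℂ) = (2 * (card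
    c : ℂ))⁻¹ * ∑ p : a × c, ∑ q : a × c, (invLogMean (lam p.1) (lam q.1) : ℂ) * ∫ g, areaEntry e
    lam (rotate g.1 g.2 Y) p q * star (areaEntry e lam (rotate g.1 g.2 Y) p q) ∂(haarProd a b) := by
  have hq : ∀ g : U(a) × U(b), (areaQuad e lam (rotate g.1 g.2 Y) : ℂ) = (2 * (card c : ℂ))⁻¹ *
        ∑ p : a × c, ∑ q : a × c, (invLogMean (lam p.1) (lam q.1) : ℂ) *
          (areaEntry e lam (rotate g.1 g.2 Y) p q * star (areaEntry e lam (rotate g.1 g.2 Y) p q)) := by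
    intro g
    rw [areaQuad]
    push_cast
    congr 1
    refine sum_congr rfl fun p _ => sum_congr rfl fun q _ => ?_
    rw [star_def, mul_conj', mul_comm, areaEntry]
  have hc : ∀ p q, Continuous fun g : U(a) × U(b) =>
      areaEntry e lam (rotate g.1 g.2 Y) p q * star (areaEntry e lam (rotate g.1 g.2 Y) p q) :=
    fun p q => (continuous_areaEntry_rotate e lam Y p q).mul
      (continuous_areaEntry_rotate e lam Y p q).star
  have hint := fun p q : a × c => (integrable_haarProd (hc p q)).const_mul
    (invLogMean (lam p.1) (lam q.1) : ℂ)
  have hcont : Continuous fun g : U(a) × U(b) =>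
      (areaQuad e lam (rotate g.1 g.2 Y) : ℂ) := by
    simp only [hq]
    exact continuous_const.mul (continuous_finsetSum _ fun p _ => continuous_finsetSum _ fun q _ =>
      continuous_const.mul (hc p q))
  have h1 : (avgQuad e lam Y : ℂ) =
      ∫ g, (areaQuad e lam (rotate g.1 g.2 Y) : ℂ) ∂(haarProd a b) := by
    rw [integral_prod _ (integrable_haarProd hcont), avgQuad, ← integral_complex_ofReal]
    exact integral_congr_ae (Eventually.of_forall fun U => integral_complex_ofReal.symm)
  rw [h1]
  simp only [hq]
  rw [integral_const_mul, integral_finsetSum _ fun p _ => integrable_finsetSum _ fun q _ => hint p q]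
  congr 1
  refine sum_congr rfl fun p _ => ?_
  rw [integral_finsetSum _ fun q _ => hint p q]
  exact sum_congr rfl fun q _ => integral_const_mul _ _

lemma Balanced.conjTranspose {Y : TMat a b c} (hY : Balanced Y) : Balanced Yᴴ := by
  have h : ∀ y y' s t, sliceA Yᴴ y y' s t = (sliceA Y y' y t s)ᴴ := fun _ _ _ _ => rfl
  constructor
  · intro y y' s t
    rw [h, trace_conjTranspose, hY.1, star_zero]
  · intro s t
    simp only [h, ← Matrix.conjTranspose_sum, hY.2, conjTranspose_zero]

lemma integral_areaEntry_mul_star [Nontrivial a] [Nontrivial b] (e : a ↪ b) (lam : a → ℝ) {Y : TMat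
    a b c} (hY : Balanced Y) (Y' : TMat a b c) (i j : a) (s t : c) : ∫ g, areaEntry e lam (rotate
    g.1 g.2 Y) (i, s) (j, t) * star (areaEntry e lam (rotate g.1 g.2 Y') (i, s) (j, t)) ∂(haarProd a
    b) = ∑ l, ∑ l', rt(lam l) * rt(lam l') * (rt(lam j) * rt(lam j) * (haarCoeff i l i l' *
    haarCoeff (e j) (e l) (e j) (e l') * blockHs Y' Y s t) - rt(lam j) * rt(lam i) * (haarCoeff i l
    l' j * haarCoeff (e j) (e l) (e l') (e i) * blockHs Y'ᴴ Y s t) - rt(lam i) * rt(lam j) *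
    (haarCoeff l j i l' * haarCoeff (e l) (e i) (e j) (e l') * blockHs Y' Yᴴ s t) + rt(lam i) *
    rt(lam i) * (haarCoeff l j l' j * haarCoeff (e l) (e i) (e l') (e i) * blockHs Y'ᴴ Yᴴ s t)) :=
    by
  have hI : ∀ (X X' : TMat a b c) (p q p' q' : Tri a b c), Integrable (fun g : U(a) × U(b) =>
        rotate g.1 g.2 X p q * star (rotate g.1 g.2 X' p' q')) (haarProd a b) := by
    intro X X' p q p' q'
    have h : Continuous fun g : U(a) × U(b) =>
        rotate g.1 g.2 X p q * star (rotate g.1 g.2 X' p' q') :=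
      (continuous_rotate X p q).mul (continuous_rotate X' p' q').star
    exact integrable_haarProd h
  have hexp : ∀ g : U(a) × U(b), areaEntry e lam (rotate g.1 g.2 Y) (i, s) (j, t) *
        star (areaEntry e lam (rotate g.1 g.2 Y') (i, s) (j, t)) =
      ∑ l, ∑ l', rt(lam l) * rt(lam l') * (rt(lam j) * rt(lam j) *
            (rotate g.1 g.2 Y ((i, e j), s) ((l, e l), t) *
              star (rotate g.1 g.2 Y' ((i, e j), s) ((l', e l'), t))) -
          rt(lam j) * rt(lam i) * (rotate g.1 g.2 Y ((i, e j), s) ((l, e l), t) *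
              star (rotate g.1 g.2 Y'ᴴ ((l', e l'), s) ((j, e i), t))) -
          rt(lam i) * rt(lam j) * (rotate g.1 g.2 Yᴴ ((l, e l), s) ((j, e i), t) *
              star (rotate g.1 g.2 Y' ((i, e j), s) ((l', e l'), t))) +
          rt(lam i) * rt(lam i) * (rotate g.1 g.2 Yᴴ ((l, e l), s) ((j, e i), t) *
              star (rotate g.1 g.2 Y'ᴴ ((l', e l'), s) ((j, e i), t)))) := by
    intro g
    rw [areaEntry_rotate, areaEntry_rotate, star_sum, sum_mul_sum]
    refine sum_congr rfl fun l _ => sum_congr rfl fun l' _ => ?_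
    simp only [star_mul', star_sub, star_def, conj_ofReal]
    ring
  have hJ := fun (l l' : a) => ((((hI Y Y' ((i, e j), s) ((l, e l), t) ((i, e j), s)
      ((l', e l'), t)).const_mul (rt(lam j) * rt(lam j))).sub_fun
    ((hI Y Y'ᴴ ((i, e j), s) ((l, e l), t) ((l', e l'), s) ((j, e i), t)).const_mul
      (rt(lam j) * rt(lam i)))).sub_fun
    ((hI Yᴴ Y' ((l, e l), s) ((j, e i), t) ((i, e j), s) ((l', e l'), t)).const_mul
      (rt(lam i) * rt(lam j)))).fun_add
    ((hI Yᴴ Y'ᴴ ((l, e l), s) ((j, e i), t) ((l', e l'), s) ((j, e i), t)).const_mul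
      (rt(lam i) * rt(lam i)))
  have hJ' := fun l l' => (hJ l l').const_mul (rt(lam l) * rt(lam l'))
  simp only [hexp]
  rw [integral_finsetSum _ fun l _ => integrable_finsetSum _ fun l' _ => hJ' l l']
  refine sum_congr rfl fun l _ => ?_
  rw [integral_finsetSum _ fun l' _ => hJ' l l']
  refine sum_congr rfl fun l' _ => ?_
  rw [integral_const_mul, integral_add, integral_sub, integral_sub, integral_const_mul,
    integral_const_mul, integral_const_mul, integral_const_mul, integral_rotate_mul_star hY,
    integral_rotate_mul_star hY, integral_rotate_mul_star hY.conjTranspose, integral_rotate_mul_star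
    hY.conjTranspose]
  · exact (hI _ _ _ _ _ _).const_mul _
  · exact (hI _ _ _ _ _ _).const_mul _
  · exact ((hI _ _ _ _ _ _).const_mul _).sub_fun ((hI _ _ _ _ _ _).const_mul _)
  · exact (hI _ _ _ _ _ _).const_mul _
  · exact (((hI _ _ _ _ _ _).const_mul _).sub_fun ((hI _ _ _ _ _ _).const_mul _)).sub_fun
      ((hI _ _ _ _ _ _).const_mul _)
  · exact (hI _ _ _ _ _ _).const_mul _

/-- A balanced operator contributes independently of operators orthogonal to it blockwise. -/
lemma avgQuad_add [Nontrivial a] [Nontrivial b] (e : a ↪ b) (lam : a → ℝ) {Y Y' : TMat a b c} (hY :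
    Balanced Y) (h : ∀ s t, blockHs Y' Y s t = 0) (h' : ∀ s t, blockHs Y' Yᴴ s t = 0) (hY' : Y'ᴴ =
    -Y') : avgQuad e lam (Y + Y') = avgQuad e lam Y + avgQuad e lam Y' := by
  have hneg : ∀ X s t, blockHs (-Y') X s t = -blockHs Y' X s t := by
    intro X s t
    simp [blockHs, sliceA, hs]
  have hcross : ∀ p q : a × c, ∫ g, areaEntry e lam (rotate g.1 g.2 Y) p q *
      star (areaEntry e lam (rotate g.1 g.2 Y') p q) ∂(haarProd a b) = 0 := by
    rintro ⟨i, s⟩ ⟨j, t⟩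
    rw [integral_areaEntry_mul_star e lam hY]
    simp [hY', hneg, h, h']
  have hcont : ∀ (X X' : TMat a b c) (p q : a × c), Integrable (fun g : U(a) × U(b) =>
        areaEntry e lam (rotate g.1 g.2 X) p q * star (areaEntry e lam (rotate g.1 g.2 X') p q))
        (haarProd a b) := by
    intro X X' p q
    have h : Continuous fun g : U(a) × U(b) =>
        areaEntry e lam (rotate g.1 g.2 X) p q * star (areaEntry e lam (rotate g.1 g.2 X') p q) :=
      (continuous_areaEntry_rotate e lam X p q).mul (continuous_areaEntry_rotate e lam X' p q).star
    exact integrable_haarProd h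
  have hcross' : ∀ p q : a × c, ∫ g, areaEntry e lam (rotate g.1 g.2 Y') p q *
      star (areaEntry e lam (rotate g.1 g.2 Y) p q) ∂(haarProd a b) = 0 := by
    intro p q
    have h1 := congrArg (starRingEnd ℂ) (hcross p q)
    rw [← integral_conj, map_zero] at h1
    rw [← h1]
    refine integral_congr_ae (Eventually.of_forall fun g => ?_)
    simp [mul_comm]
  apply ofReal_injective
  rw [ofReal_add, ofReal_avgQuad, ofReal_avgQuad, ofReal_avgQuad, ← mul_add, ← sum_add_distrib]
  congr 1
  refine sum_congr rfl fun p _ => ?_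
  rw [← sum_add_distrib]
  refine sum_congr rfl fun q _ => ?_
  rw [← mul_add]
  congr 1
  simp only [rotate_add, areaEntry_add, star_add, add_mul, mul_add]
  rw [integral_add ((hcont _ _ p q).fun_add (hcont _ _ p q)) ((hcont _ _ p q).fun_add (hcont _ _ p
    q)), integral_add (hcont _ _ p q) (hcont _ _ p q), integral_add (hcont _ _ p q) (hcont _ _ p q),
    hcross, hcross', add_zero, zero_add]

end AverageForm

end

section

section BalancedAverage

lemma sum_comm_pair {α β γ δ : Type} [Fintype α] [Fintype β] [Fintype γ] [Fintype δ] (f : α → β → γ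
    → δ → ℂ) : ∑ s, ∑ t, ∑ l, ∑ l', f s t l l' = ∑ l, ∑ l', ∑ s, ∑ t, f s t l l' := by
  rw [sum_congr rfl fun _ _ => sum_comm, sum_comm]
  refine sum_congr rfl fun p _ => ?_
  rw [sum_congr rfl fun _ _ => sum_comm, sum_comm]

lemma sum_blockHs (Y' Y : TMat a b c) : ∑ s, ∑ t, blockHs Y' Y s t = hs Y' Y := by
  simp only [blockHs, hs, sliceA, of_apply, sum_prod_type]
  symm
  refine (sum_congr rfl fun x _ => sum_congr rfl fun y _ =>
    sum_congr rfl fun s _ => ?_).trans ((sum_comm_pair fun x y s t => ∑ x', ∑ y',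
      star (Y' ((x, y), s) ((x', y'), t)) * Y ((x, y), s) ((x', y'), t)).trans
    (sum_congr rfl fun s _ => sum_congr rfl fun t _ => ?_))
  · rw [sum_congr rfl fun _ _ => sum_comm, sum_comm]
  · rw [sum_comm]
    refine sum_congr rfl fun y _ => ?_
    rw [sum_congr rfl fun _ _ => sum_comm, sum_comm]

/-- Normalisation of the Haar coefficients. -/
def haarNorm (n : Type) [Fintype n] : ℝ := (card n : ℝ) * ((card n : ℝ) ^ 2 - 1)

lemma haarCoeff_left (i l l' : a) : haarCoeff i l i l' = if l = l' then ((((card a : ℝ) - if i = l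
    then 1 else 0) / haarNorm a : ℝ) : ℂ) else 0 := by
  unfold haarCoeff haarNorm
  by_cases h : l = l'
  · subst h
    by_cases h2 : i = l <;> simp [h2]
  · have : ¬ (i = l ∧ i = l') := fun h2 => h (h2.1.symm.trans h2.2)
    simp [h, this]

lemma haarCoeff_right (l j l' : a) : haarCoeff l j l' j = if l = l' then ((((card a : ℝ) - if j = l
    then 1 else 0) / haarNorm a : ℝ) : ℂ) else 0 := by
  unfold haarCoeff haarNorm
  by_cases h : l = l'
  · subst h
    by_cases h2 : l = j
    · simp [h2]
    · simp [h2, Ne.symm h2]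
  · have : ¬ (l = j ∧ l' = j) := fun h2 => h (h2.1.trans h2.2.symm)
    simp [h, this]

lemma haarCoeff_cross (e : a ↪ b) (i j l l' : a) : haarCoeff i l l' j * haarCoeff (e j) (e l) (e l')
    (e i) = (((haarNorm a * haarNorm b)⁻¹ * (((card a : ℝ) * card b + 1) * (if l = i then if l' = i
    then if i = j then 1 else 0 else 0 else 0) - card a * (if l = j then if l' = i then 1 else 0
    else 0) - card b * (if l = i then if l' = j then 1 else 0 else 0)) : ℝ) : ℂ) := by
  unfold haarCoeff haarNorm
  simp only [e.injective.eq_iff]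
  push_cast
  rw [div_mul_div_comm, div_eq_inv_mul]
  congr 1
  by_cases h1 : l = i <;> by_cases h2 : l' = i <;> by_cases h3 : i = j <;>
    by_cases h4 : l = j <;> by_cases h5 : l' = j <;> simp_all [eq_comm] <;> ring

lemma haarCoeff_cross' (e : a ↪ b) (i j l l' : a) : haarCoeff l j i l' * haarCoeff (e l) (e i) (e j)
    (e l') = (((haarNorm a * haarNorm b)⁻¹ * (((card a : ℝ) * card b + 1) * (if l = i then if l' = i
    then if i = j then 1 else 0 else 0 else 0) - card b * (if l = j then if l' = i then 1 else 0
    else 0) - card a * (if l = i then if l' = j then 1 else 0 else 0)) : ℝ) : ℂ) := by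
  unfold haarCoeff haarNorm
  simp only [e.injective.eq_iff]
  push_cast
  rw [div_mul_div_comm, div_eq_inv_mul]
  congr 1
  by_cases h1 : l = i <;> by_cases h2 : l' = i <;> by_cases h3 : i = j <;>
    by_cases h4 : l = j <;> by_cases h5 : l' = j <;> simp_all [eq_comm] <;> ring

/-- Haar average of the squared blocks of the contracted operator. -/
def balancedCoeff (lam : a → ℝ) (Y : TMat a b c) (i j : a) : ℝ :=
  (haarNorm a * haarNorm b)⁻¹ * (nsq Y * (lam j * ((card a : ℝ) * card b - card a * lam j -
        card b * lam i + if i = j then lam i else 0) +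
      lam i * ((card a : ℝ) * card b - card a * lam i -
        card b * lam j + if i = j then lam i else 0)) -
    2 * (hs Yᴴ Y).re * (((card a : ℝ) * card b + 1) * (if i = j then lam i ^ 2 else 0) -
      ((card a : ℝ) + card b) * (lam i * lam j)))

lemma sum_integral_areaEntry [Nontrivial a] [Nontrivial b] (e : a ↪ b) {lam : a → ℝ} (hlam : ∀ i, 0
    < lam i) (hsum : ∑ i, lam i = 1) {Y : TMat a b c} (hY : Balanced Y) (i j : a) : ∑ s, ∑ t, ∫ g,
    areaEntry e lam (rotate g.1 g.2 Y) (i, s) (j, t) * star (areaEntry e lam (rotate g.1 g.2 Y) (i,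
    s) (j, t)) ∂(haarProd a b) = (balancedCoeff lam Y i j : ℂ) := by
  set r : a → ℂ := fun i => rt(lam i) with hr
  have hrr : ∀ i, r i * r i = (lam i : ℂ) := fun i => by
    rw [hr, ← ofReal_mul, mul_self_sqrt (hlam i).le]
  simp only [integral_areaEntry_mul_star e lam hY]
  rw [sum_comm_pair]
  simp only [← mul_sum, sum_add_distrib, sum_sub_distrib, sum_blockHs, hs_self, nsq_conjTranspose]
  have hτ : hs Yᴴ Y + hs Y Yᴴ = ((2 * (hs Yᴴ Y).re : ℝ) : ℂ) := by
    rw [← star_hs Yᴴ Y, star_def, add_conj]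
  have hS1 : ∀ i j : a, ∑ l, ∑ l', r l * r l' *
      ((if l = l' then ((((card a : ℝ) - if i = l then 1 else 0) / haarNorm a : ℝ) : ℂ)
        else 0) * if l = l' then
        ((((card b : ℝ) - if j = l then 1 else 0) / haarNorm b : ℝ) : ℂ) else 0) =
      (((haarNorm a * haarNorm b)⁻¹ * ((card a : ℝ) * card b -
        card a * lam j - card b * lam i + if i = j then lam i else 0) : ℝ) : ℂ) := by
    intro i j
    have h1 : ∀ l, ∑ l', r l * r l' *
      ((if l = l' then ((((card a : ℝ) - if i = l then 1 else 0) / haarNorm a : ℝ) : ℂ)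
        else 0) * if l = l' then
        ((((card b : ℝ) - if j = l then 1 else 0) / haarNorm b : ℝ) : ℂ) else 0) =
      (((haarNorm a * haarNorm b)⁻¹ * ((card a : ℝ) * card b * lam l -
        (if j = l then card a * lam l else 0) - (if i = l then card b * lam l else 0)
          + if i = l then if j = l then lam l else 0 else 0) : ℝ) : ℂ) := by
      intro l
      rw [sum_eq_single l]
      · rw [hrr, if_pos rfl, if_pos rfl, ← ofReal_mul, ← ofReal_mul, div_mul_div_comm,
          div_eq_inv_mul]
        congr 1
        by_cases h2 : i = l <;> by_cases h3 : j = l <;> simp [h2, h3] <;> ring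
      · intro l' _ h
        simp [h.symm]
      · simp
    simp only [h1]
    rw [← ofReal_sum, ← mul_sum, sum_add_distrib, sum_sub_distrib, sum_sub_distrib, ← mul_sum, hsum]
    simp [eq_comm]
  have hS2 : ∀ D d₁ d₂ : ℝ, ∑ l, ∑ l', r l * r l' * (((haarNorm a * haarNorm b)⁻¹ * (D *
        (if l = i then if l' = i then if i = j then 1 else 0 else 0 else 0) -
        d₁ * (if l = j then if l' = i then 1 else 0 else 0) -
        d₂ * (if l = i then if l' = j then 1 else 0 else 0)) : ℝ) : ℂ) =
      (((haarNorm a * haarNorm b)⁻¹ * (D * (if i = j then lam i else 0) -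
        (d₁ + d₂) * (√(lam i) * √(lam j))) : ℝ) : ℂ) := by
    intro D d₁ d₂
    have h1 : ∑ l, ∑ l', √(lam l) * √(lam l') *
        (if l = i then if l' = i then if i = j then 1 else 0 else 0 else 0) =
        if i = j then lam i else 0 := by
      by_cases h : i = j <;> simp [h, mul_self_sqrt (hlam _).le]
    have h2 : ∑ l, ∑ l', √(lam l) * √(lam l') *
        (if l = j then if l' = i then 1 else 0 else 0) = √(lam i) * √(lam j) := by
      simp [mul_comm]
    have h3 : ∑ l, ∑ l', √(lam l) * √(lam l') *
        (if l = i then if l' = j then 1 else 0 else 0) = √(lam i) * √(lam j) := by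
      simp
    rw [add_mul, ← sub_sub, ← h1]
    nth_rw 1 [← h2]
    rw [← h3]
    simp only [mul_sum, ← sum_sub_distrib]
    push_cast
    exact sum_congr rfl fun l _ => sum_congr rfl fun l' _ => by simp only [hr]; ring
  have hgen : ∀ (A B C D : a → a → ℂ) (n n' τ τ' α β γ δ : ℂ),
      ∑ l, ∑ l', r l * r l' * (α * (A l l' * n) - β * (B l l' * τ) - γ * (C l l' * τ') +
        δ * (D l l' * n')) = α * n * ∑ l, ∑ l', r l * r l' * A l l' -
        β * τ * ∑ l, ∑ l', r l * r l' * B l l' - γ * τ' * ∑ l, ∑ l', r l * r l' * C l l' +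
        δ * n' * ∑ l, ∑ l', r l * r l' * D l l' := by
    intro A B C D n n' τ τ' α β γ δ
    simp only [mul_sum, ← sum_sub_distrib, ← sum_add_distrib]
    exact sum_congr rfl fun l _ => sum_congr rfl fun l' _ => by ring
  simp only [haarCoeff_left, haarCoeff_right, haarCoeff_cross, haarCoeff_cross', e.injective.eq_iff]
  refine (hgen _ _ _ _ _ _ _ _ _ _ _ _).trans ?_
  rw [hS1, hS1, hS2, hS2]
  have hij : r i * r j * (√(lam i) * √(lam j) : ℝ) = (lam i : ℂ) * lam j := by
    rw [← hrr i, ← hrr j, hr]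
    push_cast
    ring
  have hδ : r i * r j * ((if i = j then lam i else 0 : ℝ) : ℂ) = ((if i = j then lam i ^ 2 else 0 : ℝ) : ℂ) := by
    by_cases h : i = j
    · subst h
      rw [if_pos rfl, if_pos rfl, hrr, pow_two, ofReal_mul]
    · simp [h]
  have hd' : ((if i = j then lam i else 0 : ℝ)) = if j = i then lam j else 0 := by
    by_cases h : i = j
    · simp [h]
    · simp [h, Ne.symm h]
  change r j * r j * (nsq Y : ℂ) * _ - r j * r i * _ * _ - r i * r j * _ * _ + r i * r i * (nsq Y : ℂ) * _ = _
  rw [hrr, hrr, balancedCoeff, ← hd', mul_comm (r j) (r i)]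
  push_cast at hij hδ hτ ⊢
  linear_combination (exp := 1) (-((haarNorm a : ℂ) * haarNorm b)⁻¹ * (((card a : ℂ) * card b + 1) * ((if i = j then lam i ^ 2 else 0 : ℝ) : ℂ) - ((card a : ℂ) + card b) * (lam i * lam j))) * hτ + (-((haarNorm a : ℂ) * haarNorm b)⁻¹ * (hs Yᴴ Y + hs Y Yᴴ)) * (((card a : ℂ) * card b + 1) * hδ - ((card a : ℂ) + card b) * hij)

end BalancedAverage

end

section

section AverageBounds

lemma invLogMean_mul_sub_sq (x y : ℝ) : invLogMean x y * (x - y) ^ 2 = (x - y) * (log x - log y) :=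
    by
  unfold invLogMean
  split_ifs with h
  · simp [h]
  · have := sub_ne_zero.2 h
    field_simp

lemma invLogMean_bounds {x y : ℝ} (hx : 0 < x) (hy : 0 < y) : 0 < invLogMean x y ∧ 1 ≤ invLogMean x
    y * (x + y) ∧ invLogMean x y * (x * y) ≤ x + y := by
  unfold invLogMean
  split_ifs with h
  · subst h
    refine ⟨by positivity, ?_, ?_⟩
    · field_simp
      norm_num
    · field_simp
      nlinarith
  · have key : ∀ x y : ℝ, 0 < x → 0 < y → y < x → 0 < (log x - log y) / (x - y) ∧
        1 ≤ (log x - log y) / (x - y) * (x + y) ∧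
        (log x - log y) / (x - y) * (x * y) ≤ x + y := by
      intro x y hx hy hxy
      have hd := sub_pos.2 hxy
      have h1 : log x - log y ≤ x / y - 1 := by
        rw [← log_div hx.ne' hy.ne']
        exact log_le_sub_one_of_pos (by positivity)
      have h2 : 1 - y / x ≤ log x - log y := by
        rw [← log_div hx.ne' hy.ne']
        have := Real.one_sub_inv_le_log_of_pos (div_pos hx hy)
        rwa [inv_div] at this
      have h3 : x / y - 1 = (x - y) / y := by field_simp
      have h4 : 1 - y / x = (x - y) / x := by field_simp
      rw [h3] at h1
      rw [h4] at h2
      have h5 : (log x - log y) / (x - y) ≤ 1 / y := by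
        rw [div_le_div_iff₀ hd hy]
        rw [le_div_iff₀ hy] at h1
        linarith
      have h6 : 1 / x ≤ (log x - log y) / (x - y) := by
        rw [div_le_div_iff₀ hx hd]
        rw [div_le_iff₀ hx] at h2
        linarith
      refine ⟨lt_of_lt_of_le (by positivity) h6, ?_, ?_⟩
      · calc (1 : ℝ) = 1 / x * x := by field_simp
          _ ≤ 1 / x * (x + y) := by gcongr; linarith
          _ ≤ _ := by gcongr
      · calc _ ≤ 1 / y * (x * y) := by gcongr
          _ = x := by field_simp
          _ ≤ _ := by linarith
    rcases lt_or_gt_of_ne h with h' | h'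
    · have := key y x hy hx h'
      rwa [← neg_sub (log x), ← neg_sub x, neg_div_neg_eq, add_comm y, mul_comm y] at this
    · exact key x y hx hy h'

lemma sum_invLogMean_mul_add {lam : a → ℝ} (hlam : ∀ i, 0 < lam i) [Nonempty a] {r : ℝ} (hr : 0 < r)
    : ∑ i, ∑ j, invLogMean (lam i) (lam j) * (lam i + lam j) = 2 * (card a * r) * f₃ r lam := by
  have hd := card_pos_real a
  rw [f₃, ← mul_assoc, mul_assoc 2, mul_one_div_cancel (by positivity), mul_one, mul_sum]
  refine sum_congr rfl fun i _ => ?_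
  rw [mul_sum]
  refine sum_congr rfl fun j _ => ?_
  unfold invLogMean
  have hi := hlam i
  split_ifs with h
  · rw [← h]
    field_simp
    norm_num
  · have := sub_ne_zero.2 h
    rw [log_div hi.ne' (hlam j).ne']
    field_simp

lemma sum_invLogMean_mul_sub_sq {lam : a → ℝ} (hlam : ∀ i, 0 < lam i) [Nonempty a] : ∑ i, ∑ j,
    invLogMean (lam i) (lam j) * (lam i - lam j) ^ 2 = 2 * card a * f₁ lam := by
  have hd := card_pos_real a
  rw [f₁, ← mul_assoc, mul_one_div_cancel (by positivity), one_mul]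
  refine sum_congr rfl fun i _ => sum_congr rfl fun j _ => ?_
  rw [invLogMean_mul_sub_sq, log_div (hlam i).ne' (hlam j).ne']

lemma sum_invLogMean_mul_mul_le {lam : a → ℝ} (hlam : ∀ i, 0 < lam i) (hsum : ∑ i, lam i = 1) : ∑ i,
    ∑ j, invLogMean (lam i) (lam j) * (lam i * lam j) ≤ 2 * card a := by
  calc _ ≤ ∑ i, ∑ j, (lam i + lam j) := sum_le_sum fun i _ => sum_le_sum fun j _ =>
        (invLogMean_bounds (hlam i) (hlam j)).2.2
    _ = _ := by
      simp only [sum_add_distrib, sum_const, card_univ, nsmul_eq_mul, hsum, ← mul_sum]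
      ring

lemma f₁_nonneg {lam : a → ℝ} (hlam : ∀ i, 0 < lam i) [Nonempty a] : 0 ≤ f₁ lam := by
  have h := sum_invLogMean_mul_sub_sq hlam
  have h2 : 0 ≤ ∑ i, ∑ j, invLogMean (lam i) (lam j) * (lam i - lam j) ^ 2 :=
    sum_nonneg fun i _ => sum_nonneg fun j _ =>
      mul_nonneg (invLogMean_bounds (hlam i) (hlam j)).1.le (sq_nonneg _)
  have hd := card_pos_real a
  rw [h] at h2
  nlinarith [h2, hd]

lemma le_f₃ {lam : a → ℝ} (hlam : ∀ i, 0 < lam i) [Nonempty a] {r : ℝ} (hr : 0 < r) : (card a : ℝ) ≤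
    2 * r * f₃ r lam := by
  have hd := card_pos_real a
  have h : (card a : ℝ) * card a ≤ 2 * (card a * r) * f₃ r lam := by
    rw [← sum_invLogMean_mul_add hlam hr]
    calc (card a : ℝ) * card a = ∑ i : a, ∑ j : a, 1 := by simp
      _ ≤ _ := sum_le_sum fun i _ => sum_le_sum fun j _ =>
        (invLogMean_bounds (hlam i) (hlam j)).2.1
  refine le_of_mul_le_mul_left (h.trans_eq ?_) hd
  ring

lemma norm_hs_le {m n : Type} [Fintype m] [Fintype n] {X Y : Matrix m n ℂ} (h : nsq X = nsq Y) : |2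
    * (hs X Y).re| ≤ 2 * nsq Y := by
  have h1 := nsq_nonneg (X + Y)
  have h2 := nsq_nonneg (X - Y)
  have e1 : nsq (X + Y) = nsq X + nsq Y + 2 * (hs X Y).re := by
    have : (nsq (X + Y) : ℂ) = nsq X + nsq Y + (hs X Y + star (hs X Y)) := by
      rw [star_hs, ← hs_self, ← hs_self, ← hs_self, hs_add_left, hs_add_right, hs_add_right]
      ring
    rw [star_def, add_conj] at this
    exact_mod_cast this
  have e2 : nsq (X - Y) = nsq X + nsq Y - 2 * (hs X Y).re := by
    have : (nsq (X - Y) : ℂ) = nsq X + nsq Y - (hs X Y + star (hs X Y)) := by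
      rw [star_hs, ← hs_self, ← hs_self, ← hs_self, hs_sub_left, hs_sub_right, hs_sub_right]
      ring
    rw [star_def, add_conj] at this
    exact_mod_cast this
  rw [abs_le]
  constructor <;> linarith

lemma avgQuad_balanced [Nontrivial a] [Nontrivial b] (e : a ↪ b) {lam : a → ℝ} (hlam : ∀ i, 0 < lam
    i) (hsum : ∑ i, lam i = 1) {Y : TMat a b c} (hY : Balanced Y) : avgQuad e lam Y = (2 * (card c :
    ℝ))⁻¹ * ∑ i, ∑ j, invLogMean (lam i) (lam j) * balancedCoeff lam Y i j := by
  apply ofReal_injective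
  rw [ofReal_avgQuad]
  push_cast
  congr 1
  rw [sum_prod_type]
  refine sum_congr rfl fun i _ => ?_
  rw [sum_congr rfl fun s _ => sum_prod_type _, sum_comm]
  refine sum_congr rfl fun j _ => ?_
  rw [← sum_integral_areaEntry e hlam hsum hY, mul_sum]
  simp only [mul_sum]

/-- Leading coefficient of the average of a balanced operator, with its error. -/
lemma abs_avgQuad_balanced_sub_le [Nontrivial a] [Nontrivial b] [Nonempty c] (e : a ↪ b) {lam : a →
    ℝ} (hlam : ∀ i, 0 < lam i) (hsum : ∑ i, lam i = 1) {Y : TMat a b c} (hY : Balanced Y) {d r : ℝ}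
    (hd : d = card a) (hr : r = card b) (hdr : d ≤ r) : |avgQuad e lam Y - nsq Y * (d * r) / (card c
    * (d ^ 2 - 1) * (r ^ 2 - 1)) * f₃ r lam| ≤ 40 * (nsq Y / (d * r * card c)) * ((1 / d ^ 2 + 1 / r
    ^ 2) * (f₁ lam + f₃ r lam)) := by
  have hd2 : 2 ≤ d := by
    rw [hd]
    exact_mod_cast one_lt_card
  have hr2 : 2 ≤ r := hd2.trans hdr
  have hc0 : (0 : ℝ) < card c := by positivity
  have hA := nsq_nonneg Y
  set A := nsq Y with hAdef
  have hf1 := f₁_nonneg hlam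
  have hf3 := le_f₃ hlam (r := r) (by linarith)
  rw [← hd] at hf3
  have hf30 : 0 < f₃ r lam := by
    have h1 : 0 < 2 * r * f₃ r lam := by linarith
    have h2 : 0 < 2 * r := by linarith
    exact (mul_pos_iff_of_pos_left h2).1 h1
  set κ := haarNorm a * haarNorm b with hκ
  have hκe : κ = d * (d ^ 2 - 1) * (r * (r ^ 2 - 1)) := by
    rw [hκ, haarNorm, haarNorm, ← hd, ← hr]
  have hd1 : 3 / 4 * d ^ 2 ≤ d ^ 2 - 1 := by nlinarith
  have hr1 : 3 / 4 * r ^ 2 ≤ r ^ 2 - 1 := by nlinarith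
  have hκ1 : 9 / 16 * (d * r) ^ 3 ≤ κ := by
    calc 9 / 16 * (d * r) ^ 3 = d * (3 / 4 * d ^ 2) * (r * (3 / 4 * r ^ 2)) := by ring
      _ ≤ d * (d ^ 2 - 1) * (r * (r ^ 2 - 1)) := by gcongr; nlinarith
      _ = κ := hκe.symm
  have hκ0 : 0 < κ := lt_of_lt_of_le (by positivity) hκ1
  set L := fun i j => invLogMean (lam i) (lam j) with hL
  have hL0 : ∀ i j, 0 < L i j := fun i j => (invLogMean_bounds (hlam i) (hlam j)).1
  have hmain : A * (d * r) / (card c * (d ^ 2 - 1) * (r ^ 2 - 1)) * f₃ r lam =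
      (2 * (card c : ℝ))⁻¹ * ∑ i, ∑ j, L i j * (κ⁻¹ * (A * ((lam i + lam j) * (d * r)))) := by
    have h1 : ∑ i, ∑ j, L i j * (κ⁻¹ * (A * ((lam i + lam j) * (d * r)))) =
        κ⁻¹ * A * (d * r) * ∑ i, ∑ j, L i j * (lam i + lam j) := by
      simp only [mul_sum]
      exact sum_congr rfl fun i _ => sum_congr rfl fun j _ => by ring
    rw [h1, sum_invLogMean_mul_add hlam (r := r) (by linarith), ← hd, hκe]
    have h2 : d ^ 2 - 1 ≠ 0 := by nlinarith
    have h3 : r ^ 2 - 1 ≠ 0 := by nlinarith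
    field_simp
  have hterm : ∀ i j, |L i j * balancedCoeff lam Y i j -
      L i j * (κ⁻¹ * (A * ((lam i + lam j) * (d * r))))| ≤ κ⁻¹ * A * (d * (L i j * (lam i - lam j) ^ 2) +
        (4 * d + 4 * r) * (L i j * (lam i * lam j)) + (2 * (d * r) + 4) * if i = j then lam i else 0) := by
    intro i j
    have hi := hlam i
    have hj := hlam j
    have hδ : L i j * (if i = j then lam i ^ 2 else 0) = if i = j then lam i else 0 := by
      by_cases h : i = j
      · subst h
        simp only [hL, invLogMean, if_true]
        field_simp
      · simp [h]
    set δ := if i = j then lam i ^ 2 else 0 with hδd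
    have hδ0 : 0 ≤ δ := by
      rw [hδd]
      positivity
    have hδi : lam i * (if i = j then lam i else 0) = δ := by
      by_cases h : i = j <;> simp [hδd, h, pow_two]
    have hδj : lam j * (if i = j then lam i else 0) = δ := by
      by_cases h : i = j <;> simp [hδd, h, pow_two]
    have hτ : |2 * (hs Yᴴ Y).re| ≤ 2 * A := norm_hs_le (nsq_conjTranspose Y)
    have h1 : L i j * balancedCoeff lam Y i j - L i j * (κ⁻¹ * (A * ((lam i + lam j) * (d * r)))) =
        κ⁻¹ * L i j * (A * (2 * δ - d * (lam i ^ 2 + lam j ^ 2) - 2 * r * (lam i * lam j)) -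
          2 * (hs Yᴴ Y).re * ((d * r + 1) * δ - (d + r) * (lam i * lam j))) := by
      rw [balancedCoeff, ← hd, ← hr, ← hAdef, ← hδd, mul_add (lam j), mul_add (lam i), hδi, hδj]
      ring
    rw [h1, abs_mul, abs_of_pos (mul_pos (inv_pos.2 hκ0) (hL0 i j))]
    have h2 : |A * (2 * δ - d * (lam i ^ 2 + lam j ^ 2) - 2 * r * (lam i * lam j)) -
          2 * (hs Yᴴ Y).re * ((d * r + 1) * δ - (d + r) * (lam i * lam j))| ≤
        A * (2 * δ + d * (lam i ^ 2 + lam j ^ 2) + 2 * r * (lam i * lam j)) +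
          2 * A * ((d * r + 1) * δ + (d + r) * (lam i * lam j)) := by
      refine (abs_sub _ _).trans (add_le_add ?_ ?_)
      · rw [abs_mul, abs_of_nonneg hA]
        gcongr
        rw [abs_le]
        have : 0 ≤ d * (lam i ^ 2 + lam j ^ 2) + 2 * r * (lam i * lam j) := by positivity
        constructor <;> linarith
      · rw [abs_mul]
        gcongr
        rw [abs_le]
        have h3 : 0 ≤ (d * r + 1) * δ := by positivity
        have h4 : 0 ≤ (d + r) * (lam i * lam j) := by positivity
        constructor <;> linarith
    refine (mul_le_mul_of_nonneg_left h2 (mul_pos (inv_pos.2 hκ0) (hL0 i j)).le).trans_eq ?_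
    rw [← hδ]
    ring
  rw [hmain, avgQuad_balanced e hlam hsum hY, ← mul_sub, abs_mul, abs_of_pos (by positivity), ←
    sum_sub_distrib]
  simp only [← sum_sub_distrib]
  have hsum1 : |∑ i, ∑ j, (L i j * balancedCoeff lam Y i j -
      L i j * (κ⁻¹ * (A * ((lam i + lam j) * (d * r)))))| ≤
      κ⁻¹ * A * (d * (2 * d * f₁ lam) + (4 * d + 4 * r) * (2 * d) + (2 * (d * r) + 4)) := by
    refine (abs_sum_le_sum_abs _ _).trans ((sum_le_sum fun i _ =>
      (abs_sum_le_sum_abs _ _).trans (sum_le_sum fun j _ => hterm i j)).trans ?_)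
    have h1 : ∑ i, ∑ j, κ⁻¹ * A * (d * (L i j * (lam i - lam j) ^ 2) +
        (4 * d + 4 * r) * (L i j * (lam i * lam j)) + (2 * (d * r) + 4) * if i = j then lam i else 0) =
        κ⁻¹ * A * (d * (∑ i, ∑ j, L i j * (lam i - lam j) ^ 2) +
        (4 * d + 4 * r) * (∑ i, ∑ j, L i j * (lam i * lam j)) +
          (2 * (d * r) + 4) * ∑ i, ∑ j, if i = j then lam i else 0) := by
      simp only [mul_sum, ← sum_add_distrib]
    have h2 : ∑ i, ∑ j, (if i = j then lam i else 0) = 1 := by simp [hsum]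
    rw [h1, h2, sum_invLogMean_mul_sub_sq hlam, ← hd, mul_one]
    have h3 := sum_invLogMean_mul_mul_le hlam hsum
    rw [← hd] at h3
    gcongr
  have hE : d * (2 * d * f₁ lam) + (4 * d + 4 * r) * (2 * d) + (2 * (d * r) + 4) ≤
      2 * d ^ 2 * f₁ lam + 22 * (d * r) := by
    nlinarith [mul_le_mul_of_nonneg_left hdr (by linarith : 0 ≤ d), mul_le_mul hd2 hr2 (by norm_num) (by linarith)]
  calc _ ≤ (2 * (card c : ℝ))⁻¹ * (κ⁻¹ * A * (d * (2 * d * f₁ lam) +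
        (4 * d + 4 * r) * (2 * d) + (2 * (d * r) + 4))) := by gcongr
    _ ≤ (2 * (card c : ℝ))⁻¹ * ((9 / 16 * (d * r) ^ 3)⁻¹ * A * (2 * d ^ 2 * f₁ lam + 22 * (d * r))) := by
      refine mul_le_mul_of_nonneg_left (mul_le_mul (mul_le_mul_of_nonneg_right
        (inv_anti₀ (by positivity) hκ1) hA) hE (by positivity) (by positivity)) (by positivity)
    _ = 16 / 9 * (A / (d * r * card c)) * (f₁ lam * (1 / r ^ 2) + 11 * (1 / (d * r))) := by
      field_simp
      ring
    _ ≤ 16 / 9 * (A / (d * r * card c)) * (f₁ lam * (1 / r ^ 2) + 11 * (2 * f₃ r lam * (1 / d ^ 2))) := by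
      gcongr
      rw [mul_one_div, div_le_div_iff₀ (by positivity) (by positivity)]
      nlinarith
    _ ≤ _ := by
      have h1 : 0 ≤ A / (d * r * card c) := by positivity
      have h2 : 0 ≤ f₁ lam * (1 / r ^ 2) := by positivity
      have h3 : 0 ≤ f₁ lam * (1 / d ^ 2) := by positivity
      have h4 : 0 ≤ f₃ r lam * (1 / r ^ 2) := by positivity
      have h5 : 0 ≤ f₃ r lam * (1 / d ^ 2) := by positivity
      have h6 : 16 / 9 * (f₁ lam * (1 / r ^ 2) + 11 * (2 * f₃ r lam * (1 / d ^ 2))) ≤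
          40 * ((1 / d ^ 2 + 1 / r ^ 2) * (f₁ lam + f₃ r lam)) := by
        linarith
      nlinarith

end AverageBounds

end

section

section LocalAverages

/-- Mean square of an entry of the first-order change of the reduced state. -/
def areaMean (e : a ↪ b) (lam : a → ℝ) (Y : TMat a b c) (p q : a × c) : ℝ :=
  ∫ g, ‖areaEntry e lam (rotate g.1 g.2 Y) p q‖ ^ 2 ∂(haarProd a b)

lemma avgQuad_eq (e : a ↪ b) (lam : a → ℝ) (Y : TMat a b c) : avgQuad e lam Y = (2 * (card c : ℝ))⁻¹
    * ∑ p : a × c, ∑ q : a × c, invLogMean (lam p.1) (lam q.1) * areaMean e lam Y p q := by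
  apply ofReal_injective
  rw [ofReal_avgQuad]
  push_cast
  congr 1
  refine sum_congr rfl fun p _ => sum_congr rfl fun q _ => ?_
  rw [areaMean, ← integral_complex_ofReal]
  congr 1
  refine integral_congr_ae (Eventually.of_forall fun g => ?_)
  simp only [star_def, mul_conj', ofReal_pow]

lemma areaMean_add_add_le (e : a ↪ b) (lam : a → ℝ) (X Y Z : TMat a b c) (p q : a × c) : areaMean e
    lam (X + Y + Z) p q ≤ 3 * (areaMean e lam X p q + areaMean e lam Y p q + areaMean e lam Z p q)
    := by
  have hi : ∀ T : TMat a b c, Integrable (fun g : U(a) × U(b) =>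
        ‖areaEntry e lam (rotate g.1 g.2 T) p q‖ ^ 2) (haarProd a b) := fun T =>
    (Continuous.integrable_of_hasCompactSupport
      ((continuous_areaEntry_rotate e lam T p q).norm.pow 2) (HasCompactSupport.of_compactSpace _))
  simp only [areaMean]
  rw [← integral_add (hi X) (hi Y), ← integral_add ((hi X).fun_add (hi Y)) (hi Z), ←
    integral_const_mul]
  refine integral_mono (hi _) ((((hi X).fun_add (hi Y)).fun_add (hi Z)).const_mul 3) fun g => ?_
  simp only [rotate_add, areaEntry_add]
  generalize areaEntry e lam (rotate g.1 g.2 X) p q = x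
  generalize areaEntry e lam (rotate g.1 g.2 Y) p q = y
  generalize areaEntry e lam (rotate g.1 g.2 Z) p q = z
  have h : ‖x + y + z‖ ≤ ‖x‖ + ‖y‖ + ‖z‖ := norm_add₃_le
  have h0 := norm_nonneg (x + y + z)
  nlinarith [sq_nonneg (‖x‖ - ‖y‖), sq_nonneg (‖y‖ - ‖z‖), sq_nonneg (‖x‖ - ‖z‖)]

lemma integral_norm_adj_sq_le {n : Type} [Fintype n] [DecidableEq n] [Nontrivial n] {X : Mat n} (hX
    : X.trace = 0) (i l : n) : ∫ U : U(n), ‖adj U X i l‖ ^ 2 ∂(haarU n) ≤ nsq X / ((card n : ℝ) ^ 2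
    - 1) := by
  have h2 : (2 : ℝ) ≤ card n := by exact_mod_cast one_lt_card (α := n)
  have h1 : ∫ U : U(n), ‖adj U X i l‖ ^ 2 ∂(haarU n) =
      ((card n : ℝ) - if i = l then 1 else 0) / haarNorm n * nsq X := by
    apply ofReal_injective
    have h3 := integral_adj_mul_star hX X i l i l
    rw [haarCoeff_left, if_pos rfl, hs_self, ← ofReal_mul] at h3
    rw [← h3, ← integral_complex_ofReal]
    refine integral_congr_ae (Eventually.of_forall fun g => ?_)
    simp only [star_def, mul_conj', ofReal_pow]
  have h3 : 0 < (card n : ℝ) ^ 2 - 1 := by nlinarith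
  rw [h1, div_eq_inv_mul _ ((card n : ℝ) ^ 2 - 1)]
  refine mul_le_mul_of_nonneg_right ?_ (nsq_nonneg X)
  rw [haarNorm, div_le_iff₀ (by positivity), mul_comm (card n : ℝ), inv_mul_cancel_left₀ h3.ne']
  split_ifs <;> linarith

lemma adj_of_ite {n : Type} [Fintype n] [DecidableEq n] (U : U(n)) (z : ℂ) (j k : n) : adj U (of fun
    y y' => if y = y' then z else 0) j k = if j = k then z else 0 := by
  have h : (of fun y y' : n => if y = y' then z else 0) = z • (1 : Mat n) := by
    ext
    simp [Matrix.one_apply]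
  rw [h, adj_smul, adj_one, Matrix.smul_apply, Matrix.one_apply]
  simp

lemma adj_zero {n : Type} [Fintype n] [DecidableEq n] (U : U(n)) : adj U (0 : Mat n) = 0 := by
  rw [adj, Matrix.mul_zero, Matrix.zero_mul]

lemma rotate_liftA (U : U(a)) (U' : U(b)) (X : Mat (a × c)) (i l : a) (j k : b) (s t : c) : rotate U
    U' (liftA X) ((i, j), s) ((l, k), t) = if j = k then adj U (of fun x x' => X (x, s) (x', t)) i l
    else 0 := by
  rw [rotate_apply, ← adj_of_ite U']
  congr 2
  ext y y'
  by_cases h : y = y'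
  · subst h
    simp only [if_true]
    congr 1
    ext x x'
    simp [sliceA, liftA]
  · have h1 : sliceA (liftA (b := b) X) y y' s t = 0 := by
      ext x x'
      simp [sliceA, liftA, h]
    simp [h1, h, adj_zero]

lemma rotate_liftB (U : U(a)) (U' : U(b)) (X : Mat (b × c)) (i l : a) (j k : b) (s t : c) : rotate U
    U' (liftB X) ((i, j), s) ((l, k), t) = if i = l then adj U' (of fun y y' => X (y, t) (y', s)) j
    k else 0 := by
  have h : ∀ y y', sliceA (liftB (a := a) X) y y' s t =
      of fun x x' => if x = x' then X (y, t) (y', s) else 0 := fun y y' => rfl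
  rw [rotate_apply]
  simp only [h, adj_of_ite]
  by_cases hil : i = l
  · simp [hil]
  · simp only [hil, if_false]
    exact congrFun (congrFun (adj_zero U') j) k

lemma rotate_one_kronecker (U : U(a)) (U' : U(b)) (Z : Mat c) (i l : a) (j k : b) (s t : c) : rotate
    U U' ((1 : Mat (a × b)) ⊗ₖ Z) ((i, j), s) ((l, k), t) = if i = l then if j = k then Z s t else 0
    else 0 := by
  have h : ((1 : Mat (a × b)) ⊗ₖ Z) =
      liftA (of fun p q : a × c => if p.1 = q.1 then Z p.2 q.2 else 0) := by
    ext ⟨⟨x, y⟩, s⟩ ⟨⟨x', y'⟩, t⟩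
    simp only [kroneckerMap_apply, Matrix.one_apply, liftA, of_apply, Prod.mk.injEq]
    split_ifs <;> simp_all
  rw [h, rotate_liftA]
  simp only [of_apply]
  rw [adj_of_ite]
  split_ifs <;> rfl

lemma areaEntry_rotate_anti (e : a ↪ b) (lam : a → ℝ) {Y : TMat a b c} (hY : Yᴴ = -Y) (U : U(a)) (U'
    : U(b)) (i j : a) (s t : c) : areaEntry e lam (rotate U U' Y) (i, s) (j, t) = ∑ l, rt(lam l) *
    (rt(lam j) * rotate U U' Y ((i, e j), s) ((l, e l), t) + rt(lam i) * rotate U U' Y ((l, e l), s)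
    ((j, e i), t)) := by
  have h : rotate U U' Yᴴ = -rotate U U' Y := by
    rw [hY, ← neg_one_smul ℂ Y, rotate_smul, neg_one_smul]
  simp only [areaEntry_rotate, h, Matrix.neg_apply, mul_neg, sub_neg_eq_add]

lemma ofReal_sqrt_mul_self {x : ℝ} (hx : 0 ≤ x) : ((√x : ℝ) : ℂ) * ((√x : ℝ) : ℂ) = x := by
  rw [← ofReal_mul, mul_self_sqrt hx]

variable {lam : a → ℝ}

lemma areaMean_liftA_le [Nontrivial a] (e : a ↪ b) (hlam : ∀ i, 0 < lam i) {X : Mat (a × c)} (hX :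
    (liftA (b := b) X)ᴴ = -liftA X) (htr : ∀ s t, ∑ x, X (x, s) (x, t) = 0) (i j : a) (s t : c) :
    areaMean e lam (liftA X) (i, s) (j, t) ≤ (lam i + lam j) ^ 2 * (nsq (of fun x x' => X (x, s)
    (x', t)) / ((card a : ℝ) ^ 2 - 1)) := by
  have h : ∀ g : U(a) × U(b),
      ‖areaEntry e lam (rotate g.1 g.2 (liftA X)) (i, s) (j, t)‖ ^ 2 = (lam i + lam j) ^ 2 *
        ‖adj g.1 (of fun x x' => X (x, s) (x', t)) i j‖ ^ 2 := by
    intro g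
    rw [areaEntry_rotate_anti e lam hX]
    simp only [rotate_liftA, e.injective.eq_iff, mul_add, mul_ite, mul_zero, sum_add_distrib,
      sum_ite_eq, sum_ite_eq', mem_univ, if_true]
    rw [← mul_assoc, ← mul_assoc, ofReal_sqrt_mul_self (hlam i).le, ofReal_sqrt_mul_self (hlam
      j).le, ← add_mul, norm_mul, mul_pow, ← ofReal_add, norm_real, norm_eq_abs, sq_abs, add_comm
      (lam j)]
  rw [areaMean]
  simp only [h]
  rw [integral_const_mul, integral_fun_fst (fun U : U(a) => ‖adj U (of fun x x' => X (x, s) (x', t))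
    i j‖ ^ 2), probReal_univ, one_smul]
  exact mul_le_mul_of_nonneg_left (integral_norm_adj_sq_le
    (X := of fun x x' => X (x, s) (x', t)) (htr s t) i j) (sq_nonneg _)

lemma areaMean_liftB_le [Nontrivial b] (e : a ↪ b) (hlam : ∀ i, 0 < lam i) {X : Mat (b × c)} (hX :
    (liftB (a := a) X)ᴴ = -liftB X) (htr : ∀ s t, ∑ y, X (y, t) (y, s) = 0) (i j : a) (s t : c) :
    areaMean e lam (liftB X) (i, s) (j, t) ≤ 4 * (lam i * lam j) * (nsq (of fun y y' => X (y, t)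
    (y', s)) / ((card b : ℝ) ^ 2 - 1)) := by
  have h : ∀ g : U(a) × U(b),
      ‖areaEntry e lam (rotate g.1 g.2 (liftB X)) (i, s) (j, t)‖ ^ 2 = 4 * (lam i * lam j) *
        ‖adj g.2 (of fun y y' => X (y, t) (y', s)) (e j) (e i)‖ ^ 2 := by
    intro g
    rw [areaEntry_rotate_anti e lam hX]
    simp only [rotate_liftB, mul_add, mul_ite, mul_zero, sum_add_distrib, sum_ite_eq, sum_ite_eq',
      mem_univ, if_true]
    rw [← mul_assoc, ← mul_assoc, mul_comm rt(lam j), ← add_mul, ← two_mul, norm_mul, mul_pow,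
      norm_mul, norm_mul, norm_real, norm_real, norm_eq_abs, norm_eq_abs, mul_pow, mul_pow, sq_abs,
      sq_abs, sq_sqrt (hlam i).le, sq_sqrt (hlam j).le, norm_ofNat]
    ring
  rw [areaMean]
  simp only [h]
  rw [integral_const_mul, integral_fun_snd (fun U : U(b) => ‖adj U (of fun y y' => X (y, t) (y', s))
    (e j) (e i)‖ ^ 2), probReal_univ, one_smul]
  have := hlam i
  have := hlam j
  exact mul_le_mul_of_nonneg_left (integral_norm_adj_sq_le
    (X := of fun y y' => X (y, t) (y', s)) (htr s t) _ _) (by positivity)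

lemma areaMean_one_kronecker (e : a ↪ b) (hlam : ∀ i, 0 < lam i) {Z : Mat c} (hZ : ((1 : Mat (a ×
    b)) ⊗ₖ Z)ᴴ = -((1 : Mat (a × b)) ⊗ₖ Z)) (i j : a) (s t : c) : areaMean e lam ((1 : Mat (a × b))
    ⊗ₖ Z) (i, s) (j, t) = (if i = j then lam i ^ 2 else 0) * (4 * ‖Z s t‖ ^ 2) := by
  have h : ∀ g : U(a) × U(b),
      ‖areaEntry e lam (rotate g.1 g.2 ((1 : Mat (a × b)) ⊗ₖ Z)) (i, s) (j, t)‖ ^ 2 =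
        (if i = j then lam i ^ 2 else 0) * (4 * ‖Z s t‖ ^ 2) := by
    intro g
    rw [areaEntry_rotate_anti e lam hZ]
    by_cases hij : i = j
    · subst hij
      simp only [rotate_one_kronecker, mul_add, mul_ite, mul_zero, sum_add_distrib, sum_ite_eq,
        sum_ite_eq', mem_univ, if_true, e.injective.eq_iff]
      rw [← mul_assoc, ofReal_sqrt_mul_self (hlam i).le, ← two_mul, norm_mul, norm_mul, norm_real,
        norm_ofNat, norm_eq_abs, mul_pow, mul_pow, sq_abs]
      ring
    · have h1 : ∀ l : a, rt(lam l) *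
          (rt(lam j) * (if i = l then if e j = e l then Z s t else 0 else 0) +
          rt(lam i) * (if l = j then if e l = e i then Z s t else 0 else 0)) = 0 := by
        intro l
        simp only [e.injective.eq_iff]
        by_cases h2 : i = l
        · subst h2
          simp [hij, Ne.symm hij]
        · simp only [h2, Ne.symm h2, if_false, ite_self, mul_zero, add_zero]
      simp only [rotate_one_kronecker, h1, hij, sum_const_zero, norm_zero, if_false]
      ring
  rw [areaMean]
  simp only [h, integral_const, probReal_univ, one_smul]

end LocalAverages

end

section

section LocalBounds

lemma nsq_liftA (X : Mat (a × c)) : nsq (liftA (b := b) X) = card b * nsq X := by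
  have h : ∀ (x : a) (y : b) (s : c), ∑ q : Tri a b c, ‖liftA (b := b) X ((x, y), s) q‖ ^ 2 =
      ∑ x', ∑ t, ‖X (x, s) (x', t)‖ ^ 2 := by
    intro x y s
    simp only [sum_prod_type, liftA, of_apply]
    refine sum_congr rfl fun x' _ => ?_
    rw [sum_eq_single y (fun k _ hk => by simp [Ne.symm hk]) (by simp)]
    simp
  simp only [nsq]
  rw [sum_prod_type, sum_prod_type]
  simp only [h, sum_const, card_univ, nsmul_eq_mul, sum_prod_type, mul_sum]

lemma nsq_liftB (X : Mat (b × c)) : nsq (liftB (a := a) X) = card a * nsq X := by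
  have h : ∀ (x : a) (y : b) (s : c), ∑ q : Tri a b c, ‖liftB (a := a) X ((x, y), s) q‖ ^ 2 =
      ∑ y', ∑ t, ‖X (y, t) (y', s)‖ ^ 2 := by
    intro x y s
    simp only [sum_prod_type, liftB, of_apply]
    rw [sum_eq_single x (fun k _ hk => by simp [Ne.symm hk]) (by simp)]
    simp
  simp only [nsq]
  rw [sum_prod_type, sum_prod_type]
  simp only [h, sum_const, card_univ, nsmul_eq_mul, sum_prod_type]
  congr 1
  refine sum_congr rfl fun y _ => ?_
  rw [sum_comm]
  conv_rhs => rw [sum_comm]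
  exact sum_congr rfl fun y' _ => sum_comm

lemma sum_pair_mul {α β : Type} [Fintype α] [Fintype β] (f : α → α → ℝ) (g : β → β → ℝ) : ∑ p : α ×
    β, ∑ q : α × β, f p.1 q.1 * g p.2 q.2 = (∑ i, ∑ j, f i j) * ∑ s, ∑ t, g s t := by
  simp only [sum_prod_type, ← mul_sum, ← sum_mul]

lemma sum_nsq_block {α β : Type} [Fintype α] [Fintype β] (X : Mat (α × β)) : ∑ s, ∑ t, nsq (of fun x
    x' => X (x, s) (x', t)) = nsq X := by
  simp only [nsq, of_apply, sum_prod_type]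
  rw [Finset.sum_comm.symm.trans sum_comm]
  refine (sum_congr rfl fun s _ => sum_comm).trans (Finset.sum_comm.trans ?_)
  refine sum_congr rfl fun x _ => sum_congr rfl fun s _ => sum_comm

lemma avgQuad_local_le [Nontrivial a] [Nontrivial b] [Nonempty c] (e : a ↪ b) {lam : a → ℝ} (hlam :
    ∀ i, 0 < lam i) (hsum : ∑ i, lam i = 1) {Ya Yb Yc : TMat a b c} (ha : expB a b c Ya = Ya) (ha' :
    expA a b c Ya = 0) (hYa : Yaᴴ = -Ya) (hb : expA a b c Yb = Yb) (hb' : expB a b c Yb = 0) (hYb :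
    Ybᴴ = -Yb) (hc : expA a b c Yc = Yc) (hc' : expB a b c Yc = Yc) (hYc : Ycᴴ = -Yc) {d r : ℝ} (hd
    : d = card a) (hr : r = card b) : avgQuad e lam (Ya + Yb + Yc) ≤ (card c : ℝ)⁻¹ * ((3 * d * f₁
    lam + 12 * d) * (nsq Ya / r / (d ^ 2 - 1)) + 12 * d * (nsq Yb / d / (r ^ 2 - 1)) + 6 * (nsq Yc /
    (d * r))) := by
  have hd0 : 0 < d := by rw [hd]; positivity
  have hr0 : 0 < r := by rw [hr]; positivity
  have hd2 : (2 : ℝ) ≤ d := by rw [hd]; exact_mod_cast one_lt_card (α := a)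
  have hr2 : (2 : ℝ) ≤ r := by rw [hr]; exact_mod_cast one_lt_card (α := b)
  have hd1 : 0 < d ^ 2 - 1 := by nlinarith
  have hr1 : 0 < r ^ 2 - 1 := by nlinarith
  have hI : ∀ Y : TMat a b c, Yᴴ = -Y → (I • Y)ᴴ = I • Y := by
    intro Y hY
    rw [conjTranspose_smul, hY, star_def, conj_I, neg_smul, smul_neg, neg_neg]
  have hII : ∀ Y : TMat a b c, (-I) • I • Y = Y := by
    intro Y
    rw [smul_smul, neg_mul, I_mul_I, neg_neg, one_smul]
  obtain ⟨X, rfl⟩ : ∃ X, liftA X = Ya := by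
    obtain ⟨X, -, hX⟩ := exists_liftA (Y := I • Ya) (by rw [map_smul, ha]) (hI Ya hYa)
    exact ⟨(-I) • X, by rw [liftA_smul, hX, hII]⟩
  obtain ⟨Z, rfl⟩ : ∃ Z, liftB Z = Yb := by
    obtain ⟨X, -, hX⟩ := exists_liftB (Y := I • Yb) (by rw [map_smul, hb]) (hI Yb hYb)
    exact ⟨(-I) • X, by rw [liftB_smul, hX, hII]⟩
  obtain ⟨Q, rfl⟩ := exists_one_kronecker hc hc'
  have htrX : ∀ s t, ∑ x, X (x, s) (x, t) = 0 := by
    intro s t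
    obtain ⟨x⟩ := (inferInstance : Nonempty a)
    obtain ⟨y⟩ := (inferInstance : Nonempty b)
    have h := congrFun (congrFun ha' ((x, y), s)) ((x, y), t)
    rw [expA_apply, if_pos rfl] at h
    simpa [liftA, card_ne_zero] using h
  have htrZ : ∀ s t, ∑ y, Z (y, t) (y, s) = 0 := by
    intro s t
    obtain ⟨x⟩ := (inferInstance : Nonempty a)
    obtain ⟨y⟩ := (inferInstance : Nonempty b)
    have h := congrFun (congrFun hb' ((x, y), s)) ((x, y), t)
    rw [expB_apply, if_pos rfl] at h
    simpa [liftB, card_ne_zero] using h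
  set L := fun i j => invLogMean (lam i) (lam j) with hL
  have hL0 : ∀ i j, 0 < L i j := fun i j => (invLogMean_bounds (hlam i) (hlam j)).1
  set gA := fun s t : c => nsq (of fun x x' => X (x, s) (x', t)) with hgA
  set gB := fun s t : c => nsq (of fun y y' => Z (y, t) (y', s)) with hgB
  have hbound : ∑ p : a × c, ∑ q : a × c, L p.1 q.1 *
      areaMean e lam (liftA X + liftB Z + (1 : Mat (a × b)) ⊗ₖ Q) p q ≤
      3 * ((∑ i, ∑ j, L i j * (lam i + lam j) ^ 2) * (nsq X / (d ^ 2 - 1)) +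
        (∑ i, ∑ j, L i j * (4 * (lam i * lam j))) * (nsq Z / (r ^ 2 - 1)) +
        (∑ i, ∑ j, L i j * if i = j then lam i ^ 2 else 0) * (4 * nsq Q)) := by
    have hA : nsq X / (d ^ 2 - 1) = ∑ s, ∑ t, gA s t / (d ^ 2 - 1) := by
      simp only [← sum_div]
      rw [hgA, sum_nsq_block]
    have hB : nsq Z / (r ^ 2 - 1) = ∑ s, ∑ t, gB s t / (r ^ 2 - 1) := by
      simp only [← sum_div]
      rw [hgB, sum_comm, sum_nsq_block]
    have hC : 4 * nsq Q = ∑ s, ∑ t, 4 * ‖Q s t‖ ^ 2 := by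
      rw [nsq, mul_sum]
      simp only [mul_sum]
    rw [hA, hB, hC, ← sum_pair_mul, ← sum_pair_mul, ← sum_pair_mul, ← sum_add_distrib, ←
      sum_add_distrib, mul_sum]
    refine sum_le_sum fun p _ => ?_
    rw [← sum_add_distrib, ← sum_add_distrib, mul_sum]
    refine sum_le_sum fun q _ => ?_
    obtain ⟨i, s⟩ := p
    obtain ⟨j, t⟩ := q
    have h1 := areaMean_liftA_le (b := b) e hlam hYa htrX i j s t
    have h2 := areaMean_liftB_le e hlam hYb htrZ i j s t
    have h3 := areaMean_one_kronecker e hlam hYc i j s t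
    rw [← hd] at h1
    rw [← hr] at h2
    refine (mul_le_mul_of_nonneg_left ((areaMean_add_add_le e lam _ _ _ _ _).trans
      (mul_le_mul_of_nonneg_left (add_le_add (add_le_add h1 h2) h3.le) (by norm_num)))
      (hL0 i j).le).trans_eq ?_
    simp only [hgA, hgB]
    ring
  have hS1 : ∑ i, ∑ j, L i j * (lam i + lam j) ^ 2 ≤ 2 * d * f₁ lam + 8 * d := by
    have h1 : ∀ i j, L i j * (lam i + lam j) ^ 2 =
        L i j * (lam i - lam j) ^ 2 + 4 * (L i j * (lam i * lam j)) := fun i j => by ring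
    simp only [h1, sum_add_distrib, ← mul_sum]
    rw [sum_invLogMean_mul_sub_sq hlam, hd]
    linarith [sum_invLogMean_mul_mul_le hlam hsum]
  have hS2 : ∑ i, ∑ j, L i j * (4 * (lam i * lam j)) ≤ 8 * d := by
    have h1 : ∀ i j, L i j * (4 * (lam i * lam j)) = 4 * (L i j * (lam i * lam j)) :=
      fun i j => by ring
    simp only [h1, ← mul_sum]
    rw [hd]
    linarith [sum_invLogMean_mul_mul_le hlam hsum]
  have hS3 : ∑ i, ∑ j, L i j * (if i = j then lam i ^ 2 else 0) = 1 := by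
    rw [← hsum]
    refine sum_congr rfl fun i _ => ?_
    rw [sum_eq_single i (fun j _ hj => by simp [Ne.symm hj]) (by simp)]
    have := hlam i
    simp only [hL, invLogMean, if_true]
    field_simp
  have hnA : nsq (liftA (b := b) X) / r = nsq X := by
    rw [nsq_liftA, ← hr, mul_div_cancel_left₀ _ hr0.ne']
  have hnB : nsq (liftB (a := a) Z) / d = nsq Z := by
    rw [nsq_liftB, ← hd, mul_div_cancel_left₀ _ hd0.ne']
  have hnC : nsq ((1 : Mat (a × b)) ⊗ₖ Q) / (d * r) = nsq Q := by
    have h1 : nsq (1 : Mat (a × b)) = d * r := by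
      simp [nsq, Matrix.one_apply, apply_ite, hd, hr]
    rw [nsq_kronecker, h1, mul_div_cancel_left₀ _ (by positivity)]
  rw [hnA, hnB, hnC, avgQuad_eq]
  refine (mul_le_mul_of_nonneg_left hbound (by positivity)).trans ?_
  rw [hS3]
  have hX0 : 0 ≤ nsq X / (d ^ 2 - 1) := div_nonneg (nsq_nonneg _) hd1.le
  have hZ0 : 0 ≤ nsq Z / (r ^ 2 - 1) := div_nonneg (nsq_nonneg _) hr1.le
  rw [mul_inv, mul_comm (2 : ℝ)⁻¹, mul_assoc]
  refine mul_le_mul_of_nonneg_left ?_ (by positivity)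
  nlinarith [mul_le_mul_of_nonneg_right hS1 hX0, mul_le_mul_of_nonneg_right hS2 hZ0]

lemma blockHs_eq_zero_of_expB {Y Y' : TMat a b c} (hY : Balanced Y) (h : expB a b c Y' = Y') (s t :
    c) : blockHs Y' Y s t = 0 := by
  have h1 : blockHs Y' Y s t = ∑ y, ∑ x, ∑ l, ∑ y',
      star (Y' ((x, y), s) ((l, y'), t)) * Y ((x, y), s) ((l, y'), t) := by
    simp only [blockHs, hs]
    refine sum_congr rfl fun y _ => ?_
    rw [sum_comm]
    exact sum_congr rfl fun x _ => sum_comm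
  rw [h1, ← h, sum_comm]
  refine sum_eq_zero fun x _ => ?_
  rw [sum_comm]
  refine sum_eq_zero fun l _ => ?_
  have h4 := congrFun (congrFun (hY.2 s t) x) l
  rw [Matrix.sum_apply] at h4
  simp only [expB_apply, apply_ite star, star_zero, ite_mul, zero_mul, sum_ite_eq, mem_univ, if_true]
  rw [← mul_sum]
  exact mul_eq_zero_of_right _ h4

lemma blockHs_eq_zero_of_expA {Y Y' : TMat a b c} (hY : Balanced Y) (h : expA a b c Y' = Y') (s t :
    c) : blockHs Y' Y s t = 0 := by
  rw [blockHs]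
  refine sum_eq_zero fun y _ => sum_eq_zero fun y' _ => ?_
  rw [hs, ← h]
  simp only [sliceA, of_apply, expA_apply, apply_ite star, star_zero, ite_mul, zero_mul, sum_ite_eq,
    mem_univ, if_true]
  rw [← mul_sum]
  have h3 := hY.1 y y' s t
  simp only [trace, diag_apply, sliceA, of_apply] at h3
  rw [h3, mul_zero]

lemma balanced_of_exp [Nonempty a] [Nonempty b] {Y : TMat a b c} (hA : expA a b c Y = 0) (hB : expB
    a b c Y = 0) : Balanced Y := by
  constructor
  · intro y y' s t
    obtain ⟨x⟩ := ‹Nonempty a›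
    have h := congrFun (congrFun hA ((x, y), s)) ((x, y'), t)
    rw [expA_apply, if_pos rfl] at h
    simpa [card_ne_zero, trace, sliceA] using h
  · intro s t
    obtain ⟨y⟩ := ‹Nonempty b›
    ext x l
    have h := congrFun (congrFun hB ((x, y), s)) ((l, y), t)
    rw [expB_apply, if_pos rfl] at h
    rw [Matrix.sum_apply]
    simpa [sliceA, card_ne_zero] using h

lemma blockHs_add (X X' Y : TMat a b c) (s t : c) : blockHs (X + X') Y s t = blockHs X Y s t +
    blockHs X' Y s t := by
  simp only [blockHs, ← sum_add_distrib]
  exact sum_congr rfl fun y _ => sum_congr rfl fun y' _ => hs_add_left _ _ _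

lemma local_estimate {d r C k S A0 Na Nb Nc F1 F3 : ℝ} (hd2 : 2 ≤ d) (hdr : d ≤ r) (hC : 0 ≤ C) (hc0
    : 0 < k) (hf1 : 0 ≤ F1) (hf30 : 0 < F3) (hf3 : d ≤ 2 * r * F3) (n0 : 0 ≤ A0) (hA' : Na ≤ C * A0
    / r ^ 2) (hB' : Nb ≤ C * A0 / d ^ 2) (hC' : Nc ≤ C * A0 / (d * r)) (h3 : S ≤ k⁻¹ * ((3 * d * F1
    + 12 * d) * (Na / r / (d ^ 2 - 1)) + 12 * d * (Nb / d / (r ^ 2 - 1)) + 6 * (Nc / (d * r)))) : S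
    ≤ (d * r * k)⁻¹ * (C * A0) * (76 * ((1 / d ^ 2 + 1 / r ^ 2) * (F1 + F3))) := by
  have hr2 : (2 : ℝ) ≤ r := hd2.trans hdr
  have hd1 : 3 / 4 * d ^ 2 ≤ d ^ 2 - 1 := by nlinarith
  have hr1 : 3 / 4 * r ^ 2 ≤ r ^ 2 - 1 := by nlinarith
  have hdr0 : 0 < d * r := by positivity
  set w := (d * r * k)⁻¹ with hw
  have hw0 : 0 < w := by positivity
  set x := 1 / d ^ 2 with hx
  set y := 1 / r ^ 2 with hy
  have hx0 : 0 < x := by positivity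
  have hy0 : 0 < y := by positivity
  have hxy : 1 / (d * r) ≤ 2 * F3 * x := by
    rw [hx, mul_one_div, div_le_div_iff₀ (by positivity) (by positivity)]
    nlinarith
  have hyx : y ≤ 1 / (d * r) := by
    rw [hy]
    exact one_div_le_one_div_of_le hdr0 (by nlinarith)
  have e1 : Na / r / (d ^ 2 - 1) ≤ C * A0 * y / r / (3 / 4 * d ^ 2) := by
    have : C * A0 / r ^ 2 = C * A0 * y := by rw [hy]; ring
    rw [← this]
    gcongr
  have e2 : Nb / d / (r ^ 2 - 1) ≤ C * A0 / d ^ 2 / d / (3 / 4 * r ^ 2) := by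
    gcongr
  have e3 : Nc / (d * r) ≤ C * A0 / (d * r) / (d * r) := by gcongr
  have e4 : S ≤ k⁻¹ * ((3 * d * F1 + 12 * d) * (C * A0 * y / r / (3 / 4 * d ^ 2)) +
      12 * d * (C * A0 / d ^ 2 / d / (3 / 4 * r ^ 2)) + 6 * (C * A0 / (d * r) / (d * r))) := by
    refine h3.trans ?_
    gcongr
  have e5 : k⁻¹ * ((3 * d * F1 + 12 * d) * (C * A0 * y / r / (3 / 4 * d ^ 2)) +
      12 * d * (C * A0 / d ^ 2 / d / (3 / 4 * r ^ 2)) + 6 * (C * A0 / (d * r) / (d * r))) =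
      w * (C * A0) * ((4 * F1 + 16) * y + 22 * (1 / (d * r))) := by
    rw [hw]
    field_simp
    ring
  refine (e4.trans_eq e5).trans (mul_le_mul_of_nonneg_left ?_ (by positivity))
  have g1 : 0 ≤ x * F1 := by positivity
  have g2 : 0 ≤ y * F1 := by positivity
  have g3 : 0 ≤ y * F3 := by positivity
  nlinarith

lemma abs_sub_le_of_estimates {d r C k S S0 A0 Na Nb Nc F1 F3 : ℝ} (hd2 : 2 ≤ d) (hdr : d ≤ r) (hC :
    0 ≤ C) (hc0 : 0 < k) (hf1 : 0 ≤ F1) (hf30 : 0 < F3) (hf3 : d ≤ 2 * r * F3) (n0 : 0 ≤ A0) (na : 0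
    ≤ Na) (nb : 0 ≤ Nb) (h0 : 0 ≤ S) (hA' : Na ≤ C * A0 / r ^ 2) (hB' : Nb ≤ C * A0 / d ^ 2) (hC' :
    Nc ≤ C * A0 / (d * r)) (h2 : |S0 - A0 * (d * r) / (k * (d ^ 2 - 1) * (r ^ 2 - 1)) * F3| ≤ 40 *
    (A0 / (d * r * k)) * ((1 / d ^ 2 + 1 / r ^ 2) * (F1 + F3))) (h3 : S ≤ k⁻¹ * ((3 * d * F1 + 12 *
    d) * (Na / r / (d ^ 2 - 1)) + 12 * d * (Nb / d / (r ^ 2 - 1)) + 6 * (Nc / (d * r)))) : |S0 + S -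
    (1 - 1 / d ^ 2)⁻¹ * (1 - 1 / r ^ 2)⁻¹ * ((A0 + Na + Nb) / (d * r * k)) * F3| ≤ (40 + 78 * C) *
    (1 / d ^ 2 + 1 / r ^ 2) * ((A0 + Na + Nb) / (d * r * k)) * (F1 + F3) := by
  have hr2 : (2 : ℝ) ≤ r := hd2.trans hdr
  have hd1 : 3 / 4 * d ^ 2 ≤ d ^ 2 - 1 := by nlinarith
  have hr1 : 3 / 4 * r ^ 2 ≤ r ^ 2 - 1 := by nlinarith
  have hd3 : 0 < d ^ 2 - 1 := lt_of_lt_of_le (by positivity) hd1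
  have hr3 : 0 < r ^ 2 - 1 := lt_of_lt_of_le (by positivity) hr1
  have hdr0 : 0 < d * r := by positivity
  set w := (d * r * k)⁻¹ with hw
  have hw0 : 0 < w := by positivity
  set x := 1 / d ^ 2 with hx
  set y := 1 / r ^ 2 with hy
  have hx0 : 0 < x := by positivity
  have hy0 : 0 < y := by positivity
  have hrest := local_estimate hd2 hdr hC hc0 hf1 hf30 hf3 n0 hA' hB' hC' h3
  have hmain : (1 - 1 / d ^ 2)⁻¹ * (1 - 1 / r ^ 2)⁻¹ * ((A0 + Na + Nb) / (d * r * k)) * F3 =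
      A0 * (d * r) / (k * (d ^ 2 - 1) * (r ^ 2 - 1)) * F3 +
        (Na + Nb) * (w * ((d ^ 2 / (d ^ 2 - 1)) * (r ^ 2 / (r ^ 2 - 1)))) * F3 := by
    have h7 : 1 - 1 / d ^ 2 = (d ^ 2 - 1) / d ^ 2 := by field_simp
    have h8 : 1 - 1 / r ^ 2 = (r ^ 2 - 1) / r ^ 2 := by field_simp
    rw [h7, h8, hw]
    field_simp
    ring
  have hextra : (Na + Nb) * (w * ((d ^ 2 / (d ^ 2 - 1)) * (r ^ 2 / (r ^ 2 - 1)))) * F3 ≤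
      w * (C * A0) * (2 * ((x + y) * (F1 + F3))) := by
    have g1 : d ^ 2 / (d ^ 2 - 1) ≤ 4 / 3 := by rw [div_le_iff₀ hd3]; linarith
    have g2 : r ^ 2 / (r ^ 2 - 1) ≤ 4 / 3 := by rw [div_le_iff₀ hr3]; linarith
    have g3 : Na + Nb ≤ C * A0 * (x + y) := by
      rw [hx, hy, mul_add, mul_one_div, mul_one_div]
      linarith
    calc _ ≤ (C * A0 * (x + y)) * (w * (4 / 3 * (4 / 3))) * F3 := by gcongr
      _ = w * (C * A0) * (16 / 9 * ((x + y) * F3)) := by ring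
      _ ≤ _ := by
        gcongr
        · norm_num
        · linarith
  have hextra0 : 0 ≤ (Na + Nb) * (w * ((d ^ 2 / (d ^ 2 - 1)) * (r ^ 2 / (r ^ 2 - 1)))) * F3 := by
    positivity
  have hfin : w * A0 * ((40 + 78 * C) * ((x + y) * (F1 + F3))) ≤
      (40 + 78 * C) * (x + y) * ((A0 + Na + Nb) / (d * r * k)) * (F1 + F3) := by
    have : (40 + 78 * C) * (x + y) * ((A0 + Na + Nb) / (d * r * k)) * (F1 + F3) =
        w * (A0 + Na + Nb) * ((40 + 78 * C) * ((x + y) * (F1 + F3))) := by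
      rw [hw]
      ring
    rw [this]
    gcongr
    linarith
  have h2' : |S0 - A0 * (d * r) / (k * (d ^ 2 - 1) * (r ^ 2 - 1)) * F3| ≤
      w * A0 * (40 * ((x + y) * (F1 + F3))) := by
    refine h2.trans_eq ?_
    rw [hw]
    ring
  refine le_trans ?_ hfin
  rw [hmain]
  have hsum : w * A0 * ((40 + 78 * C) * ((x + y) * (F1 + F3))) =
      w * A0 * (40 * ((x + y) * (F1 + F3))) + w * (C * A0) * (76 * ((x + y) * (F1 + F3))) +
        w * (C * A0) * (2 * ((x + y) * (F1 + F3))) := by ring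
  rw [hsum]
  rw [abs_le] at h2' ⊢
  constructor <;> linarith [h2'.1, h2'.2]

lemma avgQuad_areaPart_split [Nontrivial a] [Nontrivial b] [Nonempty c] (e : a ↪ b) (lam : a → ℝ)
    {Y0 Ya Yb Yc : TMat a b c} (hbal : Balanced Y0) (ha : expB a b c Ya = Ya) (hYa : Yaᴴ = -Ya) (hb
    : expA a b c Yb = Yb) (hYb : Ybᴴ = -Yb) (hc : expA a b c Yc = Yc) (hYc : Ycᴴ = -Yc) : avgQuad e
    lam (Y0 + (Ya + Yb + Yc)) = avgQuad e lam Y0 + avgQuad e lam (Ya + Yb + Yc) := by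
  have horth : ∀ Y, Balanced Y → ∀ s t, blockHs (Ya + Yb + Yc) Y s t = 0 := by
    intro Y hY s t
    rw [blockHs_add, blockHs_add, blockHs_eq_zero_of_expB hY ha, blockHs_eq_zero_of_expA hY hb,
      blockHs_eq_zero_of_expA hY hc, add_zero, add_zero]
  refine avgQuad_add e lam hbal (horth _ hbal) (horth _ hbal.conjTranspose) ?_
  rw [conjTranspose_add, conjTranspose_add, hYa, hYb, hYc, neg_add, neg_add]

lemma nsq_antiPart_le_of_preservesStar {T : Type} [Fintype T] {q : End ℂ (Mat T)} (hq :
    PreservesStar q) (X : Mat T) : nsq (q (antiPart X)) ≤ nsq (q X) ∧ (q (antiPart X))ᴴ = -q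
    (antiPart X) := by
  rw [hq.antiPart]
  exact ⟨by linarith [nsq_herm_add_anti (q X), nsq_nonneg (hermPart (q X))],
    antiPart_conjTranspose _⟩

end LocalBounds

end

section

section AreaBound

lemma abs_avgQuad_areaPart_sub_le [Nontrivial a] [Nontrivial b] [Nonempty c] (e : a ↪ b) {lam : a →
    ℝ} (hlam : ∀ i, 0 < lam i) (hsum : ∑ i, lam i = 1) (R : TMat a b c) {d r C : ℝ} (hd : d = card
    a) (hr : r = card b) (hdr : d ≤ r) (hC : 0 ≤ C) (hA : nsq (compA a b c R) ≤ C * nsq (compO a b c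
    R) / r ^ 2) (hB : nsq (compB a b c R) ≤ C * nsq (compO a b c R) / d ^ 2) (hCc : nsq (compC a b c
    R) ≤ C * nsq (compO a b c R) / (d * r)) : |avgQuad e lam (resid R + antiPart (compC a b c R)) -
    (1 - 1 / d ^ 2)⁻¹ * (1 - 1 / r ^ 2)⁻¹ * (nsq (resid R) / (d * r * card c)) * f₃ r lam| ≤ (40 +
    78 * C) * (1 / d ^ 2 + 1 / r ^ 2) * (nsq (resid R) / (d * r * card c)) * (f₁ lam + f₃ r lam) :=
    by
  have hd2 : (2 : ℝ) ≤ d := by rw [hd]; exact_mod_cast one_lt_card (α := a)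
  have hr0 : 0 < r := by linarith
  have hc0 : (0 : ℝ) < card c := by positivity
  have hf3 := le_f₃ hlam hr0
  rw [← hd] at hf3
  have hf30 : 0 < f₃ r lam := by
    have h1 : 0 < 2 * r * f₃ r lam := by linarith
    exact (mul_pos_iff_of_pos_left (by linarith : 0 < 2 * r)).1 h1
  have hOA := LinearMap.congr_fun (expA_mul_compO (a := a) (b := b) (c := c)) R
  have hOB := LinearMap.congr_fun (expB_mul_compO (a := a) (b := b) (c := c)) R
  obtain ⟨hnA, hanA⟩ := nsq_antiPart_le_of_preservesStar preservesStar_compA R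
  obtain ⟨hnB, hanB⟩ := nsq_antiPart_le_of_preservesStar preservesStar_compB R
  obtain ⟨hnC, hanC⟩ := nsq_antiPart_le_of_preservesStar preservesStar_compC R
  have haB := LinearMap.congr_fun (expB_mul_compA (a := a) (b := b) (c := c)) (antiPart R)
  have haA := LinearMap.congr_fun (expA_mul_compA (a := a) (b := b) (c := c)) (antiPart R)
  have hbA := LinearMap.congr_fun (expA_mul_compB (a := a) (b := b) (c := c)) (antiPart R)
  have hbB := LinearMap.congr_fun (expB_mul_compB (a := a) (b := b) (c := c)) (antiPart R)
  have hcA := LinearMap.congr_fun (expA_mul_compC (a := a) (b := b) (c := c)) (antiPart R)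
  have hcB := LinearMap.congr_fun (expB_mul_compC (a := a) (b := b) (c := c)) (antiPart R)
  rw [End.mul_apply] at hOA hOB haB haA hbA hbB hcA hcB
  rw [LinearMap.zero_apply] at hOA hOB haA hbB
  have hbal : Balanced (compO a b c R) := balanced_of_exp hOA hOB
  have hres : nsq (resid R) = nsq (compO a b c R) + nsq (compA a b c (antiPart R)) +
    nsq (compB a b c (antiPart R)) := by rw [resid, nsq_three]
  have hsplit : resid R + antiPart (compC a b c R) = compO a b c R +
      (compA a b c (antiPart R) + compB a b c (antiPart R) + compC a b c (antiPart R)) := by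
    rw [resid, ← preservesStar_compC.antiPart, add_assoc, add_assoc, add_assoc]
  rw [hres, hsplit, avgQuad_areaPart_split e lam hbal haB hanA hbA hanB hcA hanC]
  have h2 := abs_avgQuad_balanced_sub_le e hlam hsum hbal hd hr hdr
  have h3 := avgQuad_local_le e hlam hsum haB haA hanA hbA hbB hanB hcA hcB hanC hd hr
  have h0 : 0 ≤ avgQuad e lam (compA a b c (antiPart R) + compB a b c (antiPart R) +
      compC a b c (antiPart R)) := by
    rw [avgQuad_eq]
    refine mul_nonneg (by positivity) (sum_nonneg fun p _ => sum_nonneg fun q _ =>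
      mul_nonneg (invLogMean_bounds (hlam _) (hlam _)).1.le ?_)
    exact integral_nonneg fun g => by positivity
  have n1 := nsq_nonneg (compO a b c R)
  have n2 := nsq_nonneg (compA a b c (antiPart R))
  have n3 := nsq_nonneg (compB a b c (antiPart R))
  have hA' := hnA.trans hA
  have hB' := hnB.trans hB
  have hC' := hnC.trans hCc
  generalize avgQuad e lam (compA a b c (antiPart R) + compB a b c (antiPart R) +
      compC a b c (antiPart R)) = S at *
  generalize avgQuad e lam (compO a b c R) = S0 at *
  generalize nsq (compA a b c (antiPart R)) = Na at *
  generalize nsq (compB a b c (antiPart R)) = Nb at *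
  generalize nsq (compC a b c (antiPart R)) = Nc at *
  generalize nsq (compO a b c R) = A0 at *
  exact abs_sub_le_of_estimates hd2 hdr hC hc0 (f₁_nonneg hlam) hf30 hf3 n1 n2 n3 h0 hA' hB' hC' h2 h3

end AreaBound

end

section

/-! ### Leading order of the stabilizer Rényi entropy -/

section Magic

variable {X : Type} [Fintype X]

/-- Inner product of state vectors. -/
def br (u v : X → ℂ) : ℂ := star u ⬝ᵥ v

lemma br_apply (u v : X → ℂ) : br u v = ∑ x, star (u x) * v x := rfl

lemma br_add (u v w : X → ℂ) : br u (v + w) = br u v + br u w := by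
  simp only [br, dotProduct_add]

lemma br_sub (u v w : X → ℂ) : br u (v - w) = br u v - br u w := by
  simp only [br, dotProduct_sub]

lemma br_smul (u v : X → ℂ) (z : ℂ) : br u (z • v) = z * br u v := by
  simp only [br, dotProduct_smul, smul_eq_mul]

lemma star_br (u v : X → ℂ) : star (br u v) = br v u := by
  simp only [br_apply, star_sum, star_mul', star_star, mul_comm]

lemma add_br (u v w : X → ℂ) : br (u + v) w = br u w + br v w := by
  rw [← star_br, br_add, star_add, star_br, star_br]

lemma smul_br (u v : X → ℂ) (z : ℂ) : br (z • u) v = star z * br u v := by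
  rw [← star_br, br_smul, star_mul', star_br]

lemma tendsto_br {l : Filter ℝ} {f g : ℝ → X → ℂ} {u v : X → ℂ} (hf : Tendsto f l (𝓝 u)) (hg :
    Tendsto g l (𝓝 v)) : Tendsto (fun ε => br (f ε) (g ε)) l (𝓝 (br u v)) :=
  tendsto_finsetSum _ fun x _ => ((tendsto_pi_nhds.1 hf x).star).mul (tendsto_pi_nhds.1 hg x)

lemma br_self (u : X → ℂ) : br u u = ((∑ x, ‖u x‖ ^ 2 : ℝ) : ℂ) := by
  simp only [br_apply, star_def, conj_mul', ofReal_sum, ofReal_pow]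

lemma eq_zero_of_br_self {u : X → ℂ} (h : br u u = 0) : u = 0 := by
  rw [br_self, Complex.ofReal_eq_zero, sum_eq_zero_iff_of_nonneg fun _ _ => by positivity] at h
  exact funext fun x => by simpa using h x (mem_univ x)

/-- The component of `v` orthogonal to the unit vector `S`. -/
def perp (S v : X → ℂ) : X → ℂ := v - br S v • S

lemma br_perp {S : X → ℂ} (hS : br S S = 1) (v : X → ℂ) : br S (perp S v) = 0 := by
  rw [perp, br_sub, br_smul, hS, mul_one, sub_self]

lemma br_self_eq {S : X → ℂ} (hS : br S S = 1) (v : X → ℂ) : br v v = star (br S v) * br S v + br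
    (perp S v) (perp S v) := by
  have h : v = br S v • S + perp S v := by rw [perp, add_sub_cancel]
  have h' := br_perp hS v
  have h'' : br (perp S v) S = 0 := by rw [← star_br, h', star_zero]
  conv_lhs => rw [h]
  simp only [add_br, br_add, smul_br, br_smul, hS, h', h'']
  ring

variable [DecidableEq X] [AddCommGroup X]

lemma pauli_mulVec (s : X) (χ : AddChar X ℂ) (v : X → ℂ) (x : X) : (pauli s χ *ᵥ v) x = χ (x - s) *
    v (x - s) := by
  rw [mulVec, dotProduct, sum_eq_single (x - s)]
  · simp [pauli]
  · intro y _ hy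
    rw [pauli, if_neg fun h => hy (by rw [h, add_sub_cancel_right]), zero_mul]
  · simp

lemma br_pauli (s : X) (χ : AddChar X ℂ) (u v : X → ℂ) : br u (pauli s χ *ᵥ v) = ∑ y, star (u (y +
    s)) * (χ y * v y) := by
  rw [br_apply, ← Equiv.sum_comp (Equiv.addRight s)]
  simp [pauli_mulVec]

lemma br_pauli_pauli (s : X) (χ : AddChar X ℂ) (u v : X → ℂ) : br (pauli s χ *ᵥ u) (pauli s χ *ᵥ v)
    = br u v := by
  rw [br_pauli, br_apply]
  refine sum_congr rfl fun y _ => ?_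
  rw [pauli_mulVec, add_sub_cancel_right, star_mul', mul_mul_mul_comm, star_def, conj_mul',
    AddChar.norm_apply]
  simp

lemma sum_star_br_pauli_mul (u v w x : X → ℂ) : ∑ s : X, ∑ χ : AddChar X ℂ, star (br u (pauli s χ *ᵥ
    v)) * br w (pauli s χ *ᵥ x) = card X * (br w u * br v x) := by
  have h1 : ∀ s : X, ∑ χ : AddChar X ℂ, star (br u (pauli s χ *ᵥ v)) * br w (pauli s χ *ᵥ x) =
      ∑ y, card X * (star (w (y + s)) * u (y + s)) * (star (v y) * x y) := by
    intro s
    simp only [br_pauli, star_sum, sum_mul_sum]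
    rw [sum_comm]
    refine sum_congr rfl fun y _ => ?_
    rw [sum_comm, sum_eq_single y]
    · have h2 : ∀ χ : AddChar X ℂ, star (star (u (y + s)) * (χ y * v y)) *
          (star (w (y + s)) * (χ y * x y)) = star (w (y + s)) * u (y + s) * (star (v y) * x y) := by
        intro χ
        have h3 : star (χ y) * χ y = 1 := by
          rw [star_def, conj_mul', AddChar.norm_apply]
          simp
        rw [star_mul', star_star, star_mul']
        linear_combination (star (w (y + s)) * u (y + s) * (star (v y) * x y)) * h3
      simp only [h2, sum_const, card_univ, nsmul_eq_mul, AddChar.card_eq, mul_assoc]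
    · intro z _ hz
      have h2 : ∀ χ : AddChar X ℂ, star (star (u (y + s)) * (χ y * v y)) *
          (star (w (z + s)) * (χ z * x z)) =
            u (y + s) * star (v y) * star (w (z + s)) * x z * χ (z - y) := by
        intro χ
        rw [sub_eq_add_neg, AddChar.map_add_eq_mul, AddChar.map_neg_eq_conj, star_mul', star_star,
          star_mul', star_def]
        ring
      simp only [h2]
      rw [← mul_sum, AddChar.sum_apply_eq_ite, if_neg (sub_ne_zero.2 hz), mul_zero]
    · simp
  have h2 : ∀ y, ∑ s, star (w (y + s)) * u (y + s) = br w u := fun y =>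
    Equiv.sum_comp (Equiv.addLeft y) fun x => star (w x) * u x
  simp only [h1]
  rw [sum_comm]
  simp only [← sum_mul, ← mul_sum, h2]
  rw [← br_apply, mul_assoc]

/-- Every Pauli expectation value of the unit vector `S` has modulus `0` or `1`. -/
def IsStabilizerState (S : X → ℂ) : Prop :=
  br S S = 1 ∧ ∀ (s : X) (χ : AddChar X ℂ), br S (pauli s χ *ᵥ S) = 0 ∨ ‖br S (pauli s χ *ᵥ S)‖ = 1

lemma tendsto_pow_sub_one {α : ℝ} {p : ℝ → ℝ} {q : ℝ} {l : Filter ℝ} (hp : Tendsto p l (𝓝 1)) (hq :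
    Tendsto (fun ε => (p ε - 1) / ε ^ 2) l (𝓝 q)) : Tendsto (fun ε => (p ε ^ α - 1) / ε ^ 2) l (𝓝 (α
    * q)) := by
  have hd : HasDerivAt (fun x : ℝ => x ^ α) α 1 := by
    simpa using Real.hasDerivAt_rpow_const (x := 1) (p := α) (Or.inl one_ne_zero)
  have h := ((continuousAt_dslope_same.2 hd.differentiableAt).tendsto.comp hp).mul hq
  rw [dslope_same, hd.deriv] at h
  refine h.congr fun ε => ?_
  have h1 := sub_smul_dslope (fun x : ℝ => x ^ α) 1 (p ε)
  rw [smul_eq_mul, Real.one_rpow] at h1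
  rw [← h1, Function.comp_apply]
  ring

lemma tendsto_log_div {p : ℝ → ℝ} {q : ℝ} {l : Filter ℝ} (hp : Tendsto p l (𝓝 1)) (hq : Tendsto (fun
    ε => (p ε - 1) / ε ^ 2) l (𝓝 q)) : Tendsto (fun ε => log (p ε) / ε ^ 2) l (𝓝 q) := by
  have hd : HasDerivAt log 1 1 := by simpa using Real.hasDerivAt_log (one_ne_zero)
  have h := ((continuousAt_dslope_same.2 hd.differentiableAt).tendsto.comp hp).mul hq
  rw [dslope_same, hd.deriv, one_mul] at h
  refine h.congr fun ε => ?_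
  have h1 := sub_smul_dslope log 1 (p ε)
  rw [smul_eq_mul, Real.log_one, sub_zero] at h1
  rw [← h1, Function.comp_apply]
  ring

lemma tendsto_pauli_term {S : X → ℂ} (hS : IsStabilizerState S) {φ : ℝ → X → ℂ} {φ1 : X → ℂ} (hφ : ∀
    ε, br (φ ε) (φ ε) = 1) (hd : Tendsto (fun ε : ℝ => (ε : ℂ)⁻¹ • (φ ε - S)) (𝓝[≠] 0) (𝓝 φ1)) {α :
    ℝ} (hα : 1 < α) (s : X) (χ : AddChar X ℂ) : Tendsto (fun ε => (‖br (φ ε) (pauli s χ *ᵥ φ ε)‖ ^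
    (2 * α) - ‖br S (pauli s χ *ᵥ S)‖ ^ 2) / ε ^ 2) (𝓝[≠] 0) (𝓝 (2 * α * ((star (br S (pauli s χ *ᵥ
    S)) * br (perp S φ1) (pauli s χ *ᵥ perp S φ1)).re - ‖br S (pauli s χ *ᵥ S)‖ ^ 2 * (br (perp S
    φ1) (perp S φ1)).re))) := by
  set P := pauli s χ with hP
  have hε : Tendsto (fun ε : ℝ => (ε : ℂ)) (𝓝[≠] 0) (𝓝 0) :=
    (continuous_ofReal.tendsto' 0 0 (by simp)).mono_left nhdsWithin_le_nhds
  have hne : ∀ᶠ ε : ℝ in 𝓝[≠] 0, ε ≠ 0 := self_mem_nhdsWithin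
  have hlim : Tendsto φ (𝓝[≠] 0) (𝓝 S) := by
    have h := (hε.smul hd).add_const S
    rw [zero_smul, zero_add] at h
    refine h.congr' (hne.mono fun ε h0 => ?_)
    rw [smul_inv_smul₀ (by exact_mod_cast h0), sub_add_cancel]
  have hmv : ∀ {f : ℝ → X → ℂ} {u : X → ℂ}, Tendsto f (𝓝[≠] 0) (𝓝 u) →
      Tendsto (fun ε => P *ᵥ f ε) (𝓝[≠] 0) (𝓝 (P *ᵥ u)) := fun {f u} hf =>
    ((continuous_const.matrix_mulVec continuous_id : Continuous fun v : X → ℂ => P *ᵥ v).tendsto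
      u).comp hf
  rcases hS.2 s χ with hz | hz
  · rw [← hP] at hz
    rw [hz, star_zero, zero_mul, norm_zero]
    have hg : Tendsto (fun ε : ℝ => (ε : ℂ)⁻¹ * br (φ ε) (P *ᵥ φ ε)) (𝓝[≠] 0)
        (𝓝 (br φ1 (P *ᵥ S) + br S (P *ᵥ φ1))) := by
      refine ((tendsto_br hd (hmv hlim)).add (tendsto_br tendsto_const_nhds (hmv hd))).congr
        fun ε => ?_
      rw [smul_br, mulVec_smul, br_smul, Matrix.mulVec_sub, br_sub, hz, sub_zero, star_inv₀,
        star_def, conj_ofReal, ← mul_add, sub_eq_add_neg, add_br, ← neg_one_smul ℂ S, smul_br]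
      simp
    have hg0 := (tendsto_br hlim (hmv hlim)).norm.rpow_const (p := 2 * α - 2) (Or.inr (by linarith))
    rw [hz, norm_zero, Real.zero_rpow (by linarith)] at hg0
    have h := (hg.norm.pow 2).mul hg0
    simp only [mul_zero] at h
    simp only [zero_re, ne_eq, OfNat.ofNat_ne_zero, not_false_eq_true, zero_pow, zero_mul, sub_zero,
      mul_zero]
    refine h.congr fun ε => ?_
    have h1 : ‖br (φ ε) (P *ᵥ φ ε)‖ ^ (2 * α) =
        ‖br (φ ε) (P *ᵥ φ ε)‖ ^ 2 * ‖br (φ ε) (P *ᵥ φ ε)‖ ^ (2 * α - 2) := by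
      rw [← rpow_two, ← Real.rpow_add_of_nonneg (norm_nonneg _) (by norm_num) (by linarith),
        add_sub_cancel]
    rw [h1, norm_mul, norm_inv, norm_real, norm_eq_abs, mul_pow, inv_pow, sq_abs, mul_assoc,
      div_eq_inv_mul]
  · rw [← hP] at hz
    set z := br S (P *ᵥ S) with hzd
    have hzz : star z * z = 1 := by
      rw [star_def, conj_mul', hz]
      simp
    have hPS : P *ᵥ S = z • S := by
      refine sub_eq_zero.1 (eq_zero_of_br_self ?_)
      rw [br_sub, br_smul, sub_eq_add_neg (P *ᵥ S), ← neg_one_smul ℂ (z • S), add_br, add_br,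
        smul_br, smul_br, smul_br, smul_br, br_pauli_pauli, hS.1, ← hzd, ← star_br, ← hzd]
      simp only [star_neg, star_one]
      linear_combination -hzz
    have hexp : ∀ ε, br (φ ε) (P *ᵥ φ ε) = z * ((1 - br (perp S (φ ε)) (perp S (φ ε))) +
        star z * br (perp S (φ ε)) (P *ᵥ perp S (φ ε))) := by
      intro ε
      set η := perp S (φ ε) with hη
      have h1 : φ ε = br S (φ ε) • S + η := by rw [hη, perp, add_sub_cancel]
      have h2 : br S η = 0 := br_perp hS.1 _
      have h3 : br η S = 0 := by rw [← star_br, h2, star_zero]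
      have h4 : br S (P *ᵥ η) = 0 := by
        have h5 := br_pauli_pauli s χ S η
        rw [← hP, hPS, smul_br, h2] at h5
        have h6 : z * (star z * br S (P *ᵥ η)) = 0 := by rw [h5, mul_zero]
        linear_combination h6 - br S (P *ᵥ η) * hzz
      have h5 := br_self_eq hS.1 (φ ε)
      rw [hφ, ← hη] at h5
      have h6 : br (φ ε) (P *ᵥ φ ε) = star (br S (φ ε)) * br S (φ ε) * z + br η (P *ᵥ η) := by
        conv_lhs => rw [h1]
        simp only [Matrix.mulVec_add, mulVec_smul, add_br, br_add, smul_br, br_smul, hPS, h3, h4,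
          hS.1]
        ring
      rw [h6]
      linear_combination (-z) * h5 - br η (P *ᵥ η) * hzz
    have hη : Tendsto (fun ε : ℝ => (ε : ℂ)⁻¹ • perp S (φ ε)) (𝓝[≠] 0) (𝓝 (perp S φ1)) := by
      have h := hd.sub ((tendsto_br (tendsto_const_nhds (x := S)) hd).smul_const S)
      refine h.congr fun ε => ?_
      rw [perp, br_smul, br_sub, hS.1, ← smul_smul, ← smul_sub, sub_smul, one_smul]
      congr 1
      abel
    have hD := ((tendsto_br hη (hmv hη)).const_mul (star z)).sub (tendsto_br hη hη)
    have hform : ∀ ε : ℝ, ε ≠ 0 → ‖br (φ ε) (P *ᵥ φ ε)‖ ^ 2 - 1 =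
        ε ^ 2 * (2 * (star z * br ((ε : ℂ)⁻¹ • perp S (φ ε)) (P *ᵥ ((ε : ℂ)⁻¹ • perp S (φ ε))) -
          br ((ε : ℂ)⁻¹ • perp S (φ ε)) ((ε : ℂ)⁻¹ • perp S (φ ε))).re + ε ^ 2 *
        ‖star z * br ((ε : ℂ)⁻¹ • perp S (φ ε)) (P *ᵥ ((ε : ℂ)⁻¹ • perp S (φ ε))) -
          br ((ε : ℂ)⁻¹ • perp S (φ ε)) ((ε : ℂ)⁻¹ • perp S (φ ε))‖ ^ 2) := by
      intro ε h0
      have h0' : (ε : ℂ) ≠ 0 := by exact_mod_cast h0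
      set D := star z * br ((ε : ℂ)⁻¹ • perp S (φ ε)) (P *ᵥ ((ε : ℂ)⁻¹ • perp S (φ ε))) -
        br ((ε : ℂ)⁻¹ • perp S (φ ε)) ((ε : ℂ)⁻¹ • perp S (φ ε)) with hDd
      have h1 : br (φ ε) (P *ᵥ φ ε) = z * (1 + ((ε ^ 2 : ℝ) : ℂ) * D) := by
        rw [hexp, hDd, mulVec_smul, smul_br, smul_br, br_smul, br_smul, star_inv₀, star_def,
          conj_ofReal, ofReal_pow]
        field_simp
        ring
      rw [h1, norm_mul, hz, one_mul, ← normSq_eq_norm_sq, ← normSq_eq_norm_sq, normSq_apply,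
        normSq_apply, add_re, Complex.add_im, Complex.re_ofReal_mul, im_ofReal_mul, Complex.one_re,
        Complex.one_im]
      ring
    have hq : Tendsto (fun ε => (‖br (φ ε) (P *ᵥ φ ε)‖ ^ 2 - 1) / ε ^ 2) (𝓝[≠] 0)
        (𝓝 (2 * (star z * br (perp S φ1) (P *ᵥ perp S φ1) - br (perp S φ1) (perp S φ1)).re)) := by
      have hε2 : Tendsto (fun ε : ℝ => ε ^ 2) (𝓝[≠] 0) (𝓝 0) :=
        ((continuous_pow 2).tendsto' 0 0 (by simp)).mono_left nhdsWithin_le_nhds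
      have h := (((continuous_re.tendsto _).comp hD).const_mul 2).add (hε2.mul (hD.norm.pow 2))
      rw [zero_mul, add_zero] at h
      refine h.congr' (hne.mono fun ε h0 => ?_)
      beta_reduce
      rw [hform ε h0, mul_div_cancel_left₀ _ (pow_ne_zero 2 h0)]
      rfl
    have hp : Tendsto (fun ε => ‖br (φ ε) (P *ᵥ φ ε)‖ ^ 2) (𝓝[≠] 0) (𝓝 1) := by
      have h := (tendsto_br hlim (hmv hlim)).norm.pow 2
      rwa [← hzd, hz, one_pow] at h
    have h := tendsto_pow_sub_one (α := α) hp hq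
    rw [hz]
    convert h using 1
    · funext ε
      rw [one_pow, Real.rpow_mul (norm_nonneg _), rpow_two]
    · rw [Complex.sub_re]
      congr 1
      ring

/-- Second-order expansion of the magic around a stabilizer state. -/
lemma tendsto_sre {S : X → ℂ} (hS : IsStabilizerState S) {φ : ℝ → X → ℂ} {φ1 : X → ℂ} (hφ : ∀ ε, br
    (φ ε) (φ ε) = 1) (hd : Tendsto (fun ε : ℝ => (ε : ℂ)⁻¹ • (φ ε - S)) (𝓝[≠] 0) (𝓝 φ1)) {α : ℝ} (hα
    : 1 < α) : Tendsto (fun ε => sre α (φ ε) / ε ^ 2) (𝓝[≠] 0) (𝓝 (2 * α / (α - 1) * ∑ x, ‖perp S φ1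
    x‖ ^ 2)) := by
  have hX : (card X : ℝ) ≠ 0 := by exact_mod_cast card_ne_zero (α := X)
  have hsum : ∑ s : X, ∑ χ : AddChar X ℂ, ‖br S (pauli s χ *ᵥ S)‖ ^ 2 = card X := by
    have h := sum_star_br_pauli_mul S S S S
    simp only [hS.1, mul_one, star_def, conj_mul'] at h
    exact_mod_cast h
  have horth : ∑ s : X, ∑ χ : AddChar X ℂ,
      (star (br S (pauli s χ *ᵥ S)) * br (perp S φ1) (pauli s χ *ᵥ perp S φ1)).re = 0 := by
    have h := sum_star_br_pauli_mul S S (perp S φ1) (perp S φ1)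
    rw [br_perp hS.1, mul_zero, mul_zero] at h
    simpa only [re_sum, zero_re] using congrArg Complex.re h
  set F := fun ε => (card X : ℝ)⁻¹ * ∑ s : X, ∑ χ : AddChar X ℂ,
    ‖br (φ ε) (pauli s χ *ᵥ φ ε)‖ ^ (2 * α) with hF
  have hq : Tendsto (fun ε => (F ε - 1) / ε ^ 2) (𝓝[≠] 0)
      (𝓝 (-(2 * α * ∑ x, ‖perp S φ1 x‖ ^ 2))) := by
    have h := (tendsto_finsetSum univ fun s _ => tendsto_finsetSum univ fun χ _ =>
      tendsto_pauli_term hS hφ hd hα s χ).const_mul (card X : ℝ)⁻¹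
    convert h using 1
    · funext ε
      simp only [← sum_div, sum_sub_distrib, hsum]
      rw [hF, mul_div_assoc', mul_sub, inv_mul_cancel₀ hX]
    · simp only [← mul_sum, sum_sub_distrib, ← sum_mul, hsum, horth]
      rw [br_self, ofReal_re, zero_sub, mul_left_comm, mul_neg, inv_mul_cancel_left₀ hX, mul_neg]
  have hp : Tendsto F (𝓝[≠] 0) (𝓝 1) := by
    have hε2 : Tendsto (fun ε : ℝ => ε ^ 2) (𝓝[≠] 0) (𝓝 0) :=
      ((continuous_pow 2).tendsto' 0 0 (by simp)).mono_left nhdsWithin_le_nhds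
    have h := (hε2.mul hq).add_const 1
    rw [zero_mul, zero_add] at h
    have hne : ∀ᶠ ε : ℝ in 𝓝[≠] 0, ε ≠ 0 := self_mem_nhdsWithin
    refine h.congr' (hne.mono fun ε h0 => ?_)
    rw [mul_div_cancel₀ _ (pow_ne_zero 2 h0), sub_add_cancel]
  have h := (tendsto_log_div hp hq).const_mul (1 / (1 - α))
  convert h using 1
  · funext ε
    rw [mul_div_assoc']
    rfl
  · have h1 : α - 1 ≠ 0 := by linarith
    have h2 : 1 - α ≠ 0 := by linarith
    congr 1
    field_simp
    ring

lemma isStabilizerState_of_hom {G : Type} [Fintype G] [AddCommGroup G] (ι : G →+ X) (hι :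
    Function.Injective ι) {r : ℝ} (hr : r ^ 2 * card G = 1) {S : X → ℂ} (hS : S = fun x => ∑ g, if x
    = ι g then (r : ℂ) else 0) : IsStabilizerState S := by
  classical
  have hrc : (r : ℂ) * r * card G = 1 := by
    rw [← pow_two]
    exact_mod_cast hr
  have hb : ∀ v : X → ℂ, br S v = r * ∑ g, v (ι g) := by
    intro v
    simp only [br_apply, hS, star_sum, apply_ite star, star_zero, star_def, conj_ofReal, sum_mul,
      ite_mul, zero_mul]
    rw [sum_comm, mul_sum]
    simp
  have hSι : ∀ g, S (ι g) = r := by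
    intro g
    simp [hS, hι.eq_iff]
  constructor
  · rw [hb]
    simp only [hSι, sum_const, card_univ, nsmul_eq_mul]
    rw [← hrc]
    ring
  · intro s χ
    rw [hb]
    simp only [pauli_mulVec]
    by_cases hs : ∃ g, ι g = s
    · obtain ⟨g₀, rfl⟩ := hs
      have h1 : ∑ g, χ (ι g - ι g₀) * S (ι g - ι g₀) = r * ∑ g, (χ.compAddMonoidHom ι) g := by
        simp only [← map_sub, hSι]
        rw [mul_sum]
        exact (Equiv.sum_comp (Equiv.subRight g₀) fun g => χ (ι g) * (r : ℂ)).trans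
          (sum_congr rfl fun g _ => mul_comm _ _)
      rw [h1, AddChar.sum_eq_ite]
      split_ifs
      · right
        rw [← mul_assoc, hrc, norm_one]
      · left
        simp
    · left
      have h1 : ∀ g, S (ι g - s) = 0 := by
        intro g
        rw [hS]
        refine sum_eq_zero fun g' _ => if_neg fun h => hs ⟨g - g', ?_⟩
        rw [map_sub, ← h, sub_sub_cancel]
      simp [h1]

end Magic

end

section

/-! ### Two-body operators -/

section TwoBody

lemma AgreeAt.symm {k : Fin 4} {x y : Phys a b c} (h : AgreeAt k x y) : AgreeAt k y x := by
  fin_cases k <;> exact Eq.symm h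

lemma AgreeAt.trans {k : Fin 4} {x y z : Phys a b c} (h : AgreeAt k x y) (h' : AgreeAt k y z) :
    AgreeAt k x z := by
  fin_cases k <;> exact Eq.trans h h'

lemma ActsOn.apply_eq_zero {i j k : Fin 4} {T : PMat a b c} (h : ActsOn i j T) (hk : k ≠ i ∧ k ≠ j)
    {p q : Phys a b c} (hpq : ¬AgreeAt k p q) : T p q = 0 :=
  by_contra fun h0 => hpq (h.1 p q h0 k hk.1 hk.2)

lemma ActsOn.apply_congr {i j k : Fin 4} {T : PMat a b c} (h : ActsOn i j T) (hk : k ≠ i ∧ k ≠ j) {p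
    q p' q' : Phys a b c} (hpq : AgreeAt k p q) (hpq' : AgreeAt k p' q') (hp : ∀ m, m ≠ k → AgreeAt
    m p p' := by
      intro m hm; fin_cases m <;> first | rfl | exact absurd rfl hm)
    (hq : ∀ m, m ≠ k → AgreeAt m q q' := by
      intro m hm; fin_cases m <;> first | rfl | exact absurd rfl hm) : T p q = T p' q' := by
  by_cases H : ∀ m, m ≠ i → m ≠ j → AgreeAt m p q
  · refine h.2 p q p' q' H (fun m hi hj => ?_) (hp i hk.1.symm) (hp j hk.2.symm) (hq i hk.1.symm)
      (hq j hk.2.symm)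
    by_cases hm : m = k
    · exact hm ▸ hpq'
    · exact (hp m hm).symm.trans ((H m hi hj).trans (hq m hm))
  · push Not at H
    obtain ⟨m, hi, hj, hm⟩ := H
    have hmk : m ≠ k := fun h0 => hm (h0 ▸ hpq)
    rw [h.apply_eq_zero ⟨hi, hj⟩ hm, h.apply_eq_zero ⟨hi, hj⟩ fun h0 => hm ((hp m hmk).trans
      (h0.trans (hq m hmk).symm))]

variable [Nonempty a] [Nonempty b] [Nonempty c] {i j : Fin 4} {T : PMat a b c}

lemma ActsOn.expA_red (h : ActsOn i j T) (hk : 0 ≠ i ∧ 0 ≠ j) : expA a b c (red T) = red T := by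
  ext ⟨⟨x, y⟩, s⟩ ⟨⟨l, k⟩, t⟩
  rw [expA_apply]
  split_ifs with hxl
  · subst hxl
    have h1 : ∀ z, red T ((z, y), s) ((z, k), t) = red T ((x, y), s) ((x, k), t) := fun z =>
      sum_congr rfl fun u _ => h.apply_congr hk rfl rfl
    simp [h1]
  · exact (sum_eq_zero fun u _ => h.apply_eq_zero hk (by exact hxl)).symm

lemma ActsOn.expB_red (h : ActsOn i j T) (hk : 2 ≠ i ∧ 2 ≠ j) : expB a b c (red T) = red T := by
  ext ⟨⟨x, y⟩, s⟩ ⟨⟨l, k⟩, t⟩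
  rw [expB_apply]
  split_ifs with hxl
  · subst hxl
    have h1 : ∀ z, red T ((x, z), s) ((l, z), t) = red T ((x, y), s) ((l, y), t) := fun z =>
      sum_congr rfl fun u _ => h.apply_congr hk rfl rfl
    simp [h1]
  · exact (sum_eq_zero fun u _ => h.apply_eq_zero hk (by exact hxl)).symm

lemma ActsOn.red_apply_of_snd (h : ActsOn i j T) (hk : 3 ≠ i ∧ 3 ≠ j) (x l : a) (y k : b) (s t : c)
    : red T ((x, y), s) ((l, k), t) = T ((x, s), (y, t)) ((l, t), (k, t)) := by
  refine sum_eq_single (M := ℂ) t (fun u _ hu => h.apply_eq_zero hk fun h0 => hu ?_) (by simp)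
  exact Eq.symm h0

lemma ActsOn.red_apply_of_fst (h : ActsOn i j T) (hk : 1 ≠ i ∧ 1 ≠ j) (x l : a) (y k : b) (s t : c)
    : red T ((x, y), s) ((l, k), t) = T ((x, s), (y, t)) ((l, s), (k, s)) := by
  refine sum_eq_single (M := ℂ) s (fun u _ hu => h.apply_eq_zero hk fun h0 => hu ?_) (by simp)
  exact Eq.symm h0

lemma ActsOn.red_conjTranspose (h : ActsOn i j T) (hT : T.IsHermitian) (hk : (1 ≠ i ∧ 1 ≠ j) ∨ (3 ≠
    i ∧ 3 ≠ j)) : (red T)ᴴ = red T := by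
  ext ⟨⟨x, y⟩, s⟩ ⟨⟨l, k⟩, t⟩
  rw [conjTranspose_apply]
  rcases hk with hk | hk
  · rw [h.red_apply_of_fst hk, h.red_apply_of_fst hk, hT.apply]
    exact h.apply_congr hk rfl rfl
  · rw [h.red_apply_of_snd hk, h.red_apply_of_snd hk, hT.apply]
    exact h.apply_congr hk rfl rfl

lemma ActsOn.expC_red (h : ActsOn i j T) (hk : 1 ≠ i ∧ 1 ≠ j) (hk' : 3 ≠ i ∧ 3 ≠ j) : expC a b c
    (red T) = red T := by
  ext ⟨⟨x, y⟩, s⟩ ⟨⟨l, k⟩, t⟩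
  rw [expC_apply]
  split_ifs with hxl
  · subst hxl
    have h1 : ∀ z, red T ((x, y), z) ((l, k), z) = red T ((x, y), s) ((l, k), s) := by
      intro z
      rw [h.red_apply_of_snd hk', h.red_apply_of_snd hk']
      exact (h.apply_congr (p := ((x, z), (y, z))) (q := ((l, z), (k, z))) (p' := ((x, s), (y, z)))
        (q' := ((l, s), (k, z))) hk rfl rfl).trans (h.apply_congr hk' rfl rfl)
    simp [h1]
  · rw [h.red_apply_of_snd hk']
    exact (h.apply_eq_zero hk (by exact hxl)).symm

lemma ActsOn.resid_red (h : ActsOn i j T) (hT : T.IsHermitian) (hij : i ≠ j) : resid (red T) = 0 :=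
    by
  by_cases h0 : 0 ≠ i ∧ 0 ≠ j <;> by_cases h2 : 2 ≠ i ∧ 2 ≠ j
  · exact resid_eq_zero_of_expA_expB (h.expA_red h0) (h.expB_red h2)
  · exact resid_eq_zero_of_expA (h.expA_red h0) (h.red_conjTranspose hT (by clear h; revert i j; decide))
  · exact resid_eq_zero_of_expB (h.expB_red h2) (h.red_conjTranspose hT (by clear h; revert i j; decide))
  · exact resid_eq_zero_of_expC (h.expC_red (by clear h; revert i j; decide) (by clear h; revert i j; decide))

end TwoBody

end

section

/-! ### Non-local magic of a skewed code -/

section NonlocalMagic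

lemma choi_smul (z : ℂ) (V : Enc a b c) : choi (z • V) = z • choi V := by
  ext x
  simp only [choi, Matrix.smul_apply, Pi.smul_apply, smul_eq_mul]
  ring

lemma choi_sub (V V' : Enc a b c) : choi (V - V') = choi V - choi V' := by
  ext x
  simp only [choi, Matrix.sub_apply, Pi.sub_apply, mul_sub]

lemma sum_norm_choi (V : Enc a b c) : ∑ x, ‖choi V x‖ ^ 2 = nsq V / card (Logical a b) := by
  have h : ∀ x, ‖choi V x‖ ^ 2 = (card (Logical a b) : ℝ)⁻¹ * ‖V x.2 x.1‖ ^ 2 := by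
    intro x
    rw [choi, norm_mul, mul_pow, norm_inv, norm_real, inv_pow, norm_eq_abs, sq_abs, sq_sqrt
      (Nat.cast_nonneg _)]
  rw [nsq, div_eq_inv_mul, sum_prod_type, mul_sum, sum_comm]
  simp only [h, mul_sum]

lemma br_choi_self (V : Enc a b c) : br (choi V) (choi V) = ((nsq V / card (Logical a b) : ℝ) : ℂ)
    := by
  rw [br_self, sum_norm_choi]

lemma mderiv_list_prod {n ι : Type} [Fintype n] [DecidableEq n] (L : List ι) (A : ι → Mat n) :
    MDeriv (fun ε : ℝ => (L.map fun p => NormedSpace.exp ((I * (ε : ℂ)) • A p)).prod) (I • (L.map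
    A).sum) := by
  induction L with
  | nil => simpa using mderiv_const (1 : Mat n)
  | cons p L ih =>
    have h := (mderiv_exp (A p)).mul ih
    have h1 : (L.map fun p => NormedSpace.exp ((I * ((0 : ℝ) : ℂ)) • A p)).prod = 1 :=
      List.prod_eq_one fun x hx => by
        obtain ⟨q, -, rfl⟩ := List.mem_map.1 hx
        exact exp_I_zero_smul _
    rw [h1, exp_I_zero_smul, Matrix.mul_one, Matrix.one_mul, ← smul_add] at h
    simpa only [List.map_cons, List.prod_cons, List.sum_cons] using h

lemma list_prod_conjTranspose_mul {n : Type} [Fintype n] [DecidableEq n] (L : List (Mat n)) (h : ∀ U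
    ∈ L, Uᴴ * U = 1) : L.prodᴴ * L.prod = 1 := by
  induction L with
  | nil => simp
  | cons U L ih =>
    rw [List.prod_cons, conjTranspose_mul, Matrix.mul_assoc, ← Matrix.mul_assoc Uᴴ, h U
      List.mem_cons_self, Matrix.one_mul, ih fun V hV => h V (List.mem_cons_of_mem _ hV)]

/-- The ordered pairs of subsystems. -/
def subsystemPairs : List (Fin 4 × Fin 4) := [(0, 1), (0, 2), (0, 3), (1, 2), (1, 3), (2, 3)]

variable [Nonempty a] [Nonempty b] [Nonempty c]

lemma isStabilizerState_choi [AddCommGroup a] [AddCommGroup b] [AddCommGroup c] : IsStabilizerState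
    (choi (chiIso a b c)) := by
  refine isStabilizerState_of_hom (G := (a × b) × c)
    (r := (√(card (Logical a b) : ℝ))⁻¹ * (√(card c : ℝ))⁻¹)
    { toFun := fun g => (g.1, ((g.1.1, g.2), (g.1.2, g.2))), map_zero' := rfl,
      map_add' := fun _ _ => rfl } (fun g g' h => ?_) ?_ ?_
  · obtain ⟨h1, h2⟩ := Prod.mk.inj h
    exact Prod.ext h1 (Prod.mk.inj (Prod.mk.inj h2).1).2
  · rw [mul_pow, inv_pow, inv_pow, sq_sqrt (Nat.cast_nonneg _), sq_sqrt (Nat.cast_nonneg _),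
      card_prod (a × b) c, Nat.cast_mul, ← mul_inv, inv_mul_cancel₀]
    have h1 : (card (Logical a b) : ℝ) ≠ 0 := by exact_mod_cast card_ne_zero
    have h2 : (card c : ℝ) ≠ 0 := by exact_mod_cast card_ne_zero
    exact mul_ne_zero h1 h2
  · ext ⟨l, ⟨x, s⟩, ⟨y, t⟩⟩
    have h : ∀ g : (a × b) × c, (l, ((x, s), (y, t))) = (g.1, ((g.1.1, g.2), (g.1.2, g.2))) ↔
        g = ((x, y), s) ∧ (x, y) = l ∧ s = t := by
      rintro ⟨⟨u, v⟩, w⟩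
      simp only [Prod.mk.injEq]
      constructor
      · rintro ⟨rfl, ⟨rfl, rfl⟩, rfl, rfl⟩
        simp
      · rintro ⟨⟨⟨rfl, rfl⟩, rfl⟩, rfl, rfl⟩
        simp
    simp only [AddMonoidHom.coe_mk, ZeroHom.coe_mk, h, ite_and, Finset.sum_ite_eq', mem_univ, if_true]
    by_cases h1 : (x, y) = l <;> by_cases h2 : s = t <;> simp [choi, attachChi, chi, h1, h2]

variable {W : PMat a b c}

lemma resid_sub_smul_one (Y : TMat a b c) (z : ℂ) : resid (Y - z • (1 : TMat a b c)) = resid Y := by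
  have h1 : expC a b c (1 : TMat a b c) = 1 := by
    have := one_sub_expC_one (a := a) (b := b) (c := c)
    rw [LinearMap.sub_apply, End.one_apply, sub_eq_zero] at this
    exact this.symm
  rw [sub_eq_add_neg, resid_add, ← neg_smul,
    resid_eq_zero_of_expC (Y := -z • (1 : TMat a b c)) (by rw [map_smul, h1]), add_zero]

lemma resid_red_list_sum {ι : Type} (L : List ι) (A : ι → PMat a b c) (h : ∀ p ∈ L, resid (red (A
    p)) = 0) : resid (red (L.map A).sum) = 0 := by
  induction L with
  | nil =>
    have h0 : red (0 : PMat a b c) = 0 := by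
      ext
      simp [red]
    rw [List.map_nil, List.sum_nil, h0]
    exact resid_eq_zero_of_expC (map_zero _)
  | cons p L ih =>
    rw [List.map_cons, List.sum_cons, red_add, resid_add, h p List.mem_cons_self, ih fun q hq => h q
      (List.mem_cons_of_mem _ hq), add_zero]

variable [AddCommGroup a] [AddCommGroup b] [AddCommGroup c]

/-- The magic of a perturbed stabilizer state has a leading coefficient, bounded in terms of the
total generator. -/
lemma exists_hasMagicCoeff {α : ℝ} (hα : 1 < α) (hW : W.IsHermitian) (τ : Equiv.Perm (Fin 4)) {T :
    Fin 4 → Fin 4 → PMat a b c} (hT : IsTwoBody T) : ∃ m : ℝ, HasMagicCoeff α (fun ε => choi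
    (twoBodyCircuit τ T ε * evo W ε)) m ∧ 2 * α / (α - 1) * (nsq (resid (red W)) / (card (Logical a
    b) * card c)) ≤ m ∧ m ≤ 2 * α / (α - 1) * (nsq (red ((subsystemPairs.map fun p => T (τ p.1) (τ
    p.2)).sum + W)) / (card (Logical a b) * card c)) := by
  set A := fun p : Fin 4 × Fin 4 => T (τ p.1) (τ p.2) with hA
  have hp : ∀ p ∈ subsystemPairs, τ p.1 ≠ τ p.2 := by
    intro p hp
    rw [τ.injective.ne_iff]
    revert p
    decide
  set B := (subsystemPairs.map A).sum + W with hB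
  set J := chiIso a b c with hJ
  set M := fun ε => twoBodyCircuit τ T ε * evo W ε with hM
  have h0 : twoBodyCircuit τ T 0 = 1 := List.prod_eq_one fun x hx => by
    obtain ⟨q, -, rfl⟩ := List.mem_map.1 hx
    exact exp_I_zero_smul _
  have hM0 : M 0 = J := by
    rw [hM]
    beta_reduce
    rw [h0, evo_zero, Matrix.one_mul]
  have hM' : MDeriv M (I • (B * J)) := by
    have h := (mderiv_list_prod subsystemPairs A).mul (mderiv_evo W)
    have h1 : (subsystemPairs.map fun p => NormedSpace.exp ((I * ((0 : ℝ) : ℂ)) • A p)).prod = 1 := h0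
    rw [h1, evo_zero, Matrix.one_mul, smul_mul, ← smul_add, ← Matrix.add_mul] at h
    exact h
  have hD0 : (card (Logical a b) : ℝ) ≠ 0 := by exact_mod_cast card_ne_zero
  have hc0 : (0 : ℝ) ≤ card c := Nat.cast_nonneg _
  have hnorm : ∀ ε, br (choi (M ε)) (choi (M ε)) = 1 := by
    intro ε
    have hU : (twoBodyCircuit τ T ε)ᴴ * twoBodyCircuit τ T ε = 1 :=
      list_prod_conjTranspose_mul _ fun U hU => by
        obtain ⟨p, hp', rfl⟩ := List.mem_map.1 hU
        exact unitary_adj_mul (expU (hT _ _ (hp p hp')).1 ε)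
    rw [br_choi_self, show nsq (M ε) = nsq (evo W ε) from nsq_unitary_mul _ hU _, nsq_evo hW,
      div_self hD0, ofReal_one]
  have hlim : Tendsto (fun ε : ℝ => (ε : ℂ)⁻¹ • (choi (M ε) - choi J)) (𝓝[≠] 0)
      (𝓝 (choi (I • (B * J)))) := by
    have h := hM'.tendsto
    rw [hM0] at h
    refine tendsto_pi_nhds.2 fun x => ?_
    have h2 := (tendsto_mat.1 h x.2 x.1).const_mul rt(card (Logical a b))⁻¹
    refine h2.congr fun ε => ?_
    rw [← choi_sub, ← choi_smul]
    rfl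
  have hS := isStabilizerState_choi (a := a) (b := b) (c := c)
  have hκ : 0 ≤ 2 * α / (α - 1) := div_nonneg (by linarith) (by linarith)
  have hnsq : ∀ z : ℂ, ∑ x, ‖(choi (I • (B * J)) - z • choi J) x‖ ^ 2 =
      nsq (red B - (-I * z) • (1 : TMat a b c)) / (card (Logical a b) * card c) := by
    intro z
    have h1 : hat (I • (B * J) - z • J) = (rt(card c)⁻¹ * I) •
        (red B - (-I * z) • (1 : TMat a b c)) := by
      rw [hat_sub, hat_smul, hat_smul, hat_mul_attachChi, hat_attachChi, smul_sub, smul_smul,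
        smul_smul, smul_smul, mul_comm I]
      congr 2
      linear_combination (rt(card c)⁻¹ * z) * I_mul_I
    rw [← choi_smul, ← choi_sub, sum_norm_choi, ← nsq_hat, h1, nsq_smul, norm_mul, norm_I, norm_inv,
      norm_real, mul_one, inv_pow, norm_eq_abs, sq_abs, sq_sqrt hc0, mul_comm (card (Logical a b) :
      ℝ), div_mul_eq_div_div, div_eq_inv_mul _ (card c : ℝ)]
  refine ⟨_, tendsto_sre hS hnorm hlim hα, ?_, ?_⟩
  · refine mul_le_mul_of_nonneg_left ?_ hκ
    have hres : resid (red W) = resid (red B) := by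
      rw [hB, red_add, resid_add, resid_red_list_sum _ _ fun p hp' => (hT _ _ (hp p
        hp')).2.resid_red (hT _ _ (hp p hp')).1 (hp p hp'), zero_add]
    rw [perp, hnsq, hres, ← resid_sub_smul_one (red B) (-I * br (choi J) (choi (I • (B * J))))]
    exact div_le_div_of_nonneg_right ((nsq_resid_le_compP _).trans (nsq_compP_le _)) (by positivity)
  · refine mul_le_mul_of_nonneg_left ?_ hκ
    have h1 := br_self_eq hS.1 (choi (I • (B * J)))
    rw [br_self, br_self, star_def, conj_mul'] at h1
    have h2 : ∑ x, ‖choi (I • (B * J)) x‖ ^ 2 = ‖br (choi J) (choi (I • (B * J)))‖ ^ 2 +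
        ∑ x, ‖perp (choi J) (choi (I • (B * J))) x‖ ^ 2 := by exact_mod_cast h1
    have h3 := hnsq 0
    simp only [zero_smul, sub_zero, mul_zero] at h3
    rw [← h3, h2]
    linarith [sq_nonneg ‖br (choi J) (choi (I • (B * J)))‖]

end NonlocalMagic

end

section

section OptimalCircuit

open Classical in
/-- The operator on the subsystems `i` and `j` with kernel `g`. -/
def pairOp (i j : Fin 4) (g : Phys a b c → Phys a b c → ℂ) : PMat a b c :=
  of fun x y => if ∀ k, k ≠ i → k ≠ j → AgreeAt k x y then g x y else 0

lemma isHermitian_pairOp {i j : Fin 4} {g : Phys a b c → Phys a b c → ℂ} (hg : ∀ x y, star (g y x) =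
    g x y) : (pairOp i j g).IsHermitian := by
  ext x y
  have h : (∀ k, k ≠ i → k ≠ j → AgreeAt k y x) ↔ ∀ k, k ≠ i → k ≠ j → AgreeAt k x y :=
    ⟨fun h k hi hj => (h k hi hj).symm, fun h k hi hj => (h k hi hj).symm⟩
  simp only [conjTranspose_apply, pairOp, of_apply, apply_ite star, hg, star_zero]
  classical exact if_congr h rfl rfl

lemma actsOn_pairOp {i j : Fin 4} {g : Phys a b c → Phys a b c → ℂ} (hg : ∀ x y x' y', AgreeAt i x
    x' → AgreeAt j x x' → AgreeAt i y y' → AgreeAt j y y' → g x y = g x' y') : ActsOn i j (pairOp i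
    j g) := by
  refine ⟨fun x y h => ?_, fun x y x' y' h h' h1 h2 h3 h4 => ?_⟩
  · by_contra H
    exact h (if_neg H)
  · simp only [pairOp, of_apply]
    rw [if_pos h, if_pos h', hg x y x' y' h1 h2 h3 h4]

/-- Two-body generators removing everything but the residual part of a deformation. -/
def cancelGen (XA : Mat (a × c)) (XB : Mat (b × c)) (N : Mat (a × b)) (Z : Mat c) :
    Fin 4 → Fin 4 → PMat a b c
  | 0, 1 => pairOp 0 1 fun x y => XA x.1 y.1
  | 2, 3 => pairOp 2 3 fun x y => XB x.2 y.2
  | 0, 2 => pairOp 0 2 fun x y => -N (x.1.1, x.2.1) (y.1.1, y.2.1)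
  | 1, 3 => pairOp 1 3 fun x y => -(card c : ℂ)⁻¹ * ((if y.1.2 = y.2.2 then Z x.1.2 x.2.2 else 0) +
      if x.1.2 = x.2.2 then star (Z y.1.2 y.2.2) else 0)
  | _, _ => 0

lemma isTwoBody_cancelGen {XA : Mat (a × c)} {XB : Mat (b × c)} {N : Mat (a × b)} (Z : Mat c) (hA :
    XA.IsHermitian) (hB : XB.IsHermitian) (hN : N.IsHermitian) : IsTwoBody (cancelGen XA XB N Z) :=
    by
  have h0 : ∀ i j, (0 : PMat a b c).IsHermitian ∧ ActsOn i j (0 : PMat a b c) :=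
    fun i j => ⟨isHermitian_zero, fun x y h => absurd rfl h, fun _ _ _ _ _ _ _ _ _ _ => rfl⟩
  intro i j hij
  fin_cases i <;> fin_cases j <;> first | exact absurd rfl hij | exact h0 _ _ | skip
  · refine ⟨isHermitian_pairOp fun x y => hA.apply _ _, actsOn_pairOp ?_⟩
    rintro ⟨⟨x, s⟩, _⟩ ⟨⟨l, u⟩, _⟩ ⟨⟨x', s'⟩, _⟩ ⟨⟨l', u'⟩, _⟩ (rfl : x = x') (rfl : s = s')
      (rfl : l = l') (rfl : u = u')
    rfl
  · refine ⟨isHermitian_pairOp fun x y => by rw [star_neg, hN.apply], actsOn_pairOp ?_⟩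
    rintro ⟨⟨x, _⟩, ⟨y, _⟩⟩ ⟨⟨l, _⟩, ⟨k, _⟩⟩ ⟨⟨x', _⟩, ⟨y', _⟩⟩ ⟨⟨l', _⟩, ⟨k', _⟩⟩ (rfl : x = x')
      (rfl : y = y') (rfl : l = l') (rfl : k = k')
    rfl
  · refine ⟨isHermitian_pairOp fun x y => ?_, actsOn_pairOp ?_⟩
    · simp only [star_mul', star_neg, star_inv₀, star_natCast, star_add, apply_ite star, star_zero,
        star_star]
      rw [add_comm]
    · rintro ⟨⟨_, s⟩, ⟨_, t⟩⟩ ⟨⟨_, u⟩, ⟨_, v⟩⟩ ⟨⟨_, s'⟩, ⟨_, t'⟩⟩ ⟨⟨_, u'⟩, ⟨_, v'⟩⟩ (rfl : s = s')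
        (rfl : t = t') (rfl : u = u') (rfl : v = v')
      rfl
  · refine ⟨isHermitian_pairOp fun x y => hB.apply _ _, actsOn_pairOp ?_⟩
    rintro ⟨_, ⟨x, s⟩⟩ ⟨_, ⟨l, u⟩⟩ ⟨_, ⟨x', s'⟩⟩ ⟨_, ⟨l', u'⟩⟩ (rfl : x = x') (rfl : s = s')
      (rfl : l = l') (rfl : u = u')
    rfl

lemma red_cancelGen [Nonempty c] (XA : Mat (a × c)) (XB : Mat (b × c)) (N : Mat (a × b)) {Z : Mat c}
    (hZ : Z.trace = 0) : red (subsystemPairs.map fun p => cancelGen XA XB N Z p.1 p.2).sum = liftA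
    XA + liftB XB - (N ⊗ₖ (1 : Mat c) + (1 : Mat (a × b)) ⊗ₖ Z) := by
  have hc := card_cast_ne c
  have hsum : (subsystemPairs.map fun p => cancelGen XA XB N Z p.1 p.2).sum =
      cancelGen XA XB N Z 0 1 + cancelGen XA XB N Z 0 2 + cancelGen XA XB N Z 1 3 +
        cancelGen XA XB N Z 2 3 := by
    simp only [subsystemPairs, List.map_cons, List.map_nil, List.sum_cons, List.sum_nil]
    rw [show cancelGen XA XB N Z 0 3 = 0 from rfl, show cancelGen XA XB N Z 1 2 = 0 from rfl]
    abel
  have e (i j i' j' : Fin 4) (h : ∀ k, k = i' ∨ k = j' ↔ k ≠ i ∧ k ≠ j) (g) (p q : Phys a b c)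
      (P : Prop) [Decidable P] (hP : P = (AgreeAt i' p q ∧ AgreeAt j' p q)) :
      pairOp i j g p q = if P then g p q else 0 := by
    subst hP
    classical exact if_congr ⟨fun H => ⟨((h i').1 (.inl rfl)).elim (H _), ((h j').1 (.inr rfl)).elim
      (H _)⟩, fun H k hi hj => ((h k).2 ⟨hi, hj⟩).elim (fun h => h ▸ H.1) fun h => h ▸ H.2⟩ rfl rfl
  have e01 (g) (p q) := e 0 1 2 3 (by decide) g p q (p.2.1 = q.2.1 ∧ p.2.2 = q.2.2) rfl
  have e23 (g) (p q) := e 2 3 0 1 (by decide) g p q (p.1.1 = q.1.1 ∧ p.1.2 = q.1.2) rfl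
  have e02 (g) (p q) := e 0 2 1 3 (by decide) g p q (p.1.2 = q.1.2 ∧ p.2.2 = q.2.2) rfl
  have e13 (g) (p q) := e 1 3 0 2 (by decide) g p q (p.1.1 = q.1.1 ∧ p.2.1 = q.2.1) rfl
  have h1 : red (cancelGen XA XB N Z 0 1) = liftA XA := by
    ext ⟨⟨x, y⟩, s⟩ ⟨⟨l, k⟩, t⟩
    simp only [red, cancelGen, e01, of_apply, liftA]
    by_cases h : y = k <;> simp [h]
  have h2 : red (cancelGen XA XB N Z 2 3) = liftB XB := by
    ext ⟨⟨x, y⟩, s⟩ ⟨⟨l, k⟩, t⟩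
    simp only [red, cancelGen, e23, of_apply, liftB]
    by_cases h : x = l <;> simp [h]
  have h3 : red (cancelGen XA XB N Z 0 2) = -(N ⊗ₖ (1 : Mat c)) := by
    ext ⟨⟨x, y⟩, s⟩ ⟨⟨l, k⟩, t⟩
    simp only [red, cancelGen, e02, of_apply, Matrix.neg_apply, kroneckerMap_apply,
      Matrix.one_apply]
    by_cases h : s = t
    · subst h
      simp
    · rw [sum_eq_zero fun u _ => if_neg fun H => h (H.1.trans H.2.symm)]
      simp [h]
  have h4 : red (cancelGen XA XB N Z 1 3) = -((1 : Mat (a × b)) ⊗ₖ Z) := by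
    ext ⟨⟨x, y⟩, s⟩ ⟨⟨l, k⟩, t⟩
    have htr : ∑ u, star (Z u u) = 0 := by
      rw [← star_sum, show ∑ u, Z u u = 0 from hZ, star_zero]
    simp only [red, cancelGen, e13, of_apply, Matrix.neg_apply, kroneckerMap_apply,
      Matrix.one_apply, Prod.mk.injEq]
    by_cases h : x = l ∧ y = k
    · simp only [if_pos h, if_true, ← mul_sum, sum_add_distrib]
      rw [sum_const, card_univ, nsmul_eq_mul]
      split_ifs
      · rw [htr]; field_simp; ring
      · rw [sum_const_zero]; field_simp; ring
    · simp [h]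
  rw [hsum, red_add, red_add, red_add, h1, h2, h3, h4]
  abel

variable [Nonempty a] [Nonempty b] [Nonempty c] [AddCommGroup a] [AddCommGroup b] [AddCommGroup c]

lemma hasNonlocalMagicCoeff_evo {W : PMat a b c} {α : ℝ} (hα : 1 < α) (hW : W.IsHermitian) :
    SkewedCode.HasNonlocalMagicCoeff α (evo W) (2 * α / (α - 1) * (nsq (resid (red W)) / (card
    (Logical a b) * card c))) := by
  refine ⟨fun τ T hT => (exists_hasMagicCoeff hα hW τ hT).imp fun _ h => h.1, ?_, ?_⟩
  · obtain ⟨XA, XB, N, Z, hA, hB, hN, hZ, hdec⟩ := exists_local_generators hW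
    have hT := isTwoBody_cancelGen Z hA hB hN
    obtain ⟨m, h1, h2, h3⟩ := exists_hasMagicCoeff hα hW 1 hT
    have h4 : red ((subsystemPairs.map fun p => cancelGen XA XB N Z p.1 p.2).sum + W) =
        resid (red W) := by
      rw [red_add, red_cancelGen XA XB N hZ, sub_add_eq_add_sub, hdec, add_sub_cancel_right]
    simp only [Equiv.Perm.coe_one, id_eq, h4] at h3
    exact ⟨1, _, hT, h3.antisymm h2 ▸ h1⟩
  · rintro m' ⟨τ, T, hT, h⟩
    obtain ⟨m, h1, h2, -⟩ := exists_hasMagicCoeff hα hW τ hT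
    exact tendsto_nhds_unique h h1 ▸ h2

lemma StabilizerCode.hasNonlocalMagicCoeff (C : StabilizerCode a b c) {W : PMat a b c} {α : ℝ} (hα :
    1 < α) (hW : W.IsHermitian) : C.HasNonlocalMagicCoeff α W (2 * α / (α - 1) * (nsq (resid (red
    (C.conjugated W))) / (card (Logical a b) * card c))) := by
  unfold StabilizerCode.HasNonlocalMagicCoeff
  simp only [C.recover_skewed]
  exact hasNonlocalMagicCoeff_evo hα (isHermitian_conj hW _)

end OptimalCircuit

end

section

section GaussianMoments

variable {ι κ : Type} [Fintype ι] [Fintype κ]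

lemma integral_sq_gaussianReal (v : NNReal) : ∫ x, x ^ 2 ∂gaussianReal 0 v = v := by
  have h := variance_fun_id_gaussianReal (μ := 0) (v := v)
  rwa [variance_of_integral_eq_zero aemeasurable_id' integral_id_gaussianReal] at h

lemma integral_pow_four_gaussianReal (w : NNReal) : ∫ x, x ^ 4 ∂gaussianReal 0 w = 3 * (w : ℝ) ^ 2
    := by
  have h := iteratedDeriv_mgf_zero (X := fun x : ℝ => x) (μ := gaussianReal 0 w)
    (by simp [integrableExpSet_fun_id_gaussianReal]) 4
  set v : ℝ := (w : ℝ)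
  have hd (p p' : ℝ → ℝ) (hp : ∀ t, HasDerivAt p (p' t) t) :
      deriv (fun t => p t * exp (v * t ^ 2 / 2)) =
        fun t => (p' t + v * t * p t) * exp (v * t ^ 2 / 2) := by
    ext t
    have h1 : HasDerivAt (fun t : ℝ => v * t ^ 2 / 2) (v * t) t := by
      convert! ((hasDerivAt_pow 2 t).const_mul v).div_const 2 using 1
      simp
      ring
    have h2 := ((hp t).fun_mul h1.exp).deriv
    rw [h2]
    ring
  have e : mgf (fun x : ℝ => x) (gaussianReal 0 w) = fun t => 1 * exp (v * t ^ 2 / 2) := by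
    rw [mgf_fun_id_gaussianReal]
    simp [v]
  have h3 (t : ℝ) : HasDerivAt (fun t => 0 + v * t * 1) v t := by
    simpa using (hasDerivAt_id t).const_mul v
  have h4 (t : ℝ) : HasDerivAt (fun t => v + v * t * (0 + v * t * 1)) (2 * v ^ 2 * t : ℝ) t := by
    convert! (((hasDerivAt_id t).const_mul v).fun_mul (h3 t)).const_add v using 1
    simp
    ring
  have h5 (t : ℝ) : HasDerivAt (fun t => 2 * v ^ 2 * t + v * t * (v + v * t * (0 + v * t * 1)))
      (3 * v ^ 2 + 3 * v ^ 3 * t ^ 2 : ℝ) t := by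
    convert! ((hasDerivAt_id t).const_mul (2 * v ^ 2 : ℝ)).fun_add
      (((hasDerivAt_id t).const_mul v).fun_mul (h4 t)) using 1
    simp
    ring
  rw [e, iteratedDeriv_succ', iteratedDeriv_succ', iteratedDeriv_succ', iteratedDeriv_one, hd _ _
    fun t => hasDerivAt_const t 1, hd _ _ h3, hd _ _ h4, hd _ _ h5] at h
  simpa using h.symm

lemma map_gaussian_linear (u : ι → ℝ) : (Measure.pi fun _ : ι => gaussianReal 0 1).map (fun ω => ∑
    i, u i * ω i) = gaussianReal 0 (∑ i, u i ^ 2).toNNReal := by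
  have hm (i : ι) : MemLp (fun x => u i * x) 2 (gaussianReal 0 1) :=
    (memLp_id_gaussianReal 2).const_mul (u i)
  have h0 (i : ι) := measurePreserving_eval (fun _ : ι => gaussianReal 0 1) i
  have h1 : HasGaussianLaw (fun ω : ι → ℝ => ∑ i, u i * ω i)
      (Measure.pi fun _ : ι => gaussianReal 0 1) :=
    iIndepFun.hasGaussianLaw_fun_sum (fun i => HasGaussianLaw.fun_smul (u i)
      ((h0 i).hasLaw.hasGaussianLaw)) (iIndepFun_pi (X := fun i x => u i * x) fun i => by fun_prop)
  rw [h1.map_eq_gaussianReal]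
  have h2 : ∫ ω : ι → ℝ, ∑ i, u i * ω i ∂(Measure.pi fun _ : ι => gaussianReal 0 1) = 0 := by
    have h3 (i : ι) : Integrable (fun ω : ι → ℝ => u i * ω i)
        (Measure.pi fun _ : ι => gaussianReal 0 1) :=
      (h0 i).integrable_comp_of_integrable (g := fun x => u i * x) ((hm i).integrable (by norm_num))
    rw [integral_finsetSum _ fun i _ => h3 i]
    refine sum_eq_zero fun i _ => ?_
    rw [integral_const_mul, integral_comp_eval (μ := fun _ : ι => gaussianReal 0 1) (i := i)
      (f := fun x : ℝ => x) (by fun_prop), integral_id_gaussianReal, mul_zero]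
  have h4 := variance_sum_pi (μ := fun _ : ι => gaussianReal 0 1) hm
  rw [show (∑ i, fun ω : ι → ℝ => u i * ω i) = fun ω => ∑ i, u i * ω i from by ext; simp] at h4
  rw [h2, h4]
  exact congr_arg _ (congr_arg _ (sum_congr rfl fun i _ => by
    rw [variance_const_mul, variance_fun_id_gaussianReal]; simp))

lemma measurable_linearForm (u : ι → ℝ) : Measurable fun ω : ι → ℝ => ∑ i, u i * ω i := by
  fun_prop

lemma integrable_linearForm_pow (u : ι → ℝ) (k : ℕ) : Integrable (fun ω => (∑ i, u i * ω i) ^ k)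
    (Measure.pi fun _ : ι => gaussianReal 0 1) := by
  have h : Integrable (fun x : ℝ => x ^ k) ((Measure.pi fun _ : ι => gaussianReal 0 1).map
      fun ω => ∑ i, u i * ω i) := by
    rw [map_gaussian_linear]
    exact integrable_pow_of_integrable_exp_mul one_ne_zero (by
      simpa using integrable_exp_mul_gaussianReal (μ := 0) 1) (integrable_exp_mul_gaussianReal (-1)) k
  exact h.comp_measurable (measurable_linearForm u)

lemma integral_linearForm_sq (u : ι → ℝ) : ∫ ω, (∑ i, u i * ω i) ^ 2 ∂(Measure.pi fun _ : ι =>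
    gaussianReal 0 1) = ∑ i, u i ^ 2 := by
  rw [← integral_map (f := fun x : ℝ => x ^ 2) (measurable_linearForm u).aemeasurable (by fun_prop),
    map_gaussian_linear, integral_sq_gaussianReal, Real.coe_toNNReal _ (by positivity)]

lemma integral_linearForm_pow_four (u : ι → ℝ) : ∫ ω, (∑ i, u i * ω i) ^ 4 ∂(Measure.pi fun _ : ι =>
    gaussianReal 0 1) = 3 * (∑ i, u i ^ 2) ^ 2 := by
  rw [← integral_map (f := fun x : ℝ => x ^ 4) (measurable_linearForm u).aemeasurable (by fun_prop),
    map_gaussian_linear, integral_pow_four_gaussianReal, Real.coe_toNNReal _ (by positivity)]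

lemma linearForm_sq_mul_sq (u v : ι → ℝ) (ω : ι → ℝ) : (∑ i, u i * ω i) ^ 2 * (∑ i, v i * ω i) ^ 2 =
    12⁻¹ * ((∑ i, (u + v) i * ω i) ^ 4 + (∑ i, (u - v) i * ω i) ^ 4 + -2 * (∑ i, u i * ω i) ^ 4 + -2
    * (∑ i, v i * ω i) ^ 4) := by
  simp only [Pi.add_apply, Pi.sub_apply, add_mul, sub_mul, sum_add_distrib, sum_sub_distrib]
  ring

lemma integrable_linearForm_sq_mul_sq (u v : ι → ℝ) : Integrable (fun ω => (∑ i, u i * ω i) ^ 2 * (∑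
    i, v i * ω i) ^ 2) (Measure.pi fun _ : ι => gaussianReal 0 1) := by
  simp only [linearForm_sq_mul_sq]
  have h := integrable_linearForm_pow (ι := ι) (k := 4)
  exact ((((h _).fun_add (h _)).fun_add ((h _).const_mul _)).fun_add ((h _).const_mul _)).const_mul _

lemma integral_linearForm_sq_mul_sq (u v : ι → ℝ) : ∫ ω, (∑ i, u i * ω i) ^ 2 * (∑ i, v i * ω i) ^ 2
    ∂(Measure.pi fun _ : ι => gaussianReal 0 1) = (∑ i, u i ^ 2) * (∑ i, v i ^ 2) + 2 * (∑ i, u i *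
    v i) ^ 2 := by
  simp only [linearForm_sq_mul_sq]
  have h := integrable_linearForm_pow (ι := ι) (k := 4)
  rw [integral_const_mul, integral_add (((h _).fun_add (h _)).fun_add ((h _).const_mul _)) ((h
    _).const_mul _), integral_add ((h _).fun_add (h _)) ((h _).const_mul _), integral_add (h _) (h
    _), integral_const_mul, integral_const_mul]
  simp only [integral_linearForm_pow_four, Pi.add_apply, Pi.sub_apply, add_sq, sub_sq,
    sum_add_distrib, sum_sub_distrib, mul_assoc, ← mul_sum]
  ring

/-- A quadratic form of independent Gaussians stays within half of its mean. -/
lemma measure_quadraticForm_le (u : κ → ι → ℝ) {v E : ℝ} (hE : ∑ k, ∑ i, u k i ^ 2 = E) (hE0 : 0 <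
    E) (hu : ∑ k, ∑ l, (∑ i, u k i * u l i) ^ 2 ≤ v * E) : (Measure.pi fun _ : ι => gaussianReal 0
    1) {ω | E / 2 ≤ |(∑ k, (∑ i, u k i * ω i) ^ 2) - E|} ≤ ENNReal.ofReal (8 * v / E) := by
  set P := Measure.pi fun _ : ι => gaussianReal 0 1
  set Q : (ι → ℝ) → ℝ := fun ω => ∑ k, (∑ i, u k i * ω i) ^ 2 with hQ
  have hs (k) := integrable_linearForm_pow (u k) 2
  have i1 : Integrable Q P := integrable_finsetSum _ fun k _ => hs k
  have e1 : ∫ ω, Q ω ∂P = E := by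
    rw [hQ, integral_finsetSum _ fun k _ => hs k]
    simp only [integral_linearForm_sq, hE]
  have q2 (ω) : Q ω ^ 2 = ∑ p : κ × κ, (∑ i, u p.1 i * ω i) ^ 2 * (∑ i, u p.2 i * ω i) ^ 2 := by
    rw [sq, hQ, sum_mul_sum, sum_prod_type]
  have i2 : Integrable (fun ω => Q ω ^ 2) P := by
    simp only [q2]
    exact integrable_finsetSum _ fun p _ => integrable_linearForm_sq_mul_sq _ _
  have e2 : ∫ ω, Q ω ^ 2 ∂P = E ^ 2 + 2 * ∑ k, ∑ l, (∑ i, u k i * u l i) ^ 2 := by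
    simp only [q2]
    rw [integral_finsetSum _ fun p _ => integrable_linearForm_sq_mul_sq _ _]
    simp only [integral_linearForm_sq_mul_sq, sum_prod_type, sum_add_distrib, ← mul_sum, ← sum_mul]
    rw [hE, sq]
  have q3 (ω) : (Q ω - E) ^ 2 = Q ω ^ 2 + -2 * E * Q ω + E ^ 2 := by ring
  have i3 : Integrable (fun ω => (Q ω - E) ^ 2) P := by
    simp only [q3]
    exact (i2.fun_add (i1.const_mul _)).add (integrable_const _)
  have h := mul_meas_ge_le_integral_of_nonneg (μ := P) (ae_of_all _ fun ω => sq_nonneg (Q ω - E)) i3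
    ((E / 2) ^ 2)
  have e3 : ∫ ω, (Q ω - E) ^ 2 ∂P ≤ 2 * (v * E) := by
    simp only [q3]
    rw [integral_add (i2.fun_add (i1.const_mul _)) (integrable_const _), integral_add i2
      (i1.const_mul _), integral_const_mul, e1, e2, integral_const, probReal_univ]
    simp
    linarith
  have hset : {ω | E / 2 ≤ |Q ω - E|} = {ω | (E / 2) ^ 2 ≤ (Q ω - E) ^ 2} := by
    ext ω
    rw [Set.mem_ofPred_eq, Set.mem_ofPred_eq, sq_le_sq, abs_of_pos (half_pos hE0)]
  rw [hset, ← ofReal_measureReal]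
  refine ENNReal.ofReal_le_ofReal ?_
  rw [le_div_iff₀ hE0]
  refine le_of_mul_le_mul_right ?_ hE0
  nlinarith [h.trans e3]

lemma measure_quadraticForm_ge (u : κ → ι → ℝ) {E t : ℝ} (hE : ∑ k, ∑ i, u k i ^ 2 = E) (ht : 0 < t)
    : (Measure.pi fun _ : ι => gaussianReal 0 1) {ω | t ≤ ∑ k, (∑ i, u k i * ω i) ^ 2} ≤
    ENNReal.ofReal (E / t) := by
  have hs (k) := integrable_linearForm_pow (u k) 2
  have h := mul_meas_ge_le_integral_of_nonneg (μ := Measure.pi fun _ : ι => gaussianReal 0 1)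
    (f := fun ω => ∑ k, (∑ i, u k i * ω i) ^ 2)
    (ae_of_all _ fun ω => sum_nonneg fun k _ => sq_nonneg _) (integrable_finsetSum _ fun k _ => hs k) t
  rw [integral_finsetSum _ fun k _ => hs k] at h
  simp only [integral_linearForm_sq, hE] at h
  rw [← ofReal_measureReal]
  exact ENNReal.ofReal_le_ofReal ((le_div_iff₀' ht).2 h)

end GaussianMoments

end

section

section GUE

variable {n : Type} [Fintype n]

/-- Coefficients of `ω ↦ Re ⟨Z, gueMatrix s ω⟩`. -/
def gueCoeff (s : ℝ) (Z : Mat n) : Bool × n × n → ℝ := fun i =>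
  s / 2 * if i.1 then ((Z + Zᴴ) i.2.1 i.2.2).im else ((Z + Zᴴ) i.2.1 i.2.2).re

lemma isHermitian_gueMatrix (s : ℝ) (ω : Bool × n × n → ℝ) : (gueMatrix s ω : Mat n).IsHermitian :=
    by
  ext j k
  apply Complex.ext <;> simp only [gueMatrix, conjTranspose_apply, star_def, map_mul, map_add,
    conj_ofReal, conj_I] <;> simp <;> ring_nf <;> simp

lemma re_hs_gueMatrix (s : ℝ) (Z : Mat n) (ω : Bool × n × n → ℝ) : (hs Z (gueMatrix s ω)).re = ∑ i,
    gueCoeff s Z i * ω i := by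
  have h1 : (hs Z (gueMatrix s ω)).re = (∑ j, ∑ k, s / 2 * ((Z j k).re * ω (false, j, k) +
      (Z j k).im * ω (true, j, k))) + ∑ j, ∑ k, s / 2 * ((Z j k).re * ω (false, k, j) -
      (Z j k).im * ω (true, k, j)) := by
    simp only [hs, re_sum, ← sum_add_distrib]
    refine sum_congr rfl fun j _ => sum_congr rfl fun k _ => ?_
    simp [gueMatrix]
    ring
  rw [h1, sum_comm (f := fun j k => s / 2 * ((Z j k).re * ω (false, k, j) - (Z j k).im * ω (true, k, j)))]
  simp only [sum_prod_type, Fintype.sum_bool, gueCoeff, ← sum_add_distrib]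
  refine sum_congr rfl fun j _ => sum_congr rfl fun k _ => ?_
  simp
  ring

lemma sum_gueCoeff_mul (s : ℝ) (Z Z' : Mat n) : ∑ i, gueCoeff s Z i * gueCoeff s Z' i = s ^ 2 / 2 *
    ((hs Z Z').re + (Z * Z').trace.re) := by
  have h1 : (hs Z Z').re + (Z * Z').trace.re = ∑ j, ∑ k, ((Z j k).re * (Z' j k).re +
      (Z j k).im * (Z' j k).im + ((Z j k).re * (Z' k j).re - (Z j k).im * (Z' k j).im)) := by
    simp only [hs, trace, diag_apply, Matrix.mul_apply, re_sum, ← sum_add_distrib]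
    refine sum_congr rfl fun j _ => sum_congr rfl fun k _ => ?_
    simp
  have h2 : (hs Z Z').re + (Z * Z').trace.re = ∑ j, ∑ k, ((Z k j).re * (Z' k j).re +
      (Z k j).im * (Z' k j).im + ((Z k j).re * (Z' j k).re - (Z k j).im * (Z' j k).im)) := by
    rw [h1, sum_comm]
  rw [show s ^ 2 / 2 * ((hs Z Z').re + (Z * Z').trace.re) = s ^ 2 / 4 *
    (((hs Z Z').re + (Z * Z').trace.re) + ((hs Z Z').re + (Z * Z').trace.re)) by ring]
  nth_rewrite 1 [h1]
  rw [h2]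
  simp only [sum_prod_type, Fintype.sum_bool, gueCoeff, ← sum_add_distrib, mul_sum]
  refine sum_congr rfl fun j _ => sum_congr rfl fun k _ => ?_
  simp
  ring

end GUE

section ReducedGUE

/-- The inverse of `hat`. -/
def unhat (Y : TMat a b c) : Enc a b c := of fun p l => Y ((p.1.1, p.2.1), p.1.2) (l, p.2.2)

lemma hat_unhat (Y : TMat a b c) : hat (unhat Y) = Y := rfl

/-- Representative of the functional `W ↦ ⟨Y, red (U W U†)⟩`. -/
def dualRed (U : U(Phys a b c)) (Y : TMat a b c) : PMat a b c :=
  rt(card c) • (U.1ᴴ * (unhat Y * (chiIso a b c)ᴴ) * U.1)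

variable [Nonempty c]

lemma red_eq_hat (W : PMat a b c) : red W = rt(card c) • hat (W * chiIso a b c) := by
  rw [hat_mul_attachChi, smul_smul, mul_inv_cancel₀ (by simp), one_smul]

lemma hs_dualRed (U : U(Phys a b c)) (Y : TMat a b c) (W : PMat a b c) : hs (dualRed U Y) W = hs Y
    (red (U.1 * W * U.1ᴴ)) := by
  rw [red_eq_hat, dualRed, hs_smul_left, hs_smul_right]
  change _ = _ * hs (hat (unhat Y)) _
  rw [hs_hat, hs_eq_trace, hs_eq_trace, star_def, conj_ofReal]
  simp only [conjTranspose_mul, conjTranspose_conjTranspose, Matrix.mul_assoc]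
  rw [trace_mul_comm]
  simp only [Matrix.mul_assoc]
  rw [trace_mul_comm]
  simp only [Matrix.mul_assoc]

variable [Nonempty a] [Nonempty b]

lemma hs_dualRed_dualRed (U : U(Phys a b c)) (Y Y' : TMat a b c) : hs (dualRed U Y) (dualRed U Y') =
    card c * hs Y Y' := by
  have h : (chiIso a b c)ᴴ * chiIso a b c = 1 := by
    simpa [evo] using evo_conjTranspose_mul (a := a) (b := b) (c := c) isHermitian_zero 0
  have h2 : U.1 * dualRed U Y' * U.1ᴴ = rt(card c) • (unhat Y' * (chiIso a b c)ᴴ) := by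
    rw [dualRed, Matrix.mul_smul, smul_mul]
    simp only [Matrix.mul_assoc, unitary_mul_adj, Matrix.mul_one]
    rw [← Matrix.mul_assoc, unitary_mul_adj, Matrix.one_mul]
  rw [hs_dualRed, h2, red_smul, red_eq_hat, Matrix.mul_assoc, h, Matrix.mul_one, hat_unhat,
    smul_smul, ← ofReal_mul, mul_self_sqrt (Nat.cast_nonneg _), hs_smul_right, ofReal_natCast]

lemma trace_dualRed_mul (U : U(Phys a b c)) {Y : TMat a b c} (hY : expC a b c Y = 0) (Y' : TMat a b
    c) : (dualRed U Y' * dualRed U Y).trace = 0 := by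
  have h : (chiIso a b c)ᴴ * unhat Y = 0 := by
    rw [conjTranspose_mul_eq_traceSnd, hat_attachChi, hat_unhat, conjTranspose_smul,
      conjTranspose_one, smul_mul, Matrix.one_mul]
    ext p q
    have h1 := congr_fun (congr_fun hY (p, Classical.arbitrary c)) (q, Classical.arbitrary c)
    rw [expC_apply, if_pos rfl, Matrix.zero_apply, mul_eq_zero, or_iff_right (by simp)] at h1
    simp only [traceSnd, Matrix.smul_apply, ← smul_sum, h1, smul_zero, Matrix.zero_apply]
  rw [dualRed, dualRed, smul_mul, Matrix.mul_smul]
  have h2 : (U.1ᴴ * (unhat Y' * (chiIso a b c)ᴴ) * U.1) *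
      (U.1ᴴ * (unhat Y * (chiIso a b c)ᴴ) * U.1) = 0 := by
    simp only [Matrix.mul_assoc]
    rw [← Matrix.mul_assoc (U : PMat a b c), unitary_mul_adj, Matrix.one_mul, ← Matrix.mul_assoc
      (chiIso a b c)ᴴ, h]
    simp
  rw [h2, smul_zero, smul_zero, Matrix.trace_zero]

/-- The orthonormal real basis of matrix units, projected by `q`. -/
def projUnit (q : End ℂ (TMat a b c)) (k : Bool × Tri a b c × Tri a b c) :
    TMat a b c := q (single k.2.1 k.2.2 (if k.1 then I else 1))

lemma sum_bool_prod {T : Type} [Fintype T] (f : Bool × T × T → ℝ) : ∑ k, f k = ∑ x, ∑ y, (f (true,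
    x, y) + f (false, x, y)) := by
  rw [sum_prod_type, Fintype.sum_bool, ← sum_add_distrib]
  exact sum_prod_type _

lemma sum_sq_re_hs_projUnit {q : End ℂ (TMat a b c)} (hq : IsSelfAdj q) (X : TMat a b c) : ∑ k, (hs
    (projUnit q k) X).re ^ 2 = nsq (q X) := by
  unfold projUnit
  rw [sum_bool_prod]
  simp only [hq _ X]
  have h (x y : Tri a b c) (z : ℂ) (Y : TMat a b c) : hs (single x y z) Y = star z * Y x y := by
    simp [hs, single_apply, ite_and, apply_ite star]
  simp only [h, nsq]
  refine sum_congr rfl fun x _ => sum_congr rfl fun y _ => ?_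
  rw [← Complex.normSq_eq_norm_sq, normSq_apply]
  simp
  ring

/-- The dimension of the range of the projection `q`. -/
def projDim (q : End ℂ (TMat a b c)) : ℝ := ∑ x, ∑ y, nsq (q (single x y 1))

lemma sum_nsq_projUnit (q : End ℂ (TMat a b c)) : ∑ k, nsq (projUnit q k) = 2 * projDim q := by
  have h (x y : Tri a b c) : single x y I = I • single x y (1 : ℂ) := by simp
  rw [sum_bool_prod]
  simp only [projUnit, if_true, if_false, h, map_smul, nsq_smul, norm_I, projDim,
    Bool.false_eq_true, mul_sum]
  refine sum_congr rfl fun x _ => sum_congr rfl fun y _ => ?_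
  ring

section Concentration

variable {q : End ℂ (TMat a b c)} (hq : IsSelfAdj q) (hqq : q * q = q)
  (hC : expC a b c * q = 0) (U : U(Phys a b c)) (s : ℝ)

include hC in
lemma sum_gueCoeff_projUnit_mul (k l) : ∑ i, gueCoeff s (dualRed U (projUnit q k)) i * gueCoeff s
    (dualRed U (projUnit q l)) i = s ^ 2 / 2 * (card c * (hs (projUnit q k) (projUnit q l)).re) :=
    by
  have h := LinearMap.congr_fun hC (single l.2.1 l.2.2 (if l.1 then I else 1))
  rw [End.mul_apply, LinearMap.zero_apply] at h
  rw [sum_gueCoeff_mul, hs_dualRed_dualRed, trace_dualRed_mul U (Y := projUnit q l) h]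
  simp

include hC in
lemma sum_gueCoeff_projUnit_sq : ∑ k, ∑ i, gueCoeff s (dualRed U (projUnit q k)) i ^ 2 = s ^ 2 *
    card c * projDim q := by
  simp only [sq (gueCoeff _ _ _), sum_gueCoeff_projUnit_mul hC U s, hs_self, ofReal_re, ← mul_sum,
    sum_nsq_projUnit]
  ring

include hq hqq in
lemma nsq_red_gue (ω) : nsq (q (red (U.1 * gueMatrix s ω * U.1ᴴ))) = ∑ k, (∑ i, gueCoeff s (dualRed
    U (projUnit q k)) i * ω i) ^ 2 := by
  simp only [← re_hs_gueMatrix, hs_dualRed, sum_sq_re_hs_projUnit hq]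

include hq hqq hC in
lemma gaussians_le (hs : 0 < s) (hT : 0 < projDim q) : gaussians (Phys a b c) {ω | s ^ 2 * card c *
    projDim q / 2 ≤ |nsq (q (red (U.1 * gueMatrix s ω * U.1ᴴ))) - s ^ 2 * card c * projDim q|} ≤
    ENNReal.ofReal (4 / projDim q) := by
  have hc := card_pos_real c
  simp only [nsq_red_gue hq hqq U s]
  refine (measure_quadraticForm_le (v := s ^ 2 * card c / 2) _ (sum_gueCoeff_projUnit_sq hC U s)
    (by positivity) ?_).trans_eq ?_
  · have h (k) : q (projUnit q k) = projUnit q k := LinearMap.congr_fun hqq _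
    simp only [sum_gueCoeff_projUnit_mul hC U s, mul_pow, ← mul_sum]
    have h2 : ∑ k, ∑ l, (SkewedCode.hs (projUnit q k) (projUnit q l)).re ^ 2 = 2 * projDim q := by
      rw [sum_comm, ← sum_nsq_projUnit]
      exact sum_congr rfl fun l _ => by rw [sum_sq_re_hs_projUnit hq, h]
    rw [h2]
    apply le_of_eq
    ring
  · congr 1
    field_simp
    ring

include hq hqq hC in
lemma gaussians_ge {t : ℝ} (ht : 0 < t) : gaussians (Phys a b c) {ω | t ≤ nsq (q (red (U.1 *
    gueMatrix s ω * U.1ᴴ)))} ≤ ENNReal.ofReal (s ^ 2 * card c * projDim q / t) := by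
  simp only [nsq_red_gue hq hqq U s]
  exact measure_quadraticForm_ge _ (sum_gueCoeff_projUnit_sq hC U s) ht

end Concentration

end ReducedGUE

end

section

section Dimensions

variable {n : Type} [Fintype n] [DecidableEq n]

/-- Projection to the multiples of the identity. -/
def tracePart (X : Mat n) : Mat n := ((card n : ℂ)⁻¹ * X.trace) • 1

lemma sum_nsq_tracePart [Nonempty n] : ∑ x : n, ∑ y, nsq (tracePart (single x y 1)) = 1 := by
  have hn : (card n : ℝ) ≠ 0 := by exact_mod_cast card_ne_zero
  have h (x y : n) : nsq (tracePart (single x y 1)) = if x = y then (card n : ℝ)⁻¹ else 0 := by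
    rw [tracePart, nsq_smul, nsq_one]
    split_ifs with hxy
    · subst hxy
      simp
      field_simp
    · rw [Matrix.trace_single_eq_of_ne _ _ _ hxy]
      simp
  simp [h, hn]

lemma sum_nsq_traceless [Nonempty n] : ∑ x : n, ∑ y, nsq (traceless (single x y 1)) = (card n : ℝ) ^
    2 - 1 := by
  have hn : (card n : ℂ) ≠ 0 := by exact_mod_cast card_ne_zero
  have h (X : Mat n) : nsq (traceless X) = nsq X - nsq (tracePart X) := by
    rw [eq_sub_iff_add_eq, ← nsq_add_of_re_hs_eq_zero, show traceless X + tracePart X = X from sub_add_cancel _ _]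
    have h2 : (traceless X).trace = 0 := by
      simp only [traceless, trace_sub, trace_smul, trace_one, smul_eq_mul]
      field_simp
      ring
    rw [tracePart, hs_smul_right, ← star_hs, hs_eq_trace, conjTranspose_one, Matrix.one_mul, h2]
    simp
  have h1 (x y : n) : nsq (single x y (1 : ℂ)) = 1 := by
    simp [nsq, single_apply, ite_and, apply_ite]
  simp only [h, h1, sum_sub_distrib, sum_nsq_tracePart]
  simp [sq]

lemma projDim_of_kronecker {q : End ℂ (TMat a b c)} {f : Mat a → Mat a} {g : Mat b → Mat b} {h : Mat
    c → Mat c} (hq : ∀ X Y Z, q ((X ⊗ₖ Y) ⊗ₖ Z) = (f X ⊗ₖ g Y) ⊗ₖ h Z) : projDim q = (∑ x, ∑ y, nsq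
    (f (single x y 1))) * (∑ x, ∑ y, nsq (g (single x y 1))) * ∑ x, ∑ y, nsq (h (single x y 1)) :=
    by
  have key (F : a → ℝ) (G : b → ℝ) (H : c → ℝ) :
      ∑ p : Tri a b c, F p.1.1 * G p.1.2 * H p.2 = (∑ x, F x) * (∑ y, G y) * ∑ z, H z := by
    simp only [sum_prod_type, ← mul_sum, ← sum_mul]
  unfold projDim
  rw [← key]
  refine sum_congr rfl fun p _ => ?_
  rw [← key]
  refine sum_congr rfl fun r _ => ?_
  rw [← nsq_kronecker, ← nsq_kronecker, ← hq, Matrix.single_kronecker_single,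
    Matrix.single_kronecker_single, one_mul, one_mul]

lemma expA_kronecker (X : Mat a) (Y : Mat b) (Z : Mat c) : expA a b c ((X ⊗ₖ Y) ⊗ₖ Z) = (tracePart X
    ⊗ₖ Y) ⊗ₖ Z := by
  ext ⟨⟨x, y⟩, s⟩ ⟨⟨l, k⟩, t⟩
  simp only [expA_apply, tracePart, kroneckerMap_apply, Matrix.smul_apply, Matrix.one_apply,
    smul_eq_mul, trace, diag_apply, ← sum_mul]
  split_ifs <;> ring

lemma expB_kronecker (X : Mat a) (Y : Mat b) (Z : Mat c) : expB a b c ((X ⊗ₖ Y) ⊗ₖ Z) = (X ⊗ₖ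
    tracePart Y) ⊗ₖ Z := by
  ext ⟨⟨x, y⟩, s⟩ ⟨⟨l, k⟩, t⟩
  simp only [expB_apply, tracePart, kroneckerMap_apply, Matrix.smul_apply, Matrix.one_apply,
    smul_eq_mul, trace, diag_apply, ← sum_mul, ← mul_sum]
  split_ifs <;> ring

lemma one_sub_expA_kronecker (X : Mat a) (Y : Mat b) (Z : Mat c) : (1 - expA a b c) ((X ⊗ₖ Y) ⊗ₖ Z)
    = (traceless X ⊗ₖ Y) ⊗ₖ Z := by
  rw [LinearMap.sub_apply, expA_kronecker, End.one_apply, traceless, tracePart]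
  ext p q
  simp only [Matrix.sub_apply, kroneckerMap_apply]
  ring

lemma one_sub_expB_kronecker (X : Mat a) (Y : Mat b) (Z : Mat c) : (1 - expB a b c) ((X ⊗ₖ Y) ⊗ₖ Z)
    = (X ⊗ₖ traceless Y) ⊗ₖ Z := by
  rw [LinearMap.sub_apply, expB_kronecker, End.one_apply, traceless, tracePart]
  ext p q
  simp only [Matrix.sub_apply, kroneckerMap_apply]
  ring

variable [Nonempty a] [Nonempty b] [Nonempty c]

lemma projDim_compO : projDim (compO a b c) = ((card a : ℝ) ^ 2 - 1) * ((card b : ℝ) ^ 2 - 1) *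
    ((card c : ℝ) ^ 2 - 1) := by
  simp only [← sum_nsq_traceless]
  exact projDim_of_kronecker fun X Y Z => by
    simp only [compO, End.mul_apply, one_sub_expC_kronecker, one_sub_expB_kronecker,
      one_sub_expA_kronecker]

lemma projDim_compA : projDim (compA a b c) = ((card a : ℝ) ^ 2 - 1) * ((card c : ℝ) ^ 2 - 1) :=
    by
  rw [projDim_of_kronecker (f := traceless) (g := tracePart) (h := traceless) fun X Y Z => by
    simp only [compA, End.mul_apply, one_sub_expC_kronecker, expB_kronecker,
      one_sub_expA_kronecker], sum_nsq_traceless, sum_nsq_traceless, sum_nsq_tracePart, mul_one]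

lemma projDim_compB : projDim (compB a b c) = ((card b : ℝ) ^ 2 - 1) * ((card c : ℝ) ^ 2 - 1) :=
    by
  rw [projDim_of_kronecker (f := tracePart) (g := traceless) (h := traceless) fun X Y Z => by
    simp only [compB, End.mul_apply, one_sub_expC_kronecker, one_sub_expB_kronecker,
      expA_kronecker], sum_nsq_traceless, sum_nsq_traceless, sum_nsq_tracePart, one_mul]

lemma projDim_compC : projDim (compC a b c) = (card c : ℝ) ^ 2 - 1 := by
  rw [projDim_of_kronecker (f := tracePart) (g := tracePart) (h := traceless) fun X Y Z => by
    simp only [compC, End.mul_apply, one_sub_expC_kronecker, expB_kronecker, expA_kronecker],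
    sum_nsq_traceless, sum_nsq_tracePart, sum_nsq_tracePart, one_mul, one_mul]

end Dimensions

section GoodEvent

/-- Numerical core of the good event. -/
lemma component_bounds {d r e QO QA QB QC DO DA DB : ℝ} (hd : 2 ≤ d) (hdr : d ≤ r) (he : 0 < e) (hDO
    : DO = (d ^ 2 - 1) * (r ^ 2 - 1) * e) (hDA : DA = (d ^ 2 - 1) * e) (hDB : DB = (r ^ 2 - 1) * e)
    (hO : |QO - DO| < DO / 2) (hA : |QA - DA| < DA / 2) (hB : |QB - DB| < DB / 2) (hC : QC < 2 * DO
    / (d * r)) : QA ≤ 4 * QO / r ^ 2 ∧ QB ≤ 4 * QO / d ^ 2 ∧ QC ≤ 4 * QO / (d * r) := by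
  have hO' := (abs_lt.1 hO).1
  have hr : 2 ≤ r := hd.trans hdr
  refine ⟨?_, ?_, hC.le.trans ?_⟩
  · rw [le_div_iff₀ (by positivity)]
    have h1 := (abs_lt.1 hA).2
    have h2 : 0 < DA := by rw [hDA]; exact mul_pos (by nlinarith) he
    have h3 : DO = DA * (r ^ 2 - 1) := by rw [hDO, hDA]; ring
    have h4 : QA * r ^ 2 ≤ 3 / 2 * DA * r ^ 2 := by gcongr; linarith
    have h5 : DA * 4 ≤ DA * r ^ 2 := by gcongr; nlinarith
    nlinarith
  · rw [le_div_iff₀ (by positivity)]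
    have h1 := (abs_lt.1 hB).2
    have h2 : 0 < DB := by rw [hDB]; exact mul_pos (by nlinarith) he
    have h3 : DO = DB * (d ^ 2 - 1) := by rw [hDO, hDB]; ring
    have h4 : QB * d ^ 2 ≤ 3 / 2 * DB * d ^ 2 := by gcongr; linarith
    have h5 : DB * 4 ≤ DB * d ^ 2 := by gcongr; nlinarith
    nlinarith
  · have : 0 < d * r := by positivity
    exact div_le_div_of_nonneg_right (by linarith) this.le

variable [Nonempty a] [Nonempty b] [Nonempty c]

lemma expC_eq_one (hc : card c = 1) : expC a b c = 1 := by
  obtain ⟨z, hz⟩ := Fintype.card_eq_one_iff.1 hc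
  refine LinearMap.ext fun Y => ?_
  ext ⟨p, s⟩ ⟨q, t⟩
  have : Unique c := ⟨⟨z⟩, hz⟩
  rw [expC_apply, hz s, hz t, hc]
  simp [hz]

lemma dimension_bounds {d r k : ℝ} (hd : 2 ≤ d) (hdr : d ≤ r) (hk : 3 ≤ k) : d ≤ (d ^ 2 - 1) * (r ^
    2 - 1) * k ∧ d ≤ (d ^ 2 - 1) * k ∧ d ≤ (r ^ 2 - 1) * k ∧ d * d * r ≤ 2 * ((d ^ 2 - 1) * (r ^ 2 -
    1)) := by
  have hdd : 3 / 4 * d ^ 2 ≤ d ^ 2 - 1 := by nlinarith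
  have hr2 : 3 / 2 * r ≤ r ^ 2 - 1 := by nlinarith
  have hd1 : d ≤ d ^ 2 - 1 := by nlinarith
  have h1 : d ≤ (d ^ 2 - 1) * k := by nlinarith
  refine ⟨?_, h1, by nlinarith, ?_⟩
  · rw [mul_right_comm]
    nlinarith
  · nlinarith [mul_le_mul hdd hr2 (by linarith) (by linarith)]

lemma four_div_le {x d : ℝ} (hd : 0 < d) (h : d ≤ x) : ENNReal.ofReal (4 / x) ≤ ENNReal.ofReal (4 /
    d) := by
  gcongr

lemma gaussians_components_le (U : U(Phys a b c)) {s d r : ℝ} (hs : 0 < s) (hd : d = card a) (hr : r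
    = card b) (hd2 : 2 ≤ d) (hdr : d ≤ r) (hc : 1 < card c) : gaussians (Phys a b c) {ω | ¬ (nsq
    (compA a b c (red (U.1 * gueMatrix s ω * U.1ᴴ))) ≤ 4 * nsq (compO a b c (red (U.1 * gueMatrix s
    ω * U.1ᴴ))) / r ^ 2 ∧ nsq (compB a b c (red (U.1 * gueMatrix s ω * U.1ᴴ))) ≤ 4 * nsq (compO a b
    c (red (U.1 * gueMatrix s ω * U.1ᴴ))) / d ^ 2 ∧ nsq (compC a b c (red (U.1 * gueMatrix s ω *
    U.1ᴴ))) ≤ 4 * nsq (compO a b c (red (U.1 * gueMatrix s ω * U.1ᴴ))) / (d * r))} ≤ ENNReal.ofReal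
    (13 / d) := by
  have hc2 : (2 : ℝ) ≤ card c := by exact_mod_cast hc
  have hk : (3 : ℝ) ≤ (card c : ℝ) ^ 2 - 1 := by nlinarith
  have hE : 0 < s ^ 2 * card c := by positivity
  have TO := projDim_compO (a := a) (b := b) (c := c)
  have TA := projDim_compA (a := a) (b := b) (c := c)
  have TB := projDim_compB (a := a) (b := b) (c := c)
  have TC := projDim_compC (a := a) (b := b) (c := c)
  rw [← hd, ← hr] at TO
  rw [← hd] at TA
  rw [← hr] at TB
  obtain ⟨lO, lA, lB, h4⟩ := dimension_bounds hd2 hdr hk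
  rw [← TO] at lO
  rw [← TA] at lA
  rw [← TB] at lB
  have hd0 : 0 < d := by linarith
  have hr0 : 0 < r := by linarith
  set E := s ^ 2 * card c with hEdef
  have ht : 0 < 2 * (E * projDim (compO a b c)) / (d * r) := by
    have : 0 < projDim (compO a b c) := hd0.trans_le lO
    positivity
  have mO := gaussians_le isSelfAdj_compO compO_mul_self (mul_eq_zero_swap isSelfAdj_compO isSelfAdj_expC
    compO_mul_expC) U s hs (hd0.trans_le lO)
  have mA := gaussians_le isSelfAdj_compA compA_mul_self (mul_eq_zero_swap isSelfAdj_compA isSelfAdj_expC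
    compA_mul_expC) U s hs (hd0.trans_le lA)
  have mB := gaussians_le isSelfAdj_compB compB_mul_self (mul_eq_zero_swap isSelfAdj_compB isSelfAdj_expC
    compB_mul_expC) U s hs (hd0.trans_le lB)
  have mC := gaussians_ge isSelfAdj_compC compC_mul_self (mul_eq_zero_swap isSelfAdj_compC isSelfAdj_expC
    compC_mul_expC) U s ht
  have mC' : ENNReal.ofReal (s ^ 2 * card c * projDim (compC a b c) /
      (2 * (E * projDim (compO a b c)) / (d * r))) ≤ ENNReal.ofReal (1 / d) := by
    refine ENNReal.ofReal_le_ofReal ?_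
    rw [div_le_div_iff₀ ht hd0, ← hEdef, one_mul, le_div_iff₀ (by positivity), TO, TC]
    have hek : 0 ≤ E * ((card c : ℝ) ^ 2 - 1) := by
      have : (0 : ℝ) ≤ (card c : ℝ) ^ 2 - 1 := by linarith
      positivity
    calc _ = E * ((card c : ℝ) ^ 2 - 1) * (d * d * r) := by ring
      _ ≤ _ := mul_le_mul_of_nonneg_left h4 hek
      _ = _ := by ring
  have hun := (measure_union_le _ _).trans (add_le_add ((measure_union_le _ _).trans
    (add_le_add ((measure_union_le _ _).trans (add_le_add (mO.trans (four_div_le hd0 lO))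
    (mA.trans (four_div_le hd0 lA)))) (mB.trans (four_div_le hd0 lB)))) (mC.trans mC'))
  rw [← ENNReal.ofReal_add (by positivity) (by positivity), ← ENNReal.ofReal_add (by positivity)
    (by positivity), ← ENNReal.ofReal_add (by positivity) (by positivity),
    show 4 / d + 4 / d + 4 / d + 1 / d = 13 / d by ring] at hun
  refine (measure_mono fun ω hω => ?_).trans hun
  by_contra H
  rw [Set.mem_union, Set.mem_union, Set.mem_union, not_or, not_or, not_or] at H
  refine hω (component_bounds hd2 hdr (e := E * ((card c : ℝ) ^ 2 - 1)) (mul_pos hE (by linarith))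
    (by rw [TO]; ring) (by rw [TA]; ring) (by rw [TB]; ring) (not_le.1 H.1.1.1) (not_le.1 H.1.1.2)
    (not_le.1 H.1.2) (not_le.1 H.2))

end GoodEvent

section TypicalSkew

variable [Nontrivial a] [Nontrivial b] [Nonempty c]
  [AddCommGroup a] [AddCommGroup b] [AddCommGroup c]

lemma StabilizerCode.area_law_of_components (C : StabilizerCode a b c) {W : PMat a b c} (hW :
    W.IsHermitian) {d r : ℝ} (hd : d = card a) (hr : r = card b) (hdr : d ≤ r) (hA : nsq (compA a b
    c (red (C.conjugated W))) ≤ 4 * nsq (compO a b c (red (C.conjugated W))) / r ^ 2) (hB : nsq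
    (compB a b c (red (C.conjugated W))) ≤ 4 * nsq (compO a b c (red (C.conjugated W))) / d ^ 2) (hC
    : nsq (compC a b c (red (C.conjugated W))) ≤ 4 * nsq (compO a b c (red (C.conjugated W))) / (d *
    r)) {α : ℝ} (hα : 1 < α) : ∃ M : ℝ, C.HasNonlocalMagicCoeff α W M ∧ ∀ (RA : ℝ → U(a × c)) (RB :
    ℝ → U(b × c)), (∀ ε : ℝ, IsOptimalRecovery (C.skewed W ε) (RA ε) (RB ε)) → ∀ (e : a ↪ b) (lam :
    a → ℝ), (∀ i, 0 < lam i) → ∑ i, lam i = 1 → ∃ S₂ : ℝ, Tendsto (fun ε : ℝ => avgCorrection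
    (C.skewed W ε) (RA ε) (RB ε) (bulkState e lam) / ε ^ 2) (𝓝[≠] 0) (𝓝 S₂) ∧ |S₂ - (α - 1) / (2 *
    α) * (1 - 1 / d ^ 2)⁻¹ * (1 - 1 / r ^ 2)⁻¹ * M * f₃ r lam| ≤ 352 * (1 / d ^ 2 + 1 / r ^ 2) * ((α
    - 1) / (2 * α) * M) * (f₁ lam + f₃ r lam) := by
  refine ⟨_, C.hasNonlocalMagicCoeff hα hW, fun RA RB hopt e lam hlam hsum =>
    ⟨_, C.tendsto_avgCorrection hW hopt e hlam hsum, ?_⟩⟩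
  have h := abs_avgQuad_areaPart_sub_le e hlam hsum (red (C.conjugated W)) hd hr hdr (by norm_num) hA hB hC
  have hM : (α - 1) / (2 * α) * (2 * α / (α - 1) * (nsq (resid (red (C.conjugated W))) /
      ((card (Logical a b) : ℝ) * card c))) = nsq (resid (red (C.conjugated W))) / (d * r * card c) := by
    have h1 : α - 1 ≠ 0 := by linarith
    have h2 : α ≠ 0 := by linarith
    rw [card_prod, Nat.cast_mul, ← hd, ← hr]
    field_simp
  refine (le_of_eq ?_).trans (h.trans (le_of_eq ?_))
  · congr 2
    rw [← hM]
    ring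
  · rw [hM]
    norm_num

end TypicalSkew

end

end SkewedCode

end

theorem mainTheorem3 :
    -- optimal recoveries of a skewed stabilizer code exist
    (∀ (n nbar m : ℕ) (C : StabilizerCode (Qubits n) (Qubits nbar) (Qubits m))
        (W : Matrix (Phys (Qubits n) (Qubits nbar) (Qubits m))
          (Phys (Qubits n) (Qubits nbar) (Qubits m)) ℂ), W.IsHermitian →
      ∀ ε : ℝ, ∃ (RA : Matrix.unitaryGroup (Qubits n × Qubits m) ℂ)
        (RB : Matrix.unitaryGroup (Qubits nbar × Qubits m) ℂ),
        IsOptimalRecovery (C.skewed W ε) RA RB) ∧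
    -- leading-order formula for a typical GUE deformation `W = gueMatrix s ω`
    (∃ K : ℝ, 0 < K ∧ ∀ δ : ℝ, 0 < δ → ∃ d₀ : ℕ,
      ∀ n nbar m : ℕ, d₀ ≤ 2 ^ n → n ≤ nbar →
      ∀ (C : StabilizerCode (Qubits n) (Qubits nbar) (Qubits m)) (s : ℝ), 0 < s →
      gaussians (Phys (Qubits n) (Qubits nbar) (Qubits m))
        {ω | ¬ ∀ α : ℝ, 1 < α →
          ∃ M : ℝ, C.HasNonlocalMagicCoeff α (gueMatrix s ω) M ∧
          ∀ (RA : ℝ → Matrix.unitaryGroup (Qubits n × Qubits m) ℂ)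
            (RB : ℝ → Matrix.unitaryGroup (Qubits nbar × Qubits m) ℂ),
            (∀ ε : ℝ, IsOptimalRecovery (C.skewed (gueMatrix s ω) ε) (RA ε) (RB ε)) →
          ∀ (e : Qubits n ↪ Qubits nbar) (lam : Qubits n → ℝ),
            (∀ i, 0 < lam i) → ∑ i, lam i = 1 →
          ∃ S₂ : ℝ,
            Tendsto (fun ε : ℝ => avgCorrection (C.skewed (gueMatrix s ω) ε) (RA ε) (RB ε)
                (bulkState e lam) / ε ^ 2) (𝓝[≠] 0) (𝓝 S₂) ∧
            |S₂ - (α - 1) / (2 * α) * (1 - 1 / ((2 : ℝ) ^ n) ^ 2)⁻¹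
                  * (1 - 1 / ((2 : ℝ) ^ nbar) ^ 2)⁻¹ * M * f₃ (2 ^ nbar) lam|
              ≤ K * (1 / ((2 : ℝ) ^ n) ^ 2 + 1 / ((2 : ℝ) ^ nbar) ^ 2)
                  * ((α - 1) / (2 * α) * M) * (f₁ lam + f₃ (2 ^ nbar) lam)}
        ≤ ENNReal.ofReal δ) := by
  refine ⟨fun n nbar m C W _ ε => exists_optimalRecovery _, 352, by norm_num, fun δ hδ => ?_⟩
  obtain ⟨N, hN⟩ := exists_nat_ge (13 / δ)
  refine ⟨max N 2, fun n nbar m hd hnn C s hs => ?_⟩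
  have hcard (k : ℕ) : (2 : ℝ) ^ k = Fintype.card (Qubits k) := by simp [ZMod.card]
  have hd2 : (2 : ℝ) ≤ 2 ^ n := by exact_mod_cast (le_max_right N 2).trans hd
  have hdN : 13 / δ ≤ (2 : ℝ) ^ n := hN.trans (by exact_mod_cast (le_max_left N 2).trans hd)
  have hdr : (2 : ℝ) ^ n ≤ 2 ^ nbar := pow_le_pow_right₀ (by norm_num) hnn
  have : Nontrivial (Qubits n) := Fintype.one_lt_card_iff_nontrivial.1
    (by exact_mod_cast (by rw [← hcard]; linarith : (1 : ℝ) < Fintype.card (Qubits n)))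
  have : Nontrivial (Qubits nbar) := Fintype.one_lt_card_iff_nontrivial.1
    (by exact_mod_cast (by rw [← hcard]; linarith : (1 : ℝ) < Fintype.card (Qubits nbar)))
  by_cases hc : 1 < Fintype.card (Qubits m)
  · refine (measure_mono ?_).trans
      ((gaussians_components_le (kronU C.RA C.RB) hs (hcard n) (hcard nbar) hd2 hdr hc).trans
        (ENNReal.ofReal_le_ofReal ?_))
    · exact fun ω hω h => hω fun α hα => C.area_law_of_components (isHermitian_gueMatrix s ω) (hcard n) (hcard nbar) hdr
        h.1 h.2.1 h.2.2 hα
    · rwa [div_le_iff₀ (by positivity), mul_comm, ← div_le_iff₀ hδ]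
  · have h1 := expC_eq_one (a := Qubits n) (b := Qubits nbar)
      (le_antisymm (not_lt.1 hc) Fintype.card_pos)
    refine (measure_mono (t := ∅) ?_).trans (by simp)
    exact fun ω hω => hω fun α hα => C.area_law_of_components (isHermitian_gueMatrix s ω) (hcard n) (hcard nbar) hdr
      (by simp [compA, compO, h1]) (by simp [compB, compO, h1]) (by simp [compC, compO, h1]) hα
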